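/- **Setting.** Let $1\le r\le p$, $0\le d\le r$, and let $A^*\in\mathbb R^{p\times p}$ have rank $r$, largest and smallest nonzero singular values $\sigma_1,\sigma_r$, and $\kappa=\sigma_1/\sigma_r$. Suppose $A^*=[C^*\ R^*]\,D^*\,[C^*\ P^*]^\top$ with $C^*\in\mathbb R^{p\times d}$, $R^*,P^*\in\mathbb R^{p\times(r-d)}$, $D^*\in\mathbb R^{r\times r}$, where $[C^*\ R^*]$ and $[C^*\ P^*]$ have orthonormal columns. Let $(y_t)_{t\in\mathbb Z}$ be a strictly stationary solution of $y_t=A^*y_{t-1}+\varepsilon_t$ in $\mathbb R^p$, of which $y_0,\dots,y_T$ are observed; put $X=[y_0\cdots y_{T-1}]$, $Y=[y_1\cdots y_T]$. *Assumptions.* (1) The spectral radius of $A^*$ is less than $1$. (2) $\varepsilon_t=\Sigma_\varepsilon^{1/2}\zeta_t$ with $\Sigma_\varepsilon$ positive definite and $\zeta_t$ i.i.d. with mean $0$, covariance $I_p$ and mutually independent entries satisfying $\mathbb E e^{u\zeta_{it}}\le e^{\tau^2u^2/2}$ for all $u\in\mathbb R$. (3) $\sin\theta_1(R^*,P^*)\ge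 g_{\min}>0$, where $\theta_1(R,P)=\arccos s_1$ with $s_1$ the largest singular value of $R^\top P$ ($s_1=0$ if $d=r$). *Quantities.* Let $\mathcal A(z)=I_p-A^*z$, $\mu_{\min}=\min_{|z|=1}\lambda_{\min}(\mathcal A^\dagger(z)\mathcal A(z))$, $\mu_{\max}=\max_{|z|=1}\lambda_{\max}(\mathcal A^\dagger(z)\mathcal A(z))$, and $$\alpha=\frac{\lambda_{\min}(\Sigma_\varepsilon)}{2\mu_{\max}},\quad \beta=\frac{3\lambda_{\max}(\Sigma_\varepsilon)}{2\mu_{\min}},\quad M_1=\frac{\lambda_{\max}(\Sigma_\varepsilon)}{\mu_{\min}^{1/2}},\quad M_2=\frac{\lambda_{\min}(\Sigma_\varepsilon)\,\mu_{\min}}{\lambda_{\max}(\Sigma_\varepsilon)\,\mu_{\max}},$$ $$d_{\rm RR}(p,r)=r(2p-r),\qquad d_{\rm CS}(p,r,d)=r(2p-r)-d\Big(p-\frac{d+1}2\Big).$$ *Algorithm.* For $a,b,\eta>0$, run gradient descent with step size $\eta$ on $$\tfrac1{2T}\|Y-[C\ R]D[C\ P]^\top X\|_F^2+\tfrac a2\big\|[C\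 R]^\top[C\ R]-b^2I_r\big\|_F^2+\tfrac a2\big\|[C\ P]^\top[C\ P]-b^2I_r\big\|_F^2$$ in the form \begin{align*} C^{+}&=C-\eta\nabla_C\mathcal L-\eta a\big[2C(C^\top C-b^2I_d)+RR^\top C+PP^\top C\big],\\ R^{+}&=R-\eta\nabla_R\mathcal L-\eta a\big[R(R^\top R-b^2I_{r-d})+CC^\top R\big],\\ P^{+}&=P-\eta\nabla_P\mathcal L-\eta a\big[P(P^\top P-b^2I_{r-d})+CC^\top P\big],\\ D^{+}&=D-\eta\nabla_D\mathcal L, \end{align*} where $\nabla_C\mathcal L,\dots,\nabla_D\mathcal L$ are the partial gradients of the first (least squares) term. Write $A^{(i)}=[C^{(i)}\ R^{(i)}]D^{(i)}[C^{(i)}\ P^{(i)}]^\top$ for the $i$-th iterate. The initial value is spectral: with $\hat H$ the first $r$ eigenvectors of $YX^\top(XX^\top)^{-1}XY^\top$, take a singular value decomposition $\hat H\hat H^\top YX^\top(XX^\top)^{-1}=\tilde U\tilde S\tilde V^\top$ of the reduced-rank estimator $\tilde A$ ($\tilde U,\tilde V\in\mathbb R^{p\times r}$); let $\tilde R$, $\tilde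 P$ be the top $r-d$ left singular vectors of $\tilde U\tilde U^\top(I-\tilde V\tilde V^\top)$ and $\tilde V\tilde V^\top(I-\tilde U\tilde U^\top)$, let $\tilde C$ be the top $d$ eigenvectors of $(I-\tilde R\tilde R^\top)(I-\tilde P\tilde P^\top)(\tilde U\tilde U^\top+\tilde V\tilde V^\top)(I-\tilde R\tilde R^\top)(I-\tilde P\tilde P^\top)$, and $\tilde D=[\tilde C\ \tilde R]^\top\tilde A[\tilde C\ \tilde P]$; set $(C^{(0)},R^{(0)},P^{(0)},D^{(0)})=(b\tilde C,b\tilde R,b\tilde P,b^{-2}\tilde D)$. **Theorem.** For every $K\ge1$ there are positive constants $C_T,c_0,C_P,C_N,C_L,C_B$ with $C_L\le 1$, depending only on $K$, such that the following holds. Suppose that (1)–(3) hold, that $$T\ge C_T\max(\tau^4,\tau^2)M_2^{-2}\,p,\qquad \kappa^2g_{\min}^{-2}\alpha^{-1}\tau^2M_1\sqrt{\frac{d_{\rm RR}(p,r)}T}\le c_0\,\sigma_r ,$$ that $K^{-1}\le a/(\alpha\sigma_1^{2/3}\kappa^{-2})\le K$ and $K^{-1}\le b/\sigma_1^{1/3}\le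 K$, and that $\eta=\eta_0\beta^{-1}\sigma_1^{-4/3}$ with $0<\eta_0\le 1/(260K^4)$. Then for every integer $I\ge 0$ with $$I\ \ge\ C_N\,\frac{\log(\kappa^{-1}\sigma_1^{-1/3}g_{\min})}{\log(1-C_L\,\eta_0\,\alpha\beta^{-1}\kappa^{-2})}$$ (a number that does not involve $p$ or $T$ except through $\kappa,\sigma_1,g_{\min},\alpha,\beta,\eta_0$), with probability at least $$1-4\exp\!\big[-C_PM_2^2\min(\tau^{-2},\tau^{-4})T\big]-2\exp(-C_Pp)$$ $XX^\top$ is invertible, the spectral initial value exists, and, for every choice of the eigenvectors and singular vectors in its construction, $$\|A^{(I)}-A^*\|_F\ \le\ C_B\,\kappa\,\alpha^{-1}\tau^2M_1\sqrt{\frac{d_{\rm CS}(p,r,d)}T}.$$ Moreover, when $d\ge1$ and $p\ge2$, $\sqrt{d_{\rm CS}(p,r,d)/T}<\sqrt{d_{\rm RR}(p,r)/T}$, so this rate improves on the reduced-rank rate. -/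

import Mathlib

open MeasureTheory ProbabilityTheory Matrix

noncomputable section

namespace CommonVAR

/-! ### Matrix quantities -/

/-- Frobenius norm of a real matrix. -/
def frobNorm {m n : Type*} [Fintype m] [Fintype n] (M : Matrix m n ℝ) : ℝ :=
  Real.sqrt (∑ i, ∑ j, M i j ^ 2)

/-- The `k`-th largest singular value of a real matrix, counted from `k = 0`
(and equal to `0` beyond the rank). -/
def sigma {m n : Type*} [Fintype m] [DecidableEq m] [Fintype n] [DecidableEq n]
    (M : Matrix m n ℝ) (k : ℕ) : ℝ :=
  (Matrix.toEuclideanLin M).singularValues k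

/-- Largest eigenvalue of a (real or complex) Hermitian matrix. -/
def lamMax {𝕜 : Type*} [RCLike 𝕜] {p : ℕ} (M : Matrix (Fin p) (Fin p) 𝕜) : ℝ :=
  sSup (spectrum ℝ M)

/-- Smallest eigenvalue of a (real or complex) Hermitian matrix. -/
def lamMin {𝕜 : Type*} [RCLike 𝕜] {p : ℕ} (M : Matrix (Fin p) (Fin p) 𝕜) : ℝ :=
  sInf (spectrum ℝ M)

/-- `W` consists of the first `k` columns of an orthogonal matrix that diagonalises the symmetric
matrix `M`, the eigenvalues being in decreasing order. -/
def IsTopEigenvectors {p k : ℕ} (M : Matrix (Fin p) (Fin p) ℝ) (W : Matrix (Fin p) (Fin k) ℝ) :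
    Prop :=
  ∃ (hk : k ≤ p) (Q : Matrix (Fin p) (Fin p) ℝ) (l : Fin p → ℝ),
    Qᵀ * Q = 1 ∧ Antitone l ∧ M = Q * Matrix.diagonal l * Qᵀ ∧
      W = Q.submatrix id (Fin.castLE hk)

/-- `W` consists of the first `k` left singular vectors in some singular value decomposition of
`M` with the singular values in decreasing order. -/
def IsTopLeftSingularVectors {p k : ℕ} (M : Matrix (Fin p) (Fin p) ℝ)
    (W : Matrix (Fin p) (Fin k) ℝ) : Prop :=
  ∃ (hk : k ≤ p) (U V : Matrix (Fin p) (Fin p) ℝ) (s : Fin p → ℝ),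
    Uᵀ * U = 1 ∧ Vᵀ * V = 1 ∧ Antitone s ∧ (∀ i, 0 ≤ s i) ∧
      M = U * Matrix.diagonal s * Vᵀ ∧ W = U.submatrix id (Fin.castLE hk)

/-- Sine of the smallest canonical angle `θ₁ = arccos (s₁)` between the column spaces of two
matrices with orthonormal columns, `s₁` being the largest singular value of `Rᵀ P`. -/
def sinTheta1 {p k : ℕ} (R P : Matrix (Fin p) (Fin k) ℝ) : ℝ :=
  Real.sin (Real.arccos (sigma (Rᵀ * P) 0))

/-! ### Quantities of the autoregression `y_t = A y_{t-1} + ε_t` -/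

/-- The matrix polynomial `𝒜(z) = I - A z`. -/
def charPoly {p : ℕ} (A : Matrix (Fin p) (Fin p) ℝ) (z : ℂ) : Matrix (Fin p) (Fin p) ℂ :=
  1 - z • A.map Complex.ofReal

def muMin {p : ℕ} (A : Matrix (Fin p) (Fin p) ℝ) : ℝ :=
  ⨅ z : Circle, lamMin ((charPoly A z)ᴴ * charPoly A z)

def muMax {p : ℕ} (A : Matrix (Fin p) (Fin p) ℝ) : ℝ :=
  ⨆ z : Circle, lamMax ((charPoly A z)ᴴ * charPoly A z)

/-- `α_RSC`, where `S` is the covariance matrix of the errors. -/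
def alphaRSC {p : ℕ} (A S : Matrix (Fin p) (Fin p) ℝ) : ℝ :=
  lamMin S / (2 * muMax A)

def betaRSS {p : ℕ} (A S : Matrix (Fin p) (Fin p) ℝ) : ℝ :=
  3 * lamMax S / (2 * muMin A)

def M1 {p : ℕ} (A S : Matrix (Fin p) (Fin p) ℝ) : ℝ :=
  lamMax S / Real.sqrt (muMin A)

def M2 {p : ℕ} (A S : Matrix (Fin p) (Fin p) ℝ) : ℝ :=
  (lamMin S * muMin A) / (lamMax S * muMax A)

/-- Number of parameters of a `p × p` matrix of rank `r`. -/
def dRR (p r : ℕ) : ℝ := (r : ℝ) * (2 * p - r)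

/-- Number of parameters of a `p × p` matrix of rank `r` whose row and column spaces have a common
subspace of dimension `d`. -/
def dCS (p r d : ℕ) : ℝ := (r : ℝ) * (2 * p - r) - (d : ℝ) * (p - ((d : ℝ) + 1) / 2)

/-! ### The model -/

/-- The components `C, R, P, D` of a matrix `[C R] D [C P]ᵀ`. -/
structure Comp (p r d : ℕ) where
  C : Matrix (Fin p) (Fin d) ℝ
  R : Matrix (Fin p) (Fin (r - d)) ℝ
  P : Matrix (Fin p) (Fin (r - d)) ℝ
  D : Matrix (Fin d ⊕ Fin (r - d)) (Fin d ⊕ Fin (r - d)) ℝ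

namespace Comp

variable {p r d : ℕ}

/-- `[C R]`. -/
def CR (θ : Comp p r d) : Matrix (Fin p) (Fin d ⊕ Fin (r - d)) ℝ := Matrix.fromCols θ.C θ.R

/-- `[C P]`. -/
def CP (θ : Comp p r d) : Matrix (Fin p) (Fin d ⊕ Fin (r - d)) ℝ := Matrix.fromCols θ.C θ.P

/-- `A(C, R, P, D) = [C R] D [C P]ᵀ`. -/
def toMat (θ : Comp p r d) : Matrix (Fin p) (Fin p) ℝ := θ.CR * θ.D * θ.CPᵀ

/-- The components form an orthonormal common-subspace decomposition of the rank `r` matrix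
`A`. -/
structure IsDecompOf (θ : Comp p r d) (A : Matrix (Fin p) (Fin p) ℝ) : Prop where
  orth_CR : θ.CRᵀ * θ.CR = 1
  orth_CP : θ.CPᵀ * θ.CP = 1
  eq_mat : A = θ.toMat
  rank_eq : A.rank = r

end Comp

/-- The error assumption: `ε_t = S^{1/2} ζ_t`, where `S` is the positive definite covariance matrix
of the errors with positive semidefinite square root `Sh`, and the vectors `ζ_t` are i.i.d. with
mean zero, identity covariance and independent `τ²`-sub-Gaussian entries. -/
structure ErrorAssumption {Ω : Type*} [MeasurableSpace Ω] (μ : Measure Ω) {p : ℕ}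
    (S Sh : Matrix (Fin p) (Fin p) ℝ) (τ : NNReal) (ζ : ℤ → Ω → Fin p → ℝ) : Prop where
  posDef : S.PosDef
  sqrt_psd : Sh.PosSemidef
  sqrt_sq : Sh * Sh = S
  meas : ∀ t, Measurable (ζ t)
  indep : iIndepFun ζ μ
  ident : ∀ t, IdentDistrib (ζ t) (ζ 0) μ μ
  mean : ∀ t i, ∫ ω, ζ t ω i ∂μ = 0
  cov : ∀ t i j, ∫ ω, ζ t ω i * ζ t ω j ∂μ = if i = j then 1 else 0
  indep_entries : ∀ t, iIndepFun (fun (i : Fin p) (ω : Ω) => ζ t ω i) μ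
  subG : ∀ t i, HasSubgaussianMGF (fun ω => ζ t ω i) (τ ^ 2) μ

/-- `y` is a strictly stationary solution of `y_t = A y_{t-1} + Sh ζ_t`. -/
structure IsStationaryVAR {Ω : Type*} [MeasurableSpace Ω] (μ : Measure Ω) {p : ℕ}
    (A Sh : Matrix (Fin p) (Fin p) ℝ) (ζ y : ℤ → Ω → Fin p → ℝ) : Prop where
  meas : ∀ t, Measurable (y t)
  eqn : ∀ t, ∀ᵐ ω ∂μ, y t ω = A *ᵥ y (t - 1) ω + Sh *ᵥ ζ t ω
  stationary : ∀ h : ℤ,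
    μ.map (fun ω (t : ℤ) => y (t + h) ω) = μ.map (fun ω (t : ℤ) => y t ω)

/-- `X = [y_0 ⋯ y_{T-1}]`. -/
def dataX {p : ℕ} (T : ℕ) (y : ℤ → Fin p → ℝ) : Matrix (Fin p) (Fin T) ℝ :=
  Matrix.of fun i t => y (t : ℕ) i

/-- `Y = [y_1 ⋯ y_T]`. -/
def dataY {p : ℕ} (T : ℕ) (y : ℤ → Fin p → ℝ) : Matrix (Fin p) (Fin T) ℝ :=
  Matrix.of fun i t => y ((t : ℕ) + 1) i

/-! ### The gradient descent algorithm -/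

section Algorithm

variable {p r d T : ℕ}

/-- Gradient `T⁻¹ (A X - Y) Xᵀ` of the loss `(2T)⁻¹ ‖Y - A X‖_F²` with respect to `A`. -/
def gradL (X Y : Matrix (Fin p) (Fin T) ℝ) (A : Matrix (Fin p) (Fin p) ℝ) :
    Matrix (Fin p) (Fin p) ℝ :=
  (T : ℝ)⁻¹ • ((A * X - Y) * Xᵀ)

/-- One iteration with step size `η` on the loss `(2T)⁻¹ ‖Y - [C R] D [C P]ᵀ X‖_F²` regularised by
`(a/2) ‖[C R]ᵀ[C R] - b² I‖_F² + (a/2) ‖[C P]ᵀ[C P] - b² I‖_F²`. -/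
def gdStep (X Y : Matrix (Fin p) (Fin T) ℝ) (a b η : ℝ) (θ : Comp p r d) : Comp p r d :=
  let G := gradL X Y θ.toMat
  let D11 := θ.D.toBlocks₁₁
  let D12 := θ.D.toBlocks₁₂
  let D21 := θ.D.toBlocks₂₁
  let D22 := θ.D.toBlocks₂₂
  { C := θ.C - η • (G * (θ.C * D11ᵀ + θ.P * D12ᵀ) + Gᵀ * (θ.C * D11 + θ.R * D21))
      - (η * a) • ((2 : ℝ) • (θ.C * (θ.Cᵀ * θ.C - (b ^ 2) • (1 : Matrix (Fin d) (Fin d) ℝ)))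
          + θ.R * θ.Rᵀ * θ.C + θ.P * θ.Pᵀ * θ.C)
    R := θ.R - η • (G * θ.CP * (Matrix.fromCols D21 D22)ᵀ)
      - (η * a) • (θ.R * (θ.Rᵀ * θ.R - (b ^ 2) • (1 : Matrix (Fin (r - d)) (Fin (r - d)) ℝ))
          + θ.C * θ.Cᵀ * θ.R)
    P := θ.P - η • (Gᵀ * θ.CR * (Matrix.fromCols D12ᵀ D22ᵀ)ᵀ)
      - (η * a) • (θ.P * (θ.Pᵀ * θ.P - (b ^ 2) • (1 : Matrix (Fin (r - d)) (Fin (r - d)) ℝ))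
          + θ.C * θ.Cᵀ * θ.P)
    D := θ.D - η • (θ.CRᵀ * G * θ.CP) }

/-- `θ` is an output of the spectral initialisation based on the reduced-rank autoregression.
Eigenvectors and singular vectors are determined only up to the usual ambiguity (at least signs);
any choice is an output. -/
def IsSpectralInit (X Y : Matrix (Fin p) (Fin T) ℝ) (b : ℝ) (θ : Comp p r d) : Prop :=
  IsUnit (X * Xᵀ).det ∧
  ∃ (H U V : Matrix (Fin p) (Fin r) ℝ) (s : Fin r → ℝ) (A : Matrix (Fin p) (Fin p) ℝ)
    (θ' : Comp p r d),
    -- the reduced-rank estimator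
    IsTopEigenvectors (Y * Xᵀ * (X * Xᵀ)⁻¹ * (X * Yᵀ)) H ∧
    A = H * Hᵀ * (Y * Xᵀ * (X * Xᵀ)⁻¹) ∧
    -- its singular value decomposition
    Uᵀ * U = 1 ∧ Vᵀ * V = 1 ∧ Antitone s ∧ (∀ i, 0 ≤ s i) ∧ A = U * Matrix.diagonal s * Vᵀ ∧
    -- the response-specific, the predictor-specific and the common component
    IsTopLeftSingularVectors (U * Uᵀ * (1 - V * Vᵀ)) θ'.R ∧
    IsTopLeftSingularVectors (V * Vᵀ * (1 - U * Uᵀ)) θ'.P ∧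
    IsTopEigenvectors
      ((1 - θ'.R * θ'.Rᵀ) * (1 - θ'.P * θ'.Pᵀ) * (U * Uᵀ + V * Vᵀ) *
        (1 - θ'.R * θ'.Rᵀ) * (1 - θ'.P * θ'.Pᵀ)) θ'.C ∧
    θ'.D = θ'.CRᵀ * A * θ'.CP ∧
    -- rescaling
    θ.C = b • θ'.C ∧ θ.R = b • θ'.R ∧ θ.P = b • θ'.P ∧ θ.D = (b ^ 2)⁻¹ • θ'.D

end Algorithm

end CommonVAR

end

/-! The argument separates a deterministic analysis from one probabilistic event. On the event
`GoodSample` the Gram matrix `X Xᵀ` lies between `T α` and `T β`, and the noise form `u ⬝ (Y - A X)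
Xᵀ v` is at most `n₀ |u| |Xᵀ v|` with `n₀` of order `τ √(λ_max p)`. Normalising by `|Xᵀ v|` rather
than by `|v|` makes a perturbation `B` of rank `k` interact with the noise by at most `n₀ √k ‖B
X‖_F` (`GoodSample.trace_noise_le`).

Deterministic part. The basic inequality for the best rank-`r` fit gives an error `δ` of order `n₀
√r / √(T α)` for the reduced-rank estimator (`reducedRank_error`). Dividing by `σ_r` turns this into
errors of the column and row projections. The separation `g` then makes the leading singular vectors
of `G₁ (1 - G₂)` and `G₂ (1 - G₁)` capture the specific directions, and the remaining directions are
nearly shared. Projecting the reduced-rank estimator onto the estimated structure costs a factor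
`κ`, so the initial error is at most `13 κ δ` (`spectralInit_spec`).

Gradient descent is controlled by monotonicity, not by a contraction estimate. The update is a
gradient step for a regularised objective, and with the prescribed step size it cannot increase that
objective near the truth (`objective_gdStep_le`). At the initial value the regulariser vanishes, so
its sublevel set consists of points with small prediction error and small balancing defect
(`sublevel_bounds`). These two smallness properties are exactly what the next descent step needs. By
induction every iterate stays in the sublevel set and within a constant times the initial bound of
the truth (`frobNorm_iterate_le`).

Two elementary identities give the stated rate. Since `β λ_max = (3/2) M₁²`, the quantity `κ √(β/α)
δ` is of order `κ α⁻¹ τ M₁ √(d_RR / T)`, and `τ ≤ 2 τ²` because unit variance forces `τ ≥ 1/2`.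
Since `x (2p - x)` increases on `[0, p]`, `d_RR ≤ 2 d_CS`, so the reduced-rank rate is already the
common-subspace rate up to a constant.

Probabilistic part. The process is first replaced by the autoregression started from zero `n` steps
before the sample, whose path is linear in finitely many independent sub-Gaussian variables.
Parseval's identity on the unit circle bounds its energy by `λ_max / μ_min` times that of the
innovations (`energy_le`), hence the relevant quadratic forms. The Hanson-Wright inequality, proved
by decoupling and Gaussian linearisation, controls the Gram matrix. An exponential supermartingale
controls the noise in fixed directions. Nets with `5 ^ p` points make both bounds uniform
(`measure_not_goodSample_le`). Along a subsequence of `n` the initial state is forgotten almost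
surely, and `GoodSample` is a closed condition, so the probability bound passes to the stationary
solution (`measure_not_goodSample_data_le`). -/

set_option linter.unusedSectionVars false

/-! ### Matrix analysis: norms, projections, eigenvectors and singular values. -/

namespace CommonVAR

open scoped Matrix.Norms.L2Operator

/-! ### Frobenius and operator norms -/

section Norms

variable {l m n : Type*} [Fintype l] [Fintype m] [Fintype n]
  [DecidableEq l] [DecidableEq m] [DecidableEq n]

lemma trace_transpose_mul_eq_sum (M N : Matrix m n ℝ) :
    (Mᵀ * N).trace = ∑ i, ∑ j, M i j * N i j := by
  simp only [Matrix.trace, Matrix.diag, Matrix.mul_apply, Matrix.transpose_apply]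
  exact Finset.sum_comm

lemma frobNorm_nonneg (M : Matrix m n ℝ) : 0 ≤ frobNorm M := Real.sqrt_nonneg _

lemma frobNorm_sq_sum (M : Matrix m n ℝ) : frobNorm M ^ 2 = ∑ i, ∑ j, M i j ^ 2 :=
  Real.sq_sqrt (Finset.sum_nonneg fun _ _ => Finset.sum_nonneg fun _ _ => sq_nonneg _)

lemma frobNorm_sq (M : Matrix m n ℝ) : frobNorm M ^ 2 = (Mᵀ * M).trace := by
  rw [frobNorm_sq_sum, trace_transpose_mul_eq_sum]
  simp only [sq]

lemma frobNorm_transpose (M : Matrix m n ℝ) : frobNorm Mᵀ = frobNorm M := by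
  simp only [frobNorm, Matrix.transpose_apply]
  rw [Finset.sum_comm]

lemma frobNorm_sq' (M : Matrix m n ℝ) : frobNorm M ^ 2 = (M * Mᵀ).trace := by
  rw [← frobNorm_transpose, frobNorm_sq, Matrix.transpose_transpose]

lemma frobNorm_neg (M : Matrix m n ℝ) : frobNorm (-M) = frobNorm M := by
  simp [frobNorm]

lemma frobNorm_zero : frobNorm (0 : Matrix m n ℝ) = 0 := by simp [frobNorm]

section Frob
open scoped Matrix.Norms.Frobenius

lemma frobNorm_add_le (M N : Matrix m n ℝ) : frobNorm (M + N) ≤ frobNorm M + frobNorm N := by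
  have h : ∀ M : Matrix m n ℝ,
      frobNorm M = @norm _ Matrix.frobeniusNormedAddCommGroup.toNorm M := by
    intro M
    rw [Matrix.frobenius_norm_def, frobNorm, Real.sqrt_eq_rpow]
    simp
  rw [h, h, h]
  exact @norm_add_le _ Matrix.frobeniusNormedAddCommGroup.toSeminormedAddCommGroup.toSeminormedAddGroup M N

end Frob

lemma frobNorm_sub_le (M N : Matrix m n ℝ) : frobNorm (M - N) ≤ frobNorm M + frobNorm N := by
  rw [sub_eq_add_neg, ← frobNorm_neg N]
  exact frobNorm_add_le _ _

lemma abs_trace_transpose_mul_le (M N : Matrix m n ℝ) :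
    |(Mᵀ * N).trace| ≤ frobNorm M * frobNorm N := by
  rw [trace_transpose_mul_eq_sum, frobNorm, frobNorm, ← Real.sqrt_mul (by positivity)]
  refine Real.abs_le_sqrt ?_
  simp only [← Finset.sum_product']
  exact Finset.sum_mul_sq_le_sq_mul_sq _ _ _

lemma frobNorm_eq_zero {M : Matrix m n ℝ} (h : frobNorm M = 0) : M = 0 := by
  have h2 : frobNorm M ^ 2 = 0 := by rw [h]; norm_num
  rw [frobNorm_sq_sum] at h2
  ext i j
  have h3 := (Finset.sum_eq_zero_iff_of_nonneg
    (fun i _ => Finset.sum_nonneg fun j _ => sq_nonneg (M i j))).1 h2 i (Finset.mem_univ _)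
  simpa using (Finset.sum_eq_zero_iff_of_nonneg (fun j _ => sq_nonneg (M i j))).1 h3 j
    (Finset.mem_univ _)

lemma dot_self_eq_norm_sq (v : n → ℝ) : v ⬝ᵥ v = ‖(WithLp.toLp 2 v : EuclideanSpace ℝ n)‖ ^ 2 := by
  rw [EuclideanSpace.norm_sq_eq]
  simp [dotProduct, sq]

lemma dot_self_nonneg (v : n → ℝ) : 0 ≤ v ⬝ᵥ v := by
  rw [dot_self_eq_norm_sq]; positivity

lemma dot_self_pos {v : n → ℝ} (hv : v ≠ 0) : 0 < v ⬝ᵥ v :=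
  lt_of_le_of_ne (dot_self_nonneg v) fun h => hv (dotProduct_self_eq_zero.1 h.symm)

lemma abs_dot_le (u v : n → ℝ) : |u ⬝ᵥ v| ≤ √(u ⬝ᵥ u) * √(v ⬝ᵥ v) := by
  rw [← Real.sqrt_mul (dot_self_nonneg u)]
  refine Real.abs_le_sqrt ?_
  simp only [dotProduct, ← sq]
  exact Finset.sum_mul_sq_le_sq_mul_sq _ _ _

lemma mulVec_dot_self_le (M : Matrix m n ℝ) (v : n → ℝ) :
    (M *ᵥ v) ⬝ᵥ (M *ᵥ v) ≤ ‖M‖ ^ 2 * (v ⬝ᵥ v) := by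
  rw [dot_self_eq_norm_sq, dot_self_eq_norm_sq, ← mul_pow]
  exact pow_le_pow_left₀ (norm_nonneg _) (M.l2_opNorm_mulVec (WithLp.toLp 2 v)) 2

lemma sqrt_mulVec_dot_self_le (M : Matrix m n ℝ) (v : n → ℝ) :
    √((M *ᵥ v) ⬝ᵥ (M *ᵥ v)) ≤ ‖M‖ * √(v ⬝ᵥ v) := by
  refine Real.sqrt_le_iff.2 ⟨by positivity, ?_⟩
  rw [mul_pow, Real.sq_sqrt (dot_self_nonneg v)]
  exact mulVec_dot_self_le M v

lemma opNorm_le_of_dot {M : Matrix m n ℝ} {c : ℝ} (hc : 0 ≤ c)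
    (h : ∀ v, (M *ᵥ v) ⬝ᵥ (M *ᵥ v) ≤ c ^ 2 * (v ⬝ᵥ v)) : ‖M‖ ≤ c := by
  rw [Matrix.l2_opNorm_def]
  refine ContinuousLinearMap.opNorm_le_bound _ hc fun x => ?_
  have := h (WithLp.ofLp x)
  rw [dot_self_eq_norm_sq, dot_self_eq_norm_sq, ← mul_pow] at this
  exact le_of_sq_le_sq this (by positivity)

lemma opNorm_transpose (M : Matrix m n ℝ) : ‖Mᵀ‖ = ‖M‖ := by
  rw [← Matrix.conjTranspose_eq_transpose_of_trivial, Matrix.l2_opNorm_conjTranspose]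

/-- Testing with `u = M v` gives `|M v|² ≤ c |M v| |v|`; cancelling `|M v|` leaves the claim, the
case `M v = 0` being trivial. -/
lemma opNorm_le_of_bilin {M : Matrix m n ℝ} {c : ℝ} (hc : 0 ≤ c)
    (h : ∀ u v, |u ⬝ᵥ M *ᵥ v| ≤ c * √(u ⬝ᵥ u) * √(v ⬝ᵥ v)) : ‖M‖ ≤ c := by
  refine opNorm_le_of_dot hc fun v => ?_
  have h1 := h (M *ᵥ v) v
  rw [abs_of_nonneg (dot_self_nonneg _)] at h1
  set a := (M *ᵥ v) ⬝ᵥ (M *ᵥ v) with ha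
  have ha0 : 0 ≤ a := dot_self_nonneg _
  have h2 : √a * √a ≤ √a * (c * √(v ⬝ᵥ v)) := by
    rw [Real.mul_self_sqrt ha0]; linarith [h1, mul_comm (√a) (c * √(v ⬝ᵥ v)), mul_right_comm c (√a) √(v ⬝ᵥ v)]
  rcases eq_or_lt_of_le (Real.sqrt_nonneg a) with h3 | h3
  · rw [eq_comm, Real.sqrt_eq_zero ha0] at h3
    rw [h3]; exact mul_nonneg (sq_nonneg c) (dot_self_nonneg v)
  · have h4 := le_of_mul_le_mul_left h2 h3
    rw [← Real.sq_sqrt ha0, ← Real.sq_sqrt (dot_self_nonneg v), ← mul_pow]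
    exact pow_le_pow_left₀ h3.le h4 2

lemma frobNorm_sq_mul_cols (M : Matrix l m ℝ) (N : Matrix m n ℝ) :
    frobNorm (M * N) ^ 2 = ∑ j, (M *ᵥ Nᵀ j) ⬝ᵥ (M *ᵥ Nᵀ j) := by
  rw [frobNorm_sq_sum, Finset.sum_comm]
  simp [dotProduct, Matrix.mulVec, Matrix.mul_apply, sq]

lemma frobNorm_sq_cols (N : Matrix m n ℝ) : frobNorm N ^ 2 = ∑ j, Nᵀ j ⬝ᵥ Nᵀ j := by
  rw [frobNorm_sq_sum, Finset.sum_comm]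
  simp [dotProduct, sq]

lemma frobNorm_mul_le (M : Matrix l m ℝ) (N : Matrix m n ℝ) :
    frobNorm (M * N) ≤ ‖M‖ * frobNorm N := by
  refine le_of_sq_le_sq ?_ (mul_nonneg (norm_nonneg _) (frobNorm_nonneg _))
  rw [mul_pow, frobNorm_sq_mul_cols, frobNorm_sq_cols, Finset.mul_sum]
  exact Finset.sum_le_sum fun j _ => mulVec_dot_self_le _ _

lemma frobNorm_mul_le' (M : Matrix l m ℝ) (N : Matrix m n ℝ) :
    frobNorm (M * N) ≤ frobNorm M * ‖N‖ := by
  rw [← frobNorm_transpose, Matrix.transpose_mul, mul_comm, ← opNorm_transpose,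
    ← frobNorm_transpose M]
  exact frobNorm_mul_le _ _

lemma le_frobNorm_mul {M : Matrix l m ℝ} {c : ℝ}
    (h : ∀ v, c ^ 2 * (v ⬝ᵥ v) ≤ (M *ᵥ v) ⬝ᵥ (M *ᵥ v)) (N : Matrix m n ℝ) :
    c * frobNorm N ≤ frobNorm (M * N) := by
  refine le_of_sq_le_sq ?_ (frobNorm_nonneg _)
  rw [mul_pow, frobNorm_sq_mul_cols, frobNorm_sq_cols, Finset.mul_sum]
  exact Finset.sum_le_sum fun j _ => h _

lemma le_frobNorm_mul' {N : Matrix m n ℝ} {c : ℝ}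
    (h : ∀ v, c ^ 2 * (v ⬝ᵥ v) ≤ (Nᵀ *ᵥ v) ⬝ᵥ (Nᵀ *ᵥ v)) (M : Matrix l m ℝ) :
    c * frobNorm M ≤ frobNorm (M * N) := by
  rw [← frobNorm_transpose M, ← frobNorm_transpose (M * N), Matrix.transpose_mul]
  exact le_frobNorm_mul h _

lemma opNorm_le_frobNorm (M : Matrix m n ℝ) : ‖M‖ ≤ frobNorm M := by
  refine opNorm_le_of_dot (frobNorm_nonneg _) fun v => ?_
  rw [frobNorm_sq_sum, Finset.sum_mul]
  simp only [dotProduct, ← sq]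
  refine Finset.sum_le_sum fun i _ => ?_
  exact Finset.sum_mul_sq_le_sq_mul_sq _ _ _

/-! ### Matrices with orthonormal columns -/

lemma mulVec_dot_mulVec (M : Matrix m n ℝ) (u v : n → ℝ) :
    (M *ᵥ u) ⬝ᵥ (M *ᵥ v) = u ⬝ᵥ ((Mᵀ * M) *ᵥ v) := by
  rw [← Matrix.mulVec_mulVec, Matrix.dotProduct_mulVec u, Matrix.vecMul_transpose]

lemma orth_mulVec_dot {Q : Matrix m n ℝ} (hQ : Qᵀ * Q = 1) (v : n → ℝ) :
    (Q *ᵥ v) ⬝ᵥ (Q *ᵥ v) = v ⬝ᵥ v := by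
  rw [mulVec_dot_mulVec, hQ, Matrix.one_mulVec]

lemma opNorm_orth_le {Q : Matrix m n ℝ} (hQ : Qᵀ * Q = 1) : ‖Q‖ ≤ 1 :=
  opNorm_le_of_dot zero_le_one fun v => by rw [orth_mulVec_dot hQ]; simp

lemma frobNorm_orth_mul {Q : Matrix m n ℝ} (hQ : Qᵀ * Q = 1) (M : Matrix n l ℝ) :
    frobNorm (Q * M) = frobNorm M := by
  refine (sq_eq_sq₀ (frobNorm_nonneg _) (frobNorm_nonneg _)).1 ?_
  rw [frobNorm_sq, frobNorm_sq, Matrix.transpose_mul, Matrix.mul_assoc, ← Matrix.mul_assoc Qᵀ, hQ,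
    Matrix.one_mul]

lemma frobNorm_mul_orth {Q : Matrix m n ℝ} (hQ : Qᵀ * Q = 1) (M : Matrix l n ℝ) :
    frobNorm (M * Qᵀ) = frobNorm M := by
  rw [← frobNorm_transpose, Matrix.transpose_mul, Matrix.transpose_transpose,
    frobNorm_orth_mul hQ, frobNorm_transpose]

/-- Orthogonal projection matrices. -/
structure IsProj (P : Matrix m m ℝ) : Prop where
  symm : Pᵀ = P
  idem : P * P = P

lemma isProj_orth {Q : Matrix m n ℝ} (hQ : Qᵀ * Q = 1) : IsProj (Q * Qᵀ) where
  symm := by simp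
  idem := by rw [Matrix.mul_assoc, ← Matrix.mul_assoc Qᵀ, hQ, Matrix.one_mul]

lemma IsProj.one_sub {P : Matrix m m ℝ} (h : IsProj P) : IsProj (1 - P) where
  symm := by simp [h.symm]
  idem := by simp [mul_sub, sub_mul, h.idem]

/-- A squared residual becomes linear in the projection, the form in which Ky Fan's principle
compares two projections. -/
lemma IsProj.frobNorm_mul_sq {P : Matrix m m ℝ} (h : IsProj P) (M : Matrix m n ℝ) :
    frobNorm (P * M) ^ 2 = (P * (M * Mᵀ)).trace := by
  rw [frobNorm_sq', Matrix.transpose_mul, h.symm, Matrix.mul_assoc, Matrix.trace_mul_comm,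
    ← Matrix.mul_assoc, Matrix.mul_assoc, h.idem, Matrix.trace_mul_comm]

lemma IsProj.dot {P : Matrix m m ℝ} (h : IsProj P) (v : m → ℝ) :
    (P *ᵥ v) ⬝ᵥ (P *ᵥ v) = v ⬝ᵥ (P *ᵥ v) := by
  rw [mulVec_dot_mulVec, h.symm, h.idem]

lemma IsProj.dot_add {P : Matrix m m ℝ} (h : IsProj P) (v : m → ℝ) :
    (P *ᵥ v) ⬝ᵥ (P *ᵥ v) + ((1 - P) *ᵥ v) ⬝ᵥ ((1 - P) *ᵥ v) = v ⬝ᵥ v := by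
  rw [h.dot, h.one_sub.dot, Matrix.sub_mulVec, Matrix.one_mulVec, dotProduct_sub]; ring

lemma IsProj.dot_le {P : Matrix m m ℝ} (h : IsProj P) (v : m → ℝ) :
    (P *ᵥ v) ⬝ᵥ (P *ᵥ v) ≤ v ⬝ᵥ v := by
  rw [← h.dot_add v]; linarith [dot_self_nonneg ((1 - P) *ᵥ v)]

lemma IsProj.opNorm_le {P : Matrix m m ℝ} (h : IsProj P) : ‖P‖ ≤ 1 :=
  opNorm_le_of_dot zero_le_one fun v => by simpa using h.dot_le v

lemma IsProj.frobNorm_mul_le {P : Matrix m m ℝ} (h : IsProj P) (M : Matrix m n ℝ) :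
    frobNorm (P * M) ≤ frobNorm M :=
  (CommonVAR.frobNorm_mul_le P M).trans (mul_le_of_le_one_left (frobNorm_nonneg _) h.opNorm_le)

lemma IsProj.frobNorm_mul_le' {P : Matrix m m ℝ} (h : IsProj P) (M : Matrix n m ℝ) :
    frobNorm (M * P) ≤ frobNorm M :=
  (CommonVAR.frobNorm_mul_le' M P).trans (mul_le_of_le_one_right (frobNorm_nonneg _) h.opNorm_le)

end Norms

end CommonVAR

namespace CommonVAR

open scoped Matrix.Norms.L2Operator

/-! ### Eigenvalue decompositions in matrix form -/

/-- `Q` diagonalises `M` with eigenvalues `l` in decreasing order. -/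
structure IsEig {p : ℕ} (M Q : Matrix (Fin p) (Fin p) ℝ) (l : Fin p → ℝ) : Prop where
  orth : Qᵀ * Q = 1
  anti : Antitone l
  eq : M = Q * Matrix.diagonal l * Qᵀ

lemma mul_diagonal_mul_transpose_apply {l m n : Type*} [Fintype n] [DecidableEq n]
    (Q : Matrix l n ℝ) (R : Matrix m n ℝ) (d : n → ℝ) (i : l) (j : m) :
    (Q * Matrix.diagonal d * Rᵀ) i j = ∑ x, Q i x * d x * R j x := by
  rw [Matrix.mul_apply]
  simp only [Matrix.mul_diagonal, Matrix.transpose_apply]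

lemma exists_isEig {p : ℕ} {M : Matrix (Fin p) (Fin p) ℝ} (hM : Mᵀ = M) :
    ∃ Q l, IsEig M Q l := by
  have hH : M.IsHermitian := by
    rw [Matrix.IsHermitian, Matrix.conjTranspose_eq_transpose_of_trivial, hM]
  let Q₀ : Matrix (Fin p) (Fin p) ℝ := hH.eigenvectorUnitary
  have h1 : Q₀ᵀ * Q₀ = 1 := by
    have := (Matrix.mem_unitaryGroup_iff').1 hH.eigenvectorUnitary.2
    rwa [Matrix.star_eq_conjTranspose, Matrix.conjTranspose_eq_transpose_of_trivial] at this
  have h2 : M = Q₀ * Matrix.diagonal hH.eigenvalues * Q₀ᵀ := by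
    have := hH.spectral_theorem
    rw [Unitary.conjStarAlgAut_apply] at this
    conv_lhs => rw [this]
    rw [Matrix.star_eq_conjTranspose, Matrix.conjTranspose_eq_transpose_of_trivial]
    rfl
  -- Sorting the negated eigenvalues increasingly puts the eigenvalues in decreasing order.
  let e := Tuple.sort fun i => -hH.eigenvalues i
  have he : Monotone ((fun i => -hH.eigenvalues i) ∘ e) := Tuple.monotone_sort _
  refine ⟨Q₀.submatrix id e, hH.eigenvalues ∘ e, ?_, fun i j hij => ?_, ?_⟩
  · ext i j
    have := congrFun (congrFun h1 (e i)) (e j)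
    simp only [Matrix.mul_apply, Matrix.transpose_apply, Matrix.submatrix_apply, id,
      Matrix.one_apply, EmbeddingLike.apply_eq_iff_eq] at this ⊢
    exact this
  · have := he hij
    simpa using this
  · conv_lhs => rw [h2]
    ext i j
    rw [mul_diagonal_mul_transpose_apply, mul_diagonal_mul_transpose_apply]
    exact (Equiv.sum_comp e fun k => Q₀ i k * hH.eigenvalues k * Q₀ j k).symm

lemma orth_mul_transpose {p : ℕ} {Q : Matrix (Fin p) (Fin p) ℝ} (hQ : Qᵀ * Q = 1) :
    Q * Qᵀ = 1 := mul_eq_one_comm.1 hQ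

/-- The first `k` columns. -/
lemma firstCols_orth {p k : ℕ} (hk : k ≤ p) {Q : Matrix (Fin p) (Fin p) ℝ} (hQ : Qᵀ * Q = 1) :
    (Q.submatrix id (Fin.castLE hk))ᵀ * Q.submatrix id (Fin.castLE hk) = 1 := by
  ext i j
  have := congrFun (congrFun hQ (Fin.castLE hk i)) (Fin.castLE hk j)
  simp only [Matrix.mul_apply, Matrix.transpose_apply, Matrix.submatrix_apply, id,
    Matrix.one_apply, Fin.castLE_inj] at this ⊢
  exact this

lemma sum_castLE {p k : ℕ} (hk : k ≤ p) (f : Fin p → ℝ) :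
    ∑ i : Fin k, f (Fin.castLE hk i) = ∑ i : Fin p, if (i : ℕ) < k then f i else 0 := by
  rw [← Finset.sum_filter]
  refine Finset.sum_bij (fun i _ => Fin.castLE hk i) ?_ ?_ ?_ ?_
  · intro i _; simp
  · intro i _ j _ h; simpa using h
  · intro j hj
    exact ⟨⟨j, by simpa using hj⟩, Finset.mem_univ _, rfl⟩
  · intro i _; rfl

lemma firstCols_mul_transpose {p k : ℕ} (hk : k ≤ p) (Q : Matrix (Fin p) (Fin p) ℝ) :
    Q.submatrix id (Fin.castLE hk) * (Q.submatrix id (Fin.castLE hk))ᵀ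
      = Q * Matrix.diagonal (fun i : Fin p => if (i : ℕ) < k then 1 else 0) * Qᵀ := by
  ext i j
  rw [mul_diagonal_mul_transpose_apply, Matrix.mul_apply]
  simp only [Matrix.transpose_apply, Matrix.submatrix_apply, id]
  rw [sum_castLE hk fun x => Q i x * Q j x]
  refine Finset.sum_congr rfl fun x _ => ?_
  split_ifs <;> simp

/-- `G i i = |G eᵢ|²` and a projection does not lengthen `eᵢ`. In an eigenbasis these diagonal
entries are the weights of Ky Fan's principle. -/
lemma IsProj.diag_mem {n : Type*} [Fintype n] [DecidableEq n] {G : Matrix n n ℝ} (h : IsProj G)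
    (i : n) : 0 ≤ G i i ∧ G i i ≤ 1 := by
  have h1 := h.dot (Pi.single i 1)
  have h2 := h.dot_le (Pi.single i 1)
  have h3 := dot_self_nonneg (G *ᵥ Pi.single i 1)
  simp only [single_dotProduct, one_mul, Pi.single_eq_same, Matrix.mulVec_single_one,
    Matrix.col_apply] at h1 h2 h3
  exact ⟨by linarith, by linarith⟩

/-- Ky Fan's maximum principle. -/
lemma trace_proj_mul_le {p k : ℕ} (hk : k ≤ p) {M Q : Matrix (Fin p) (Fin p) ℝ} {l : Fin p → ℝ}
    (h : IsEig M Q l) {G : Matrix (Fin p) (Fin p) ℝ} (hG : IsProj G) (hGk : G.trace = k) :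
    (G * M).trace ≤ (Q.submatrix id (Fin.castLE hk) * (Q.submatrix id (Fin.castLE hk))ᵀ * M).trace
      := by
  -- In the eigenbasis the trace is a weighted sum of eigenvalues, with the diagonal of the rotated
  -- projection as weights.
  have key : ∀ G : Matrix (Fin p) (Fin p) ℝ, (G * M).trace = ∑ i, (Qᵀ * G * Q) i i * l i := by
    intro G
    rw [h.eq, ← Matrix.mul_assoc, Matrix.trace_mul_comm, ← Matrix.mul_assoc, ← Matrix.mul_assoc]
    simp [Matrix.trace, Matrix.mul_diagonal]
  have htr : ∑ i, (Qᵀ * G * Q) i i = k := by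
    rw [← hGk]
    change (Qᵀ * G * Q).trace = _
    rw [Matrix.trace_mul_comm, ← Matrix.mul_assoc, orth_mul_transpose h.orth, Matrix.one_mul]
  have hc : IsProj (Qᵀ * G * Q) :=
    ⟨by simp [Matrix.mul_assoc, hG.symm], by
      rw [show Qᵀ * G * Q * (Qᵀ * G * Q) = Qᵀ * (G * (Q * Qᵀ) * G) * Q by
        simp only [Matrix.mul_assoc], orth_mul_transpose h.orth, Matrix.mul_one, hG.idem]⟩
  rw [key, key, firstCols_mul_transpose]
  have h0 : ∀ i, (Qᵀ * (Q * Matrix.diagonal (fun i : Fin p => if (i : ℕ) < k then (1 : ℝ) else 0)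
      * Qᵀ) * Q) i i = if (i : ℕ) < k then 1 else 0 := by
    intro i
    rw [show ∀ D, Qᵀ * (Q * D * Qᵀ) * Q = (Qᵀ * Q) * D * (Qᵀ * Q) by
      intro D; simp only [Matrix.mul_assoc], h.orth]
    simp
  simp only [h0]
  -- A threshold between the first `k` eigenvalues and the rest: the `k`-th eigenvalue, which has
  -- index `k - 1`, or any upper bound when `k = 0`.
  obtain ⟨t, ht1, ht2⟩ : ∃ t, (∀ i : Fin p, (i : ℕ) < k → t ≤ l i) ∧
      (∀ i : Fin p, ¬ (i : ℕ) < k → l i ≤ t) := by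
    rcases Nat.eq_zero_or_pos k with rfl | hk0
    · exact ⟨∑ i, |l i|, by simp, fun i _ => (le_abs_self _).trans
        (Finset.single_le_sum (f := fun i => |l i|) (fun _ _ => abs_nonneg _) (Finset.mem_univ i))⟩
    · refine ⟨l ⟨k - 1, by omega⟩, fun i hi => h.anti ?_, fun i hi => h.anti ?_⟩
      · rw [Fin.le_def]; simp only; omega
      · rw [Fin.le_def]; simp only; omega
  have h1 : ∑ i : Fin p, (if (i : ℕ) < k then (1 : ℝ) else 0) = k := by
    rw [← sum_castLE hk fun _ => 1]; simp
  -- Both factors change sign at index `k`, so every term is nonnegative. Both systems of weights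
  -- sum to `k`, hence the threshold `t` cancels.
  have h2 : 0 ≤ ∑ i : Fin p, ((if (i : ℕ) < k then (1 : ℝ) else 0) - (Qᵀ * G * Q) i i)
      * (l i - t) := by
    refine Finset.sum_nonneg fun i _ => ?_
    split_ifs with hi
    · exact mul_nonneg (by linarith [(hc.diag_mem i).2]) (by linarith [ht1 i hi])
    · exact mul_nonneg_of_nonpos_of_nonpos (by linarith [(hc.diag_mem i).1])
        (by linarith [ht2 i hi])
  simp only [sub_mul, mul_sub, Finset.sum_sub_distrib, ← Finset.sum_mul] at h2
  rw [h1, htr] at h2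
  linarith

lemma trace_orth_proj {m n : Type*} [Fintype m] [Fintype n] [DecidableEq m] [DecidableEq n]
    {W : Matrix m n ℝ} (h : Wᵀ * W = 1) : (W * Wᵀ).trace = Fintype.card n := by
  rw [Matrix.trace_mul_comm, h, Matrix.trace_one]

/-- Courant-Fischer lower bound. -/
lemma IsEig.le_of_subspace {p k : ℕ} {M Q : Matrix (Fin p) (Fin p) ℝ} {l : Fin p → ℝ}
    (h : IsEig M Q l) {W : Matrix (Fin p) (Fin k) ℝ} {c : ℝ} (hW : Wᵀ * W = 1)
    (hc : ∀ y, c * (y ⬝ᵥ y) ≤ (W *ᵥ y) ⬝ᵥ (M *ᵥ (W *ᵥ y))) (i : Fin p) (hi : (i : ℕ) < k) :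
    c ≤ l i := by
  -- `B` has fewer rows than columns, so some nonzero vector of the subspace is orthogonal to the
  -- first `i` eigenvectors; its quadratic form is at most `l i` times its squared length.
  let B : Matrix (Fin i) (Fin k) ℝ := (Qᵀ * W).submatrix (Fin.castLE i.2.le) id
  obtain ⟨y, hy0, hy⟩ : ∃ y, y ≠ 0 ∧ B *ᵥ y = 0 := by
    have hne : LinearMap.ker B.mulVecLin ≠ ⊥ :=
      LinearMap.ker_ne_bot_of_finrank_lt (by simpa using hi)
    obtain ⟨y, hy, hy0⟩ := (Submodule.ne_bot_iff _).1 hne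
    exact ⟨y, hy0, hy⟩
  let z := Qᵀ *ᵥ (W *ᵥ y)
  have hz : ∀ j : Fin p, j < i → z j = 0 := by
    intro j hj
    have := congrFun hy ⟨j, hj⟩
    simpa [B, z, Matrix.mulVec, dotProduct, Matrix.mul_apply] using this
  have hzz : z ⬝ᵥ z = y ⬝ᵥ y := by
    rw [orth_mulVec_dot (by rw [Matrix.transpose_transpose, orth_mul_transpose h.orth]),
      orth_mulVec_dot hW]
  have hM : (W *ᵥ y) ⬝ᵥ (M *ᵥ (W *ᵥ y)) = ∑ j, l j * z j ^ 2 := by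
    rw [h.eq, ← Matrix.mulVec_mulVec, ← Matrix.mulVec_mulVec, Matrix.dotProduct_mulVec,
      ← Matrix.mulVec_transpose, dotProduct]
    refine Finset.sum_congr rfl fun j _ => ?_
    rw [Matrix.mulVec_diagonal]; ring
  have h1 := hc y
  rw [hM] at h1
  have h2 : ∑ j, l j * z j ^ 2 ≤ l i * (z ⬝ᵥ z) := by
    rw [dotProduct, Finset.mul_sum]
    refine Finset.sum_le_sum fun j _ => ?_
    rcases lt_or_ge j i with hj | hj
    · simp [hz j hj]
    · rw [← sq]; exact mul_le_mul_of_nonneg_right (h.anti hj) (sq_nonneg _)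
  rw [hzz] at h2
  exact le_of_mul_le_mul_right (h1.trans h2) (dot_self_pos hy0)

/-! ### Singular value decompositions -/

/-- With `V` an eigenbasis of `Kᵀ K`, the columns of `K V` are orthogonal with lengths `√(l i)`.
Gram-Schmidt merely normalises the nonzero ones and fills in orthonormal vectors for the zero ones,
which gives `U`. -/
lemma exists_svd {p : ℕ} (K : Matrix (Fin p) (Fin p) ℝ) :
    ∃ (U V : Matrix (Fin p) (Fin p) ℝ) (s : Fin p → ℝ), Uᵀ * U = 1 ∧ Vᵀ * V = 1 ∧ Antitone s ∧
      (∀ i, 0 ≤ s i) ∧ K = U * Matrix.diagonal s * Vᵀ := by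
  obtain ⟨V, l, h⟩ := exists_isEig (M := Kᵀ * K) (by simp)
  have hcol : ∀ i j, (K * V)ᵀ i ⬝ᵥ (K * V)ᵀ j = if i = j then l i else 0 := by
    intro i j
    have : ((K * V)ᵀ * (K * V)) i j = if i = j then l i else 0 := by
      rw [Matrix.transpose_mul, Matrix.mul_assoc, ← Matrix.mul_assoc Kᵀ, h.eq,
        show Vᵀ * (V * Matrix.diagonal l * Vᵀ * V) = (Vᵀ * V) * Matrix.diagonal l * (Vᵀ * V) by
          simp only [Matrix.mul_assoc], h.orth, Matrix.one_mul, Matrix.mul_one,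
          Matrix.diagonal_apply]
    rw [← this]
    simp only [Matrix.mul_apply (M := (K * V)ᵀ), dotProduct, Matrix.transpose_apply]
  have hl0 : ∀ i, 0 ≤ l i := fun i => by
    have := hcol i i
    rw [if_pos rfl] at this
    rw [← this]; exact dot_self_nonneg _
  let f : Fin p → EuclideanSpace ℝ (Fin p) := fun i => WithLp.toLp 2 ((K * V)ᵀ i)
  have hin : ∀ i j, inner ℝ (f i) (f j) = if i = j then l i else 0 := by
    intro i j
    rw [← hcol i j]
    simp only [f, EuclideanSpace.inner_toLp_toLp, star_trivial]
    exact dotProduct_comm _ _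
  have hpw : Pairwise fun i j => inner ℝ (f i) (f j) = 0 := fun i j hij => by
    simp [hin, hij]
  have hnorm : ∀ i, ‖f i‖ = √(l i) := fun i => by
    rw [norm_eq_sqrt_real_inner, hin, if_pos rfl]
  let b := InnerProductSpace.gramSchmidtOrthonormalBasis (𝕜 := ℝ)
    (E := EuclideanSpace ℝ (Fin p)) (by simp) f
  have hfb : ∀ i, f i = √(l i) • b i := by
    intro i
    by_cases hi : f i = 0
    · have := hnorm i
      rw [hi, norm_zero] at this
      rw [← this, hi, zero_smul]
    · rw [InnerProductSpace.gramSchmidtOrthonormalBasis_apply_of_orthogonal _ hpw hi, hnorm,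
        smul_smul]
      have : √(l i) ≠ 0 := by rw [← hnorm]; exact norm_ne_zero_iff.2 hi
      simp [this]
  let U : Matrix (Fin p) (Fin p) ℝ := Matrix.of fun i j => b j i
  refine ⟨U, V, fun i => √(l i), ?_, h.orth, fun i j hij => Real.sqrt_le_sqrt (h.anti hij),
    fun i => Real.sqrt_nonneg _, ?_⟩
  · ext i j
    have := orthonormal_iff_ite.1 b.orthonormal i j
    simp only [PiLp.inner_apply, RCLike.inner_apply, conj_trivial] at this
    rw [Matrix.one_apply, ← this, Matrix.mul_apply]
    exact Finset.sum_congr rfl fun x _ => mul_comm _ _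
  · have h1 : K * V = U * Matrix.diagonal fun i => √(l i) := by
      ext i j
      have := congrArg (fun x : EuclideanSpace ℝ (Fin p) => x i) (hfb j)
      simp only [f, PiLp.smul_apply, smul_eq_mul] at this
      rw [Matrix.mul_diagonal]
      simp only [Matrix.transpose_apply] at this
      rw [this]; simp [U, mul_comm]
    rw [← h1, Matrix.mul_assoc, orth_mul_transpose h.orth, Matrix.mul_one]

/-- The data of the first `k` eigenvectors. -/
lemma IsTopEigenvectors.exists_isEig {p k : ℕ} {M : Matrix (Fin p) (Fin p) ℝ}
    {W : Matrix (Fin p) (Fin k) ℝ} (h : IsTopEigenvectors M W) :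
    ∃ (hk : k ≤ p) (Q : Matrix (Fin p) (Fin p) ℝ) (l : Fin p → ℝ), IsEig M Q l ∧
      W = Q.submatrix id (Fin.castLE hk) := by
  obtain ⟨hk, Q, l, h1, h2, h3, h4⟩ := h
  exact ⟨hk, Q, l, ⟨h1, h2, h3⟩, h4⟩

lemma exists_isTopEigenvectors {p k : ℕ} (hk : k ≤ p) {M : Matrix (Fin p) (Fin p) ℝ}
    (hM : Mᵀ = M) : ∃ W : Matrix (Fin p) (Fin k) ℝ, IsTopEigenvectors M W := by
  obtain ⟨Q, l, h⟩ := exists_isEig hM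
  exact ⟨_, hk, Q, l, h.orth, h.anti, h.eq, rfl⟩

lemma exists_isTopLeftSingularVectors {p k : ℕ} (hk : k ≤ p) (M : Matrix (Fin p) (Fin p) ℝ) :
    ∃ W : Matrix (Fin p) (Fin k) ℝ, IsTopLeftSingularVectors M W := by
  obtain ⟨U, V, s, h1, h2, h3, h4, h5⟩ := exists_svd M
  exact ⟨_, hk, U, V, s, h1, h2, h3, h4, h5, rfl⟩

/-- Makes the variational principles for eigenvectors available for the singular vectors of the
algorithm. -/
lemma IsTopLeftSingularVectors.isTopEigenvectors {p k : ℕ} {K : Matrix (Fin p) (Fin p) ℝ}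
    {W : Matrix (Fin p) (Fin k) ℝ} (h : IsTopLeftSingularVectors K W) :
    IsTopEigenvectors (K * Kᵀ) W := by
  obtain ⟨hk, U, V, s, h1, h2, h3, h4, h5, h6⟩ := h
  refine ⟨hk, U, fun i => s i * s i, h1, fun i j hij => ?_, ?_, h6⟩
  · exact mul_le_mul (h3 hij) (h3 hij) (h4 _) (h4 _)
  · rw [h5, Matrix.transpose_mul, Matrix.transpose_mul, Matrix.transpose_transpose,
      Matrix.diagonal_transpose,
      show U * Matrix.diagonal s * Vᵀ * (V * (Matrix.diagonal s * Uᵀ))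
        = U * (Matrix.diagonal s * (Vᵀ * V) * Matrix.diagonal s) * Uᵀ by
        simp only [Matrix.mul_assoc], h2, Matrix.mul_one, Matrix.diagonal_mul_diagonal]

lemma IsTopEigenvectors.orth {p k : ℕ} {M : Matrix (Fin p) (Fin p) ℝ}
    {W : Matrix (Fin p) (Fin k) ℝ} (h : IsTopEigenvectors M W) : Wᵀ * W = 1 := by
  obtain ⟨hk, Q, l, hE, rfl⟩ := h.exists_isEig
  exact firstCols_orth hk hE.orth

/-- Ky Fan's maximum principle. -/
lemma IsTopEigenvectors.trace_le {p k : ℕ} {M : Matrix (Fin p) (Fin p) ℝ}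
    {W : Matrix (Fin p) (Fin k) ℝ} (h : IsTopEigenvectors M W) {G : Matrix (Fin p) (Fin p) ℝ}
    (hG : IsProj G) (hGk : G.trace = k) : (G * M).trace ≤ (W * Wᵀ * M).trace := by
  obtain ⟨hk, Q, l, hE, rfl⟩ := h.exists_isEig
  exact trace_proj_mul_le hk hE hG hGk

/-- The leading eigenvalues are at least `c` if the quadratic form is on a `k`-dimensional
subspace. -/
lemma IsTopEigenvectors.exists_eigenvalues {p k : ℕ} {M : Matrix (Fin p) (Fin p) ℝ}
    {W : Matrix (Fin p) (Fin k) ℝ} (h : IsTopEigenvectors M W) {W₀ : Matrix (Fin p) (Fin k) ℝ}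
    {c : ℝ} (hW : W₀ᵀ * W₀ = 1)
    (hc : ∀ y, c * (y ⬝ᵥ y) ≤ (W₀ *ᵥ y) ⬝ᵥ (M *ᵥ (W₀ *ᵥ y))) :
    ∃ l : Fin k → ℝ, (∀ i, c ≤ l i) ∧ M * W = W * Matrix.diagonal l := by
  obtain ⟨hk, Q, l, hE, rfl⟩ := h.exists_isEig
  refine ⟨fun i => l (Fin.castLE hk i), fun i => hE.le_of_subspace hW hc _ i.2, ?_⟩
  have h1 : M * Q = Q * Matrix.diagonal l := by
    conv_lhs => rw [hE.eq]
    rw [Matrix.mul_assoc, hE.orth, Matrix.mul_one]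
  ext i j
  have := congrFun (congrFun h1 i) (Fin.castLE hk j)
  rw [Matrix.mul_diagonal] at this ⊢
  exact this

/-- Eigenvectors to positive eigenvalues lie in the range of the matrix. -/
lemma mul_eq_zero_of_eigen {m n k : Type*} [Fintype m] [Fintype n] [Fintype k] [DecidableEq k]
    {M : Matrix m m ℝ} {W : Matrix m k ℝ} {l : k → ℝ} (hl : ∀ i, 0 < l i)
    (h : M * W = W * Matrix.diagonal l) {B : Matrix n m ℝ} (hB : B * M = 0) : B * W = 0 := by
  have h1 : W = M * W * Matrix.diagonal fun i => (l i)⁻¹ := by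
    rw [h, Matrix.mul_assoc, Matrix.diagonal_mul_diagonal]
    have : (fun i => l i * (l i)⁻¹) = fun _ => 1 := funext fun i => mul_inv_cancel₀ (hl i).ne'
    rw [this, Matrix.diagonal_one, Matrix.mul_one]
  rw [h1, ← Matrix.mul_assoc, ← Matrix.mul_assoc, hB, Matrix.zero_mul, Matrix.zero_mul]

/-! ### Singular values -/

section Sigma

variable {m n : Type*} [Fintype m] [Fintype n] [DecidableEq m] [DecidableEq n]

/-- The basis diagonalises `Aᵀ A`; the upper and lower bounds in terms of `sigma` are read off this
sum of squares. -/
lemma exists_sigma_expansion (A : Matrix m n ℝ) :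
    ∃ e : OrthonormalBasis (Fin (Fintype.card n)) ℝ (EuclideanSpace ℝ n),
      (∀ v : n → ℝ, (A *ᵥ v) ⬝ᵥ (A *ᵥ v)
        = ∑ i : Fin (Fintype.card n), sigma A i ^ 2 * (inner ℝ (e i) (WithLp.toLp 2 v)) ^ 2) := by
  let T := Matrix.toEuclideanLin A
  have hn : Module.finrank ℝ (EuclideanSpace ℝ n) = Fintype.card n := by simp
  let e := T.isSymmetric_adjoint_comp_self.eigenvectorBasis hn
  refine ⟨e, fun v => ?_⟩
  let x : EuclideanSpace ℝ n := WithLp.toLp 2 v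
  have h1 : (A *ᵥ v) ⬝ᵥ (A *ᵥ v) = inner ℝ x ((LinearMap.adjoint T ∘ₗ T) x) := by
    rw [LinearMap.comp_apply, LinearMap.adjoint_inner_right, real_inner_self_eq_norm_sq,
      dot_self_eq_norm_sq]
    rfl
  rw [h1, ← e.sum_inner_mul_inner]
  refine Finset.sum_congr rfl fun i _ => ?_
  have h2 := T.sq_singularValues_fin hn i
  have h3 : inner ℝ (e i) ((LinearMap.adjoint T ∘ₗ T) x)
      = T.isSymmetric_adjoint_comp_self.eigenvalues hn i * inner ℝ (e i) x := by
    rw [← T.isSymmetric_adjoint_comp_self (e i) x,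
      T.isSymmetric_adjoint_comp_self.apply_eigenvectorBasis hn i]
    simp [inner_smul_left, e]
  rw [h3, ← h2, real_inner_comm]
  change _ = T.singularValues i ^ 2 * _
  ring

lemma sum_inner_sq (e : OrthonormalBasis (Fin (Fintype.card n)) ℝ (EuclideanSpace ℝ n))
    (v : n → ℝ) : ∑ i, (inner ℝ (e i) (WithLp.toLp 2 v)) ^ 2 = v ⬝ᵥ v := by
  rw [dot_self_eq_norm_sq]
  have := e.sum_sq_norm_inner_right (WithLp.toLp 2 v)
  simpa using this

lemma sigma_nonneg (A : Matrix m n ℝ) (k : ℕ) : 0 ≤ sigma A k :=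
  LinearMap.singularValues_nonneg _ _

lemma sigma_antitone (A : Matrix m n ℝ) : Antitone (sigma A) :=
  LinearMap.singularValues_antitone _

lemma mulVec_dot_le_sigma (A : Matrix m n ℝ) (v : n → ℝ) :
    (A *ᵥ v) ⬝ᵥ (A *ᵥ v) ≤ sigma A 0 ^ 2 * (v ⬝ᵥ v) := by
  obtain ⟨e, he⟩ := exists_sigma_expansion A
  rw [he, ← sum_inner_sq e, Finset.mul_sum]
  refine Finset.sum_le_sum fun i _ => mul_le_mul_of_nonneg_right ?_ (sq_nonneg (inner ℝ (e i) (WithLp.toLp 2 v)))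
  exact pow_le_pow_left₀ (sigma_nonneg _ _) (sigma_antitone A (Nat.zero_le _)) 2

lemma opNorm_le_sigma (A : Matrix m n ℝ) : ‖A‖ ≤ sigma A 0 :=
  opNorm_le_of_dot (sigma_nonneg _ _) (mulVec_dot_le_sigma A)

lemma sigma_pos_iff (A : Matrix m n ℝ) (k : ℕ) : 0 < sigma A k ↔ k < A.rank := by
  rw [sigma, LinearMap.singularValues_pos_iff_lt_finrank_range,
    Matrix.rank_eq_finrank_range_toLin A (EuclideanSpace.basisFun m ℝ).toBasis
      (EuclideanSpace.basisFun n ℝ).toBasis, ← Matrix.toEuclideanLin_eq_toLin_orthonormal]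

/-- The basis vectors with index at least `r` lie in the kernel of `A`, so `v` has no component
along them, and the remaining singular values are at least the `r`-th, which has index `r - 1`. -/
lemma le_mulVec_dot_of_rank {A : Matrix m n ℝ} {r : ℕ} (hr : A.rank = r) {v : n → ℝ}
    (hv : ∀ w, A *ᵥ w = 0 → w ⬝ᵥ v = 0) :
    sigma A (r - 1) ^ 2 * (v ⬝ᵥ v) ≤ (A *ᵥ v) ⬝ᵥ (A *ᵥ v) := by
  obtain ⟨e, he⟩ := exists_sigma_expansion A
  rw [he, ← sum_inner_sq e, Finset.mul_sum]
  refine Finset.sum_le_sum fun i _ => ?_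
  rcases lt_or_ge (i : ℕ) r with hi | hi
  · refine mul_le_mul_of_nonneg_right ?_ (sq_nonneg (inner ℝ (e i) (WithLp.toLp 2 v)))
    exact pow_le_pow_left₀ (sigma_nonneg _ _) (sigma_antitone A (by omega)) 2
  · have h0 : sigma A i = 0 :=
      le_antisymm (not_lt.1 fun h => by rw [sigma_pos_iff] at h; omega) (sigma_nonneg _ _)
    have h1 := he (WithLp.ofLp (e i))
    have h2 : ∀ j, inner ℝ (e j) (WithLp.toLp 2 (WithLp.ofLp (e i))) = if j = i then (1:ℝ) else 0 :=
      fun j => orthonormal_iff_ite.1 e.orthonormal j i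
    simp only [h2] at h1
    simp only [ite_pow, one_pow, ne_eq, OfNat.ofNat_ne_zero, not_false_eq_true, zero_pow,
      mul_ite, mul_one, mul_zero, Finset.sum_ite_eq', Finset.mem_univ, if_true] at h1
    rw [h0, zero_pow two_ne_zero, dotProduct_self_eq_zero] at h1
    have h3 := hv _ h1
    have h4 : inner ℝ (e i) (WithLp.toLp 2 v) = 0 := by
      rw [← h3, EuclideanSpace.inner_eq_star_dotProduct]
      simp [dotProduct_comm]
    rw [h4]; simp

/-- A lower bound for a square matrix transfers to its transpose. -/
lemma le_transpose_mulVec_dot {D : Matrix n n ℝ} {c : ℝ} (hc : 0 < c)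
    (h : ∀ v, c ^ 2 * (v ⬝ᵥ v) ≤ (D *ᵥ v) ⬝ᵥ (D *ᵥ v)) (v : n → ℝ) :
    c ^ 2 * (v ⬝ᵥ v) ≤ (Dᵀ *ᵥ v) ⬝ᵥ (Dᵀ *ᵥ v) := by
  have hinj : Function.Injective D.mulVec := by
    rw [← Matrix.coe_mulVecLin, ← LinearMap.ker_eq_bot]
    refine (Submodule.eq_bot_iff _).2 fun w hw => ?_
    have h1 := h w
    have hw' : D *ᵥ w = 0 := hw
    rw [hw', dotProduct_zero] at h1
    by_contra h0
    have := dot_self_pos h0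
    have : 0 < c ^ 2 * (w ⬝ᵥ w) := by positivity
    linarith
  -- With `v = D w`, `|v|² = ⟨Dᵀ v, w⟩ ≤ |Dᵀ v| |w|`, while the hypothesis gives `c |w| ≤ |v|`.
  obtain ⟨w, hw⟩ := (LinearMap.injective_iff_surjective (f := D.mulVecLin)).1 hinj v
  have hw' : D *ᵥ w = v := hw
  have h1 := h w
  rw [hw'] at h1
  have h2 : v ⬝ᵥ v = (Dᵀ *ᵥ v) ⬝ᵥ w := by
    conv_lhs => rw [← hw', Matrix.dotProduct_mulVec, ← Matrix.mulVec_transpose, hw']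
  have h3 := abs_dot_le (Dᵀ *ᵥ v) w
  rw [← h2, abs_of_nonneg (dot_self_nonneg v)] at h3
  have hv0 := dot_self_nonneg v
  have ha0 := dot_self_nonneg (Dᵀ *ᵥ v)
  have hw0 := dot_self_nonneg w
  have h4 : (v ⬝ᵥ v) ^ 2 ≤ ((Dᵀ *ᵥ v) ⬝ᵥ (Dᵀ *ᵥ v)) * (w ⬝ᵥ w) := by
    calc (v ⬝ᵥ v) ^ 2 ≤ (√((Dᵀ *ᵥ v) ⬝ᵥ (Dᵀ *ᵥ v)) * √(w ⬝ᵥ w)) ^ 2 :=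
          pow_le_pow_left₀ hv0 h3 2
      _ = _ := by rw [mul_pow, Real.sq_sqrt ha0, Real.sq_sqrt hw0]
  rcases eq_or_lt_of_le hv0 with h5 | h5
  · rw [← h5, mul_zero]; exact ha0
  · refine le_of_mul_le_mul_right ?_ h5
    calc c ^ 2 * (v ⬝ᵥ v) * (v ⬝ᵥ v) = c ^ 2 * (v ⬝ᵥ v) ^ 2 := by ring
      _ ≤ c ^ 2 * (((Dᵀ *ᵥ v) ⬝ᵥ (Dᵀ *ᵥ v)) * (w ⬝ᵥ w)) := by gcongr
      _ = ((Dᵀ *ᵥ v) ⬝ᵥ (Dᵀ *ᵥ v)) * (c ^ 2 * (w ⬝ᵥ w)) := by ring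
      _ ≤ _ := mul_le_mul_of_nonneg_left h1 ha0

end Sigma

end CommonVAR

/-! ### Specific and common subspaces of two projections. -/

namespace CommonVAR

open scoped Matrix.Norms.L2Operator

/-! ### Thin singular value decompositions and projections -/

lemma exists_thin_svd {p k : ℕ} (hk : k ≤ p) {K : Matrix (Fin p) (Fin p) ℝ} (hK : K.rank ≤ k) :
    ∃ (U V : Matrix (Fin p) (Fin k) ℝ) (s : Fin k → ℝ), Uᵀ * U = 1 ∧ Vᵀ * V = 1 ∧ Antitone s ∧
      (∀ i, 0 ≤ s i) ∧ K = U * Matrix.diagonal s * Vᵀ := by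
  obtain ⟨U, V, s, hU, hV, hs, hs0, h⟩ := exists_svd K
  have hrank : (Matrix.diagonal s).rank ≤ k := by
    have h1 : Matrix.diagonal s = Uᵀ * K * V := by
      rw [h, show Uᵀ * (U * Matrix.diagonal s * Vᵀ) * V
        = (Uᵀ * U) * Matrix.diagonal s * (Vᵀ * V) by simp only [Matrix.mul_assoc], hU, hV]
      simp
    rw [h1]
    exact ((Matrix.rank_mul_le_left _ _).trans (Matrix.rank_mul_le_right _ _)).trans hK
  rw [Matrix.rank_diagonal, Fintype.card_subtype] at hrank
  -- A positive singular value with index `i ≥ k` would come with `i + 1 > k` positive diagonal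
  -- entries, against the rank bound.
  have hz : ∀ i : Fin p, ¬ (i : ℕ) < k → s i = 0 := by
    intro i hi
    by_contra hne
    have hpos : 0 < s i := lt_of_le_of_ne (hs0 i) (Ne.symm hne)
    have hsub : (Finset.Iic i) ⊆ Finset.univ.filter fun j => s j ≠ 0 := by
      intro j hj
      simp only [Finset.mem_filter, Finset.mem_univ, true_and]
      exact (hpos.trans_le (hs (Finset.mem_Iic.1 hj))).ne'
    have := (Finset.card_le_card hsub).trans hrank
    rw [Fin.card_Iic] at this
    omega
  refine ⟨U.submatrix id (Fin.castLE hk), V.submatrix id (Fin.castLE hk),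
    fun i => s (Fin.castLE hk i), firstCols_orth hk hU, firstCols_orth hk hV,
    fun i j hij => hs (by simpa using hij), fun i => hs0 _, ?_⟩
  ext i j
  rw [h, mul_diagonal_mul_transpose_apply, mul_diagonal_mul_transpose_apply]
  simp only [Matrix.submatrix_apply, id]
  rw [sum_castLE hk fun x => U i x * s x * V j x]
  refine Finset.sum_congr rfl fun x _ => ?_
  split_ifs with hx
  · rfl
  · rw [hz x hx]; simp

/-- A projection of trace `k` has a `k`-dimensional orthonormal basis of its range. -/
lemma IsProj.exists_orth {p k : ℕ} (hk : k ≤ p) {G : Matrix (Fin p) (Fin p) ℝ} (hG : IsProj G)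
    (htr : G.trace = k) : ∃ W : Matrix (Fin p) (Fin k) ℝ, Wᵀ * W = 1 ∧ W * Wᵀ = G := by
  obtain ⟨W, hW⟩ := exists_isTopEigenvectors hk hG.symm
  -- Ky Fan's principle with `G` itself as competitor gives `tr (W Wᵀ G) ≥ k`, whence `‖W Wᵀ - G‖_F²
  -- = 2 k - 2 tr (W Wᵀ G) ≤ 0`.
  refine ⟨W, hW.orth, ?_⟩
  have h1 := hW.trace_le hG htr
  rw [hG.idem, htr] at h1
  have hP := isProj_orth hW.orth
  have h2 : frobNorm (W * Wᵀ - G) ^ 2 ≤ 0 := by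
    rw [frobNorm_sq, Matrix.transpose_sub, hP.symm, hG.symm,
      show (W * Wᵀ - G) * (W * Wᵀ - G) = W * Wᵀ * (W * Wᵀ) + G * G - W * Wᵀ * G - G * (W * Wᵀ) by
        noncomm_ring, hP.idem, hG.idem, Matrix.trace_sub, Matrix.trace_sub, Matrix.trace_add,
        Matrix.trace_mul_comm G, trace_orth_proj hW.orth, htr, Fintype.card_fin]
    linarith
  have h3 : frobNorm (W * Wᵀ - G) = 0 := pow_eq_zero_iff two_ne_zero |>.1 (le_antisymm h2 (sq_nonneg _))
  exact sub_eq_zero.1 (frobNorm_eq_zero h3)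

/-- Because the two projections have equal traces, each fails to contain the other by the same
amount; this is the factor `2`. -/
lemma frobNorm_proj_sub {p : ℕ} {n n' : Type*} [Fintype n] [DecidableEq n] [Fintype n']
    [DecidableEq n'] (hnn : Fintype.card n = Fintype.card n') {U : Matrix (Fin p) n ℝ}
    {V : Matrix (Fin p) n' ℝ} (hU : Uᵀ * U = 1) (hV : Vᵀ * V = 1) :
    frobNorm (V * Vᵀ - U * Uᵀ) ^ 2 = 2 * frobNorm ((1 - V * Vᵀ) * U) ^ 2 := by
  have hP := isProj_orth hU
  have hG := isProj_orth hV
  rw [hG.one_sub.frobNorm_mul_sq, frobNorm_sq, Matrix.transpose_sub, hP.symm, hG.symm,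
    show (V * Vᵀ - U * Uᵀ) * (V * Vᵀ - U * Uᵀ)
      = V * Vᵀ * (V * Vᵀ) + U * Uᵀ * (U * Uᵀ) - V * Vᵀ * (U * Uᵀ) - U * Uᵀ * (V * Vᵀ) by
        noncomm_ring, hP.idem, hG.idem, Matrix.sub_mul, Matrix.trace_sub, Matrix.trace_sub,
    Matrix.trace_sub, Matrix.trace_add, Matrix.trace_mul_comm (U * Uᵀ), Matrix.one_mul,
    trace_orth_proj hU, trace_orth_proj hV, hnn]
  ring

/-! ### The specific and the common subspaces of a pair of projections -/

section Pair

variable {p k : ℕ} {G₁ G₂ : Matrix (Fin p) (Fin p) ℝ}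

/-- What the analysis uses of the leading left singular vectors `R` of `G₁ (1 - G₂)`. -/
structure SpecificPart (G₁ G₂ : Matrix (Fin p) (Fin p) ℝ) (R : Matrix (Fin p) (Fin k) ℝ)
    (e q : ℝ) : Prop where
  orth : Rᵀ * R = 1
  resid : frobNorm ((1 - R * Rᵀ) * (G₁ * (1 - G₂))) ≤ e
  range : G₁ * R = R
  eig : ∃ l : Fin k → ℝ, (∀ i, q ^ 2 ≤ l i) ∧
    (G₁ * (1 - G₂)) * (G₁ * (1 - G₂))ᵀ * R = R * Matrix.diagonal l

/-- `W` is any comparison basis. Ky Fan's principle makes the residual of `R` no worse than that of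
`W`; Courant-Fischer makes the eigenvalues at least `q²`; being positive, they place `R` in the
range of `G₁`. -/
lemma specificPart_of_isTop (h₁ : IsProj G₁) {R W : Matrix (Fin p) (Fin k) ℝ}
    {e q : ℝ} (hq : 0 < q) (hR : IsTopLeftSingularVectors (G₁ * (1 - G₂)) R) (hW : Wᵀ * W = 1)
    (hWe : frobNorm ((1 - W * Wᵀ) * (G₁ * (1 - G₂))) ≤ e)
    (hWq : ∀ y, q ^ 2 * (y ⬝ᵥ y)
      ≤ ((G₁ * (1 - G₂))ᵀ *ᵥ (W *ᵥ y)) ⬝ᵥ ((G₁ * (1 - G₂))ᵀ *ᵥ (W *ᵥ y))) :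
    SpecificPart G₁ G₂ R e q := by
  have hT := hR.isTopEigenvectors
  set K := G₁ * (1 - G₂) with hK
  obtain ⟨l, hl, hl2⟩ := hT.exists_eigenvalues hW (c := q ^ 2) fun y => by
    have := hWq y
    rwa [mulVec_dot_mulVec, Matrix.transpose_transpose] at this
  refine ⟨hT.orth, ?_, ?_, l, hl, hl2⟩
  · refine le_trans (le_of_sq_le_sq ?_ (frobNorm_nonneg _)) hWe
    rw [(isProj_orth hT.orth).one_sub.frobNorm_mul_sq, (isProj_orth hW).one_sub.frobNorm_mul_sq,
      Matrix.sub_mul, Matrix.sub_mul, Matrix.trace_sub, Matrix.trace_sub]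
    have := hT.trace_le (isProj_orth hW) (by rw [trace_orth_proj hW, Fintype.card_fin])
    linarith
  · have h0 : (1 - G₁) * (K * Kᵀ) = 0 := by
      rw [hK, ← Matrix.mul_assoc, ← Matrix.mul_assoc, Matrix.sub_mul, Matrix.one_mul, h₁.idem,
        sub_self, Matrix.zero_mul, Matrix.zero_mul]
    have := mul_eq_zero_of_eigen (fun i => (pow_pos hq 2).trans_le (hl i)) hl2 h0
    rw [Matrix.sub_mul, Matrix.one_mul, sub_eq_zero] at this
    exact this.symm

lemma IsProj.mul_sub_mul_transpose (h₁ : IsProj G₁) (h₂ : IsProj G₂) :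
    (G₁ * (1 - G₂)) * (G₁ * (1 - G₂))ᵀ = G₁ - G₁ * G₂ * G₁ := by
  rw [Matrix.transpose_mul, h₁.symm, h₂.one_sub.symm,
    show G₁ * (1 - G₂) * ((1 - G₂) * G₁) = G₁ * ((1 - G₂) * (1 - G₂)) * G₁ by
      simp only [Matrix.mul_assoc], h₂.one_sub.idem]
  rw [Matrix.mul_sub, Matrix.mul_one, Matrix.sub_mul, h₁.idem]

lemma SpecificPart.sub_isProj (h₁ : IsProj G₁) {R : Matrix (Fin p) (Fin k) ℝ} {e q : ℝ}
    (h : SpecificPart G₁ G₂ R e q) : IsProj (G₁ - R * Rᵀ) where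
  symm := by simp [h₁.symm]
  idem := by
    have hR := isProj_orth h.orth
    have h1 : G₁ * (R * Rᵀ) = R * Rᵀ := by rw [← Matrix.mul_assoc, h.range]
    have h2 : R * Rᵀ * G₁ = R * Rᵀ := by
      have := congrArg Matrix.transpose h1
      simpa [h₁.symm, Matrix.mul_assoc] using this
    rw [Matrix.sub_mul, Matrix.mul_sub, Matrix.mul_sub, h₁.idem, h1, h2, hR.idem]
    simp

/-- The response-specific directions are orthogonal to the predictor directions that are not
predictor-specific. -/
lemma SpecificPart.orthogonal (h₁ : IsProj G₁) (h₂ : IsProj G₂) {R P : Matrix (Fin p) (Fin k) ℝ}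
    {e q : ℝ} (he : 0 ≤ e) (heq : e < q) (hR : SpecificPart G₁ G₂ R e q)
    (hP : SpecificPart G₂ G₁ P e q) : (G₂ - P * Pᵀ) * R = 0 := by
  have hS := hP.sub_isProj h₂
  obtain ⟨l, hl, hl2⟩ := hR.eig
  obtain ⟨m, hm, hm2⟩ := hP.eig
  have hPP := isProj_orth hP.orth
  rw [h₁.mul_sub_mul_transpose h₂] at hl2
  rw [h₂.mul_sub_mul_transpose h₁] at hm2
  have hG2P : G₂ * (P * Pᵀ) = P * Pᵀ := by rw [← Matrix.mul_assoc, hP.range]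
  have hPG2 : P * Pᵀ * G₂ = P * Pᵀ := by
    have := congrArg Matrix.transpose hG2P
    simpa [h₂.symm, Matrix.mul_assoc] using this
  -- `P` consists of eigenvectors of `G₂ - G₂ G₁ G₂`, so `P Pᵀ` and therefore `Q = G₂ - P Pᵀ`
  -- commute with `G₂ G₁ G₂`. This transfers the eigenvalue equation from `R` to `Q R`.
  have hcomm : (G₂ - P * Pᵀ) * (G₂ * G₁ * G₂) = (G₂ * G₁ * G₂) * (G₂ - P * Pᵀ) := by
    have h1 : (G₂ - G₂ * G₁ * G₂) * (P * Pᵀ) = P * Pᵀ * (G₂ - G₂ * G₁ * G₂) := by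
      have h3 : (G₂ - G₂ * G₁ * G₂) * (P * Pᵀ) = P * Matrix.diagonal m * Pᵀ := by
        rw [← Matrix.mul_assoc, hm2]
      have h4 := congrArg Matrix.transpose h3
      rw [h3]
      simp only [Matrix.transpose_mul, Matrix.transpose_sub, h₁.symm, h₂.symm,
        Matrix.transpose_transpose, Matrix.diagonal_transpose, ← Matrix.mul_assoc] at h4
      rw [← Matrix.mul_assoc] at *
      simpa only [Matrix.mul_assoc] using h4.symm
    rw [Matrix.sub_mul, Matrix.mul_sub, hG2P, hPG2, sub_right_inj] at h1
    have h5 : G₂ * G₁ * G₂ * G₂ = G₂ * G₁ * G₂ := by rw [Matrix.mul_assoc, h₂.idem]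
    have h6 : G₂ * (G₂ * G₁ * G₂) = G₂ * G₁ * G₂ := by
      rw [← Matrix.mul_assoc, ← Matrix.mul_assoc, h₂.idem]
    rw [Matrix.sub_mul, Matrix.mul_sub, h5, h6, h1]
  have hQG : (G₂ - P * Pᵀ) * G₂ = G₂ - P * Pᵀ := by
    rw [Matrix.sub_mul, h₂.idem, hPG2]
  have hGQ : G₂ * (G₂ - P * Pᵀ) = G₂ - P * Pᵀ := by
    rw [Matrix.mul_sub, h₂.idem, hG2P]
  set Q := G₂ - P * Pᵀ with hQ
  -- the eigenvalue equation for `Q R`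
  have hER : G₁ * (G₂ * R) = R - R * Matrix.diagonal l := by
    rw [← hl2, Matrix.sub_mul, hR.range, Matrix.mul_assoc, hR.range, Matrix.mul_assoc]
    abel
  have hEQ : G₂ * G₁ * G₂ * (Q * R) = Q * R - Q * R * Matrix.diagonal l := by
    rw [← Matrix.mul_assoc, ← hcomm, show Q * (G₂ * G₁ * G₂) * R = Q * G₂ * (G₁ * (G₂ * R)) by
      simp only [Matrix.mul_assoc], hER, hQG, Matrix.mul_sub, Matrix.mul_assoc]
  -- The transpose of `(1 - G₁) Q` is the residual of `P`: the part of `G₂` left after removing `P`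
  -- is within `e` of the range of `G₁`.
  have hres : ‖(1 - G₁) * Q‖ ≤ e := by
    rw [← opNorm_transpose, Matrix.transpose_mul, h₁.one_sub.symm, hS.symm,
      show Q * (1 - G₁) = (1 - P * Pᵀ) * (G₂ * (1 - G₁)) by
        rw [← Matrix.mul_assoc, Matrix.sub_mul 1, Matrix.one_mul, hPG2]]
    exact (opNorm_le_frobNorm _).trans hP.resid
  -- A column `x` of `Q R` lies in the range of `Q` and satisfies `|(1 - G₁) x|² = l j |x|²`. The
  -- left side is at most `e² |x|²`, the right side at least `q² |x|²`, and `e < q` forces `x = 0`.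
  have hcolz : ∀ j, (Q * R)ᵀ j = 0 := by
    intro j
    set x := (Q * R)ᵀ j with hx
    have hQx : Q *ᵥ x = x := by
      ext i
      have : (Q * (Q * R)) i j = (Q * R) i j := by rw [← Matrix.mul_assoc, hS.idem]
      exact this
    have hGx : G₂ *ᵥ x = x := by
      rw [← hQx, Matrix.mulVec_mulVec, hGQ]
    have hEx : (G₂ * G₁ * G₂) *ᵥ x = x - l j • x := by
      ext i
      have := congrFun (congrFun hEQ i) j
      rw [Matrix.sub_apply, Matrix.mul_diagonal] at this
      simp only [Pi.sub_apply, Pi.smul_apply, smul_eq_mul]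
      rw [mul_comm (l j)]
      exact this
    have h1 : x ⬝ᵥ (G₁ *ᵥ x) = x ⬝ᵥ x - l j * (x ⬝ᵥ x) := by
      have h2 : x ⬝ᵥ ((G₂ * G₁ * G₂) *ᵥ x) = x ⬝ᵥ (G₁ *ᵥ x) := by
        rw [← Matrix.mulVec_mulVec, hGx, ← Matrix.mulVec_mulVec, Matrix.dotProduct_mulVec,
          ← Matrix.mulVec_transpose, h₂.symm, hGx]
      rw [← h2, hEx, dotProduct_sub, dotProduct_smul, smul_eq_mul]
    have h3 := h₁.dot_add x
    rw [h₁.dot, h1] at h3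
    have h4 := mulVec_dot_self_le ((1 - G₁) * Q) x
    rw [← Matrix.mulVec_mulVec, hQx] at h4
    by_contra hne
    have hpos := dot_self_pos hne
    have h5 : ‖(1 - G₁) * Q‖ ^ 2 ≤ e ^ 2 := pow_le_pow_left₀ (norm_nonneg _) hres 2
    have h6 : e ^ 2 < q ^ 2 := pow_lt_pow_left₀ heq he two_ne_zero
    have h7 : l j * (x ⬝ᵥ x) ≤ e ^ 2 * (x ⬝ᵥ x) := by
      calc l j * (x ⬝ᵥ x) = ((1 - G₁) *ᵥ x) ⬝ᵥ ((1 - G₁) *ᵥ x) := by linarith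
        _ ≤ _ := h4.trans (mul_le_mul_of_nonneg_right h5 hpos.le)
    have h8 := le_of_mul_le_mul_right h7 hpos
    linarith [hl j]
  ext i j
  exact congrFun (hcolz j) i

variable {R P : Matrix (Fin p) (Fin k) ℝ} {e q : ℝ}

/-- `G₁ - R Rᵀ` and `G₂ - P Pᵀ` are orthogonal to both `R` and `P`, so the outer factors leave them
alone. `R` and `P` need not be orthogonal to each other: `(1 - R Rᵀ)(1 - P Pᵀ) R Rᵀ` survives on the
left and is removed by the factor `1 - R Rᵀ` on the right. -/
lemma SpecificPart.middle_eq (h₁ : IsProj G₁) (h₂ : IsProj G₂)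
    (he : 0 ≤ e) (heq : e < q) (hR : SpecificPart G₁ G₂ R e q) (hP : SpecificPart G₂ G₁ P e q) :
    (1 - R * Rᵀ) * (1 - P * Pᵀ) * (G₁ + G₂) * (1 - R * Rᵀ) * (1 - P * Pᵀ)
      = (G₁ - R * Rᵀ) + (G₂ - P * Pᵀ) := by
  have hS₁ := hR.sub_isProj h₁
  have hS₂ := hP.sub_isProj h₂
  have o1 := hR.orthogonal h₁ h₂ he heq hP
  have o2 := hP.orthogonal h₂ h₁ he heq hR
  have a1 : R * Rᵀ * (R * Rᵀ) = R * Rᵀ := (isProj_orth hR.orth).idem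
  have a2 : P * Pᵀ * (P * Pᵀ) = P * Pᵀ := (isProj_orth hP.orth).idem
  have b1 : (G₂ - P * Pᵀ) * (R * Rᵀ) = 0 := by rw [← Matrix.mul_assoc, o1, Matrix.zero_mul]
  have b2 : (G₁ - R * Rᵀ) * (P * Pᵀ) = 0 := by rw [← Matrix.mul_assoc, o2, Matrix.zero_mul]
  have c1 : (G₁ - R * Rᵀ) * (R * Rᵀ) = 0 := by
    rw [Matrix.sub_mul, a1, ← Matrix.mul_assoc, hR.range, sub_self]
  have c2 : (G₂ - P * Pᵀ) * (P * Pᵀ) = 0 := by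
    rw [Matrix.sub_mul, a2, ← Matrix.mul_assoc, hP.range, sub_self]
  have tr : ∀ {A B : Matrix (Fin p) (Fin p) ℝ}, Aᵀ = A → Bᵀ = B → A * B = 0 → B * A = 0 := by
    intro A B hA hB h
    have := congrArg Matrix.transpose h
    rwa [Matrix.transpose_mul, hA, hB, Matrix.transpose_zero] at this
  have sR := (isProj_orth hR.orth).symm
  have sP := (isProj_orth hP.orth).symm
  have b1' := tr hS₂.symm sR b1
  have b2' := tr hS₁.symm sP b2
  have c1' := tr hS₁.symm sR c1
  have c2' := tr hS₂.symm sP c2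
  set R' := R * Rᵀ
  set P' := P * Pᵀ
  set A := G₁ - R' with hA
  set B := G₂ - P' with hB
  have e1 : G₁ + G₂ = A + B + R' + P' := by rw [hA, hB]; abel
  have l1 : (1 - R') * (1 - P') * (G₁ + G₂) = A + B + (1 - R') * (1 - P') * R' := by
    rw [e1]
    have x1 : (1 - P') * A = A := by rw [Matrix.sub_mul, b2', Matrix.one_mul, sub_zero]
    have x2 : (1 - P') * B = B := by rw [Matrix.sub_mul, c2', Matrix.one_mul, sub_zero]
    have x3 : (1 - R') * A = A := by rw [Matrix.sub_mul, c1', Matrix.one_mul, sub_zero]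
    have x4 : (1 - R') * B = B := by rw [Matrix.sub_mul, b1', Matrix.one_mul, sub_zero]
    have x5 : (1 - P') * P' = 0 := by rw [Matrix.sub_mul, a2, Matrix.one_mul, sub_self]
    simp only [Matrix.mul_add, Matrix.mul_assoc (1 - R'), x1, x2, x3, x4, x5, add_zero]
  have y1 : A * (1 - R') = A := by rw [Matrix.mul_sub, c1, Matrix.mul_one, sub_zero]
  have y2 : B * (1 - R') = B := by rw [Matrix.mul_sub, b1, Matrix.mul_one, sub_zero]
  have y3 : A * (1 - P') = A := by rw [Matrix.mul_sub, b2, Matrix.mul_one, sub_zero]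
  have y4 : B * (1 - P') = B := by rw [Matrix.mul_sub, c2, Matrix.mul_one, sub_zero]
  have y5 : R' * (1 - R') = 0 := by rw [Matrix.mul_sub, a1, Matrix.mul_one, sub_self]
  rw [l1, Matrix.add_mul, Matrix.mul_assoc _ R', y5, Matrix.mul_zero, add_zero, Matrix.add_mul,
    y1, y2, Matrix.add_mul, y3, y4]

/-- The estimated common directions. -/
lemma common_part {d : ℕ} (hd : d ≤ p) (h₁ : IsProj G₁) (h₂ : IsProj G₂) (ht₁ : G₁.trace = d + k)
    (he : 0 ≤ e) (heq : e < q)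
    (hR : SpecificPart G₁ G₂ R e q) (hP : SpecificPart G₂ G₁ P e q)
    {C : Matrix (Fin p) (Fin d) ℝ} (hC : IsTopEigenvectors
      ((1 - R * Rᵀ) * (1 - P * Pᵀ) * (G₁ + G₂) * (1 - R * Rᵀ) * (1 - P * Pᵀ)) C) :
    Rᵀ * C = 0 ∧ Pᵀ * C = 0 ∧ frobNorm ((1 - C * Cᵀ) * (G₁ - R * Rᵀ)) ≤ e ∧
      frobNorm ((1 - C * Cᵀ) * (G₂ - P * Pᵀ)) ≤ e := by
  rw [hR.middle_eq h₁ h₂ he heq hP] at hC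
  have hS₁ := hR.sub_isProj h₁
  have hS₂ := hP.sub_isProj h₂
  have o1 := hR.orthogonal h₁ h₂ he heq hP
  have o2 := hP.orthogonal h₂ h₁ he heq hR
  have hCo := isProj_orth hC.orth
  have htr : (G₁ - R * Rᵀ).trace = d := by
    rw [Matrix.trace_sub, trace_orth_proj hR.orth, ht₁, Fintype.card_fin]; ring
  -- On the `d`-dimensional range of `G₁ - R Rᵀ` the quadratic form of the sum is at least `|·|²`,
  -- so the eigenvalues belonging to `C` are at least `1`. Being positive, they place `C` in the
  -- range of the sum, orthogonal to `R` and `P`.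
  obtain ⟨W, hW1, hW2⟩ := hS₁.exists_orth hd htr
  obtain ⟨l, hl, hl2⟩ := hC.exists_eigenvalues hW1 (c := 1) fun y => by
    have h3 : (G₁ - R * Rᵀ) *ᵥ (W *ᵥ y) = W *ᵥ y := by
      rw [← hW2, Matrix.mulVec_mulVec, Matrix.mul_assoc, hW1, Matrix.mul_one]
    rw [Matrix.add_mulVec, dotProduct_add, h3, orth_mulVec_dot hW1, ← hS₂.dot]
    linarith [dot_self_nonneg ((G₂ - P * Pᵀ) *ᵥ (W *ᵥ y))]
  have hl0 : ∀ i, 0 < l i := fun i => zero_lt_one.trans_le (hl i)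
  have tr : ∀ {A : Matrix (Fin p) (Fin p) ℝ} {B : Matrix (Fin p) (Fin k) ℝ}, Aᵀ = A →
      A * B = 0 → Bᵀ * A = 0 := by
    intro A B hA h
    have := congrArg Matrix.transpose h
    rwa [Matrix.transpose_mul, hA, Matrix.transpose_zero] at this
  have z1 : (G₁ - R * Rᵀ) * R = 0 := by
    rw [Matrix.sub_mul, hR.range, Matrix.mul_assoc, hR.orth, Matrix.mul_one, sub_self]
  have z2 : (G₂ - P * Pᵀ) * P = 0 := by
    rw [Matrix.sub_mul, hP.range, Matrix.mul_assoc, hP.orth, Matrix.mul_one, sub_self]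
  -- Ky Fan's principle with competitor `G₁ - R Rᵀ`: its residual on the first summand is zero, and
  -- on the second it is the residual of `P`, at most `e`.
  have hsum : frobNorm ((1 - C * Cᵀ) * (G₁ - R * Rᵀ)) ^ 2
      + frobNorm ((1 - C * Cᵀ) * (G₂ - P * Pᵀ)) ^ 2 ≤ e ^ 2 := by
    have h3 := hC.trace_le hS₁ htr
    have h4 : frobNorm ((1 - (G₁ - R * Rᵀ)) * (G₂ - P * Pᵀ)) ≤ e := by
      have h5 : (1 - (G₁ - R * Rᵀ)) * (G₂ - P * Pᵀ) = (1 - G₁) * (G₂ - P * Pᵀ) := by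
        have : R * Rᵀ * (G₂ - P * Pᵀ) = 0 := by
          rw [Matrix.mul_assoc, tr hS₂.symm o1, Matrix.mul_zero]
        rw [sub_sub_eq_add_sub, Matrix.sub_mul, Matrix.add_mul, this, add_zero, ← Matrix.sub_mul]
      have h6 : ((1 - G₁) * (G₂ - P * Pᵀ))ᵀ = (1 - P * Pᵀ) * (G₂ * (1 - G₁)) := by
        have hG2P : G₂ * (P * Pᵀ) = P * Pᵀ := by rw [← Matrix.mul_assoc, hP.range]
        have hPG2 : P * Pᵀ * G₂ = P * Pᵀ := by
          have := congrArg Matrix.transpose hG2P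
          simpa [h₂.symm, Matrix.mul_assoc] using this
        rw [Matrix.transpose_mul, h₁.one_sub.symm, hS₂.symm, ← Matrix.mul_assoc, Matrix.sub_mul 1,
          Matrix.one_mul, hPG2]
      rw [h5, ← frobNorm_transpose, h6]
      exact hP.resid
    have h7 := pow_le_pow_left₀ (frobNorm_nonneg _) h4 2
    rw [hS₁.one_sub.frobNorm_mul_sq, hS₂.symm, hS₂.idem] at h7
    rw [hCo.one_sub.frobNorm_mul_sq, hCo.one_sub.frobNorm_mul_sq, hS₁.symm, hS₂.symm, hS₁.idem,
      hS₂.idem]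
    rw [Matrix.mul_add, Matrix.mul_add, Matrix.trace_add, Matrix.trace_add, hS₁.idem] at h3
    simp only [Matrix.sub_mul 1, Matrix.one_mul, Matrix.trace_sub _ _] at h7 ⊢
    simp only [Matrix.trace_sub] at h3 h7 ⊢
    linarith
  refine ⟨mul_eq_zero_of_eigen hl0 hl2 ?_, mul_eq_zero_of_eigen hl0 hl2 ?_,
    le_of_sq_le_sq (by nlinarith [sq_nonneg (frobNorm ((1 - C * Cᵀ) * (G₂ - P * Pᵀ)))]) he,
    le_of_sq_le_sq (by nlinarith [sq_nonneg (frobNorm ((1 - C * Cᵀ) * (G₁ - R * Rᵀ)))]) he⟩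
  · rw [Matrix.mul_add, tr hS₁.symm z1, tr hS₂.symm o1, add_zero]
  · rw [Matrix.mul_add, tr hS₁.symm o2, tr hS₂.symm z2, add_zero]

end Pair

end CommonVAR

/-! ### The spectral initial value on a good sample. -/

namespace CommonVAR

open scoped Matrix.Norms.L2Operator

lemma rank_add_le {m n : Type*} [Fintype m] [Fintype n] (A B : Matrix m n ℝ) :
    (A + B).rank ≤ A.rank + B.rank := by
  rw [Matrix.rank, Matrix.rank, Matrix.rank, Matrix.mulVecLin_add]
  exact (Submodule.finrank_mono (LinearMap.range_add_le _ _)).trans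
    (Submodule.finrank_add_le_finrank_add_finrank _ _)

lemma rank_neg {m n : Type*} [Fintype m] [Fintype n] (A : Matrix m n ℝ) : (-A).rank = A.rank := by
  simpa using Matrix.rank_smul_of_mem_nonZeroDivisors (c := (-1 : ℝ)) A
    (mem_nonZeroDivisors_of_ne_zero (by norm_num))

lemma rank_sub_le {m n : Type*} [Fintype m] [Fintype n] (A B : Matrix m n ℝ) :
    (A - B).rank ≤ A.rank + B.rank := by
  rw [sub_eq_add_neg, ← rank_neg B]
  exact rank_add_le A (-B)

/-! ### Samples with a well-conditioned Gram matrix and small noise -/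

/-- The deterministic properties of the sample `Y = A X + E` on which the analysis rests. -/
structure GoodSample {p T : ℕ} (X Y : Matrix (Fin p) (Fin T) ℝ) (A : Matrix (Fin p) (Fin p) ℝ)
    (α β n₀ : ℝ) : Prop where
  lower : ∀ v, T * α * (v ⬝ᵥ v) ≤ (Xᵀ *ᵥ v) ⬝ᵥ (Xᵀ *ᵥ v)
  upper : ∀ v, (Xᵀ *ᵥ v) ⬝ᵥ (Xᵀ *ᵥ v) ≤ T * β * (v ⬝ᵥ v)
  noise : ∀ u v, |u ⬝ᵥ (((Y - A * X) * Xᵀ) *ᵥ v)| ≤ n₀ * √(u ⬝ᵥ u) * √((Xᵀ *ᵥ v) ⬝ᵥ (Xᵀ *ᵥ v))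

section Sample

variable {p T : ℕ} {X Y : Matrix (Fin p) (Fin T) ℝ} {A : Matrix (Fin p) (Fin p) ℝ}
  {α β n₀ : ℝ}

/-- Writing `B = W (Wᵀ B)` with `rank B` orthonormal columns splits the trace into that many noise
forms. Cauchy-Schwarz over them gives the square root of the rank instead of the dimension. -/
lemma GoodSample.trace_noise_le (h : GoodSample X Y A α β n₀) (hn : 0 ≤ n₀) {k : ℕ}
    {B : Matrix (Fin p) (Fin p) ℝ} (hB : B.rank ≤ k) :
    |((Y - A * X)ᵀ * (B * X)).trace| ≤ n₀ * √k * frobNorm (B * X) := by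
  set E := Y - A * X
  obtain ⟨q, hq⟩ : ∃ q, q = B.rank := ⟨_, rfl⟩
  obtain ⟨W, V, s, hW, hV, -, -, hBs⟩ := exists_thin_svd (K := B) (k := q)
    (hq ▸ Matrix.rank_le_height B) hq.ge
  have hWB : W * (Wᵀ * B) = B := by
    conv_lhs => rw [hBs]
    rw [show Wᵀ * (W * Matrix.diagonal s * Vᵀ) = (Wᵀ * W) * (Matrix.diagonal s * Vᵀ) by
      simp only [Matrix.mul_assoc], hW, Matrix.one_mul, ← Matrix.mul_assoc, ← hBs]
  set N := Wᵀ * B with hN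
  have h1 : (Eᵀ * (B * X)).trace = ∑ j, Wᵀ j ⬝ᵥ ((E * Xᵀ) *ᵥ (N j)) := by
    have h2 : (Eᵀ * (B * X)).trace = (Wᵀ * (E * Xᵀ * Nᵀ)).trace := by
      rw [← Matrix.trace_transpose, ← hWB]
      simp only [Matrix.transpose_mul, Matrix.transpose_transpose]
      rw [show Xᵀ * (Nᵀ * Wᵀ) * E = (Xᵀ * Nᵀ) * (Wᵀ * E) by simp only [Matrix.mul_assoc],
        Matrix.trace_mul_comm]
      simp only [Matrix.mul_assoc]
    rw [h2, Matrix.trace]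
    refine Finset.sum_congr rfl fun j _ => ?_
    rw [Matrix.diag_apply, Matrix.mul_apply]
    rfl
  have hWj : ∀ j, Wᵀ j ⬝ᵥ Wᵀ j = 1 := fun j => by
    have := congrFun (congrFun hW j) j
    rwa [Matrix.one_apply_eq, Matrix.mul_apply] at this
  have hsum : ∑ j, (Xᵀ *ᵥ N j) ⬝ᵥ (Xᵀ *ᵥ N j) = frobNorm (B * X) ^ 2 := by
    have h3 : frobNorm (B * X) = frobNorm (N * X) := by
      rw [← frobNorm_orth_mul hW (N * X), ← Matrix.mul_assoc, hWB]
    rw [h3, ← frobNorm_transpose, Matrix.transpose_mul, frobNorm_sq_mul_cols]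
    simp
  calc |(Eᵀ * (B * X)).trace| ≤ ∑ j, |Wᵀ j ⬝ᵥ ((E * Xᵀ) *ᵥ (N j))| := by
        rw [h1]; exact Finset.abs_sum_le_sum_abs _ _
    _ ≤ ∑ j, n₀ * √((Xᵀ *ᵥ N j) ⬝ᵥ (Xᵀ *ᵥ N j)) := by
        refine Finset.sum_le_sum fun j _ => ?_
        have := h.noise (Wᵀ j) (N j)
        rwa [hWj, Real.sqrt_one, mul_one] at this
    _ = n₀ * ∑ j, √1 * √((Xᵀ *ᵥ N j) ⬝ᵥ (Xᵀ *ᵥ N j)) := by simp [Finset.mul_sum]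
    _ ≤ n₀ * (√(∑ j : Fin q, (1 : ℝ)) * √(∑ j, (Xᵀ *ᵥ N j) ⬝ᵥ (Xᵀ *ᵥ N j))) :=
        mul_le_mul_of_nonneg_left (Real.sum_sqrt_mul_sqrt_le _ (fun _ => zero_le_one)
          fun _ => dot_self_nonneg _) hn
    _ = n₀ * √(q : ℝ) * frobNorm (B * X) := by
        rw [hsum, Real.sqrt_sq (frobNorm_nonneg _)]
        simp [mul_assoc]
    _ ≤ _ := by
        refine mul_le_mul_of_nonneg_right (mul_le_mul_of_nonneg_left
          (Real.sqrt_le_sqrt (by rw [hq]; exact_mod_cast hB)) hn) (frobNorm_nonneg _)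

lemma GoodSample.le_frobNorm (h : GoodSample X Y A α β n₀) (hα : 0 ≤ α)
    (B : Matrix (Fin p) (Fin p) ℝ) : √(T * α) * frobNorm B ≤ frobNorm (B * X) :=
  le_frobNorm_mul' (fun v => by rw [Real.sq_sqrt (by positivity)]; exact h.lower v) B

lemma GoodSample.frobNorm_le (h : GoodSample X Y A α β n₀) (hβ : 0 ≤ β)
    (B : Matrix (Fin p) (Fin p) ℝ) : frobNorm (B * X) ≤ √(T * β) * frobNorm B := by
  have h1 : ‖Xᵀ‖ ≤ √(T * β) := opNorm_le_of_dot (Real.sqrt_nonneg _) fun v => by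
    rw [Real.sq_sqrt (by positivity)]; exact h.upper v
  rw [opNorm_transpose] at h1
  rw [mul_comm]
  exact (frobNorm_mul_le' B X).trans (mul_le_mul_of_nonneg_left h1 (frobNorm_nonneg _))

lemma GoodSample.isUnit_det (h : GoodSample X Y A α β n₀) (hα : 0 < α) (hT : 0 < T) :
    IsUnit (X * Xᵀ).det := by
  rw [isUnit_iff_ne_zero]
  intro h0
  obtain ⟨v, hv, hv0⟩ := Matrix.exists_mulVec_eq_zero_iff.2 h0
  have h1 := h.lower v
  rw [mulVec_dot_mulVec, Matrix.transpose_transpose, hv0, dotProduct_zero] at h1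
  have := dot_self_pos hv
  have : 0 < T * α * (v ⬝ᵥ v) := by positivity
  linarith

/-! ### The reduced-rank estimator -/

/-- With `B` the least squares estimator, `H Hᵀ B X` is a best rank-`r` approximation of `B X`, so
it fits `B X` at least as well as `A X` does. Expanding the squares leaves `‖D‖² ≤ 2 ⟨E, D⟩` for the
prediction error `D`, whose coefficient has rank at most `2 r`. -/
lemma reducedRank_error {r : ℕ} (h : GoodSample X Y A α β n₀) (hn : 0 ≤ n₀)
    (hX : IsUnit (X * Xᵀ).det) (hA : A.rank ≤ r) {n : Type*} [Fintype n] [DecidableEq n]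
    (hcard : Fintype.card n = r) {U : Matrix (Fin p) n ℝ} (hU : Uᵀ * U = 1)
    (hUA : U * Uᵀ * A = A) {H : Matrix (Fin p) (Fin r) ℝ}
    (hH : IsTopEigenvectors (Y * Xᵀ * (X * Xᵀ)⁻¹ * (X * Yᵀ)) H) :
    frobNorm ((H * Hᵀ * (Y * Xᵀ * (X * Xᵀ)⁻¹) - A) * X) ≤ 2 * n₀ * √(2 * r) := by
  set B := Y * Xᵀ * (X * Xᵀ)⁻¹ with hB
  have hBX : B * X * Xᵀ = Y * Xᵀ := by
    rw [hB, Matrix.mul_assoc _ X, Matrix.mul_assoc, Matrix.nonsing_inv_mul _ hX, Matrix.mul_one]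
  have hZ : B * X * (B * X)ᵀ = B * (X * Yᵀ) := by
    rw [Matrix.transpose_mul, ← Matrix.mul_assoc, hBX, hB]
    have hs : ((X * Xᵀ)⁻¹)ᵀ = (X * Xᵀ)⁻¹ := by
      rw [Matrix.transpose_nonsing_inv]; simp
    simp only [Matrix.transpose_mul, hs, Matrix.transpose_transpose, Matrix.mul_assoc]
  have hP := isProj_orth hU
  have hHH := isProj_orth hH.orth
  set E := Y - A * X
  set D := (H * Hᵀ * B - A) * X with hD
  have h1 : frobNorm ((1 - H * Hᵀ) * (B * X)) ≤ frobNorm ((B - A) * X) := by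
    refine le_trans (b := frobNorm ((1 - U * Uᵀ) * (B * X)))
      (le_of_sq_le_sq ?_ (frobNorm_nonneg _)) ?_
    · rw [hHH.one_sub.frobNorm_mul_sq, hP.one_sub.frobNorm_mul_sq, hZ, Matrix.sub_mul,
        Matrix.sub_mul, Matrix.trace_sub, Matrix.trace_sub]
      have := hH.trace_le hP (by rw [trace_orth_proj hU, hcard])
      linarith
    · have : (1 - U * Uᵀ) * (B * X) = (1 - U * Uᵀ) * ((B - A) * X) := by
        have h2 : (1 - U * Uᵀ) * A = 0 := by rw [Matrix.sub_mul, hUA, Matrix.one_mul, sub_self]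
        rw [Matrix.sub_mul B, Matrix.mul_sub, ← Matrix.mul_assoc _ A, h2, Matrix.zero_mul, sub_zero]
      rw [this]
      exact hP.one_sub.frobNorm_mul_le _
  have h2 : (1 - H * Hᵀ) * (B * X) = (B - A) * X - D := by
    rw [hD]; simp only [Matrix.sub_mul, Matrix.one_mul, Matrix.mul_assoc]; abel
  have h3 : frobNorm ((B - A) * X - D) ^ 2
      = frobNorm ((B - A) * X) ^ 2 - 2 * (((B - A) * X)ᵀ * D).trace + frobNorm D ^ 2 := by
    rw [frobNorm_sq, frobNorm_sq, frobNorm_sq, Matrix.transpose_sub, Matrix.sub_mul,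
      Matrix.mul_sub, Matrix.mul_sub, Matrix.trace_sub, Matrix.trace_sub, Matrix.trace_sub,
      ← Matrix.trace_transpose (Dᵀ * _), Matrix.transpose_mul Dᵀ, Matrix.transpose_transpose]
    ring
  -- By the normal equations `B X Xᵀ = Y Xᵀ`, the fitted difference `(B - A) X` and the noise `E`
  -- have the same inner product with anything of the form `M X`.
  have h4 : (((B - A) * X)ᵀ * D).trace = (Eᵀ * D).trace := by
    have h5 : ∀ F : Matrix (Fin p) (Fin T) ℝ,
        (Fᵀ * D).trace = ((H * Hᵀ * B - A) * (F * Xᵀ)ᵀ).trace := by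
      intro F
      rw [Matrix.trace_mul_comm, hD, Matrix.mul_assoc, Matrix.transpose_mul,
        Matrix.transpose_transpose]
    rw [h5, h5]
    congr 3
    rw [Matrix.sub_mul B, Matrix.sub_mul, Matrix.sub_mul, hBX]
  have h6 : (H * Hᵀ * B - A).rank ≤ 2 * r := by
    have h7 : (H * Hᵀ * B).rank ≤ r := by
      rw [Matrix.mul_assoc]
      exact (Matrix.rank_mul_le_left _ _).trans (Matrix.rank_le_width H)
    have h8 := rank_sub_le (H * Hᵀ * B) A
    omega
  have h10 := h.trace_noise_le hn h6
  rw [h2] at h1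
  have h11 := pow_le_pow_left₀ (frobNorm_nonneg _) h1 2
  rw [h3, h4] at h11
  have h12 := (le_abs_self _).trans h10
  rw [← hD] at h12
  push_cast at h12
  rcases eq_or_lt_of_le (frobNorm_nonneg D) with h13 | h13
  · rw [← h13]; positivity
  · have : frobNorm D * frobNorm D ≤ 2 * n₀ * √(2 * r) * frobNorm D := by nlinarith
    exact le_of_mul_le_mul_right this h13

end Sample

/-! ### The spectral initial value -/

section Init

variable {p r d T : ℕ}

lemma fromCols_orth_iff {m n₁ n₂ : Type*} [Fintype m] [DecidableEq n₁]
    [DecidableEq n₂] (C : Matrix m n₁ ℝ) (R : Matrix m n₂ ℝ) :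
    (Matrix.fromCols C R)ᵀ * Matrix.fromCols C R = 1 ↔
      Cᵀ * C = 1 ∧ Rᵀ * R = 1 ∧ Rᵀ * C = 0 := by
  rw [Matrix.transpose_fromCols, Matrix.fromRows_mul_fromCols, ← Matrix.fromBlocks_one,
    Matrix.fromBlocks_inj]
  constructor
  · rintro ⟨h1, -, h3, h4⟩; exact ⟨h1, h4, h3⟩
  · rintro ⟨h1, h4, h3⟩
    refine ⟨h1, ?_, h3, h4⟩
    have := congrArg Matrix.transpose h3
    simpa using this

/-- The inner factor of a decomposition has smallest singular value `σ_r`. -/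
lemma Comp.IsDecompOf.le_D {A : Matrix (Fin p) (Fin p) ℝ} {θ : Comp p r d} (hd : d ≤ r)
    (h : θ.IsDecompOf A) (x : Fin d ⊕ Fin (r - d) → ℝ) :
    sigma A (r - 1) ^ 2 * (x ⬝ᵥ x) ≤ (θ.D *ᵥ x) ⬝ᵥ (θ.D *ᵥ x) := by
  have hA : A = θ.CR * θ.D * θ.CPᵀ := h.eq_mat
  have h1 := le_mulVec_dot_of_rank h.rank_eq (v := θ.CP *ᵥ x) ?_
  · rw [orth_mulVec_dot h.orth_CP] at h1
    have h2 : A *ᵥ (θ.CP *ᵥ x) = θ.CR *ᵥ (θ.D *ᵥ x) := by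
      rw [hA, Matrix.mulVec_mulVec, Matrix.mul_assoc, h.orth_CP, Matrix.mul_one,
        ← Matrix.mulVec_mulVec]
    rwa [h2, orth_mulVec_dot h.orth_CR] at h1
  · intro w hw
    -- Since `A` has rank `r`, the `r × r` matrix `D` is invertible; a vector killed by `A` is then
    -- killed by `[C P]ᵀ`, so `[C P] x` is orthogonal to the kernel.
    have hdet : Function.Injective θ.D.mulVec := by
      have hr : Fintype.card (Fin d ⊕ Fin (r - d)) ≤ θ.D.rank := by
        have h2 := h.rank_eq
        rw [hA] at h2
        have h3 := (Matrix.rank_mul_le_left (θ.CR * θ.D) θ.CPᵀ).trans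
          (Matrix.rank_mul_le_right θ.CR θ.D)
        simp only [Fintype.card_sum, Fintype.card_fin]
        omega
      have h4 : Module.finrank ℝ (LinearMap.range θ.D.mulVecLin)
          = Module.finrank ℝ (Fin d ⊕ Fin (r - d) → ℝ) := by
        refine le_antisymm (Submodule.finrank_le _) ?_
        rw [Module.finrank_fintype_fun_eq_card]
        exact hr
      have h5 := Submodule.eq_top_of_finrank_eq h4
      exact LinearMap.injective_iff_surjective.2 (LinearMap.range_eq_top.1 h5)
    have h6 : θ.D *ᵥ (θ.CPᵀ *ᵥ w) = 0 := by
      have h7 : θ.CRᵀ *ᵥ (A *ᵥ w) = 0 := by rw [hw, Matrix.mulVec_zero]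
      rwa [hA, Matrix.mulVec_mulVec, ← Matrix.mul_assoc, ← Matrix.mul_assoc, h.orth_CR,
        Matrix.one_mul, ← Matrix.mulVec_mulVec] at h7
    have h8 : θ.CPᵀ *ᵥ w = 0 := hdet (by rw [h6, Matrix.mulVec_zero])
    rw [Matrix.dotProduct_mulVec, ← Matrix.mulVec_transpose, h8, zero_dotProduct]

/-- A sine-theta bound: as `G` fixes `B`, `(1 - G) A = -(1 - G)(B - A)`, and the inner factor `E` of
`A = U E Vᵀ` can be divided out at the price of `s`. -/
lemma frobNorm_proj_compl_le {A B : Matrix (Fin p) (Fin p) ℝ} {n : Type*} [Fintype n]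
    [DecidableEq n] {U V : Matrix (Fin p) n ℝ} {E : Matrix n n ℝ} {G : Matrix (Fin p) (Fin p) ℝ}
    {s δ : ℝ} (hs : 0 < s) (hV : Vᵀ * V = 1) (hA : A = U * E * Vᵀ)
    (hE : ∀ x, s ^ 2 * (x ⬝ᵥ x) ≤ (Eᵀ *ᵥ x) ⬝ᵥ (Eᵀ *ᵥ x)) (hG : IsProj G) (hB : G * B = B)
    (hδ : frobNorm (B - A) ≤ δ) : frobNorm ((1 - G) * U) ≤ δ / s := by
  rw [le_div_iff₀ hs, mul_comm]
  refine (le_frobNorm_mul' hE ((1 - G) * U)).trans ?_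
  rw [← frobNorm_mul_orth hV]
  have h1 : (1 - G) * U * E * Vᵀ = -((1 - G) * (B - A)) := by
    have h2 : (1 - G) * B = 0 := by rw [Matrix.sub_mul, hB, Matrix.one_mul, sub_self]
    rw [Matrix.mul_sub, h2, zero_sub, neg_neg, hA]
    simp only [Matrix.mul_assoc]
  rw [h1, frobNorm_neg]
  exact (hG.one_sub.frobNorm_mul_le _).trans hδ

end Init

end CommonVAR

namespace CommonVAR

open scoped Matrix.Norms.L2Operator

section SpectralInit

variable {p r d T : ℕ}

/-- `sin (arccos x) = √(1 - x²)`, and positivity of `g` excludes the case where the square root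
vanishes by convention. -/
lemma sq_le_of_le_sinTheta1 {k : ℕ} {R P : Matrix (Fin p) (Fin k) ℝ} {g : ℝ} (hg : 0 < g)
    (h : g ≤ sinTheta1 R P) : g ^ 2 ≤ 1 - ‖Rᵀ * P‖ ^ 2 := by
  rw [sinTheta1, Real.sin_arccos] at h
  have h1 : 0 < 1 - sigma (Rᵀ * P) 0 ^ 2 := by
    by_contra h2
    rw [Real.sqrt_eq_zero_of_nonpos (not_lt.1 h2)] at h
    linarith
  have h3 := pow_le_pow_left₀ hg.le h 2
  rw [Real.sq_sqrt h1.le] at h3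
  have h4 := pow_le_pow_left₀ (norm_nonneg _) (opNorm_le_sigma (Rᵀ * P)) 2
  linarith

/-- Perturbation of the specific subspace. -/
lemma specificPart_of_perturbation {k : ℕ} {C : Matrix (Fin p) (Fin d) ℝ}
    {R P : Matrix (Fin p) (Fin k) ℝ} {G₁ G₂ : Matrix (Fin p) (Fin p) ℝ} {f g : ℝ}
    (hCR : (Matrix.fromCols C R)ᵀ * Matrix.fromCols C R = 1)
    (hCP : (Matrix.fromCols C P)ᵀ * Matrix.fromCols C P = 1)
    (hg : g ^ 2 ≤ 1 - ‖Rᵀ * P‖ ^ 2) (h₁ : IsProj G₁) (h₂ : IsProj G₂)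
    (hf₁ : frobNorm (G₁ - Matrix.fromCols C R * (Matrix.fromCols C R)ᵀ) ≤ f)
    (hf₂ : frobNorm (G₂ - Matrix.fromCols C P * (Matrix.fromCols C P)ᵀ) ≤ f) (hfg : 2 * f < g)
    {R' : Matrix (Fin p) (Fin k) ℝ} (hR' : IsTopLeftSingularVectors (G₁ * (1 - G₂)) R') :
    SpecificPart G₁ G₂ R' (2 * f) (g - 2 * f) := by
  have hf0 : 0 ≤ f := (frobNorm_nonneg _).trans hf₁
  have hP₁ := isProj_orth hCR
  have hP₂ := isProj_orth hCP
  obtain ⟨hC, hR, hRC⟩ := (fromCols_orth_iff C R).1 hCR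
  obtain ⟨-, hP, hPC⟩ := (fromCols_orth_iff C P).1 hCP
  have e₁ : Matrix.fromCols C R * (Matrix.fromCols C R)ᵀ = C * Cᵀ + R * Rᵀ := by
    rw [Matrix.transpose_fromCols, Matrix.fromCols_mul_fromRows]
  have e₂ : Matrix.fromCols C P * (Matrix.fromCols C P)ᵀ = C * Cᵀ + P * Pᵀ := by
    rw [Matrix.transpose_fromCols, Matrix.fromCols_mul_fromRows]
  set P₁ := Matrix.fromCols C R * (Matrix.fromCols C R)ᵀ
  set P₂ := Matrix.fromCols C P * (Matrix.fromCols C P)ᵀ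
  have hCR0 : Cᵀ * R = 0 := by simpa using congrArg Matrix.transpose hRC
  have hCP0 : Cᵀ * P = 0 := by simpa using congrArg Matrix.transpose hPC
  -- Each of the two projections contributes an error `f`, hence the `2 f` in the residual and in
  -- the eigenvalue bound.
  have hdiff : frobNorm (G₁ * (1 - G₂) - P₁ * (1 - P₂)) ≤ 2 * f := by
    have : G₁ * (1 - G₂) - P₁ * (1 - P₂) = (G₁ - P₁) * (1 - G₂) - P₁ * (G₂ - P₂) := by
      noncomm_ring
    rw [this]
    refine (frobNorm_sub_le _ _).trans ?_
    have a1 := (h₂.one_sub.frobNorm_mul_le' (G₁ - P₁)).trans hf₁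
    have a2 := (hP₁.frobNorm_mul_le (G₂ - P₂)).trans hf₂
    linarith
  refine specificPart_of_isTop h₁ (by linarith) hR' hR ?_ fun y => ?_
  · have h0 : (1 - R * Rᵀ) * (P₁ * (1 - P₂)) = 0 := by
      have b1 : (1 - R * Rᵀ) * P₁ = C * Cᵀ := by
        rw [e₁, Matrix.mul_add, Matrix.sub_mul, Matrix.sub_mul, (isProj_orth hR).idem,
          show R * Rᵀ * (C * Cᵀ) = R * (Rᵀ * C) * Cᵀ by simp only [Matrix.mul_assoc], hRC]
        simp
      have b2 : C * Cᵀ * (1 - P₂) = 0 := by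
        rw [e₂, Matrix.mul_sub, Matrix.mul_add, (isProj_orth hC).idem,
          show C * Cᵀ * (P * Pᵀ) = C * (Cᵀ * P) * Pᵀ by simp only [Matrix.mul_assoc], hCP0]
        simp
      rw [← Matrix.mul_assoc, b1, b2]
    have h3 : (1 - R * Rᵀ) * (G₁ * (1 - G₂))
        = (1 - R * Rᵀ) * (G₁ * (1 - G₂) - P₁ * (1 - P₂)) := by
      rw [Matrix.mul_sub _ (G₁ * _), h0, sub_zero]
    rw [h3]
    exact ((isProj_orth hR).one_sub.frobNorm_mul_le _).trans hdiff
  · set z := R *ᵥ y with hz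
    have hzz : z ⬝ᵥ z = y ⬝ᵥ y := orth_mulVec_dot hR y
    have hK0 : (P₁ * (1 - P₂))ᵀ *ᵥ z = (1 - P₂) *ᵥ z := by
      have b3 : P₁ * R = R := by
        rw [e₁, Matrix.add_mul, Matrix.mul_assoc, hCR0, Matrix.mul_assoc, hR]; simp
      rw [Matrix.transpose_mul, hP₁.symm, hP₂.one_sub.symm, ← Matrix.mulVec_mulVec, hz,
        Matrix.mulVec_mulVec _ P₁, b3]
    -- For `z = R y`, only the predictor-specific directions see `z`: `|P₂ z| = |Pᵀ R y|`, so the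
    -- angle condition bounds `|(1 - P₂) z|` from below by `g |y|`.
    have hlow : g ^ 2 * (y ⬝ᵥ y) ≤ ((1 - P₂) *ᵥ z) ⬝ᵥ ((1 - P₂) *ᵥ z) := by
      have b4 := hP₂.dot_add z
      have b5 : P₂ *ᵥ z = P *ᵥ ((Pᵀ * R) *ᵥ y) := by
        rw [hz, Matrix.mulVec_mulVec, Matrix.mulVec_mulVec, e₂, Matrix.add_mul, Matrix.mul_assoc C,
          hCR0, Matrix.mul_zero, zero_add, Matrix.mul_assoc]
      rw [b5, orth_mulVec_dot hP] at b4
      have b6 := mulVec_dot_self_le (Pᵀ * R) y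
      have b7 : ‖Pᵀ * R‖ = ‖Rᵀ * P‖ := by
        rw [← opNorm_transpose, Matrix.transpose_mul, Matrix.transpose_transpose]
      rw [b7] at b6
      have b8 := mul_le_mul_of_nonneg_right hg (dot_self_nonneg y)
      linarith
    have hd2 := sqrt_mulVec_dot_self_le (G₁ * (1 - G₂) - P₁ * (1 - P₂))ᵀ z
    rw [opNorm_transpose, hzz] at hd2
    have hd3 := hd2.trans (mul_le_mul_of_nonneg_right ((opNorm_le_frobNorm _).trans hdiff)
      (Real.sqrt_nonneg _))
    -- triangle inequality in Euclidean space
    set u := (G₁ * (1 - G₂))ᵀ *ᵥ z with hu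
    have hw : (G₁ * (1 - G₂) - P₁ * (1 - P₂))ᵀ *ᵥ z = u - (1 - P₂) *ᵥ z := by
      rw [Matrix.transpose_sub, Matrix.sub_mulVec, hK0]
    rw [hw] at hd3
    have hn : ∀ v : Fin p → ℝ, √(v ⬝ᵥ v) = ‖(WithLp.toLp 2 v : EuclideanSpace ℝ (Fin p))‖ := by
      intro v; rw [dot_self_eq_norm_sq, Real.sqrt_sq (norm_nonneg _)]
    have hg0 : 0 ≤ g := by linarith
    have ht : g * √(y ⬝ᵥ y) ≤ √(((1 - P₂) *ᵥ z) ⬝ᵥ ((1 - P₂) *ᵥ z)) := by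
      refine Real.le_sqrt_of_sq_le ?_
      rw [mul_pow, Real.sq_sqrt (dot_self_nonneg y)]; exact hlow
    have htri : √(((1 - P₂) *ᵥ z) ⬝ᵥ ((1 - P₂) *ᵥ z)) ≤ √(u ⬝ᵥ u)
        + √((u - (1 - P₂) *ᵥ z) ⬝ᵥ (u - (1 - P₂) *ᵥ z)) := by
      rw [hn, hn, hn, WithLp.toLp_sub]
      have := norm_sub_le (WithLp.toLp 2 u : EuclideanSpace ℝ (Fin p))
        (WithLp.toLp 2 u - WithLp.toLp 2 ((1 - P₂) *ᵥ z))
      rwa [sub_sub_cancel] at this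
    have hfin : (g - 2 * f) * √(y ⬝ᵥ y) ≤ √(u ⬝ᵥ u) := by linarith
    have := pow_le_pow_left₀ (mul_nonneg (by linarith) (Real.sqrt_nonneg _)) hfin 2
    rwa [mul_pow, Real.sq_sqrt (dot_self_nonneg _), Real.sq_sqrt (dot_self_nonneg _)] at this

/-- The span of `[C R]` covers the range of `G₁`. -/
lemma compl_mul_of_common {k : ℕ} {C : Matrix (Fin p) (Fin d) ℝ} {R : Matrix (Fin p) (Fin k) ℝ}
    {G : Matrix (Fin p) (Fin p) ℝ} (hRC : Rᵀ * C = 0) (hG : IsProj G)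
    (hGR : G * R = R) :
    (1 - Matrix.fromCols C R * (Matrix.fromCols C R)ᵀ) * G = (1 - C * Cᵀ) * (G - R * Rᵀ) := by
  rw [Matrix.transpose_fromCols, Matrix.fromCols_mul_fromRows]
  have h1 : C * Cᵀ * (R * Rᵀ) = 0 := by
    have : Cᵀ * R = 0 := by simpa using congrArg Matrix.transpose hRC
    rw [show C * Cᵀ * (R * Rᵀ) = C * (Cᵀ * R) * Rᵀ by simp only [Matrix.mul_assoc], this]; simp
  have h2 : R * Rᵀ * G = R * Rᵀ := by
    have := congrArg Matrix.transpose hGR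
    rw [Matrix.transpose_mul, hG.symm] at this
    rw [Matrix.mul_assoc, this]
  rw [Matrix.sub_mul, Matrix.add_mul, h2, Matrix.sub_mul, Matrix.mul_sub (C * Cᵀ), h1,
    Matrix.one_mul, Matrix.one_mul, sub_zero]
  abel

/-- The reduced-rank error `δ` yields projection errors `f`, specific parts with residual `2 f`, and
factors spanning `U` and `V` up to `2 f`. Projecting the estimator `B`, of norm at most `2 σ₁`, on
both sides loses at most `4 f σ₁ = 6 κ δ` each; with `δ ≤ κ δ` this adds up to `13 κ δ`. -/
theorem spectralInit_spec {X Y : Matrix (Fin p) (Fin T) ℝ} {A : Matrix (Fin p) (Fin p) ℝ}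
    {θ : Comp p r d} {α β n₀ g b δ : ℝ} (hd : d ≤ r) (hr : 1 ≤ r) (hT : 0 < T) (hα : 0 < α)
    (hn : 0 ≤ n₀) (hS : GoodSample X Y A α β n₀) (hθ : θ.IsDecompOf A)
    (hg : 0 < g) (hgs : g ≤ sinTheta1 θ.R θ.P) (hb : 0 < b)
    (hδ : 2 * n₀ * √(2 * r) / √(T * α) ≤ δ) (hδg : 6 * δ < g * sigma A (r - 1))
    (hδ1 : δ ≤ sigma A 0) :
    (∃ θ₀ : Comp p r d, IsSpectralInit X Y b θ₀) ∧
    ∀ θ₀ : Comp p r d, IsSpectralInit X Y b θ₀ →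
      θ₀.CRᵀ * θ₀.CR = b ^ 2 • 1 ∧ θ₀.CPᵀ * θ₀.CP = b ^ 2 • 1 ∧
      frobNorm (θ₀.toMat - A) ≤ 13 * (sigma A 0 / sigma A (r - 1)) * δ := by
  have hX := hS.isUnit_det hα hT
  have hrp : r ≤ p := by rw [← hθ.rank_eq]; exact Matrix.rank_le_height A
  have hs : 0 < sigma A (r - 1) := by rw [sigma_pos_iff, hθ.rank_eq]; omega
  set s := sigma A (r - 1) with hsdef
  -- `3/2` bounds the `√2` that relates the distance of two projections to the residual of one
  -- against the other.
  set f := 3 / 2 * (δ / s) with hf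
  have hcard : Fintype.card (Fin d ⊕ Fin (r - d)) = r := by
    simp only [Fintype.card_sum, Fintype.card_fin]; omega
  have hA : A = θ.CR * θ.D * θ.CPᵀ := hθ.eq_mat
  have hUA : θ.CR * θ.CRᵀ * A = A := by
    conv_lhs => rw [hA]
    rw [show θ.CR * θ.CRᵀ * (θ.CR * θ.D * θ.CPᵀ) = θ.CR * (θ.CRᵀ * θ.CR) * θ.D * θ.CPᵀ by
      simp only [Matrix.mul_assoc], hθ.orth_CR, Matrix.mul_one, ← hA]
  have hTα : 0 < √(T * α) := Real.sqrt_pos.2 (by positivity)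
  have hrrr : ∀ H : Matrix (Fin p) (Fin r) ℝ,
      IsTopEigenvectors (Y * Xᵀ * (X * Xᵀ)⁻¹ * (X * Yᵀ)) H →
      frobNorm (H * Hᵀ * (Y * Xᵀ * (X * Xᵀ)⁻¹) - A) ≤ δ := by
    intro H hH
    refine le_trans ?_ hδ
    rw [le_div_iff₀ hTα, mul_comm]
    exact (hS.le_frobNorm hα.le _).trans
      (reducedRank_error hS hn hX hθ.rank_eq.le hcard hθ.orth_CR hUA hH)
  have hδ0 : 0 ≤ δ := le_trans (by positivity) hδ
  have hf0 : 0 ≤ f := by positivity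
  -- This is the gap `2 f < g - 2 f` between residual and smallest eigenvalue root that separates
  -- specific from common directions.
  have hfg : 2 * (2 * f) < g := by
    rw [hf]
    have : δ / s < g / 6 := by rw [div_lt_iff₀ hs]; linarith
    linarith
  have hgsq := sq_le_of_le_sinTheta1 hg hgs
  have hgsq' : g ^ 2 ≤ 1 - ‖θ.Pᵀ * θ.R‖ ^ 2 := by
    rwa [← opNorm_transpose, Matrix.transpose_mul, Matrix.transpose_transpose]
  have hfr : ∀ {U V : Matrix (Fin p) (Fin r) ℝ} {s' : Fin r → ℝ} {B : Matrix (Fin p) (Fin p) ℝ},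
      Uᵀ * U = 1 → Vᵀ * V = 1 → B = U * Matrix.diagonal s' * Vᵀ → frobNorm (B - A) ≤ δ →
      frobNorm (U * Uᵀ - θ.CR * θ.CRᵀ) ≤ f ∧ frobNorm (V * Vᵀ - θ.CP * θ.CPᵀ) ≤ f := by
    intro U V s' B hU hV hB hBA
    have key : ∀ x : ℝ, 0 ≤ x → x ≤ δ / s → ∀ y, 0 ≤ y → y ^ 2 = 2 * x ^ 2 → y ≤ f := by
      intro x hx hxs y hy hyx
      refine le_of_sq_le_sq ?_ hf0
      rw [hyx, hf, mul_pow]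
      have := pow_le_pow_left₀ hx hxs 2
      nlinarith [sq_nonneg (δ / s)]
    have hD := hθ.le_D hd
    have hD' := le_transpose_mulVec_dot hs hD
    constructor
    · refine key _ (frobNorm_nonneg _) ?_ _ (frobNorm_nonneg _)
        (frobNorm_proj_sub (by rw [hcard, Fintype.card_fin]) hθ.orth_CR hU)
      refine frobNorm_proj_compl_le hs hθ.orth_CP hA hD' (isProj_orth hU) (B := B) ?_ hBA
      conv_lhs => rw [hB]
      rw [show U * Uᵀ * (U * Matrix.diagonal s' * Vᵀ) = U * (Uᵀ * U) * Matrix.diagonal s' * Vᵀ by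
        simp only [Matrix.mul_assoc], hU, Matrix.mul_one, ← hB]
    · refine key _ (frobNorm_nonneg _) ?_ _ (frobNorm_nonneg _)
        (frobNorm_proj_sub (by rw [hcard, Fintype.card_fin]) hθ.orth_CP hV)
      refine frobNorm_proj_compl_le (A := Aᵀ) (E := θ.Dᵀ) (V := θ.CR) hs hθ.orth_CR ?_
        (by rwa [Matrix.transpose_transpose]) (isProj_orth hV) (B := Bᵀ) ?_ ?_
      · conv_lhs => rw [hA]
        simp only [Matrix.transpose_mul, Matrix.transpose_transpose, Matrix.mul_assoc]
      · have hBt : Bᵀ = V * Matrix.diagonal s' * Uᵀ := by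
          rw [hB]; simp [Matrix.mul_assoc]
        rw [hBt, show V * Vᵀ * (V * Matrix.diagonal s' * Uᵀ)
          = V * (Vᵀ * V) * Matrix.diagonal s' * Uᵀ by simp only [Matrix.mul_assoc], hV,
          Matrix.mul_one]
      · rwa [← Matrix.transpose_sub, frobNorm_transpose]
  constructor
  · obtain ⟨H, hH⟩ := exists_isTopEigenvectors hrp
      (M := Y * Xᵀ * (X * Xᵀ)⁻¹ * (X * Yᵀ)) (by
        rw [Matrix.transpose_mul, Matrix.transpose_mul, Matrix.transpose_mul,
          Matrix.transpose_mul, Matrix.transpose_nonsing_inv]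
        simp [Matrix.mul_assoc])
    have hB := hrrr H hH
    set B := H * Hᵀ * (Y * Xᵀ * (X * Xᵀ)⁻¹) with hBdef
    obtain ⟨U, V, s', hU, hV, hs', hs0, hBs⟩ := exists_thin_svd (k := r) hrp (K := B) (by
      rw [hBdef, Matrix.mul_assoc]
      exact (Matrix.rank_mul_le_left _ _).trans (Matrix.rank_le_width H))
    obtain ⟨f1, f2⟩ := hfr hU hV hBs hB
    obtain ⟨R', hR'⟩ := exists_isTopLeftSingularVectors (k := r - d) (by omega)
      (U * Uᵀ * (1 - V * Vᵀ))
    obtain ⟨P', hP'⟩ := exists_isTopLeftSingularVectors (k := r - d) (by omega)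
      (V * Vᵀ * (1 - U * Uᵀ))
    have sR := specificPart_of_perturbation hθ.orth_CR hθ.orth_CP hgsq (isProj_orth hU)
      (isProj_orth hV) f1 f2 (by linarith) hR'
    have sP := specificPart_of_perturbation hθ.orth_CP hθ.orth_CR hgsq' (isProj_orth hV)
      (isProj_orth hU) f2 f1 (by linarith) hP'
    have hmid := sR.middle_eq (isProj_orth hU) (isProj_orth hV) (by linarith) (by linarith) sP
    obtain ⟨C', hC'⟩ := exists_isTopEigenvectors (k := d) (p := p) (by omega)
      (M := (1 - R' * R'ᵀ) * (1 - P' * P'ᵀ) * (U * Uᵀ + V * Vᵀ) *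
        (1 - R' * R'ᵀ) * (1 - P' * P'ᵀ)) (by
          rw [hmid]; simp)
    let θ' : Comp p r d := ⟨C', R', P', (Matrix.fromCols C' R')ᵀ * B * Matrix.fromCols C' P'⟩
    exact ⟨⟨b • C', b • R', b • P', (b ^ 2)⁻¹ • θ'.D⟩, hX, H, U, V, s', B, θ', hH, hBdef, hU, hV,
      hs', hs0, hBs, hR', hP', hC', rfl, rfl, rfl, rfl, rfl⟩
  · rintro θ₀ ⟨-, H, U, V, s', B, θ', hH, hBdef, hU, hV, hs', hs0, hBs, hR', hP', hC', hD', hC0,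
      hR0, hP0, hD0⟩
    have hB : frobNorm (B - A) ≤ δ := by rw [hBdef]; exact hrrr H hH
    obtain ⟨f1, f2⟩ := hfr hU hV hBs hB
    have sR := specificPart_of_perturbation hθ.orth_CR hθ.orth_CP hgsq (isProj_orth hU)
      (isProj_orth hV) f1 f2 (by linarith) hR'
    have sP := specificPart_of_perturbation hθ.orth_CP hθ.orth_CR hgsq' (isProj_orth hV)
      (isProj_orth hU) f2 f1 (by linarith) hP'
    obtain ⟨c1, c2, c3, c4⟩ := common_part (by omega) (isProj_orth hU) (isProj_orth hV)
      (by rw [trace_orth_proj hU, Fintype.card_fin, ← Nat.cast_add]; congr 1; omega)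
      (by linarith) (by linarith) sR sP hC'
    have oCR : θ'.CRᵀ * θ'.CR = 1 := (fromCols_orth_iff _ _).2 ⟨hC'.orth, sR.orth, c1⟩
    have oCP : θ'.CPᵀ * θ'.CP = 1 := (fromCols_orth_iff _ _).2 ⟨hC'.orth, sP.orth, c2⟩
    have eCR : θ₀.CR = b • θ'.CR := by
      rw [Comp.CR, Comp.CR, hC0, hR0]
      ext i (j | j) <;> simp
    have eCP : θ₀.CP = b • θ'.CP := by
      rw [Comp.CP, Comp.CP, hC0, hP0]
      ext i (j | j) <;> simp
    refine ⟨?_, ?_, ?_⟩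
    · rw [eCR, Matrix.transpose_smul, Matrix.smul_mul, Matrix.mul_smul, smul_smul, oCR, sq]
    · rw [eCP, Matrix.transpose_smul, Matrix.smul_mul, Matrix.mul_smul, smul_smul, oCP, sq]
    · set QL := θ'.CR * θ'.CRᵀ with hQL
      set QR := θ'.CP * θ'.CPᵀ with hQR
      have hmat : θ₀.toMat = QL * B * QR := by
        rw [Comp.toMat, eCR, eCP, hD0, hD', Matrix.transpose_smul]
        simp only [Matrix.smul_mul, Matrix.mul_smul, smul_smul]
        rw [show b * ((b ^ 2)⁻¹ * b) = 1 by field_simp, one_smul]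
        simp only [hQL, hQR, Matrix.mul_assoc]
      have pL := isProj_orth oCR
      have pR := isProj_orth oCP
      have gB : U * Uᵀ * B = B := by
        conv_lhs => rw [hBs]
        rw [show U * Uᵀ * (U * Matrix.diagonal s' * Vᵀ)
          = U * (Uᵀ * U) * Matrix.diagonal s' * Vᵀ by simp only [Matrix.mul_assoc], hU,
          Matrix.mul_one, ← hBs]
      have gB' : B * (V * Vᵀ) = B := by
        conv_lhs => rw [hBs]
        rw [show U * Matrix.diagonal s' * Vᵀ * (V * Vᵀ)
          = U * Matrix.diagonal s' * (Vᵀ * V) * Vᵀ by simp only [Matrix.mul_assoc], hV,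
          Matrix.mul_one, ← hBs]
      have nB : ‖B‖ ≤ 2 * sigma A 0 := by
        have h1 : ‖B‖ ≤ ‖B - A‖ + ‖A‖ := by
          simpa using norm_add_le (B - A) A
        linarith [opNorm_le_sigma A, (opNorm_le_frobNorm (B - A)).trans hB]
      have t1 : frobNorm ((1 - QL) * B) ≤ 2 * f * (2 * sigma A 0) := by
        have t3 : (1 - QL) * (U * Uᵀ) = _ := compl_mul_of_common c1 (isProj_orth hU) sR.range
        rw [← gB, ← Matrix.mul_assoc, t3]
        exact (frobNorm_mul_le' _ _).trans (mul_le_mul c3 nB (norm_nonneg _) (by linarith))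
      have t2 : frobNorm (QL * (B * (1 - QR))) ≤ 2 * f * (2 * sigma A 0) := by
        have t3 : (1 - QR) * (V * Vᵀ) = _ := compl_mul_of_common c2 (isProj_orth hV) sP.range
        refine (pL.frobNorm_mul_le _).trans ?_
        rw [← gB', Matrix.mul_assoc, ← frobNorm_transpose, Matrix.transpose_mul,
          Matrix.transpose_mul, (isProj_orth hV).symm, pR.one_sub.symm, show (1 - θ'.CP * θ'.CPᵀ) * (V * Vᵀ) = _ from t3]
        refine (frobNorm_mul_le' _ _).trans (mul_le_mul c4 ?_ (norm_nonneg _) (by linarith))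
        rwa [opNorm_transpose]
      -- Telescoping `Q_L B Q_R - A`: estimation error, loss by the left projection, loss by the
      -- right projection.
      have hsplit : θ₀.toMat - A = (B - A) - (1 - QL) * B - QL * (B * (1 - QR)) := by
        rw [hmat]; noncomm_ring
      rw [hsplit]
      have h3 := frobNorm_sub_le (B - A - (1 - QL) * B) (QL * (B * (1 - QR)))
      have h4 := frobNorm_sub_le (B - A) ((1 - QL) * B)
      have h5 : 2 * f * (2 * sigma A 0) = 6 * (sigma A 0 / s) * δ := by rw [hf]; ring
      have h6 : δ ≤ sigma A 0 / s * δ := by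
        refine le_mul_of_one_le_left hδ0 ?_
        rw [one_le_div hs]
        exact sigma_antitone A (Nat.zero_le _)
      rw [h5] at t1 t2
      linarith

end SpectralInit

end CommonVAR

/-! ### Descent of the regularised objective and confinement of the iterates. -/

namespace CommonVAR

open scoped Matrix.Norms.L2Operator

/-! ### The Frobenius inner product -/

section Inner

variable {l m n : Type*} [Fintype l] [Fintype m] [Fintype n]
  [DecidableEq l] [DecidableEq m] [DecidableEq n]

/-- The Frobenius inner product. -/
def ip (M N : Matrix m n ℝ) : ℝ := (Mᵀ * N).trace

lemma ip_add_right (M N K : Matrix m n ℝ) : ip M (N + K) = ip M N + ip M K := by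
  simp [ip, Matrix.mul_add]

lemma ip_add_left (M N K : Matrix m n ℝ) : ip (M + N) K = ip M K + ip N K := by
  simp [ip, Matrix.add_mul]

lemma ip_smul_right (c : ℝ) (M N : Matrix m n ℝ) : ip M (c • N) = c * ip M N := by
  simp [ip]

lemma ip_smul_left (c : ℝ) (M N : Matrix m n ℝ) : ip (c • M) N = c * ip M N := by
  simp [ip]

lemma ip_comm (M N : Matrix m n ℝ) : ip M N = ip N M := by
  rw [ip, ip, ← Matrix.trace_transpose, Matrix.transpose_mul, Matrix.transpose_transpose]

lemma ip_self (M : Matrix m n ℝ) : ip M M = frobNorm M ^ 2 := (frobNorm_sq M).symm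

lemma abs_ip_le (M N : Matrix m n ℝ) : |ip M N| ≤ frobNorm M * frobNorm N :=
  abs_trace_transpose_mul_le M N

lemma frobNorm_add_sq (M N : Matrix m n ℝ) :
    frobNorm (M + N) ^ 2 = frobNorm M ^ 2 + 2 * ip M N + frobNorm N ^ 2 := by
  rw [← ip_self, ← ip_self, ← ip_self, ip_add_left, ip_add_right, ip_add_right, ip_comm N M]
  ring

lemma ip_mul_left (G : Matrix l n ℝ) (M : Matrix l m ℝ) (N : Matrix m n ℝ) :
    ip G (M * N) = ip (Mᵀ * G) N := by
  rw [ip, ip, Matrix.transpose_mul, Matrix.transpose_transpose, Matrix.mul_assoc]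

lemma ip_mul_right (G : Matrix l n ℝ) (M : Matrix l m ℝ) (N : Matrix m n ℝ) :
    ip G (M * N) = ip (G * Nᵀ) M := by
  rw [ip, ip, Matrix.transpose_mul, Matrix.transpose_transpose, ← Matrix.mul_assoc,
    Matrix.trace_mul_comm, Matrix.mul_assoc]

lemma ip_transpose (M N : Matrix m n ℝ) : ip Mᵀ Nᵀ = ip M N := by
  rw [ip_comm, ip, ip, Matrix.transpose_transpose, Matrix.trace_mul_comm]

/-- Keeps the spectral norm on the gradient `G`, so that second-order terms carry a bound free of
the dimension. -/
lemma abs_ip_mul_le (G : Matrix l n ℝ) (M : Matrix l m ℝ) (N : Matrix m n ℝ) :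
    |ip G (M * N)| ≤ ‖G‖ * (frobNorm M * frobNorm N) := by
  rw [ip_mul_left, ← mul_assoc, mul_comm ‖G‖]
  refine (abs_ip_le _ _).trans (mul_le_mul_of_nonneg_right ?_ (frobNorm_nonneg _))
  rw [← frobNorm_transpose M]
  exact frobNorm_mul_le' _ _

lemma ip_fromCols {n' : Type*} [Fintype n'] (A A' : Matrix m n ℝ) (B B' : Matrix m n' ℝ) :
    ip (Matrix.fromCols A B) (Matrix.fromCols A' B') = ip A A' + ip B B' := by
  rw [ip, ip, ip, Matrix.transpose_fromCols, Matrix.trace, Fintype.sum_sum_type, Matrix.trace,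
    Matrix.trace]
  simp [Matrix.fromRows_mul, Matrix.mul_fromCols]

end Inner

/-! ### Gradient descent decreases the regularised loss -/

section Descent

variable {p r d T : ℕ} {n : Type*} [Fintype n] [DecidableEq n]

/-- The least squares loss. -/
noncomputable def loss (X Y : Matrix (Fin p) (Fin T) ℝ) (B : Matrix (Fin p) (Fin p) ℝ) : ℝ :=
  (2 * (T : ℝ))⁻¹ * frobNorm (Y - B * X) ^ 2

/-- The function whose gradient descent iteration is `gdStep`. -/
noncomputable def objective (X Y : Matrix (Fin p) (Fin T) ℝ) (a b : ℝ) (θ : Comp p r d) : ℝ :=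
  -- The derivative of `‖Uᵀ U - b² I‖_F²` is `4 U (Uᵀ U - b² I)`; the weight `a / 4` therefore
  -- produces exactly the term `a U (Uᵀ U - b² I)` of the iteration.
  loss X Y θ.toMat + a / 4 * (frobNorm (θ.CRᵀ * θ.CR - b ^ 2 • 1) ^ 2
    + frobNorm (θ.CPᵀ * θ.CP - b ^ 2 • 1) ^ 2)

lemma loss_add (X Y : Matrix (Fin p) (Fin T) ℝ) (B B' : Matrix (Fin p) (Fin p) ℝ) :
    loss X Y (B + B') = loss X Y B + ip (gradL X Y B) B'
      + (2 * (T : ℝ))⁻¹ * frobNorm (B' * X) ^ 2 := by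
  have h1 : Y - (B + B') * X = (Y - B * X) + -(B' * X) := by rw [Matrix.add_mul]; abel
  have h2 : ip (gradL X Y B) B' = -((T : ℝ)⁻¹ * ip (Y - B * X) (B' * X)) := by
    rw [gradL, ip_smul_left, ip_mul_right, ← neg_sub, Matrix.neg_mul]
    rw [show ip (-((Y - B * X) * Xᵀ)) B' = ip ((-1 : ℝ) • ((Y - B * X) * Xᵀ)) B' by simp,
      ip_smul_left]
    ring
  rw [loss, loss, h1, frobNorm_add_sq, h2, frobNorm_neg]
  have h3 : ip (Y - B * X) (-(B' * X)) = - ip (Y - B * X) (B' * X) := by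
    rw [show -(B' * X) = (-1 : ℝ) • (B' * X) by simp, ip_smul_right]; ring
  rw [h3, mul_inv]
  ring

/-- Second order bound for the loss along a move of the factors. -/
lemma loss_move_le {X Y : Matrix (Fin p) (Fin T) ℝ} {A : Matrix (Fin p) (Fin p) ℝ} {α β n₀ : ℝ}
    (hS : GoodSample X Y A α β n₀) (hβ : 0 ≤ β) (hT : 0 < T)
    {U V dU dV : Matrix (Fin p) n ℝ} {D dD : Matrix n n ℝ} {u w γ : ℝ}
    (hU : ‖U‖ ≤ u) (hV : ‖V + dV‖ ≤ u) (hD : ‖D‖ ≤ w) (hD' : ‖D + dD‖ ≤ w)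
    (hG : ‖gradL X Y (U * D * Vᵀ)‖ ≤ γ) :
    loss X Y ((U + dU) * (D + dD) * (V + dV)ᵀ) ≤ loss X Y (U * D * Vᵀ)
      + (ip (gradL X Y (U * D * Vᵀ) * V * Dᵀ) dU
        + ip ((gradL X Y (U * D * Vᵀ))ᵀ * U * D) dV
        + ip (Uᵀ * gradL X Y (U * D * Vᵀ) * V) dD)
      + γ * (u * (frobNorm dU * frobNorm dD) + w * (frobNorm dU * frobNorm dV)
        + u * (frobNorm dD * frobNorm dV))
      + β / 2 * (w * u * frobNorm dU + u * u * frobNorm dD + u * w * frobNorm dV) ^ 2 := by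
  set G := gradL X Y (U * D * Vᵀ)
  have hu0 : 0 ≤ u := (norm_nonneg _).trans hU
  have hw0 : 0 ≤ w := (norm_nonneg _).trans hD
  have hγ0 : 0 ≤ γ := (norm_nonneg _).trans hG
  have fU := frobNorm_nonneg dU
  have fV := frobNorm_nonneg dV
  have fD := frobNorm_nonneg dD
  -- Telescoping with the updated factors on the right leaves three products with one increment
  -- each, so the total move is bounded without separate terms of higher order.
  set Δ := dU * ((D + dD) * (V + dV)ᵀ) + U * (dD * (V + dV)ᵀ) + (U * D) * dVᵀ with hΔ
  have e1 : (U + dU) * (D + dD) * (V + dV)ᵀ = U * D * Vᵀ + Δ := by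
    rw [hΔ, Matrix.transpose_add]
    simp only [Matrix.add_mul, Matrix.mul_add, Matrix.mul_assoc]
    abel
  -- The same move split into its linear part, which pairs with the partial gradients, and products
  -- containing at least two increments.
  have e2 : Δ = (dU * (D * Vᵀ) + U * (dD * Vᵀ) + (U * D) * dVᵀ)
      + (dU * (dD * (V + dV)ᵀ) + (dU * D) * dVᵀ + (U * dD) * dVᵀ) := by
    rw [hΔ, Matrix.transpose_add]
    simp only [Matrix.add_mul, Matrix.mul_add, Matrix.mul_assoc]
    abel
  have hVt : ‖(V + dV)ᵀ‖ ≤ u := by rwa [opNorm_transpose]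
  have hfrob : frobNorm Δ ≤ w * u * frobNorm dU + u * u * frobNorm dD + u * w * frobNorm dV := by
    have a1 : frobNorm (dU * ((D + dD) * (V + dV)ᵀ)) ≤ w * u * frobNorm dU := by
      rw [mul_comm]
      refine (frobNorm_mul_le' _ _).trans (mul_le_mul_of_nonneg_left ?_ fU)
      exact (Matrix.l2_opNorm_mul _ _).trans (mul_le_mul hD' hVt (norm_nonneg _) hw0)
    have a2 : frobNorm (U * (dD * (V + dV)ᵀ)) ≤ u * u * frobNorm dD := by
      rw [mul_assoc, mul_comm u (frobNorm dD)]
      refine (frobNorm_mul_le _ _).trans (mul_le_mul hU ?_ (frobNorm_nonneg _) hu0)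
      exact (frobNorm_mul_le' _ _).trans (mul_le_mul_of_nonneg_left hVt fD)
    have a3 : frobNorm ((U * D) * dVᵀ) ≤ u * w * frobNorm dV := by
      rw [← frobNorm_transpose dV]
      refine (frobNorm_mul_le _ _).trans (mul_le_mul_of_nonneg_right ?_ (frobNorm_nonneg _))
      exact (Matrix.l2_opNorm_mul _ _).trans (mul_le_mul hU hD (norm_nonneg _) hu0)
    rw [hΔ]
    linarith [frobNorm_add_le (dU * ((D + dD) * (V + dV)ᵀ) + U * (dD * (V + dV)ᵀ)) ((U * D) * dVᵀ),
      frobNorm_add_le (dU * ((D + dD) * (V + dV)ᵀ)) (U * (dD * (V + dV)ᵀ))]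
  have hlin : ip G (dU * (D * Vᵀ) + U * (dD * Vᵀ) + (U * D) * dVᵀ)
      = ip (G * V * Dᵀ) dU + ip (Gᵀ * U * D) dV + ip (Uᵀ * G * V) dD := by
    rw [ip_add_right, ip_add_right, ip_mul_right G dU, ip_mul_left G U, ip_mul_right _ dD,
      ip_mul_left G (U * D), ← ip_transpose _ dVᵀ]
    simp only [Matrix.transpose_mul, Matrix.transpose_transpose, Matrix.mul_assoc]
    ring
  have hquad : ip G (dU * (dD * (V + dV)ᵀ) + (dU * D) * dVᵀ + (U * dD) * dVᵀ)
      ≤ γ * (u * (frobNorm dU * frobNorm dD) + w * (frobNorm dU * frobNorm dV)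
        + u * (frobNorm dD * frobNorm dV)) := by
    have key : ∀ (M : Matrix (Fin p) n ℝ) (N : Matrix n (Fin p) ℝ) (c : ℝ),
        frobNorm M * frobNorm N ≤ c → ip G (M * N) ≤ γ * c := fun M N c hc =>
      (le_abs_self _).trans ((abs_ip_mul_le G M N).trans (mul_le_mul hG hc
        (mul_nonneg (frobNorm_nonneg _) (frobNorm_nonneg _)) hγ0))
    have b1 := key dU (dD * (V + dV)ᵀ) (u * (frobNorm dU * frobNorm dD)) (by
      have := (frobNorm_mul_le' dD (V + dV)ᵀ).trans (mul_le_mul_of_nonneg_left hVt fD)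
      calc _ ≤ frobNorm dU * (frobNorm dD * u) := mul_le_mul_of_nonneg_left this fU
        _ = _ := by ring)
    have b2 := key (dU * D) dVᵀ (w * (frobNorm dU * frobNorm dV)) (by
      have := (frobNorm_mul_le' dU D).trans (mul_le_mul_of_nonneg_left hD fU)
      rw [frobNorm_transpose]
      calc _ ≤ frobNorm dU * w * frobNorm dV := mul_le_mul_of_nonneg_right this fV
        _ = _ := by ring)
    have b3 := key (U * dD) dVᵀ (u * (frobNorm dD * frobNorm dV)) (by
      have := (frobNorm_mul_le U dD).trans (mul_le_mul_of_nonneg_right hU fD)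
      rw [frobNorm_transpose]
      calc _ ≤ u * frobNorm dD * frobNorm dV := mul_le_mul_of_nonneg_right this fV
        _ = _ := by ring)
    rw [ip_add_right, ip_add_right]
    linarith
  have hTpos : (0 : ℝ) < T := by exact_mod_cast hT
  have hsq : (2 * (T : ℝ))⁻¹ * frobNorm (Δ * X) ^ 2
      ≤ β / 2 * (w * u * frobNorm dU + u * u * frobNorm dD + u * w * frobNorm dV) ^ 2 := by
    have c1 := pow_le_pow_left₀ (frobNorm_nonneg _) (hS.frobNorm_le hβ Δ) 2
    rw [mul_pow, Real.sq_sqrt (by positivity)] at c1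
    have c2 := pow_le_pow_left₀ (frobNorm_nonneg _) hfrob 2
    calc (2 * (T : ℝ))⁻¹ * frobNorm (Δ * X) ^ 2
        ≤ (2 * (T : ℝ))⁻¹ * (T * β * frobNorm Δ ^ 2) :=
          mul_le_mul_of_nonneg_left c1 (by positivity)
      _ = β / 2 * frobNorm Δ ^ 2 := by field_simp
      _ ≤ _ := mul_le_mul_of_nonneg_left c2 (by positivity)
  rw [e1, loss_add, e2, ip_add_right, hlin, ← e2]
  linarith

/-- Second order bound for the regulariser. -/
lemma reg_move_le {U dU : Matrix (Fin p) n ℝ} {u s b : ℝ} (hU : ‖U‖ ≤ u) (hU' : ‖U + dU‖ ≤ u)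
    (hs : ‖Uᵀ * U - b ^ 2 • 1‖ ≤ s) :
    frobNorm ((U + dU)ᵀ * (U + dU) - b ^ 2 • 1) ^ 2 ≤ frobNorm (Uᵀ * U - b ^ 2 • 1) ^ 2
      + 4 * ip (U * (Uᵀ * U - b ^ 2 • 1)) dU + (2 * s + 4 * u ^ 2) * frobNorm dU ^ 2 := by
  set S := Uᵀ * U - b ^ 2 • (1 : Matrix n n ℝ) with hS
  have hSt : Sᵀ = S := by simp [hS]
  have e1 : (U + dU)ᵀ * (U + dU) - b ^ 2 • 1 = S + (dUᵀ * (U + dU) + Uᵀ * dU) := by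
    rw [hS, Matrix.transpose_add]
    simp only [Matrix.add_mul, Matrix.mul_add]
    abel
  have fU := frobNorm_nonneg dU
  have h1 : frobNorm (dUᵀ * (U + dU) + Uᵀ * dU) ≤ 2 * u * frobNorm dU := by
    have a1 := (frobNorm_mul_le' dUᵀ (U + dU)).trans
      (mul_le_mul_of_nonneg_left hU' (frobNorm_nonneg _))
    have a2 := (frobNorm_mul_le Uᵀ dU).trans (mul_le_mul_of_nonneg_right
      (((opNorm_transpose U).trans_le hU)) fU)
    rw [frobNorm_transpose] at a1
    linarith [frobNorm_add_le (dUᵀ * (U + dU)) (Uᵀ * dU)]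
  have h2 : ip S (dUᵀ * (U + dU) + Uᵀ * dU) = 2 * ip (U * S) dU + ip S (dUᵀ * dU) := by
    have b1 : ip S (Uᵀ * dU) = ip (U * S) dU := by
      rw [ip_mul_left, Matrix.transpose_transpose]
    have b2 : ip S (dUᵀ * U) = ip (U * S) dU := by
      rw [← b1, ← ip_transpose, Matrix.transpose_mul, Matrix.transpose_transpose, hSt]
    rw [Matrix.mul_add, ip_add_right, ip_add_right, b1, b2]
    ring
  have h3 : ip S (dUᵀ * dU) ≤ s * frobNorm dU ^ 2 := by
    refine (le_abs_self _).trans ((abs_ip_mul_le _ _ _).trans ?_)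
    rw [frobNorm_transpose, ← sq]
    exact mul_le_mul_of_nonneg_right hs (sq_nonneg _)
  rw [e1, frobNorm_add_sq, h2]
  have h4 := pow_le_pow_left₀ (frobNorm_nonneg _) h1 2
  rw [show (2 * u * frobNorm dU) ^ 2 = 4 * u ^ 2 * frobNorm dU ^ 2 by ring] at h4
  linarith

/-- The partial gradients of the objective with respect to `[C R]` and `[C P]` when these vary
independently. -/
noncomputable def gradU (X Y : Matrix (Fin p) (Fin T) ℝ) (a b : ℝ) (θ : Comp p r d) :
    Matrix (Fin p) (Fin d ⊕ Fin (r - d)) ℝ :=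
  gradL X Y θ.toMat * θ.CP * θ.Dᵀ + a • (θ.CR * (θ.CRᵀ * θ.CR - b ^ 2 • 1))

noncomputable def gradV (X Y : Matrix (Fin p) (Fin T) ℝ) (a b : ℝ) (θ : Comp p r d) :
    Matrix (Fin p) (Fin d ⊕ Fin (r - d)) ℝ :=
  (gradL X Y θ.toMat)ᵀ * θ.CR * θ.D + a • (θ.CP * (θ.CPᵀ * θ.CP - b ^ 2 • 1))

lemma fromCols_mul_gram {m n₁ n₂ : Type*} [Fintype m] [Fintype n₁] [Fintype n₂] [DecidableEq n₁]
    [DecidableEq n₂] (C : Matrix m n₁ ℝ) (R : Matrix m n₂ ℝ) (c : ℝ) :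
    Matrix.fromCols C R * ((Matrix.fromCols C R)ᵀ * Matrix.fromCols C R - c • 1)
      = Matrix.fromCols (C * (Cᵀ * C - c • 1) + R * Rᵀ * C)
          (R * (Rᵀ * R - c • 1) + C * Cᵀ * R) := by
  rw [Matrix.mul_sub, Matrix.transpose_fromCols, ← Matrix.mul_assoc, Matrix.fromCols_mul_fromRows,
    Matrix.mul_fromCols]
  ext i (j | j) <;>
  simp [Matrix.mul_sub, Matrix.add_mul, Matrix.mul_assoc] <;> ring

lemma gradU_eq (X Y : Matrix (Fin p) (Fin T) ℝ) (a b : ℝ) (θ : Comp p r d) :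
    gradU X Y a b θ = Matrix.fromCols
      (gradL X Y θ.toMat * (θ.C * θ.D.toBlocks₁₁ᵀ + θ.P * θ.D.toBlocks₁₂ᵀ)
        + a • (θ.C * (θ.Cᵀ * θ.C - b ^ 2 • 1) + θ.R * θ.Rᵀ * θ.C))
      (gradL X Y θ.toMat * θ.CP * (Matrix.fromCols θ.D.toBlocks₂₁ θ.D.toBlocks₂₂)ᵀ
        + a • (θ.R * (θ.Rᵀ * θ.R - b ^ 2 • 1) + θ.C * θ.Cᵀ * θ.R)) := by
  have h1 : θ.CP * θ.Dᵀ = Matrix.fromCols (θ.C * θ.D.toBlocks₁₁ᵀ + θ.P * θ.D.toBlocks₁₂ᵀ)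
      (θ.CP * (Matrix.fromCols θ.D.toBlocks₂₁ θ.D.toBlocks₂₂)ᵀ) := by
    conv_lhs => rw [← Matrix.fromBlocks_toBlocks θ.D]
    rw [Matrix.fromBlocks_transpose, Comp.CP, Matrix.fromCols_mul_fromBlocks,
      Matrix.transpose_fromCols, Matrix.fromCols_mul_fromRows]
  rw [gradU, Comp.CR, fromCols_mul_gram, Matrix.mul_assoc, h1, Matrix.mul_fromCols]
  ext i (j | j) <;> simp [Matrix.mul_assoc, mul_add]

lemma gradV_eq (X Y : Matrix (Fin p) (Fin T) ℝ) (a b : ℝ) (θ : Comp p r d) :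
    gradV X Y a b θ = Matrix.fromCols
      ((gradL X Y θ.toMat)ᵀ * (θ.C * θ.D.toBlocks₁₁ + θ.R * θ.D.toBlocks₂₁)
        + a • (θ.C * (θ.Cᵀ * θ.C - b ^ 2 • 1) + θ.P * θ.Pᵀ * θ.C))
      ((gradL X Y θ.toMat)ᵀ * θ.CR * (Matrix.fromCols θ.D.toBlocks₁₂ᵀ θ.D.toBlocks₂₂ᵀ)ᵀ
        + a • (θ.P * (θ.Pᵀ * θ.P - b ^ 2 • 1) + θ.C * θ.Cᵀ * θ.P)) := by
  have h1 : θ.CR * θ.D = Matrix.fromCols (θ.C * θ.D.toBlocks₁₁ + θ.R * θ.D.toBlocks₂₁)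
      (θ.CR * (Matrix.fromCols θ.D.toBlocks₁₂ᵀ θ.D.toBlocks₂₂ᵀ)ᵀ) := by
    conv_lhs => rw [← Matrix.fromBlocks_toBlocks θ.D]
    rw [Comp.CR, Matrix.fromCols_mul_fromBlocks,
      Matrix.transpose_fromCols, Matrix.fromCols_mul_fromRows, Matrix.transpose_transpose,
      Matrix.transpose_transpose]
  rw [gradV, Comp.CP, fromCols_mul_gram, Matrix.mul_assoc, h1, Matrix.mul_fromCols]
  ext i (j | j) <;> simp [Matrix.mul_assoc, mul_add]

/-- The common block `C` occurs in both outer factors and moves along the sum of their partial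
gradients, whereas `R` follows only its own. -/
lemma gdStep_CR (X Y : Matrix (Fin p) (Fin T) ℝ) (a b η : ℝ) (θ : Comp p r d) :
    (gdStep X Y a b η θ).CR = θ.CR + (-η) • Matrix.fromCols
      ((gradU X Y a b θ).toCols₁ + (gradV X Y a b θ).toCols₁) (gradU X Y a b θ).toCols₂ := by
  rw [gradU_eq, gradV_eq, Matrix.toCols₁_fromCols, Matrix.toCols₁_fromCols,
    Matrix.toCols₂_fromCols]
  ext i (j | j)
  · simp [gdStep, Comp.CR, Matrix.mul_add]; ring
  · simp [gdStep, Comp.CR]; ring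

lemma gdStep_CP (X Y : Matrix (Fin p) (Fin T) ℝ) (a b η : ℝ) (θ : Comp p r d) :
    (gdStep X Y a b η θ).CP = θ.CP + (-η) • Matrix.fromCols
      ((gradU X Y a b θ).toCols₁ + (gradV X Y a b θ).toCols₁) (gradV X Y a b θ).toCols₂ := by
  rw [gradU_eq, gradV_eq, Matrix.toCols₁_fromCols, Matrix.toCols₁_fromCols,
    Matrix.toCols₂_fromCols]
  ext i (j | j)
  · simp [gdStep, Comp.CP, Matrix.mul_add]; ring
  · simp [gdStep, Comp.CP]; ring

lemma opNorm_toCols₁_zero_le (M : Matrix (Fin p) (Fin d ⊕ Fin (r - d)) ℝ) :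
    ‖Matrix.fromCols M.toCols₁ (0 : Matrix (Fin p) (Fin (r - d)) ℝ)‖ ≤ ‖M‖ := by
  let E : Matrix (Fin d ⊕ Fin (r - d)) (Fin d ⊕ Fin (r - d)) ℝ := Matrix.fromBlocks 1 0 0 0
  have hE : IsProj E := ⟨by simp [E, Matrix.fromBlocks_transpose],
    by simp [E, Matrix.fromBlocks_multiply]⟩
  have h1 : Matrix.fromCols M.toCols₁ (0 : Matrix (Fin p) (Fin (r - d)) ℝ) = M * E := by
    conv_rhs => rw [← Matrix.fromCols_toCols M]
    rw [Matrix.fromCols_mul_fromBlocks]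
    simp
  rw [h1]
  exact (Matrix.l2_opNorm_mul _ _).trans (mul_le_of_le_one_right (norm_nonneg _) hE.opNorm_le)

end Descent

end CommonVAR

namespace CommonVAR

open scoped Matrix.Norms.L2Operator

section Step

variable {p r d T : ℕ}

/-- With the first block of columns shared, the gradient direction `-η ∇` decreases the linear part
of the objective by at least the squared length of the move over `2 η`. -/
lemma linear_decrease {k : Type*} [Fintype k] [DecidableEq k] {η : ℝ} (hη : 0 < η)
    (gU gV : Matrix (Fin p) (Fin d ⊕ Fin (r - d)) ℝ) (gD : Matrix k k ℝ) :
    ip gU ((-η) • Matrix.fromCols (gU.toCols₁ + gV.toCols₁) gU.toCols₂)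
      + ip gV ((-η) • Matrix.fromCols (gU.toCols₁ + gV.toCols₁) gV.toCols₂)
      + ip gD ((-η) • gD)
    ≤ -(frobNorm ((-η) • Matrix.fromCols (gU.toCols₁ + gV.toCols₁) gU.toCols₂) ^ 2
      + frobNorm ((-η) • Matrix.fromCols (gU.toCols₁ + gV.toCols₁) gV.toCols₂) ^ 2
      + frobNorm ((-η) • gD) ^ 2) / (2 * η) := by
  have e : ∀ g h : Matrix (Fin p) (Fin d ⊕ Fin (r - d)) ℝ,
      ip g h = ip g.toCols₁ h.toCols₁ + ip g.toCols₂ h.toCols₂ := fun g h => by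
    rw [← ip_fromCols, Matrix.fromCols_toCols, Matrix.fromCols_toCols]
  simp only [← ip_self, ip_smul_right, ip_smul_left, ip_fromCols, e gU (Matrix.fromCols _ _),
    e gV (Matrix.fromCols _ _), Matrix.toCols₁_fromCols, Matrix.toCols₂_fromCols]
  have h1 := sq_nonneg (frobNorm gU.toCols₂)
  have h2 := sq_nonneg (frobNorm gV.toCols₂)
  have h3 := sq_nonneg (frobNorm gD)
  rw [← ip_self] at h1 h2 h3
  -- The shared block occurs in two of the squared lengths, so the divisor `2 η` is exact there; the
  -- other blocks have a factor two to spare.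
  rw [le_div_iff₀ (by positivity)]
  simp only [ip_add_left]
  nlinarith [mul_nonneg (sq_nonneg η) h1, mul_nonneg (sq_nonneg η) h2,
    mul_nonneg (sq_nonneg η) h3]

lemma opNorm_gradient_le (gU gV : Matrix (Fin p) (Fin d ⊕ Fin (r - d)) ℝ) {c : ℝ}
    (hU : ‖gU‖ ≤ c) (hV : ‖gV‖ ≤ c) {η : ℝ} (hη : 0 ≤ η) :
    ‖(-η) • Matrix.fromCols (gU.toCols₁ + gV.toCols₁) gU.toCols₂‖ ≤ η * (2 * c) := by
  rw [norm_smul, Real.norm_eq_abs, abs_neg, abs_of_nonneg hη]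
  refine mul_le_mul_of_nonneg_left ?_ hη
  have h : Matrix.fromCols (gU.toCols₁ + gV.toCols₁) gU.toCols₂
      = gU + Matrix.fromCols gV.toCols₁ (0 : Matrix (Fin p) (Fin (r - d)) ℝ) := by
    conv_rhs => rw [← Matrix.fromCols_toCols gU]
    ext i (j | j) <;> simp
  rw [h]
  linarith [norm_add_le gU (Matrix.fromCols gV.toCols₁ (0 : Matrix (Fin p) (Fin (r - d)) ℝ)),
    opNorm_toCols₁_zero_le gV]

lemma opNorm_gradient_le' (gU gV : Matrix (Fin p) (Fin d ⊕ Fin (r - d)) ℝ) {c : ℝ}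
    (hU : ‖gU‖ ≤ c) (hV : ‖gV‖ ≤ c) {η : ℝ} (hη : 0 ≤ η) :
    ‖(-η) • Matrix.fromCols (gU.toCols₁ + gV.toCols₁) gV.toCols₂‖ ≤ η * (2 * c) := by
  rw [add_comm gU.toCols₁]
  exact opNorm_gradient_le gV gU hV hU hη

lemma opNorm_mul_le₃ {k l m n : Type*} [Fintype k] [Fintype l] [Fintype m] [Fintype n]
    [DecidableEq k] [DecidableEq l] [DecidableEq m] [DecidableEq n]
    {M : Matrix k l ℝ} {N : Matrix l m ℝ} {L : Matrix m n ℝ} {x y z : ℝ}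
    (hM : ‖M‖ ≤ x) (hN : ‖N‖ ≤ y) (hL : ‖L‖ ≤ z) : ‖M * N * L‖ ≤ x * y * z := by
  have hx := (norm_nonneg _).trans hM
  have hy := (norm_nonneg _).trans hN
  refine (Matrix.l2_opNorm_mul _ _).trans (mul_le_mul ?_ hL (norm_nonneg _) (by positivity))
  exact (Matrix.l2_opNorm_mul _ _).trans (mul_le_mul hM hN (norm_nonneg _) hx)

/-- `‖U‖² = ‖Uᵀ U‖ ≤ (11/10) b²`, and `(21/20)² = 1.1025`. -/
lemma opNorm_le_of_gram {n : Type*} [Fintype n] [DecidableEq n] {U : Matrix (Fin p) n ℝ} {b : ℝ}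
    (hb : 0 ≤ b) (h : ‖Uᵀ * U - b ^ 2 • 1‖ ≤ b ^ 2 / 10) : ‖U‖ ≤ 21 / 20 * b := by
  have h1 : ‖Uᵀ * U‖ = ‖U‖ * ‖U‖ := by
    have := Matrix.l2_opNorm_conjTranspose_mul_self U
    rwa [Matrix.conjTranspose_eq_transpose_of_trivial] at this
  have h2 : ‖(b ^ 2 • 1 : Matrix n n ℝ)‖ ≤ b ^ 2 := by
    rw [norm_smul, Real.norm_eq_abs, abs_of_nonneg (sq_nonneg b)]
    exact mul_le_of_le_one_right (sq_nonneg b) (opNorm_orth_le (by simp))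
  have h3 := norm_add_le (Uᵀ * U - b ^ 2 • 1) (b ^ 2 • 1 : Matrix n n ℝ)
  rw [sub_add_cancel, h1] at h3
  refine abs_le_of_sq_le_sq' ?_ (by positivity) |>.2
  nlinarith

lemma gdStep_D (X Y : Matrix (Fin p) (Fin T) ℝ) (a b η : ℝ) (θ : Comp p r d) :
    (gdStep X Y a b η θ).D = θ.D + (-η) • (θ.CRᵀ * gradL X Y θ.toMat * θ.CP) := by
  rw [neg_smul, ← sub_eq_add_neg]; rfl

lemma sq_add_three_le (a b c x y z : ℝ) :
    (a * x + b * z + c * y) ^ 2 ≤ (a ^ 2 + b ^ 2 + c ^ 2) * (x ^ 2 + z ^ 2 + y ^ 2) := by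
  linarith [sq_nonneg (a * z - b * x), sq_nonneg (a * y - c * x), sq_nonneg (b * y - c * z)]

/-- Here `x`, `y`, `z` are the lengths of the moves of `[C R]`, `[C P]`, `D`, and `W` is the natural
size of `D`. The gradient, curvature and regulariser terms are at most `21/100`, `6` and `3/2` times
`K⁴ β ρ⁴ (x² + y² + z²)`. -/
lemma second_order_terms_le {K β ρ b W a x y z : ℝ} (hβ : 0 < β) (hK : 1 ≤ K) (hρ : 0 < ρ)
    (hb : 0 < b) (hW0 : 0 < W) (hW : W * b ^ 2 = ρ ^ 3) (hb2 : b ≤ K * ρ)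
    (w1 : W * b ≤ K * ρ ^ 2) (q2 : b ^ 2 ≤ K ^ 2 * ρ ^ 2) (ha2 : a ≤ K * β * ρ ^ 2)
    (x0 : 0 ≤ x) (y0 : 0 ≤ y) (z0 : 0 ≤ z) :
    β * ρ ^ 3 / 10 * (6 / 5 * b * (x * z) + 17 / 10 * W * (x * y) + 6 / 5 * b * (z * y))
      + β / 2 * (17 / 10 * W * (6 / 5 * b) * x + 6 / 5 * b * (6 / 5 * b) * z
      + 6 / 5 * b * (17 / 10 * W) * y) ^ 2
      + a / 4 * ((2 * (b ^ 2 / 10) + 4 * (6 / 5 * b) ^ 2) * x ^ 2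
      + (2 * (b ^ 2 / 10) + 4 * (6 / 5 * b) ^ 2) * y ^ 2)
      ≤ 8 * (K ^ 4 * β * ρ ^ 4 * (x ^ 2 + y ^ 2 + z ^ 2)) := by
  have hK0 : 0 < K := by linarith
  have hKsq : (1 : ℝ) ≤ K ^ 2 := one_le_pow₀ hK
  have hK4 : K ^ 2 ≤ K ^ 4 := pow_le_pow_right₀ hK (by norm_num)
  have hK14 : K ≤ K ^ 4 := le_self_pow₀ hK (by norm_num)
  obtain ⟨ℓ, hℓ⟩ : ∃ ℓ, ℓ = K ^ 4 * β * ρ ^ 4 := ⟨_, rfl⟩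
  have hℓ0 : 0 < ℓ := by rw [hℓ]; positivity
  obtain ⟨q, hq⟩ : ∃ q, q = x ^ 2 + y ^ 2 + z ^ 2 := ⟨_, rfl⟩
  have q0 : 0 ≤ q := by rw [hq]; positivity
  have r1 : β * ρ ^ 3 / 10 * (6 / 5 * b * (x * z) + 17 / 10 * W * (x * y) + 6 / 5 * b * (z * y))
      ≤ 21 / 100 * (ℓ * q) := by
    have c1 : β * ρ ^ 3 * b ≤ ℓ := by
      calc β * ρ ^ 3 * b ≤ β * ρ ^ 3 * (K * ρ) := mul_le_mul_of_nonneg_left hb2 (by positivity)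
        _ = K * (β * ρ ^ 4) := by ring
        _ ≤ K ^ 4 * (β * ρ ^ 4) := mul_le_mul_of_nonneg_right hK14 (by positivity)
        _ = _ := by rw [hℓ]; ring
    have c2 : β * ρ ^ 3 * W ≤ ℓ := by
      calc β * ρ ^ 3 * W = β * (W * b) ^ 2 := by rw [← hW]; ring
        _ ≤ β * (K * ρ ^ 2) ^ 2 :=
          mul_le_mul_of_nonneg_left (pow_le_pow_left₀ (by positivity) w1 2) hβ.le
        _ = K ^ 2 * (β * ρ ^ 4) := by ring
        _ ≤ K ^ 4 * (β * ρ ^ 4) := mul_le_mul_of_nonneg_right hK4 (by positivity)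
        _ = _ := by rw [hℓ]; ring
    have d1 : x * z ≤ q / 2 := by nlinarith [sq_nonneg (x - z), sq_nonneg y]
    have d2 : x * y ≤ q / 2 := by nlinarith [sq_nonneg (x - y), sq_nonneg z]
    have d3 : z * y ≤ q / 2 := by nlinarith [sq_nonneg (z - y), sq_nonneg x]
    have e1 := mul_le_mul c1 d1 (by positivity) hℓ0.le
    have e2 := mul_le_mul c2 d2 (by positivity) hℓ0.le
    have e3 := mul_le_mul c1 d3 (by positivity) hℓ0.le
    have : 0 ≤ ℓ * q := by positivity
    calc _ = 3 / 25 * (β * ρ ^ 3 * b * (x * z)) + 17 / 100 * (β * ρ ^ 3 * W * (x * y))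
          + 3 / 25 * (β * ρ ^ 3 * b * (z * y)) := by ring
      _ ≤ _ := by linarith
  have r2 : β / 2 * (17 / 10 * W * (6 / 5 * b) * x + 6 / 5 * b * (6 / 5 * b) * z
      + 6 / 5 * b * (17 / 10 * W) * y) ^ 2 ≤ 6 * (ℓ * q) := by
    have c1 : (W * b) ^ 2 ≤ K ^ 4 * ρ ^ 4 := by
      calc (W * b) ^ 2 ≤ (K * ρ ^ 2) ^ 2 := pow_le_pow_left₀ (by positivity) w1 2
        _ = K ^ 2 * ρ ^ 4 := by ring
        _ ≤ _ := mul_le_mul_of_nonneg_right hK4 (by positivity)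
    have c2 : (b ^ 2) ^ 2 ≤ K ^ 4 * ρ ^ 4 := by
      calc (b ^ 2) ^ 2 ≤ (K ^ 2 * ρ ^ 2) ^ 2 := pow_le_pow_left₀ (by positivity) q2 2
        _ = _ := by ring
    obtain ⟨u, hu⟩ : ∃ u, u = W * b := ⟨_, rfl⟩
    obtain ⟨v, hv⟩ : ∃ v, v = b ^ 2 := ⟨_, rfl⟩
    obtain ⟨N, hN⟩ : ∃ N, N = K ^ 4 * ρ ^ 4 := ⟨_, rfl⟩
    have N0 : 0 ≤ N := by rw [hN]; positivity
    rw [← hu, ← hN] at c1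
    rw [← hv, ← hN] at c2
    have c3 : (51 / 25 * u * x + 36 / 25 * v * z + 51 / 25 * u * y) ^ 2 ≤ 12 * N * q := by
      have cs : (51 / 25 * u * x + 36 / 25 * v * z + 51 / 25 * u * y) ^ 2
          ≤ ((51 / 25 * u) ^ 2 + (36 / 25 * v) ^ 2 + (51 / 25 * u) ^ 2) * q := by
        rw [hq, add_right_comm (x ^ 2)]
        exact sq_add_three_le _ _ _ _ _ _
      refine cs.trans (mul_le_mul_of_nonneg_right ?_ q0)
      calc _ = 5202 / 625 * u ^ 2 + 1296 / 625 * v ^ 2 := by ring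
        _ ≤ _ := by linarith
    calc _ = β / 2 * (51 / 25 * u * x + 36 / 25 * v * z + 51 / 25 * u * y) ^ 2 := by
          rw [hv, hu]; ring
      _ ≤ β / 2 * (12 * N * q) := mul_le_mul_of_nonneg_left c3 (by positivity)
      _ = _ := by rw [hℓ, hN]; ring
  have r3 : a / 4 * ((2 * (b ^ 2 / 10) + 4 * (6 / 5 * b) ^ 2) * x ^ 2
      + (2 * (b ^ 2 / 10) + 4 * (6 / 5 * b) ^ 2) * y ^ 2) ≤ 3 / 2 * (ℓ * q) := by
    have c1 : a * b ^ 2 ≤ ℓ := by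
      calc a * b ^ 2 ≤ (K * β * ρ ^ 2) * (K ^ 2 * ρ ^ 2) :=
            mul_le_mul ha2 q2 (by positivity) (by positivity)
        _ = K ^ 3 * (β * ρ ^ 4) := by ring
        _ ≤ K ^ 4 * (β * ρ ^ 4) :=
          mul_le_mul_of_nonneg_right (pow_le_pow_right₀ hK (by norm_num)) (by positivity)
        _ = _ := by rw [hℓ]; ring
    have d : x ^ 2 + y ^ 2 ≤ q := by rw [hq]; nlinarith [sq_nonneg z]
    have := mul_le_mul c1 d (by positivity) hℓ0.le
    have : 0 ≤ ℓ * q := by positivity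
    calc _ = 149 / 100 * (a * b ^ 2 * (x ^ 2 + y ^ 2)) := by ring
      _ ≤ _ := by linarith
  have : 0 ≤ ℓ * q := by positivity
  rw [← hℓ, ← hq]
  linarith

set_option maxHeartbeats 800000 in
/-- One gradient step does not increase the objective. -/
theorem objective_gdStep_le {X Y : Matrix (Fin p) (Fin T) ℝ} {A : Matrix (Fin p) (Fin p) ℝ}
    {α β n₀ K ρ a b η : ℝ} (hS : GoodSample X Y A α β n₀) (hβ : 0 < β) (hT : 0 < T)
    (hK : 1 ≤ K) (hρ : 0 < ρ) (hb : 0 < b) (hb1 : ρ ≤ K * b) (hb2 : b ≤ K * ρ) (ha : 0 ≤ a)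
    (ha2 : a ≤ K * β * ρ ^ 2) (hη : 0 < η) (hη2 : η * (260 * K ^ 4 * β * ρ ^ 4) ≤ 1)
    {θ : Comp p r d}
    (hSU : ‖θ.CRᵀ * θ.CR - b ^ 2 • 1‖ ≤ b ^ 2 / (10 * K))
    (hSV : ‖θ.CPᵀ * θ.CP - b ^ 2 • 1‖ ≤ b ^ 2 / (10 * K))
    (hD : ‖θ.D‖ * b ^ 2 ≤ 8 / 5 * ρ ^ 3)
    (hG : ‖gradL X Y θ.toMat‖ ≤ β * ρ ^ 3 / 10) :
    objective X Y a b (gdStep X Y a b η θ) ≤ objective X Y a b θ := by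
  have hK0 : 0 < K := by linarith
  -- `ρ³ = W b²` gives the size of `D` in a balanced factorisation: outer factors of norm about `b`
  -- and a product of norm about `ρ³`.
  obtain ⟨W, hW⟩ : ∃ W : ℝ, W * b ^ 2 = ρ ^ 3 := ⟨ρ ^ 3 / b ^ 2, by field_simp⟩
  have hW0 : 0 < W := by
    by_contra h
    have : W * b ^ 2 ≤ 0 := mul_nonpos_of_nonpos_of_nonneg (not_lt.1 h) (by positivity)
    rw [hW] at this
    exact absurd this (by have := pow_pos hρ 3; linarith)
  have hD' : ‖θ.D‖ ≤ 8 / 5 * W := by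
    refine le_of_mul_le_mul_right ?_ (pow_pos hb 2)
    rw [mul_assoc, hW]; exact hD
  have hKsq : (1 : ℝ) ≤ K ^ 2 := one_le_pow₀ hK
  have hK4 : K ^ 2 ≤ K ^ 4 := pow_le_pow_right₀ hK (by norm_num)
  have hK14 : K ≤ K ^ 4 := le_self_pow₀ hK (by norm_num)
  have q1 : ρ ^ 2 ≤ K ^ 2 * b ^ 2 := by rw [← mul_pow]; exact pow_le_pow_left₀ hρ.le hb1 2
  have q2 : b ^ 2 ≤ K ^ 2 * ρ ^ 2 := by rw [← mul_pow]; exact pow_le_pow_left₀ hb.le hb2 2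
  -- `W b ≤ K ρ²`, `W² b² ≤ K² ρ⁴`, `b⁴ ≤ K⁴ ρ⁴`
  have w1 : W * b ≤ K * ρ ^ 2 := by
    refine le_of_mul_le_mul_right ?_ hb
    calc W * b * b = ρ * ρ ^ 2 := by rw [mul_assoc, ← sq, hW]; ring
      _ ≤ (K * b) * ρ ^ 2 := mul_le_mul_of_nonneg_right hb1 (by positivity)
      _ = _ := by ring
  have hSU' : b ^ 2 / (10 * K) ≤ b ^ 2 / 10 := by gcongr; linarith
  have nU := opNorm_le_of_gram hb.le (hSU.trans hSU')
  have nV := opNorm_le_of_gram hb.le (hSV.trans hSU')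
  set G := gradL X Y θ.toMat with hGdef
  set ℓ := K ^ 4 * β * ρ ^ 4 with hℓ
  have hℓ0 : 0 < ℓ := by positivity
  -- sizes of the gradients
  have hgb : ∀ (M N : Matrix (Fin p) (Fin d ⊕ Fin (r - d)) ℝ)
      (L : Matrix (Fin d ⊕ Fin (r - d)) (Fin d ⊕ Fin (r - d)) ℝ) (H : Matrix (Fin p) (Fin p) ℝ),
      ‖M‖ ≤ 21 / 20 * b → ‖N‖ ≤ 21 / 20 * b → ‖L‖ ≤ 8 / 5 * W → ‖H‖ ≤ β * ρ ^ 3 / 10 →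
      ‖Nᵀ * N - b ^ 2 • 1‖ ≤ b ^ 2 / (10 * K) →
      ‖H * M * L + a • (N * (Nᵀ * N - b ^ 2 • 1))‖ ≤ ℓ * b := by
    intro M N L H hM hN hL hH hSN
    have c1 := opNorm_mul_le₃ hH hM hL
    have c2 : ‖a • (N * (Nᵀ * N - b ^ 2 • 1))‖
        ≤ (K * β * ρ ^ 2) * (21 / 20 * b * (b ^ 2 / (10 * K))) := by
      rw [norm_smul, Real.norm_eq_abs, abs_of_nonneg ha]
      refine mul_le_mul ha2 ?_ (norm_nonneg _) (by positivity)
      exact (Matrix.l2_opNorm_mul _ _).trans (mul_le_mul hN hSN (norm_nonneg _) (by positivity))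
    have c3 : (K * β * ρ ^ 2) * (21 / 20 * b * (b ^ 2 / (10 * K)))
        = 21 / 200 * (β * ρ ^ 2 * b * b ^ 2) := by field_simp; norm_num
    have c4 : β * ρ ^ 2 * b * b ^ 2 ≤ ℓ * b := by
      calc β * ρ ^ 2 * b * b ^ 2 ≤ β * ρ ^ 2 * b * (K ^ 2 * ρ ^ 2) :=
            mul_le_mul_of_nonneg_left q2 (by positivity)
        _ = K ^ 2 * (β * ρ ^ 4 * b) := by ring
        _ ≤ K ^ 4 * (β * ρ ^ 4 * b) := mul_le_mul_of_nonneg_right hK4 (by positivity)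
        _ = _ := by rw [hℓ]; ring
    have c5 : β * ρ ^ 3 / 10 * (21 / 20 * b) * (8 / 5 * W) ≤ 21 / 125 * (ℓ * b) := by
      have : β * ρ ^ 3 * (W * b) ≤ ℓ * b := by
        calc β * ρ ^ 3 * (W * b) ≤ β * ρ ^ 3 * (K * ρ ^ 2) :=
              mul_le_mul_of_nonneg_left w1 (by positivity)
          _ = K * β * ρ ^ 4 * ρ := by ring
          _ ≤ K * β * ρ ^ 4 * (K * b) := mul_le_mul_of_nonneg_left hb1 (by positivity)
          _ = K ^ 2 * (β * ρ ^ 4 * b) := by ring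
          _ ≤ K ^ 4 * (β * ρ ^ 4 * b) := mul_le_mul_of_nonneg_right hK4 (by positivity)
          _ = _ := by rw [hℓ]; ring
      calc _ = 21 / 125 * (β * ρ ^ 3 * (W * b)) := by ring
        _ ≤ _ := by linarith
    have := norm_add_le (H * M * L) (a • (N * (Nᵀ * N - b ^ 2 • 1)))
    have : 0 < ℓ * b := by positivity
    linarith
  set gU := gradU X Y a b θ with hgU
  set gV := gradV X Y a b θ with hgV
  set gD := θ.CRᵀ * G * θ.CP with hgD
  have ngU : ‖gU‖ ≤ ℓ * b :=
    hgb _ _ _ _ nV nU ((opNorm_transpose _).trans_le hD') hG hSU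
  have ngV : ‖gV‖ ≤ ℓ * b :=
    hgb _ _ _ _ nU nV hD' ((opNorm_transpose _).trans_le hG) hSV
  have ngD : ‖gD‖ ≤ ℓ * W := by
    refine (opNorm_mul_le₃ ((opNorm_transpose _).trans_le nU) hG nV).trans ?_
    have : β * ρ ^ 3 * b ^ 2 ≤ ℓ * W := by
      calc β * ρ ^ 3 * b ^ 2 = β * W * (b ^ 2) ^ 2 := by rw [← hW]; ring
        _ ≤ β * W * (K ^ 2 * ρ ^ 2) ^ 2 :=
          mul_le_mul_of_nonneg_left (pow_le_pow_left₀ (by positivity) q2 2) (by positivity)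
        _ = _ := by rw [hℓ]; ring
    have h0 : 0 < ℓ * W := by positivity
    calc _ = 441 / 4000 * (β * ρ ^ 3 * b ^ 2) := by ring
      _ ≤ _ := by linarith
  have hηℓ : η * ℓ ≤ 1 / 260 := by rw [hℓ]; linarith
  have hnU := opNorm_gradient_le gU gV ngU ngV hη.le
  have hnV := opNorm_gradient_le' gU gV ngU ngV hη.le
  have hlin := linear_decrease hη gU gV gD
  have eU := gdStep_CR X Y a b η θ
  have eV := gdStep_CP X Y a b η θ
  have eD := gdStep_D X Y a b η θ
  rw [← hgU, ← hgV] at eU eV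
  rw [← hGdef, ← hgD] at eD
  set dU := (-η) • Matrix.fromCols (gU.toCols₁ + gV.toCols₁) gU.toCols₂
  set dV := (-η) • Matrix.fromCols (gU.toCols₁ + gV.toCols₁) gV.toCols₂
  have hnD : ‖(-η) • gD‖ ≤ η * (ℓ * W) := by
    rw [norm_smul, Real.norm_eq_abs, abs_neg, abs_of_nonneg hη.le]
    exact mul_le_mul_of_nonneg_left ngD hη.le
  set dD := (-η) • gD
  have sb : η * (2 * (ℓ * b)) ≤ b / 130 := by
    have := mul_le_mul_of_nonneg_right hηℓ hb.le
    linarith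
  have sW : η * (ℓ * W) ≤ W / 260 := by
    have := mul_le_mul_of_nonneg_right hηℓ hW0.le
    linarith
  -- The slightly larger radii `6/5 b` and `17/10 W` hold both before and after the step, as the
  -- second-order bounds require.
  have uU : ‖θ.CR‖ ≤ 6 / 5 * b := by linarith
  have uV : ‖θ.CP‖ ≤ 6 / 5 * b := by linarith
  have uU' : ‖θ.CR + dU‖ ≤ 6 / 5 * b := by linarith [norm_add_le θ.CR dU]
  have uV' : ‖θ.CP + dV‖ ≤ 6 / 5 * b := by linarith [norm_add_le θ.CP dV]
  have uD : ‖θ.D‖ ≤ 17 / 10 * W := by linarith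
  have uD' : ‖θ.D + dD‖ ≤ 17 / 10 * W := by linarith [norm_add_le θ.D dD]
  have m1 := loss_move_le hS hβ.le hT (dU := dU) uU uV' uD uD' hG
  have m2 := reg_move_le uU uU' (hSU.trans hSU')
  have m3 := reg_move_le uV uV' (hSV.trans hSU')
  have k1 : ip gU dU = ip (G * θ.CP * θ.Dᵀ) dU + a * ip (θ.CR * (θ.CRᵀ * θ.CR - b ^ 2 • 1)) dU := by
    rw [hgU, gradU, ip_add_left, ip_smul_left]
  have k2 : ip gV dV = ip (Gᵀ * θ.CR * θ.D) dV + a * ip (θ.CP * (θ.CPᵀ * θ.CP - b ^ 2 • 1)) dV := by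
    rw [hgV, gradV, ip_add_left, ip_smul_left]
  have eM : (gdStep X Y a b η θ).toMat = (θ.CR + dU) * (θ.D + dD) * (θ.CP + dV)ᵀ := by
    rw [Comp.toMat, eU, eV, eD]
  rw [objective, eM, eU, eV, objective]
  change loss X Y _ ≤ loss X Y θ.toMat + (ip (G * θ.CP * θ.Dᵀ) dU + ip (Gᵀ * θ.CR * θ.D) dV
    + ip gD dD) + _ + _ at m1
  have x0 := frobNorm_nonneg dU
  have y0 := frobNorm_nonneg dV
  have z0 := frobNorm_nonneg dD
  have s2 := mul_le_mul_of_nonneg_left m2 (show 0 ≤ a / 4 by positivity)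
  have s3 := mul_le_mul_of_nonneg_left m3 (show 0 ≤ a / 4 by positivity)
  generalize frobNorm dU = x at *
  generalize frobNorm dV = y at *
  generalize frobNorm dD = z at *
  obtain ⟨q, hq⟩ : ∃ q, q = x ^ 2 + y ^ 2 + z ^ 2 := ⟨_, rfl⟩
  rw [← hq] at hlin
  have q0 : 0 ≤ q := by rw [hq]; positivity
  -- The linear gain is at least `130 ℓ q`, the second-order loss below at most `8 ℓ q`.
  have hlin' : -q / (2 * η) ≤ -(130 * (ℓ * q)) := by
    rw [div_le_iff₀ (by positivity)]
    have := mul_le_mul_of_nonneg_right hηℓ q0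
    linarith
  have quad := second_order_terms_le hβ hK hρ hb hW0 hW hb2 w1 q2 ha2 x0 y0 z0
  rw [← hq, ← hℓ] at quad
  have : 0 ≤ ℓ * q := by positivity
  linarith

end Step

end CommonVAR

namespace CommonVAR

open scoped Matrix.Norms.L2Operator

section Iterate

variable {p r d T : ℕ}

lemma Comp.rank_toMat_le (hd : d ≤ r) (θ : Comp p r d) : θ.toMat.rank ≤ r := by
  have h := (Matrix.rank_mul_le_left (θ.CR * θ.D) θ.CPᵀ).trans (Matrix.rank_le_card_width _)
  simp only [Fintype.card_sum, Fintype.card_fin] at h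
  unfold Comp.toMat
  omega

/-- The excess loss of `B` is half the squared prediction error up to the noise term. -/
lemma abs_loss_sub_le {X Y : Matrix (Fin p) (Fin T) ℝ} {A B : Matrix (Fin p) (Fin p) ℝ}
    {α β n₀ N : ℝ} (hS : GoodSample X Y A α β n₀) (hn : 0 ≤ n₀) (hT : 0 < T) {k : ℕ}
    (hk : (B - A).rank ≤ k) (hN : n₀ * √k ≤ √T * N) :
    |loss X Y B - loss X Y A - (frobNorm ((B - A) * X) / √T) ^ 2 / 2|
      ≤ N * (frobNorm ((B - A) * X) / √T) := by
  have hT0 : (0 : ℝ) < T := by exact_mod_cast hT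
  have hsT : 0 < √(T : ℝ) := Real.sqrt_pos.2 hT0
  have h1 : loss X Y B - loss X Y A - (frobNorm ((B - A) * X) / √T) ^ 2 / 2
      = -((T : ℝ)⁻¹ * ((Y - A * X)ᵀ * ((B - A) * X)).trace) := by
    have e := loss_add X Y A (B - A)
    rw [add_sub_cancel] at e
    rw [e, div_pow, Real.sq_sqrt hT0.le, gradL, ip_smul_left, ← neg_sub Y, Matrix.neg_mul]
    have : ip (-((Y - A * X) * Xᵀ)) (B - A) = -((Y - A * X)ᵀ * ((B - A) * X)).trace := by
      rw [← neg_one_smul ℝ, ip_smul_left, ← ip_mul_right, ip]; ring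
    rw [this]
    field_simp
    ring
  rw [h1, abs_neg, abs_mul, abs_of_pos (inv_pos.2 hT0)]
  have h2 := (hS.trace_noise_le hn hk).trans
    (mul_le_mul_of_nonneg_right hN (frobNorm_nonneg _))
  calc (T : ℝ)⁻¹ * |((Y - A * X)ᵀ * ((B - A) * X)).trace|
      ≤ (T : ℝ)⁻¹ * (√T * N * frobNorm ((B - A) * X)) :=
        mul_le_mul_of_nonneg_left h2 (inv_nonneg.2 hT0.le)
    _ = (√T * √T)⁻¹ * (√T * N * frobNorm ((B - A) * X)) := by rw [Real.mul_self_sqrt hT0.le]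
    _ = _ := by field_simp

/-- Components on which the objective is at most its value at a good initial point are close to
the truth and nearly balanced. -/
lemma sublevel_bounds {X Y : Matrix (Fin p) (Fin T) ℝ} {A : Matrix (Fin p) (Fin p) ℝ}
    {α β n₀ a b Δ : ℝ} (hd : d ≤ r) (hS : GoodSample X Y A α β n₀) (hn : 0 ≤ n₀) (hT : 0 < T)
    (hA : A.rank = r) (hα : 0 < α) (hβ : 0 ≤ β) (ha : 0 ≤ a) (hΔ : 0 ≤ Δ)
    {θ₀ θ : Comp p r d} (hU : θ₀.CRᵀ * θ₀.CR = b ^ 2 • 1) (hV : θ₀.CPᵀ * θ₀.CP = b ^ 2 • 1)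
    (hE : √β * frobNorm (θ₀.toMat - A) ≤ 13 * (√α * Δ))
    (hN : 2 * n₀ * √(2 * r) ≤ √T * (√α * Δ))
    (hF : objective X Y a b θ ≤ objective X Y a b θ₀) :
    frobNorm (θ.toMat - A) ≤ 14 * Δ ∧
      a * frobNorm (θ.CRᵀ * θ.CR - b ^ 2 • 1) ^ 2 ≤ 368 * (α * Δ ^ 2) ∧
      a * frobNorm (θ.CPᵀ * θ.CP - b ^ 2 • 1) ^ 2 ≤ 368 * (α * Δ ^ 2) := by
  have hT0 : (0 : ℝ) < T := by exact_mod_cast hT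
  have hsT : 0 < √(T : ℝ) := Real.sqrt_pos.2 hT0
  have hsα : 0 < √α := Real.sqrt_pos.2 hα
  obtain ⟨H, hH⟩ : ∃ H, H = √α * Δ := ⟨_, rfl⟩
  have hH0 : 0 ≤ H := by rw [hH]; positivity
  have hN' : n₀ * √((2 * r : ℕ) : ℝ) ≤ √T * (H / 2) := by
    push_cast; rw [hH]; linarith
  have hrk : ∀ θ' : Comp p r d, (θ'.toMat - A).rank ≤ 2 * r := fun θ' => by
    have := rank_sub_le θ'.toMat A
    have := θ'.rank_toMat_le hd
    omega
  have l1 := abs_le.1 (abs_loss_sub_le hS hn hT (hrk θ) hN')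
  have l0 := abs_le.1 (abs_loss_sub_le hS hn hT (hrk θ₀) hN')
  rw [objective, objective, hU, hV, sub_self, frobNorm_zero] at hF
  set h := frobNorm ((θ.toMat - A) * X) / √T with hh
  set h₀ := frobNorm ((θ₀.toMat - A) * X) / √T with hh₀
  have hh0 : 0 ≤ h := div_nonneg (frobNorm_nonneg _) hsT.le
  -- `h` and `h₀` are the normalised prediction errors of the current and the initial point,
  -- measured against `H = √α Δ`.
  have hh00 : 0 ≤ h₀ := div_nonneg (frobNorm_nonneg _) hsT.le
  have hh13 : h₀ ≤ 13 * H := by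
    rw [hh₀, div_le_iff₀ hsT]
    refine (hS.frobNorm_le hβ _).trans ?_
    rw [Real.sqrt_mul hT0.le, mul_assoc, hH]
    calc √T * (√β * frobNorm (θ₀.toMat - A)) ≤ √T * (13 * (√α * Δ)) :=
          mul_le_mul_of_nonneg_left hE hsT.le
      _ = _ := by ring
  obtain ⟨u, hu⟩ : ∃ u, u = a * frobNorm (θ.CRᵀ * θ.CR - b ^ 2 • 1) ^ 2 := ⟨_, rfl⟩
  obtain ⟨v, hv⟩ : ∃ v, v = a * frobNorm (θ.CPᵀ * θ.CP - b ^ 2 • 1) ^ 2 := ⟨_, rfl⟩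
  have hu0 : 0 ≤ u := by rw [hu]; positivity
  have hv0 : 0 ≤ v := by rw [hv]; positivity
  have hF' : h ^ 2 / 2 - H / 2 * h + (u + v) / 4 ≤ h₀ ^ 2 / 2 + H / 2 * h₀ := by
    have e : a / 4 * (frobNorm (θ.CRᵀ * θ.CR - b ^ 2 • 1) ^ 2
        + frobNorm (θ.CPᵀ * θ.CP - b ^ 2 • 1) ^ 2) = (u + v) / 4 := by rw [hu, hv]; ring
    rw [e] at hF
    linarith [l1.1, l0.2]
  have hq : h₀ ^ 2 ≤ (13 * H) ^ 2 := pow_le_pow_left₀ hh00 hh13 2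
  have hq' : H * h₀ ≤ H * (13 * H) := mul_le_mul_of_nonneg_left hh13 hH0
  -- `91 = 13²/2 + 13/2`, the value of the upper bound at `h₀ = 13 H`. The same number is `14²/2 -
  -- 14/2`, which is why `h ≤ 14 H` follows.
  have hq2 : h ^ 2 / 2 - H / 2 * h + (u + v) / 4 ≤ 91 * H ^ 2 := by linarith
  have hH2 : H ^ 2 = α * Δ ^ 2 := by rw [hH, mul_pow, Real.sq_sqrt hα.le]
  -- Completing the square leaves `u + v ≤ (364 + 1/2) H²`.
  have huv : u + v ≤ 368 * (α * Δ ^ 2) := by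
    rw [← hH2]; linarith [sq_nonneg (h - H / 2), sq_nonneg H]
  refine ⟨?_, by rw [← hu]; linarith, by rw [← hv]; linarith⟩
  have h14 : h ≤ 14 * H := by
    by_contra hc
    push Not at hc
    have hx : 0 < h - 14 * H := by linarith
    nlinarith [mul_pos hx hx, mul_nonneg hx.le hH0]
  have hl := hS.le_frobNorm hα.le (θ.toMat - A)
  rw [hh, div_le_iff₀ hsT, hH] at h14
  rw [Real.sqrt_mul hT0.le] at hl
  refine le_of_mul_le_mul_left ?_ (mul_pos hsT hsα)
  linarith

lemma GoodSample.opNorm_gradL_le {X Y : Matrix (Fin p) (Fin T) ℝ} {A B : Matrix (Fin p) (Fin p) ℝ}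
    {α β n₀ : ℝ} (hS : GoodSample X Y A α β n₀) (hn : 0 ≤ n₀) (hT : 0 < T) (hβ : 0 ≤ β) :
    ‖gradL X Y B‖ ≤ β * ‖B - A‖ + n₀ * √β / √T := by
  have hT0 : (0 : ℝ) < T := by exact_mod_cast hT
  have hsT : 0 < √(T : ℝ) := Real.sqrt_pos.2 hT0
  have hX : ‖Xᵀ‖ ≤ √(T * β) := opNorm_le_of_dot (Real.sqrt_nonneg _) fun v => by
    rw [Real.sq_sqrt (by positivity)]; exact hS.upper v
  have h1 : gradL X Y B = (T : ℝ)⁻¹ • ((B - A) * (X * Xᵀ)) - (T : ℝ)⁻¹ • ((Y - A * X) * Xᵀ) := by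
    rw [gradL, ← smul_sub, ← Matrix.mul_assoc, ← Matrix.sub_mul, Matrix.sub_mul B A X]
    congr 2; abel
  have h2 : ‖(T : ℝ)⁻¹ • ((B - A) * (X * Xᵀ))‖ ≤ β * ‖B - A‖ := by
    rw [norm_smul, Real.norm_eq_abs, abs_of_pos (inv_pos.2 hT0)]
    have : ‖(B - A) * (X * Xᵀ)‖ ≤ ‖B - A‖ * (T * β) := by
      refine (Matrix.l2_opNorm_mul _ _).trans (mul_le_mul_of_nonneg_left ?_ (norm_nonneg _))
      refine (Matrix.l2_opNorm_mul _ _).trans ?_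
      rw [← Real.mul_self_sqrt (show 0 ≤ T * β by positivity)]
      exact mul_le_mul ((opNorm_transpose X).symm.trans_le hX) hX (norm_nonneg _)
        (Real.sqrt_nonneg _)
    calc (T : ℝ)⁻¹ * ‖(B - A) * (X * Xᵀ)‖ ≤ (T : ℝ)⁻¹ * (‖B - A‖ * (T * β)) :=
          mul_le_mul_of_nonneg_left this (inv_nonneg.2 hT0.le)
      _ = _ := by field_simp
  have h3 : ‖(T : ℝ)⁻¹ • ((Y - A * X) * Xᵀ)‖ ≤ n₀ * √β / √T := by
    rw [norm_smul, Real.norm_eq_abs, abs_of_pos (inv_pos.2 hT0)]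
    have : ‖(Y - A * X) * Xᵀ‖ ≤ n₀ * √(T * β) := opNorm_le_of_bilin (by positivity) fun u v => by
      refine (hS.noise u v).trans ?_
      have := Real.sqrt_le_sqrt (hS.upper v)
      rw [Real.sqrt_mul (by positivity)] at this
      calc _ ≤ n₀ * √(u ⬝ᵥ u) * (√(T * β) * √(v ⬝ᵥ v)) :=
            mul_le_mul_of_nonneg_left this (by positivity)
        _ = _ := by ring
    rw [Real.sqrt_mul hT0.le] at this
    calc (T : ℝ)⁻¹ * ‖(Y - A * X) * Xᵀ‖ ≤ (√T * √T)⁻¹ * (n₀ * (√T * √β)) := by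
          rw [Real.mul_self_sqrt hT0.le]
          exact mul_le_mul_of_nonneg_left this (inv_nonneg.2 hT0.le)
      _ = _ := by field_simp
  rw [h1]
  exact (norm_sub_le _ _).trans (add_le_add h2 h3)

/-- With nearly orthogonal outer factors, `b⁴ D` equals `[C R]ᵀ A [C P]`, for `A` the product, up to
Gram defects of size at most `(2/10 + 1/100) b⁴ ‖D‖`. Solving for `‖D‖` gives `1.1025 / 0.79 < 7/5`.
-/
lemma Comp.opNorm_D_le {θ : Comp p r d} {b s : ℝ} (hb : 0 < b)
    (hSU : ‖θ.CRᵀ * θ.CR - b ^ 2 • 1‖ ≤ b ^ 2 / 10)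
    (hSV : ‖θ.CPᵀ * θ.CP - b ^ 2 • 1‖ ≤ b ^ 2 / 10) (hs : ‖θ.toMat‖ ≤ s) :
    ‖θ.D‖ * b ^ 2 ≤ 7 / 5 * s := by
  have nU := opNorm_le_of_gram hb.le hSU
  have nV := opNorm_le_of_gram hb.le hSV
  set S₁ := θ.CRᵀ * θ.CR - b ^ 2 • (1 : Matrix (Fin d ⊕ Fin (r - d)) (Fin d ⊕ Fin (r - d)) ℝ) with h₁
  set S₂ := θ.CPᵀ * θ.CP - b ^ 2 • (1 : Matrix (Fin d ⊕ Fin (r - d)) (Fin d ⊕ Fin (r - d)) ℝ) with h₂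
  have e₁ : θ.CRᵀ * θ.CR = S₁ + b ^ 2 • 1 := by rw [h₁, sub_add_cancel]
  have e₂ : θ.CPᵀ * θ.CP = S₂ + b ^ 2 • 1 := by rw [h₂, sub_add_cancel]
  have key : (b ^ 2 * b ^ 2) • θ.D = θ.CRᵀ * θ.toMat * θ.CP
      - (b ^ 2 • (S₁ * θ.D) + b ^ 2 • (θ.D * S₂) + S₁ * θ.D * S₂) := by
    rw [Comp.toMat, show θ.CRᵀ * (θ.CR * θ.D * θ.CPᵀ) * θ.CP
      = (θ.CRᵀ * θ.CR) * θ.D * (θ.CPᵀ * θ.CP) by simp only [Matrix.mul_assoc], e₁, e₂]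
    simp only [Matrix.add_mul, Matrix.mul_add, Matrix.smul_mul, Matrix.mul_smul, Matrix.one_mul,
      Matrix.mul_one, smul_add, smul_smul]
    abel
  have hd0 := norm_nonneg θ.D
  have t1 : ‖b ^ 2 • (S₁ * θ.D)‖ ≤ b ^ 2 * (b ^ 2 / 10 * ‖θ.D‖) := by
    rw [norm_smul, Real.norm_eq_abs, abs_of_pos (by positivity)]
    exact mul_le_mul_of_nonneg_left ((Matrix.l2_opNorm_mul _ _).trans
      (mul_le_mul_of_nonneg_right hSU hd0)) (by positivity)
  have t2 : ‖b ^ 2 • (θ.D * S₂)‖ ≤ b ^ 2 * (‖θ.D‖ * (b ^ 2 / 10)) := by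
    rw [norm_smul, Real.norm_eq_abs, abs_of_pos (by positivity)]
    exact mul_le_mul_of_nonneg_left ((Matrix.l2_opNorm_mul _ _).trans
      (mul_le_mul_of_nonneg_left hSV hd0)) (by positivity)
  have t3 := opNorm_mul_le₃ hSU (le_refl ‖θ.D‖) hSV
  have t4 := opNorm_mul_le₃ ((opNorm_transpose _).trans_le nU) hs nV
  have t5 := congrArg norm key
  rw [norm_smul, Real.norm_eq_abs, abs_of_pos (by positivity)] at t5
  have t6 := norm_sub_le (θ.CRᵀ * θ.toMat * θ.CP)
    (b ^ 2 • (S₁ * θ.D) + b ^ 2 • (θ.D * S₂) + S₁ * θ.D * S₂)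
  have t7 := norm_add_le (b ^ 2 • (S₁ * θ.D) + b ^ 2 • (θ.D * S₂)) (S₁ * θ.D * S₂)
  have t8 := norm_add_le (b ^ 2 • (S₁ * θ.D)) (b ^ 2 • (θ.D * S₂))
  refine le_of_mul_le_mul_right ?_ (pow_pos hb 2)
  have hs0 := (norm_nonneg _).trans hs
  have : 0 ≤ s * b ^ 2 := by positivity
  linarith

/-- All gradient descent iterates from a good initial point stay close to the truth. -/
theorem frobNorm_iterate_le {X Y : Matrix (Fin p) (Fin T) ℝ} {A : Matrix (Fin p) (Fin p) ℝ}
    {α β n₀ K ρ κ a b η Δ : ℝ} (hd : d ≤ r) (hr : 1 ≤ r) (hS : GoodSample X Y A α β n₀)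
    (hn : 0 ≤ n₀) (hT : 0 < T) (hA : A.rank = r) (hα : 0 < α) (hαβ : α ≤ β)
    (hK : 1 ≤ K) (hρ : 0 < ρ) (hσ : ρ ^ 3 = sigma A 0) (hκ : 1 ≤ κ) (hb : 0 < b)
    (hb1 : ρ ≤ K * b) (hb2 : b ≤ K * ρ) (ha1 : α * ρ ^ 2 ≤ K * κ ^ 2 * a)
    (ha2 : a ≤ K * β * ρ ^ 2) (hη : 0 < η) (hη2 : η * (260 * K ^ 4 * β * ρ ^ 4) ≤ 1)
    (hΔ : 0 ≤ Δ) (hΔ1 : 210 * K ^ 4 * κ * Δ ≤ ρ ^ 3) {θ₀ : Comp p r d}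
    (hU : θ₀.CRᵀ * θ₀.CR = b ^ 2 • 1) (hV : θ₀.CPᵀ * θ₀.CP = b ^ 2 • 1)
    (hE : √β * frobNorm (θ₀.toMat - A) ≤ 13 * (√α * Δ))
    (hN : 2 * n₀ * √(2 * r) ≤ √T * (√α * Δ)) (I : ℕ) :
    frobNorm (((gdStep X Y a b η)^[I] θ₀).toMat - A) ≤ 14 * Δ := by
  have hβ : 0 < β := hα.trans_le hαβ
  have hK0 : 0 < K := by linarith
  have hκ0 : 0 < κ := by linarith
  have ha0 : 0 < a := by
    have : 0 < K * κ ^ 2 * a := lt_of_lt_of_le (by positivity) ha1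
    exact pos_of_mul_pos_right this (by positivity)
  have hK4 : 1 ≤ K ^ 4 := one_le_pow₀ hK
  have hΔσ : 210 * Δ ≤ ρ ^ 3 := by
    refine le_trans ?_ hΔ1
    have : 1 * 1 ≤ K ^ 4 * κ := mul_le_mul hK4 hκ zero_le_one (by positivity)
    nlinarith
  -- the Gram matrices of the factors
  have gram : ∀ S : Matrix (Fin d ⊕ Fin (r - d)) (Fin d ⊕ Fin (r - d)) ℝ,
      a * frobNorm S ^ 2 ≤ 368 * (α * Δ ^ 2) → ‖S‖ ≤ b ^ 2 / (10 * K) := by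
    intro S hS
    refine (opNorm_le_frobNorm S).trans (abs_le_of_sq_le_sq' ?_ (by positivity)).2
    have e1 : ρ ^ 2 * frobNorm S ^ 2 ≤ 368 * K * (κ * Δ) ^ 2 := by
      have h1 := mul_le_mul_of_nonneg_right ha1 (sq_nonneg (frobNorm S))
      have h2 := mul_le_mul_of_nonneg_left hS (show 0 ≤ K * κ ^ 2 by positivity)
      refine le_of_mul_le_mul_left ?_ hα
      linarith
    have e2 : (210 * K ^ 4) ^ 2 * (κ * Δ) ^ 2 ≤ (ρ ^ 3) ^ 2 := by
      rw [← mul_pow]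
      exact pow_le_pow_left₀ (by positivity) (by linarith) 2
    have e3 : ρ ^ 4 ≤ K ^ 4 * b ^ 4 := by
      rw [← mul_pow]; exact pow_le_pow_left₀ hρ.le hb1 4
    have e4 : 100 * K ^ 6 * (ρ ^ 2 * frobNorm S ^ 2) ≤ ρ ^ 6 := by
      have h1 := mul_le_mul_of_nonneg_left e1 (show 0 ≤ 100 * K ^ 6 by positivity)
      have h2 : K ^ 7 ≤ K ^ 8 := pow_le_pow_right₀ hK (by norm_num)
      have h3 := mul_le_mul_of_nonneg_right h2 (sq_nonneg (κ * Δ))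
      have h4 : 0 ≤ K ^ 8 * (κ * Δ) ^ 2 := by positivity
      nlinarith
    have e5 : 100 * K ^ 6 * frobNorm S ^ 2 ≤ K ^ 4 * b ^ 4 := by
      refine le_trans ?_ e3
      refine le_of_mul_le_mul_left ?_ (pow_pos hρ 2)
      linarith
    rw [div_pow, le_div_iff₀ (by positivity)]
    refine le_of_mul_le_mul_left ?_ (pow_pos hK0 4)
    calc _ = 100 * K ^ 6 * frobNorm S ^ 2 := by ring
      _ ≤ _ := e5
      _ = _ := by ring
  -- The sublevel set of the initial value is invariant: membership gives the size bounds on Gram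
  -- defects, `D` and the gradient under which one step cannot increase the objective.
  have step : ∀ θ : Comp p r d, objective X Y a b θ ≤ objective X Y a b θ₀ →
      objective X Y a b (gdStep X Y a b η θ) ≤ objective X Y a b θ₀ := by
    intro θ hθ
    obtain ⟨s1, s2, s3⟩ := sublevel_bounds hd hS hn hT hA hα hβ.le ha0.le hΔ hU hV hE hN hθ
    have g2 := gram _ s2
    have g3 := gram _ s3
    have hle : b ^ 2 / (10 * K) ≤ b ^ 2 / 10 := by gcongr; linarith
    have hop := (opNorm_le_frobNorm _).trans s1
    refine (objective_gdStep_le hS hβ hT hK hρ hb hb1 hb2 ha0.le ha2 hη hη2 g2 g3 ?_ ?_).trans hθ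
    · have hA1 := opNorm_le_sigma A
      have h2 := norm_add_le (θ.toMat - A) A
      rw [sub_add_cancel] at h2
      have h3 : ‖θ.toMat‖ ≤ 11 / 10 * ρ ^ 3 := by linarith
      have := θ.opNorm_D_le hb (g2.trans hle) (g3.trans hle) h3
      have h4 : 0 < ρ ^ 3 := by positivity
      linarith
    · have hT0 : (0 : ℝ) < T := by exact_mod_cast hT
      have hsT : 0 < √(T : ℝ) := Real.sqrt_pos.2 hT0
      refine (hS.opNorm_gradL_le hn hT hβ.le).trans ?_
      have h1 : n₀ * √β / √T ≤ β * Δ / 2 := by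
        have hr1 : 1 ≤ √(2 * r : ℝ) := by
          rw [Real.one_le_sqrt]
          have : (1 : ℝ) ≤ r := by exact_mod_cast hr
          linarith
        have h2 : 2 * n₀ ≤ √T * (√β * Δ) := by
          refine le_trans ?_ (hN.trans ?_)
          · exact le_mul_of_one_le_right (by positivity) hr1
          · gcongr
        rw [div_le_iff₀ hsT]
        have h3 := mul_le_mul_of_nonneg_right h2 (Real.sqrt_nonneg β)
        have h4 : √T * (√β * Δ) * √β = √T * (β * Δ) := by
          rw [mul_assoc, mul_right_comm, Real.mul_self_sqrt hβ.le]
        linarith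
      have h5 := mul_le_mul_of_nonneg_left hop hβ.le
      have h6 := mul_le_mul_of_nonneg_left hΔσ hβ.le
      have h7 : 0 ≤ β * Δ := by positivity
      linarith
  have all : objective X Y a b ((gdStep X Y a b η)^[I] θ₀) ≤ objective X Y a b θ₀ := by
    induction I with
    | zero => exact le_rfl
    | succ k ih => rw [Function.iterate_succ_apply']; exact step _ ih
  exact (sublevel_bounds hd hS hn hT hA hα hβ.le ha0.le hΔ hU hV hE hN all).1

end Iterate

end CommonVAR

/-! ### Exponential moments of linear and quadratic forms. -/

namespace CommonVAR

open scoped Matrix.Norms.L2Operator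

/-! ### Exponential moments on product spaces -/

/-- The exponential with values in the extended nonnegative reals. -/
noncomputable def eexp (x : ℝ) : ENNReal := ENNReal.ofReal (Real.exp x)

lemma eexp_add (x y : ℝ) : eexp (x + y) = eexp x * eexp y := by
  rw [eexp, eexp, eexp, Real.exp_add, ENNReal.ofReal_mul (Real.exp_nonneg _)]

lemma eexp_sum {ι : Type*} (s : Finset ι) (f : ι → ℝ) :
    eexp (∑ i ∈ s, f i) = ∏ i ∈ s, eexp (f i) := by
  simp only [eexp]
  rw [Real.exp_sum, ENNReal.ofReal_prod_of_nonneg fun i _ => Real.exp_nonneg _]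

lemma eexp_mono {x y : ℝ} (h : x ≤ y) : eexp x ≤ eexp y :=
  ENNReal.ofReal_le_ofReal (Real.exp_le_exp.2 h)

lemma eexp_zero : eexp 0 = 1 := by simp [eexp]

lemma eexp_ne_top (x : ℝ) : eexp x ≠ ⊤ := ENNReal.ofReal_ne_top

lemma measurable_eexp : Measurable eexp := ENNReal.measurable_ofReal.comp Real.measurable_exp

lemma eexp_neg_mul (x : ℝ) : eexp (-x) * eexp x = 1 := by rw [← eexp_add]; simp [eexp_zero]

/-- Chernoff's bound. -/
lemma measure_le_of_eexp {Ω : Type*} [MeasurableSpace Ω] {μ : Measure Ω} {f : Ω → ℝ}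
    (hf : Measurable f) {s a b : ℝ} (hs : 0 < s) (h : ∫⁻ ω, eexp (s * f ω) ∂μ ≤ eexp b) :
    μ {ω | a ≤ f ω} ≤ eexp (b - s * a) := by
  have h1 := mul_meas_ge_le_lintegral (μ := μ) (measurable_eexp.comp (hf.const_mul s)) (eexp (s * a))
  have h2 : {ω | a ≤ f ω} ⊆ {ω | eexp (s * a) ≤ (eexp ∘ fun ω => s * f ω) ω} := fun ω hω =>
    eexp_mono (mul_le_mul_of_nonneg_left hω hs.le)
  have h3 : eexp (s * a) * μ {ω | a ≤ f ω} ≤ eexp b :=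
    (mul_le_mul_right (measure_mono h2) _).trans (h1.trans h)
  calc μ {ω | a ≤ f ω} = eexp (-(s * a)) * (eexp (s * a) * μ {ω | a ≤ f ω}) := by
        rw [← mul_assoc, eexp_neg_mul, one_mul]
    _ ≤ eexp (-(s * a)) * eexp b := mul_le_mul_right h3 _
    _ = _ := by rw [← eexp_add]; congr 1; ring

section Pi

variable {ι : Type*} [Fintype ι] [DecidableEq ι] {ν : ι → Measure ℝ}
  [∀ k, IsProbabilityMeasure (ν k)]

lemma lintegral_pi_prod {f : ι → ℝ → ENNReal} (hf : ∀ k, Measurable (f k)) :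
    ∫⁻ x, ∏ k, f k (x k) ∂Measure.pi ν = ∏ k, ∫⁻ x, f k x ∂ν k := by
  have h := lintegral_prod_eq_prod_lintegral_of_indepFun (μ := Measure.pi ν) Finset.univ
    (fun k x => f k (x k)) (iIndepFun_pi fun k => (hf k).aemeasurable)
    (fun k => (hf k).comp (measurable_pi_apply k))
  rw [h]
  refine Finset.prod_congr rfl fun k _ => ?_
  exact (measurePreserving_eval ν k).lintegral_comp (hf k)

lemma lintegral_pi_eexp_linear {c : ℝ} (hν : ∀ k u, ∫⁻ x, eexp (u * x) ∂ν k ≤ eexp (c * u ^ 2 / 2))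
    (a : ι → ℝ) : ∫⁻ x, eexp (a ⬝ᵥ x) ∂Measure.pi ν ≤ eexp (c * (a ⬝ᵥ a) / 2) := by
  simp only [dotProduct, eexp_sum]
  rw [lintegral_pi_prod (f := fun k x => eexp (a k * x))
    fun k => measurable_eexp.comp (measurable_const_mul _)]
  calc ∏ k, ∫⁻ x, eexp (a k * x) ∂ν k ≤ ∏ k, eexp (c * a k ^ 2 / 2) :=
        Finset.prod_le_prod' fun k _ => hν k (a k)
    _ = _ := by
      rw [← eexp_sum]
      congr 1
      rw [Finset.mul_sum, Finset.sum_div]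
      exact Finset.sum_congr rfl fun k _ => by ring

/-- Resampling some of the coordinates of a product measure. -/
lemma lintegral_pi_piecewise (s : ι → Prop) [DecidablePred s] {F : (ι → ℝ) → ENNReal}
    (hF : Measurable F) :
    ∫⁻ x, F x ∂Measure.pi ν
      = ∫⁻ y, ∫⁻ x, F (fun k => if s k then x k else y k) ∂Measure.pi ν ∂Measure.pi ν := by
  let g : (ι → ℝ) × (ι → ℝ) → ι → ℝ := fun q k => if s k then q.2 k else q.1 k
  have hg : Measurable g := by
    refine measurable_pi_lambda _ fun k => ?_
    by_cases h : s k
    · simp only [g, h, if_true]; fun_prop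
    · simp only [g, h, if_false]; fun_prop
  have h1 : Measure.pi ν = ((Measure.pi ν).prod (Measure.pi ν)).map g := by
    refine Measure.pi_eq fun t ht => ?_
    rw [Measure.map_apply hg (MeasurableSet.univ_pi ht)]
    have h2 : g ⁻¹' Set.univ.pi t = (Set.univ.pi fun k => if s k then Set.univ else t k) ×ˢ
        (Set.univ.pi fun k => if s k then t k else Set.univ) := by
      ext q
      simp only [g, Set.mem_preimage, Set.mem_univ_pi, Set.mem_prod]
      rw [← forall_and]
      refine forall_congr' fun k => ?_
      by_cases h : s k <;> simp [h]
    rw [h2, Measure.prod_prod, Measure.pi_pi, Measure.pi_pi, ← Finset.prod_mul_distrib]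
    refine Finset.prod_congr rfl fun k _ => ?_
    by_cases h : s k <;> simp [h]
  conv_lhs => rw [h1]
  rw [lintegral_map hF hg]
  exact lintegral_prod (fun q => F (g q)) (hF.comp hg).aemeasurable

end Pi

/-! ### Gaussian linearisation -/

lemma lintegral_gaussian_eexp_linear (u : ℝ) :
    ∫⁻ x, eexp (u * x) ∂gaussianReal 0 1 = eexp (u ^ 2 / 2) := by
  have h1 := mgf_gaussianReal (p := gaussianReal 0 1) (X := id) (μ := 0) (v := 1)
    (by rw [Measure.map_id]) u
  simp only [mgf, id, zero_mul, zero_add, NNReal.coe_one, one_mul] at h1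
  simp only [eexp]
  rw [← ofReal_integral_eq_lintegral_ofReal (integrable_exp_mul_gaussianReal u)
    (ae_of_all _ fun _ => Real.exp_nonneg _), h1]

/-- The moment is `(1 - 2 t)^(-1/2)`. Comparing squares with `exp (2 t) ≥ 1 + 2 t`, it remains that
`(1 + 2 t)² (1 - 2 t) = 1 + 2 t (1 - 2 t - 4 t²) ≥ 1`, true for `t ≤ 1/4`. -/
lemma lintegral_gaussian_eexp_sq {t : ℝ} (ht : 0 ≤ t) (ht' : t ≤ 1 / 4) :
    ∫⁻ x, eexp (t * x ^ 2) ∂gaussianReal 0 1 ≤ eexp (2 * t) := by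
  have hb : 0 < 1 / 2 - t := by linarith
  have hpdf : ∀ x, gaussianPDF 0 1 x * eexp (t * x ^ 2)
      = ENNReal.ofReal ((√(2 * Real.pi))⁻¹ * Real.exp (-(1 / 2 - t) * x ^ 2)) := by
    intro x
    rw [gaussianPDF, eexp, ← ENNReal.ofReal_mul (gaussianPDFReal_nonneg _ _ _), gaussianPDFReal]
    simp only [NNReal.coe_one, mul_one, sub_zero]
    rw [mul_assoc, ← Real.exp_add]
    congr 3; ring
  rw [gaussianReal_of_var_ne_zero _ one_ne_zero,
    lintegral_withDensity_eq_lintegral_mul _ (measurable_gaussianPDF 0 1)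
      (g := fun x => eexp (t * x ^ 2)) (measurable_eexp.comp (by fun_prop))]
  simp only [Pi.mul_apply, hpdf]
  rw [← ofReal_integral_eq_lintegral_ofReal ((integrable_exp_neg_mul_sq hb).const_mul _)
    (ae_of_all _ fun _ => by positivity), integral_const_mul, integral_gaussian, eexp]
  refine ENNReal.ofReal_le_ofReal ?_
  rw [← Real.sqrt_inv, ← Real.sqrt_mul (by positivity)]
  refine Real.sqrt_le_iff.2 ⟨(Real.exp_pos _).le, ?_⟩
  have h1 : (2 * Real.pi)⁻¹ * (Real.pi / (1 / 2 - t)) = 1 / (1 - 2 * t) := by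
    have := Real.pi_pos
    have : 1 - 2 * t ≠ 0 := by linarith
    field_simp
  rw [h1, ← Real.exp_nat_mul, div_le_iff₀ (by linarith)]
  have h2 := Real.add_one_le_exp (2 * t)
  have h3 : Real.exp ((2 : ℕ) * (2 * t)) = Real.exp (2 * t) ^ 2 := by rw [Real.exp_nat_mul]
  rw [h3]
  have h4 : (2 * t + 1) ^ 2 ≤ Real.exp (2 * t) ^ 2 := pow_le_pow_left₀ (by linarith) h2 2
  have h5 : 1 ≤ (2 * t + 1) ^ 2 * (1 - 2 * t) := by nlinarith [mul_nonneg ht ht]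
  exact h5.trans (mul_le_mul_of_nonneg_right h4 (by linarith))

section Quadratic

variable {ι κ : Type*} [Fintype ι] [DecidableEq ι] [Fintype κ] [DecidableEq κ] {ν : ι → Measure ℝ}
  [∀ k, IsProbabilityMeasure (ν k)]

lemma exists_diagonalization {M : Matrix ι ι ℝ} (hM : Mᵀ = M) :
    ∃ (Q : Matrix ι ι ℝ) (l : ι → ℝ), Qᵀ * Q = 1 ∧ M = Q * Matrix.diagonal l * Qᵀ := by
  have hH : M.IsHermitian := by
    rw [Matrix.IsHermitian, Matrix.conjTranspose_eq_transpose_of_trivial, hM]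
  refine ⟨hH.eigenvectorUnitary, hH.eigenvalues, ?_, ?_⟩
  · have := (Matrix.mem_unitaryGroup_iff').1 hH.eigenvectorUnitary.2
    rwa [Matrix.star_eq_conjTranspose, Matrix.conjTranspose_eq_transpose_of_trivial] at this
  · have := hH.spectral_theorem
    rw [Unitary.conjStarAlgAut_apply] at this
    rwa [Matrix.star_eq_conjTranspose, Matrix.conjTranspose_eq_transpose_of_trivial] at this

/-- Exponential moments of the squared norm of a linear image of a sub-Gaussian vector. -/
lemma lintegral_pi_eexp_sq {c t : ℝ} (hc : 0 ≤ c) (ht : 0 ≤ t)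
    (hν : ∀ k u, ∫⁻ x, eexp (u * x) ∂ν k ≤ eexp (c * u ^ 2 / 2)) (L : Matrix κ ι ℝ)
    (hL : 4 * (t * c * ‖L‖ ^ 2) ≤ 1) :
    ∫⁻ x, eexp (t * ((L *ᵥ x) ⬝ᵥ (L *ᵥ x))) ∂Measure.pi ν
      ≤ eexp (2 * (t * c * frobNorm L ^ 2)) := by
  obtain ⟨Q, l, hQ, hM⟩ := exists_diagonalization (M := Lᵀ * L) (by simp)
  have hquad : ∀ x, (L *ᵥ x) ⬝ᵥ (L *ᵥ x) = ∑ k, l k * (Qᵀ *ᵥ x) k ^ 2 := fun x => by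
    rw [mulVec_dot_mulVec, hM, ← Matrix.mulVec_mulVec, Matrix.dotProduct_mulVec,
      ← Matrix.vecMul_vecMul, ← Matrix.mulVec_transpose Q, dotProduct]
    refine Finset.sum_congr rfl fun k _ => ?_
    rw [Matrix.vecMul_diagonal]
    ring
  have hcol : ∀ k, l k = (L *ᵥ (Q *ᵥ Pi.single k 1)) ⬝ᵥ (L *ᵥ (Q *ᵥ Pi.single k 1)) := fun k => by
    rw [hquad, Matrix.mulVec_mulVec, hQ, Matrix.one_mulVec]
    simp [Pi.single_apply]
  have hl0 : ∀ k, 0 ≤ l k := fun k => by rw [hcol]; exact dot_self_nonneg _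
  have hl1 : ∀ k, l k ≤ ‖L‖ ^ 2 := fun k => by
    rw [hcol]
    refine (mulVec_dot_self_le L _).trans ?_
    rw [orth_mulVec_dot hQ]
    simp
  have hls : ∑ k, l k = frobNorm L ^ 2 := by
    rw [frobNorm_sq, hM, Matrix.trace_mul_comm, ← Matrix.mul_assoc, hQ, Matrix.one_mul,
      Matrix.trace_diagonal]
  -- linearise
  set γ : ι → Measure ℝ := fun _ => gaussianReal 0 1
  let h : (ι → ℝ) → ι → ℝ := fun g => Q *ᵥ fun k => √(2 * t * l k) * g k
  -- Averaging the exponential of a Gaussian linear form reproduces the exponential of the quadratic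
  -- form. After exchanging integrals, the sub-Gaussian bound in `x` applies to a linear form, and
  -- what remains is a Gaussian quadratic moment.
  have hlin : ∀ x, eexp (t * ((L *ᵥ x) ⬝ᵥ (L *ᵥ x))) = ∫⁻ g, eexp (h g ⬝ᵥ x) ∂Measure.pi γ := by
    intro x
    have e1 : ∀ g, h g ⬝ᵥ x = ∑ k, (√(2 * t * l k) * (Qᵀ *ᵥ x) k) * g k := fun g => by
      rw [dotProduct_comm, Matrix.dotProduct_mulVec, ← Matrix.mulVec_transpose, dotProduct]
      exact Finset.sum_congr rfl fun k _ => by ring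
    simp only [e1, eexp_sum]
    rw [lintegral_pi_prod (f := fun k g => eexp ((√(2 * t * l k) * (Qᵀ *ᵥ x) k) * g))
      fun k => measurable_eexp.comp (measurable_const_mul _)]
    simp only [γ, lintegral_gaussian_eexp_linear]
    rw [← eexp_sum, hquad, Finset.mul_sum]
    congr 1
    refine Finset.sum_congr rfl fun k _ => ?_
    rw [mul_pow, Real.sq_sqrt (mul_nonneg (by positivity) (hl0 k))]
    ring
  have hmeas : Measurable fun q : (ι → ℝ) × (ι → ℝ) => eexp (h q.2 ⬝ᵥ q.1) := by
    refine measurable_eexp.comp ?_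
    simp only [h, dotProduct, Matrix.mulVec]
    fun_prop
  simp only [hlin]
  rw [lintegral_lintegral_swap hmeas.aemeasurable]
  calc ∫⁻ g, ∫⁻ x, eexp (h g ⬝ᵥ x) ∂Measure.pi ν ∂Measure.pi γ
      ≤ ∫⁻ g, eexp (∑ k, c * t * l k * g k ^ 2) ∂Measure.pi γ := by
        refine lintegral_mono fun g => (lintegral_pi_eexp_linear hν (h g)).trans_eq ?_
        congr 1
        simp only [h]
        rw [orth_mulVec_dot hQ, dotProduct, Finset.mul_sum, Finset.sum_div]
        refine Finset.sum_congr rfl fun k _ => ?_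
        have := Real.mul_self_sqrt (mul_nonneg (mul_nonneg zero_le_two ht) (hl0 k))
        calc _ = c * (√(2 * t * l k) * √(2 * t * l k)) * g k ^ 2 / 2 := by ring
          _ = _ := by rw [this]; ring
    _ ≤ ∏ k, eexp (2 * (c * t * l k)) := by
        simp only [eexp_sum]
        rw [lintegral_pi_prod (f := fun k g => eexp (c * t * l k * g ^ 2))
          fun k => measurable_eexp.comp (by fun_prop)]
        refine Finset.prod_le_prod' fun k _ => lintegral_gaussian_eexp_sq
          (mul_nonneg (by positivity) (hl0 k)) ?_
        have := mul_le_mul_of_nonneg_left (hl1 k) (mul_nonneg hc ht)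
        linarith
    _ = _ := by
        rw [← eexp_sum, ← hls]
        congr 1
        rw [Finset.mul_sum, Finset.mul_sum]
        exact Finset.sum_congr rfl fun k _ => by ring

end Quadratic

end CommonVAR

namespace CommonVAR

open scoped Matrix.Norms.L2Operator

/-! ### The Hanson-Wright inequality -/

/-- A probability measure on the line with unit second moment whose moment generating function is
at most `exp (c u² / 2)`. -/
structure IsSubG (ν : Measure ℝ) (c : ℝ) : Prop where
  prob : IsProbabilityMeasure ν
  mgf : ∀ u, ∫⁻ x, eexp (u * x) ∂ν ≤ eexp (c * u ^ 2 / 2)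
  integrable : Integrable (fun x => x ^ 2) ν
  second : ∫ x, x ^ 2 ∂ν = 1

/-- The one-dimensional linearisation: `w² / 2 = (4 c)⁻¹`, so the sub-Gaussian bound leaves the
Gaussian moment at exponent exactly `1/4`. -/
lemma lintegral_eexp_sq_le {ν : Measure ℝ} [IsProbabilityMeasure ν] {c : ℝ} (hc : 0 < c)
    (hν : ∀ u, ∫⁻ x, eexp (u * x) ∂ν ≤ eexp (c * u ^ 2 / 2)) :
    ∫⁻ x, eexp ((4 * c)⁻¹ * x ^ 2) ∂ν ≤ eexp (1 / 2) := by
  set w := √(2 * (4 * c)⁻¹)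
  have hw : w ^ 2 = 2 * (4 * c)⁻¹ := Real.sq_sqrt (by positivity)
  have h1 : ∀ x : ℝ, eexp ((4 * c)⁻¹ * x ^ 2) = ∫⁻ g, eexp (w * x * g) ∂gaussianReal 0 1 := by
    intro x
    rw [lintegral_gaussian_eexp_linear, mul_pow, hw]
    congr 1; ring
  simp only [h1]
  have hm : Measurable fun q : ℝ × ℝ => eexp (w * q.1 * q.2) := measurable_eexp.comp (by fun_prop)
  rw [lintegral_lintegral_swap hm.aemeasurable]
  calc ∫⁻ g, ∫⁻ x, eexp (w * x * g) ∂ν ∂gaussianReal 0 1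
      ≤ ∫⁻ g, eexp (1 / 4 * g ^ 2) ∂gaussianReal 0 1 := by
        refine lintegral_mono fun g => ?_
        have := hν (w * g)
        simp only [mul_right_comm w _ g]
        refine this.trans_eq ?_
        rw [mul_pow, hw]
        congr 1
        field_simp
    _ ≤ eexp (2 * (1 / 4)) := lintegral_gaussian_eexp_sq (by norm_num) le_rfl
    _ = _ := by norm_num

/-- A Taylor bound with explicit linear part, so that integration against a centred variable leaves
only a term of second order. -/
lemma exp_le_quadratic (x : ℝ) : Real.exp x ≤ 1 + x + x ^ 2 * Real.exp |x| := by
  have he : 1 ≤ Real.exp |x| := Real.one_le_exp (abs_nonneg x)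
  rcases le_or_gt |x| 1 with h | h
  · have h1 := (abs_le.1 (Real.abs_exp_sub_one_sub_id_le h)).2
    nlinarith [mul_le_mul_of_nonneg_left he (sq_nonneg x)]
  · have h2 : 1 ≤ x ^ 2 := by rw [← sq_abs]; nlinarith
    rcases lt_or_ge x 0 with hx | hx
    · rw [abs_of_neg hx] at h he ⊢
      have h3 : Real.exp x ≤ 1 := Real.exp_le_one_iff.2 hx.le
      nlinarith [mul_le_mul_of_nonneg_left he (sq_nonneg x)]
    · rw [abs_of_nonneg hx]
      nlinarith [mul_le_mul_of_nonneg_right h2 (Real.exp_pos x).le]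

namespace IsSubG

variable {ν : Measure ℝ} {c : ℝ}

lemma integrable_exp_sq (h : IsSubG ν c) (hc : 0 < c) :
    Integrable (fun x => Real.exp ((4 * c)⁻¹ * x ^ 2)) ν ∧
      ∫ x, Real.exp ((4 * c)⁻¹ * x ^ 2) ∂ν ≤ Real.exp (1 / 2) := by
  have := h.prob
  have h1 := lintegral_eexp_sq_le hc h.mgf
  have hm : AEStronglyMeasurable (fun x => Real.exp ((4 * c)⁻¹ * x ^ 2)) ν := by fun_prop
  have hi : Integrable (fun x => Real.exp ((4 * c)⁻¹ * x ^ 2)) ν := by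
    refine (lintegral_ofReal_ne_top_iff_integrable hm (ae_of_all _ fun _ => Real.exp_nonneg _)).1 ?_
    exact ne_top_of_le_ne_top (eexp_ne_top _) h1
  refine ⟨hi, ?_⟩
  rw [← ENNReal.ofReal_le_ofReal_iff (Real.exp_nonneg _),
    ofReal_integral_eq_lintegral_ofReal hi (ae_of_all _ fun _ => Real.exp_nonneg _)]
  exact h1

/-- Unit variance limits how small `c` can be: `1 + (4 c)⁻¹ ≤ E exp (x² / (4 c)) ≤ √e ≤ 2`. -/
lemma inv_le_one (h : IsSubG ν c) (hc : 0 < c) : (4 * c)⁻¹ ≤ 1 := by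
  have := h.prob
  obtain ⟨hi, hle⟩ := h.integrable_exp_sq hc
  have h1 : ∫ x, (1 + (4 * c)⁻¹ * x ^ 2) ∂ν ≤ ∫ x, Real.exp ((4 * c)⁻¹ * x ^ 2) ∂ν := by
    refine integral_mono ((integrable_const _).add (h.integrable.const_mul _)) hi fun x => ?_
    have := Real.add_one_le_exp ((4 * c)⁻¹ * x ^ 2)
    simp only; linarith
  rw [integral_add (integrable_const _) (h.integrable.const_mul _), integral_const_mul, h.second]
    at h1
  simp only [integral_const, probReal_univ, smul_eq_mul, mul_one] at h1
  have h2 : Real.exp (1 / 2) ≤ 2 := by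
    have h3 : Real.exp (1 / 2) ^ 2 = Real.exp 1 := by rw [← Real.exp_nat_mul]; norm_num
    have := Real.exp_one_lt_d9
    nlinarith [Real.exp_pos (1 / 2 : ℝ)]
  linarith

/-- The linear term integrates to zero because the second moment is `1`. In the remainder, half of
the exponent `u |X|` absorbs `X²` and half absorbs `exp |s X|`; the result is integrable since `E
exp (u x²) ≤ √e`. The constant is `128 · 9/2 ≤ 600`. -/
lemma mgf_sq_sub_one (h : IsSubG ν c) (hc : 0 < c) {s : ℝ} (hs : 8 * (c * |s|) ≤ 1) :
    ∫⁻ x, eexp (s * (x ^ 2 - 1)) ∂ν ≤ eexp (600 * (c ^ 2 * s ^ 2)) := by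
  have := h.prob
  obtain ⟨hi, hle⟩ := h.integrable_exp_sq hc
  have hu := h.inv_le_one hc
  set u := (4 * c)⁻¹ with hudef
  have hu0 : 0 < u := by positivity
  have hcu : 4 * c * u = 1 := by rw [hudef]; field_simp
  have hs2 : |s| ≤ u / 2 := by
    have : |s| * (8 * c) ≤ u / 2 * (8 * c) := by linarith
    exact le_of_mul_le_mul_right this (by positivity)
  -- pointwise bound
  have hpt : ∀ x : ℝ, Real.exp (s * (x ^ 2 - 1)) ≤ 1 + s * (x ^ 2 - 1)
      + s ^ 2 * (128 * c ^ 2 * Real.exp u) * Real.exp (u * x ^ 2) := by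
    intro x
    set X := x ^ 2 - 1 with hX
    have hXle : |X| ≤ 1 + x ^ 2 := by
      rw [abs_le]; constructor <;> nlinarith [sq_nonneg x]
    have h1 := exp_le_quadratic (s * X)
    have h2 : X ^ 2 ≤ 128 * c ^ 2 * Real.exp (u / 2 * |X|) := by
      have h3 := Real.quadratic_le_exp_of_nonneg (x := u / 2 * |X|) (by positivity)
      have h4 : (u / 2 * |X|) ^ 2 = u ^ 2 / 4 * X ^ 2 := by rw [mul_pow, sq_abs]; ring
      have h5 : 0 ≤ u / 2 * |X| := by positivity
      have h6 : u ^ 2 / 8 * X ^ 2 ≤ Real.exp (u / 2 * |X|) := by linarith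
      have h7 : X ^ 2 = 128 * c ^ 2 * (u ^ 2 / 8 * X ^ 2) := by
        calc X ^ 2 = (4 * c * u) ^ 2 * X ^ 2 := by rw [hcu]; ring
          _ = _ := by ring
      rw [h7]
      exact mul_le_mul_of_nonneg_left h6 (by positivity)
    have h3 : |s * X| ≤ u / 2 * |X| := by
      rw [abs_mul]; exact mul_le_mul_of_nonneg_right hs2 (abs_nonneg _)
    have h4 : X ^ 2 * Real.exp |s * X| ≤ 128 * c ^ 2 * Real.exp u * Real.exp (u * x ^ 2) := by
      calc X ^ 2 * Real.exp |s * X|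
          ≤ (128 * c ^ 2 * Real.exp (u / 2 * |X|)) * Real.exp (u / 2 * |X|) :=
            mul_le_mul h2 (Real.exp_le_exp.2 h3) (Real.exp_nonneg _) (by positivity)
        _ = 128 * c ^ 2 * Real.exp (u * |X|) := by
            rw [mul_assoc, ← Real.exp_add]; congr 2; ring
        _ ≤ 128 * c ^ 2 * Real.exp (u + u * x ^ 2) := by
            gcongr; nlinarith
        _ = _ := by rw [Real.exp_add]; ring
    calc _ ≤ 1 + s * X + (s * X) ^ 2 * Real.exp |s * X| := h1
      _ = 1 + s * X + s ^ 2 * (X ^ 2 * Real.exp |s * X|) := by ring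
      _ ≤ 1 + s * X + s ^ 2 * (128 * c ^ 2 * Real.exp u * Real.exp (u * x ^ 2)) := by
          have := mul_le_mul_of_nonneg_left h4 (sq_nonneg s)
          linarith
      _ = _ := by ring
  have i0 : Integrable (fun x : ℝ => x ^ 2 - 1) ν := h.integrable.sub (integrable_const _)
  have i1 : Integrable (fun x : ℝ => 1 + s * (x ^ 2 - 1)) ν :=
    (integrable_const _).add (i0.const_mul _)
  have i2 : Integrable (fun x : ℝ => 1 + s * (x ^ 2 - 1)
      + s ^ 2 * (128 * c ^ 2 * Real.exp u) * Real.exp (u * x ^ 2)) ν := i1.add (hi.const_mul (s ^ 2 * (128 * c ^ 2 * Real.exp u)))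
  have hle2 : ∫⁻ x, eexp (s * (x ^ 2 - 1)) ∂ν ≤ ENNReal.ofReal (∫ x, (1 + s * (x ^ 2 - 1)
      + s ^ 2 * (128 * c ^ 2 * Real.exp u) * Real.exp (u * x ^ 2)) ∂ν) := by
    rw [ofReal_integral_eq_lintegral_ofReal i2
      (ae_of_all _ fun x => (Real.exp_nonneg _).trans (hpt x))]
    exact lintegral_mono fun x => ENNReal.ofReal_le_ofReal (hpt x)
  refine hle2.trans (ENNReal.ofReal_le_ofReal ?_)
  have i3 : ∫ x, (1 + s * (x ^ 2 - 1)) ∂ν = 1 := by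
    rw [integral_add (integrable_const _) (i0.const_mul _), integral_const_mul, integral_sub h.integrable (integrable_const _), h.second]
    simp
  rw [integral_add i1 (hi.const_mul _), i3, integral_const_mul]
  refine le_trans ?_ (Real.add_one_le_exp _)
  have h3 : Real.exp u * Real.exp (1 / 2) ≤ 9 / 2 := by
    rw [← Real.exp_add]
    have h5 : Real.exp (u + 1 / 2) ≤ Real.exp (3 / 2) := Real.exp_le_exp.2 (by linarith)
    have h6 : Real.exp (3 / 2) ^ 2 = Real.exp 1 ^ 3 := by
      rw [← Real.exp_nat_mul, ← Real.exp_nat_mul]; norm_num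
    have h7 : Real.exp 1 ^ 3 ≤ 2.7182818286 ^ 3 :=
      pow_le_pow_left₀ (Real.exp_nonneg _) Real.exp_one_lt_d9.le 3
    refine h5.trans (abs_le_of_sq_le_sq' ?_ (by norm_num)).2
    rw [h6]
    exact h7.trans (by norm_num)
  have h4 : s ^ 2 * (128 * c ^ 2 * Real.exp u) * ∫ x, Real.exp (u * x ^ 2) ∂ν
      ≤ 600 * (c ^ 2 * s ^ 2) := by
    calc _ ≤ s ^ 2 * (128 * c ^ 2 * Real.exp u) * Real.exp (1 / 2) :=
          mul_le_mul_of_nonneg_left hle (by positivity)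
      _ = 128 * (c ^ 2 * s ^ 2) * (Real.exp u * Real.exp (1 / 2)) := by ring
      _ ≤ 128 * (c ^ 2 * s ^ 2) * (9 / 2) := mul_le_mul_of_nonneg_left h3 (by positivity)
      _ ≤ _ := by nlinarith [mul_nonneg (sq_nonneg c) (sq_nonneg s)]
  linarith

end IsSubG

section HW

variable {ι : Type*} [Fintype ι] [DecidableEq ι] {ν : ι → Measure ℝ} {c : ℝ}

lemma sq_diag_sum_le (M : Matrix ι ι ℝ) : ∑ k, M k k ^ 2 ≤ frobNorm M ^ 2 := by
  rw [frobNorm_sq_sum]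
  exact Finset.sum_le_sum fun k _ =>
    Finset.single_le_sum (f := fun j => M k j ^ 2) (fun _ _ => sq_nonneg _) (Finset.mem_univ k)

lemma abs_diag_le (M : Matrix ι ι ℝ) (k : ι) : |M k k| ≤ ‖M‖ := by
  have h1 : M k k = Pi.single k 1 ⬝ᵥ (M *ᵥ Pi.single k 1) := by simp
  rw [h1]
  refine (abs_dot_le _ _).trans ?_
  have := sqrt_mulVec_dot_self_le M (Pi.single k 1)
  simpa using this

lemma lintegral_diag_le (hν : ∀ k, IsSubG (ν k) c) (hc : 0 < c) (M : Matrix ι ι ℝ) {s : ℝ}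
    (hs : 8 * (c * (|s| * ‖M‖)) ≤ 1) :
    ∫⁻ x, eexp (s * ∑ k, M k k * (x k ^ 2 - 1)) ∂Measure.pi ν
      ≤ eexp (600 * (c ^ 2 * s ^ 2 * frobNorm M ^ 2)) := by
  have := fun k => (hν k).prob
  have e : ∀ x : ι → ℝ, s * ∑ k, M k k * (x k ^ 2 - 1) = ∑ k, s * M k k * (x k ^ 2 - 1) :=
    fun x => by rw [Finset.mul_sum]; exact Finset.sum_congr rfl fun k _ => by ring
  simp only [e, eexp_sum]
  rw [lintegral_pi_prod (f := fun k x => eexp (s * M k k * (x ^ 2 - 1)))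
    fun k => measurable_eexp.comp (by fun_prop)]
  calc _ ≤ ∏ k, eexp (600 * (c ^ 2 * (s * M k k) ^ 2)) := by
        refine Finset.prod_le_prod' fun k _ => (hν k).mgf_sq_sub_one hc ?_
        refine le_trans ?_ hs
        rw [abs_mul]
        have := abs_diag_le M k
        gcongr
    _ ≤ _ := by
        rw [← eexp_sum]
        refine eexp_mono ?_
        have : ∑ k, 600 * (c ^ 2 * (s * M k k) ^ 2) = 600 * (c ^ 2 * s ^ 2 * ∑ k, M k k ^ 2) := by
          simp only [Finset.mul_sum]; exact Finset.sum_congr rfl fun k _ => by ring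
        rw [this]
        have := sq_diag_sum_le M
        gcongr

/-- The block of `M` with rows in `s` and columns outside `s`. -/
def offBlock (M : Matrix ι ι ℝ) (s : Finset ι) : Matrix ι ι ℝ :=
  Matrix.of fun j k => if j ∈ s ∧ k ∉ s then M j k else 0

lemma isProj_indicator (s : Finset ι) :
    IsProj (Matrix.diagonal fun j => if j ∈ s then (1 : ℝ) else 0) :=
  ⟨by simp, by simp⟩

lemma offBlock_eq (M : Matrix ι ι ℝ) (s : Finset ι) :
    offBlock M s = (Matrix.diagonal fun j => if j ∈ s then (1 : ℝ) else 0) * M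
      * (Matrix.diagonal fun j => if j ∈ sᶜ then (1 : ℝ) else 0) := by
  ext j k
  rw [Matrix.mul_diagonal, Matrix.diagonal_mul]
  by_cases h1 : j ∈ s <;> by_cases h2 : k ∈ s <;> simp [offBlock, h1, h2]

lemma opNorm_offBlock_le (M : Matrix ι ι ℝ) (s : Finset ι) : ‖offBlock M s‖ ≤ ‖M‖ := by
  rw [offBlock_eq]
  have := opNorm_mul_le₃ (isProj_indicator s).opNorm_le (le_refl ‖M‖) (isProj_indicator sᶜ).opNorm_le
  simpa using this

lemma frobNorm_offBlock_le (M : Matrix ι ι ℝ) (s : Finset ι) :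
    frobNorm (offBlock M s) ≤ frobNorm M := by
  rw [offBlock_eq]
  exact ((isProj_indicator sᶜ).frobNorm_mul_le' _).trans ((isProj_indicator s).frobNorm_mul_le _)

/-- Rows inside `I` and columns outside involve disjoint coordinates. With those outside `I` fixed,
the form is linear in the others, and its sub-Gaussian bound is the exponential of a squared norm in
the fixed ones. -/
lemma lintegral_offBlock_le (hν : ∀ k, IsSubG (ν k) c) (hc : 0 < c) (M : Matrix ι ι ℝ)
    (I : Finset ι) {s : ℝ} (hs : 32 * (c * (s * ‖M‖)) ^ 2 ≤ 1) :
    ∫⁻ x, eexp (s * (4 * (x ⬝ᵥ (offBlock M I *ᵥ x)))) ∂Measure.pi ν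
      ≤ eexp (16 * (c ^ 2 * s ^ 2 * frobNorm M ^ 2)) := by
  have := fun k => (hν k).prob
  set L := offBlock M I with hL
  have hmeas : Measurable fun x : ι → ℝ => eexp (s * (4 * (x ⬝ᵥ (L *ᵥ x)))) := by
    refine measurable_eexp.comp ?_
    simp only [dotProduct, Matrix.mulVec]
    fun_prop
  rw [lintegral_pi_piecewise (· ∈ I) hmeas]
  have e : ∀ x y : ι → ℝ, s * (4 * ((fun k => if k ∈ I then x k else y k) ⬝ᵥ
      (L *ᵥ fun k => if k ∈ I then x k else y k))) = ((4 * s) • (L *ᵥ y)) ⬝ᵥ x := by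
    intro x y
    have e1 : (L *ᵥ fun k => if k ∈ I then x k else y k) = L *ᵥ y := by
      funext j
      refine Finset.sum_congr rfl fun k _ => ?_
      by_cases h : k ∈ I <;> simp [hL, offBlock, h]
    have e2 : (fun k => if k ∈ I then x k else y k) ⬝ᵥ (L *ᵥ y) = (L *ᵥ y) ⬝ᵥ x := by
      refine Finset.sum_congr rfl fun j _ => ?_
      by_cases h : j ∈ I
      · simp [h, mul_comm]
      · have : (L *ᵥ y) j = 0 := Finset.sum_eq_zero fun k _ => by simp [hL, offBlock, h]
        simp [this]
    rw [e1, e2, smul_dotProduct, smul_eq_mul]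
    ring
  simp only [e]
  have h8 : (0 : ℝ) ≤ 8 * c * s ^ 2 := by positivity
  have hop := opNorm_offBlock_le M I
  calc _ ≤ ∫⁻ y, eexp (8 * c * s ^ 2 * ((L *ᵥ y) ⬝ᵥ (L *ᵥ y))) ∂Measure.pi ν := by
        refine lintegral_mono fun y => ?_
        refine (lintegral_pi_eexp_linear (fun k => (hν k).mgf) _).trans_eq ?_
        rw [smul_dotProduct, dotProduct_smul, smul_eq_mul, smul_eq_mul]
        congr 1; ring
    _ ≤ eexp (2 * (8 * c * s ^ 2 * c * frobNorm L ^ 2)) := by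
        refine lintegral_pi_eexp_sq hc.le h8 (fun k => (hν k).mgf) L ?_
        calc 4 * (8 * c * s ^ 2 * c * ‖L‖ ^ 2) ≤ 4 * (8 * c * s ^ 2 * c * ‖M‖ ^ 2) := by gcongr
          _ = 32 * (c * (s * ‖M‖)) ^ 2 := by ring
          _ ≤ 1 := hs
    _ ≤ _ := by
        refine eexp_mono ?_
        have := frobNorm_offBlock_le M I
        have h0 := frobNorm_nonneg L
        calc 2 * (8 * c * s ^ 2 * c * frobNorm L ^ 2)
            ≤ 2 * (8 * c * s ^ 2 * c * frobNorm M ^ 2) := by gcongr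
          _ = _ := by ring

/-- Toggling the element `j` is an involution on subsets that reverses the sign of `f`. -/
lemma sum_flip_eq_zero {f : Finset ι → ℝ} (j : ι) (h : ∀ I, f (symmDiff I {j}) = -f I) :
    ∑ I, f I = 0 := by
  have hinv : Function.Involutive fun I : Finset ι => symmDiff I {j} := fun I => by
    simp
  have h1 := Equiv.sum_comp (Function.Involutive.toPerm _ hinv) f
  have h2 : ∑ I, f ((Function.Involutive.toPerm _ hinv) I) = ∑ I, -f I := Finset.sum_congr rfl fun I _ => h I
  rw [h2, Finset.sum_neg_distrib] at h1
  linarith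

/-- The off-diagonal part of a quadratic form is an average of bilinear forms in disjoint sets of
variables. -/
lemma sum_offBlock (M : Matrix ι ι ℝ) (x : ι → ℝ) :
    ∑ I : Finset ι, 4 * (x ⬝ᵥ (offBlock M I *ᵥ x))
      = Fintype.card (Finset ι) * (x ⬝ᵥ (M *ᵥ x) - ∑ k, M k k * x k ^ 2) := by
  -- With signs `±1` for membership, `(1 + e j)(1 - e k) / 4` indicates `j ∈ I`, `k ∉ I`. For `j ≠
  -- k` this has mean `1/4` over all subsets, which the factor `4` compensates; for `j = k` it
  -- vanishes.
  let e : ι → Finset ι → ℝ := fun j I => if j ∈ I then 1 else -1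
  have he : ∀ j I, e j (symmDiff I {j}) = -e j I := fun j I => by
    by_cases h : j ∈ I <;> simp [e, h, Finset.mem_symmDiff]
  have he' : ∀ j k I, j ≠ k → e j (symmDiff I {k}) = e j I := fun j k I hjk => by
    simp [e, hjk, Finset.mem_symmDiff]
  have hsq : ∀ j I, e j I * e j I = 1 := fun j I => by
    by_cases h : j ∈ I <;> simp [e, h]
  have e1 : ∀ I, 4 * (x ⬝ᵥ (offBlock M I *ᵥ x))
      = ∑ j, ∑ k, M j k * x j * x k * ((1 + e j I) * (1 - e k I)) := by
    intro I
    simp only [dotProduct, Matrix.mulVec, Finset.mul_sum]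
    refine Finset.sum_congr rfl fun j _ => Finset.sum_congr rfl fun k _ => ?_
    by_cases h1 : j ∈ I <;> by_cases h2 : k ∈ I <;> simp [offBlock, e, h1, h2]
    ring
  have e2 : ∀ j k, ∑ I : Finset ι, ((1 + e j I) * (1 - e k I))
      = Fintype.card (Finset ι) * (if j = k then 0 else 1) := by
    intro j k
    have z1 := sum_flip_eq_zero (f := e j) j (he j)
    have z2 := sum_flip_eq_zero (f := e k) k (he k)
    have : ∀ I, (1 + e j I) * (1 - e k I) = 1 + e j I - e k I - e j I * e k I := fun I => by ring
    simp only [this, Finset.sum_sub_distrib, Finset.sum_add_distrib, z1, z2]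
    by_cases h : j = k
    · subst h
      simp [hsq]
    · have z3 := sum_flip_eq_zero (f := fun I => e j I * e k I) j fun I => by
        simp only [he, he' k j I (Ne.symm h)]; ring
      rw [z3]
      simp [h]
  simp only [e1]
  rw [Finset.sum_comm]
  simp only [Finset.sum_comm (s := (Finset.univ : Finset (Finset ι))), ← Finset.mul_sum, e2]
  rw [mul_sub, dotProduct, Finset.mul_sum, Finset.mul_sum, ← Finset.sum_sub_distrib]
  refine Finset.sum_congr rfl fun j _ => ?_
  have h2 : ∀ k, M j k * x j * x k * ((Fintype.card (Finset ι) : ℝ) * (if j = k then 0 else 1))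
      = Fintype.card (Finset ι) * (x j * (M j k * x k))
        - if j = k then Fintype.card (Finset ι) * (M j j * x j ^ 2) else 0 := by
    intro k
    by_cases h : j = k
    · subst h; simp; ring
    · simp [h]; ring
  simp only [h2, Finset.sum_sub_distrib, Finset.sum_ite_eq, Finset.mem_univ, if_true]
  rw [Matrix.mulVec, dotProduct, Finset.mul_sum, Finset.mul_sum]

/-- Jensen's inequality for the uniform average; it turns the decoupling identity into a bound on
exponential moments. -/
lemma eexp_average_le {κ : Type*} [Fintype κ] [Nonempty κ] {f : κ → ℝ} {y : ℝ}
    (h : ∑ i, f i = Fintype.card κ * y) :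
    eexp y ≤ (Fintype.card κ : ENNReal)⁻¹ * ∑ i, eexp (f i) := by
  have hc : (0 : ℝ) < Fintype.card κ := by exact_mod_cast Fintype.card_pos
  have h1 := convexOn_exp.map_sum_le (t := Finset.univ) (w := fun _ : κ => (Fintype.card κ : ℝ)⁻¹)
    (p := f) (fun _ _ => by positivity) (by simp [hc.ne']) (fun _ _ => Set.mem_univ _)
  simp only [smul_eq_mul, ← Finset.mul_sum] at h1
  rw [h, inv_mul_cancel_left₀ hc.ne'] at h1
  refine (ENNReal.ofReal_le_ofReal h1).trans_eq ?_
  rw [ENNReal.ofReal_mul (by positivity), ENNReal.ofReal_inv_of_pos hc, ENNReal.ofReal_natCast,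
    ENNReal.ofReal_sum_of_nonneg fun i _ => Real.exp_nonneg _]
  rfl

lemma lintegral_offDiag_le (hν : ∀ k, IsSubG (ν k) c) (hc : 0 < c) (M : Matrix ι ι ℝ) {s : ℝ}
    (hs : 32 * (c * (s * ‖M‖)) ^ 2 ≤ 1) :
    ∫⁻ x, eexp (s * (x ⬝ᵥ (M *ᵥ x) - ∑ k, M k k * x k ^ 2)) ∂Measure.pi ν
      ≤ eexp (16 * (c ^ 2 * s ^ 2 * frobNorm M ^ 2)) := by
  have h0 : (Fintype.card (Finset ι) : ENNReal) ≠ 0 := by simp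
  have hmeas : ∀ I : Finset ι,
      Measurable fun x : ι → ℝ => eexp (s * (4 * (x ⬝ᵥ (offBlock M I *ᵥ x)))) := fun I => by
    refine measurable_eexp.comp ?_
    simp only [dotProduct, Matrix.mulVec]
    fun_prop
  calc _ ≤ ∫⁻ x, (Fintype.card (Finset ι) : ENNReal)⁻¹
        * ∑ I : Finset ι, eexp (s * (4 * (x ⬝ᵥ (offBlock M I *ᵥ x)))) ∂Measure.pi ν := by
        refine lintegral_mono fun x => eexp_average_le ?_
        rw [← Finset.mul_sum, sum_offBlock]; ring
    _ = (Fintype.card (Finset ι) : ENNReal)⁻¹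
        * ∑ I : Finset ι, ∫⁻ x, eexp (s * (4 * (x ⬝ᵥ (offBlock M I *ᵥ x)))) ∂Measure.pi ν := by
        rw [lintegral_const_mul' _ _ (ENNReal.inv_ne_top.2 h0),
          lintegral_finsetSum _ fun I _ => hmeas I]
    _ ≤ (Fintype.card (Finset ι) : ENNReal)⁻¹
        * ∑ _I : Finset ι, eexp (16 * (c ^ 2 * s ^ 2 * frobNorm M ^ 2)) := by
        gcongr with I
        exact lintegral_offBlock_le hν hc M I hs
    _ = _ := by
        rw [Finset.sum_const, Finset.card_univ, nsmul_eq_mul, ← mul_assoc,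
          ENNReal.inv_mul_cancel h0 (ENNReal.natCast_ne_top _), one_mul]

/-- The Hanson-Wright inequality for exponential moments. -/
theorem lintegral_hansonWright (hν : ∀ k, IsSubG (ν k) c) (hc : 0 < c) (M : Matrix ι ι ℝ) {s : ℝ}
    (hs : 16 * (c * (|s| * ‖M‖)) ≤ 1) :
    ∫⁻ x, eexp (s * (x ⬝ᵥ (M *ᵥ x) - M.trace)) ∂Measure.pi ν
      ≤ eexp (2400 * (c ^ 2 * s ^ 2 * frobNorm M ^ 2)) := by
  set b := eexp (2400 * (c ^ 2 * s ^ 2 * frobNorm M ^ 2)) with hb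
  -- Diagonal and off-diagonal parts are dependent, so each is estimated at `2 s`; convexity of the
  -- exponential combines them below. The constant is `4 · 600`.
  have h1 := lintegral_diag_le hν hc M (s := 2 * s) (by
    rw [abs_mul, abs_two]; linarith)
  have h2 := lintegral_offDiag_le hν hc M (s := 2 * s) (by
    have e : 32 * (c * (2 * s * ‖M‖)) ^ 2 = 1 / 2 * (16 * (c * (|s| * ‖M‖))) ^ 2 := by
      have := sq_abs s
      linear_combination (-128) * c ^ 2 * ‖M‖ ^ 2 * this
    rw [e]
    have : (16 * (c * (|s| * ‖M‖))) ^ 2 ≤ 1 := pow_le_one₀ (by positivity) hs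
    linarith)
  have hF : 0 ≤ c ^ 2 * s ^ 2 * frobNorm M ^ 2 := by positivity
  have h1' := h1.trans (eexp_mono (show _ ≤ 2400 * (c ^ 2 * s ^ 2 * frobNorm M ^ 2) by
    rw [mul_pow]; linarith))
  have h2' := h2.trans (eexp_mono (show _ ≤ 2400 * (c ^ 2 * s ^ 2 * frobNorm M ^ 2) by
    rw [mul_pow]; linarith))
  have hm : ∀ f : (ι → ℝ) → ℝ, Measurable f → Measurable fun x => eexp (f x) := fun f hf =>
    measurable_eexp.comp hf
  have half : ∀ x : ι → ℝ, eexp (s * (x ⬝ᵥ (M *ᵥ x) - M.trace))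
      ≤ (Fintype.card Bool : ENNReal)⁻¹ * (eexp (2 * s * ∑ k, M k k * (x k ^ 2 - 1))
        + eexp (2 * s * (x ⬝ᵥ (M *ᵥ x) - ∑ k, M k k * x k ^ 2))) := by
    intro x
    have := eexp_average_le (κ := Bool) (y := s * (x ⬝ᵥ (M *ᵥ x) - M.trace))
      (f := fun i => if i then 2 * s * ∑ k, M k k * (x k ^ 2 - 1)
        else 2 * s * (x ⬝ᵥ (M *ᵥ x) - ∑ k, M k k * x k ^ 2)) (by
      simp [mul_sub, Finset.sum_sub_distrib, Matrix.trace]; ring)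
    simpa using this
  refine (lintegral_mono half).trans ?_
  rw [lintegral_const_mul' _ _ (by simp), lintegral_add_left (hm _ (by fun_prop))]
  calc _ ≤ (Fintype.card Bool : ENNReal)⁻¹ * (b + b) := by gcongr
    _ = b := by
      rw [← two_mul, ← mul_assoc]
      simp [ENNReal.inv_mul_cancel]

end HW

end CommonVAR

/-! ### Discretisation of operator norms. -/

namespace CommonVAR

open scoped Matrix.Norms.L2Operator

/-! ### Nets of the unit ball -/

section Net

variable {p : ℕ}

/-- A finite subset of the unit ball within distance `1/2` of every point of the ball. -/
structure IsHalfNet (N : Finset (Fin p → ℝ)) : Prop where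
  card_le : N.card ≤ 5 ^ p
  mem_ball : ∀ w ∈ N, w ⬝ᵥ w ≤ 1
  cover : ∀ v : Fin p → ℝ, v ⬝ᵥ v ≤ 1 → ∃ w ∈ N, (v - w) ⬝ᵥ (v - w) ≤ 1 / 4

/-- A subset of the ball with separation `1/2` and the largest possible cardinality is a net, since
an uncovered point could be added. Doubling it gives a `1`-separated set in the ball of radius `2`,
to which the `5 ^ p` packing bound applies. -/
lemma exists_isHalfNet (p : ℕ) : ∃ N : Finset (Fin p → ℝ), IsHalfNet N := by
  classical
  let sep : Finset (Fin p → ℝ) → Prop := fun s =>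
    (∀ w ∈ s, w ⬝ᵥ w ≤ 1) ∧ ∀ w ∈ s, ∀ w' ∈ s, w ≠ w' → 1 / 4 < (w - w') ⬝ᵥ (w - w')
  have hcard : ∀ s, sep s → s.card ≤ 5 ^ p := by
    intro s hs
    let f : (Fin p → ℝ) → EuclideanSpace ℝ (Fin p) := fun w => (2 : ℝ) • WithLp.toLp 2 w
    have hf : Function.Injective f := fun v w h => by
      have := smul_right_injective (EuclideanSpace ℝ (Fin p)) (two_ne_zero (α := ℝ)) h
      exact (WithLp.toLp_injective 2) this
    have h := Besicovitch.card_le_of_separated (E := EuclideanSpace ℝ (Fin p)) (s.image f) ?_ ?_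
    · rwa [Finset.card_image_of_injective _ hf, finrank_euclideanSpace_fin] at h
    · intro c hc
      obtain ⟨w, hw, rfl⟩ := Finset.mem_image.1 hc
      have h1 := hs.1 w hw
      rw [dot_self_eq_norm_sq] at h1
      have h2 : ‖WithLp.toLp 2 w‖ ≤ 1 := by nlinarith [norm_nonneg (WithLp.toLp 2 w)]
      simp only [f, norm_smul, Real.norm_ofNat]
      linarith
    · intro c hc c' hc' hne
      obtain ⟨w, hw, rfl⟩ := Finset.mem_image.1 hc
      obtain ⟨w', hw', rfl⟩ := Finset.mem_image.1 hc'
      have h1 := hs.2 w hw w' hw' fun h => hne (by rw [h])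
      rw [dot_self_eq_norm_sq] at h1
      simp only [f, ← smul_sub, norm_smul, Real.norm_ofNat, ← WithLp.toLp_sub]
      nlinarith [norm_nonneg (WithLp.toLp 2 (w - w'))]
  obtain ⟨N, hN, hmax⟩ : ∃ N, sep N ∧ ∀ s, sep s → s.card ≤ N.card := by
    have hne : {n | ∃ s, sep s ∧ s.card = n}.Nonempty := ⟨0, ∅, by simp [sep], rfl⟩
    have hbdd : BddAbove {n | ∃ s, sep s ∧ s.card = n} :=
      ⟨5 ^ p, by rintro _ ⟨s, hs, rfl⟩; exact hcard s hs⟩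
    obtain ⟨N, hN, hc⟩ := Nat.sSup_mem hne hbdd
    exact ⟨N, hN, fun s hs => hc ▸ le_csSup hbdd ⟨s, hs, rfl⟩⟩
  refine ⟨N, hcard N hN, hN.1, fun v hv => ?_⟩
  by_contra! hfar
  have hvN : v ∉ N := fun h => by
    have := hfar v h
    simp at this
    linarith
  have hs : sep (insert v N) := by
    refine ⟨fun w hw => ?_, fun w hw w' hw' hne => ?_⟩
    · rcases Finset.mem_insert.1 hw with rfl | h
      exacts [hv, hN.1 w h]
    · rcases Finset.mem_insert.1 hw with rfl | h <;> rcases Finset.mem_insert.1 hw' with rfl | h'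
      · exact absurd rfl hne
      · exact hfar w' h'
      · rw [← neg_sub, neg_dotProduct_neg]; exact hfar w h
      · exact hN.2 w h w' h' hne
  have := hmax _ hs
  rw [Finset.card_insert_of_notMem hvN] at this
  omega

lemma sqrt_dot_self_smul (a : ℝ) (x : Fin p → ℝ) : √((a • x) ⬝ᵥ (a • x)) = |a| * √(x ⬝ᵥ x) := by
  rw [smul_dotProduct, dotProduct_smul, smul_eq_mul, smul_eq_mul, ← mul_assoc, ← sq,
    Real.sqrt_mul (sq_nonneg a), Real.sqrt_sq_eq_abs]

/-- Replacing the direction of `x` by a net point loses at most half of `|x|`, which is absorbed on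
the left. -/
lemma IsHalfNet.sqrt_dot_le {N : Finset (Fin p → ℝ)} (hN : IsHalfNet N) {x : Fin p → ℝ} {c : ℝ}
    (h : ∀ w ∈ N, |w ⬝ᵥ x| ≤ c) : √(x ⬝ᵥ x) ≤ 2 * c := by
  have hx0 := dot_self_nonneg x
  rcases eq_or_lt_of_le hx0 with h0 | h0
  · obtain ⟨w, hw, -⟩ := hN.cover 0 (by simp)
    rw [← h0, Real.sqrt_zero]
    linarith [(abs_nonneg _).trans (h w hw)]
  · set s := √(x ⬝ᵥ x) with hs
    have hs0 : 0 < s := Real.sqrt_pos.2 h0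
    have hss : s * s = x ⬝ᵥ x := Real.mul_self_sqrt hx0
    have hu : (s⁻¹ • x) ⬝ᵥ (s⁻¹ • x) = 1 := by
      rw [smul_dotProduct, dotProduct_smul, smul_eq_mul, smul_eq_mul, ← hss]
      field_simp
    obtain ⟨w, hw, hd⟩ := hN.cover _ hu.le
    have h1 : s = w ⬝ᵥ x + (s⁻¹ • x - w) ⬝ᵥ x := by
      rw [← add_dotProduct, add_sub_cancel, smul_dotProduct, smul_eq_mul, ← hss]
      field_simp
    have h2 : |(s⁻¹ • x - w) ⬝ᵥ x| ≤ 1 / 2 * s := by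
      refine (abs_dot_le _ _).trans (mul_le_mul_of_nonneg_right ?_ hs0.le)
      rw [Real.sqrt_le_left (by norm_num)]
      linarith
    have h3 := h w hw
    have h4 := le_abs_self (w ⬝ᵥ x)
    have h5 := le_abs_self ((s⁻¹ • x - w) ⬝ᵥ x)
    linarith

/-- The operator norm of a matrix is controlled by its bilinear form on a net. -/
lemma IsHalfNet.opNorm_le {N : Finset (Fin p → ℝ)} (hN : IsHalfNet N)
    {B : Matrix (Fin p) (Fin p) ℝ} {c : ℝ} (h : ∀ w ∈ N, ∀ w' ∈ N, |w ⬝ᵥ B *ᵥ w'| ≤ c) :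
    ‖B‖ ≤ 4 * c := by
  have hc : 0 ≤ c := by
    obtain ⟨w, hw, -⟩ := hN.cover 0 (by simp)
    exact (abs_nonneg _).trans (h w hw w hw)
  have h1 : ∀ w' ∈ N, √((B *ᵥ w') ⬝ᵥ (B *ᵥ w')) ≤ 2 * c := fun w' hw' =>
    hN.sqrt_dot_le fun w hw => h w hw w' hw'
  -- Passing from the net to the ball costs `‖B‖ / 2`, again absorbed on the left.
  have h2 : ∀ v, v ⬝ᵥ v ≤ 1 → √((B *ᵥ v) ⬝ᵥ (B *ᵥ v)) ≤ 2 * c + ‖B‖ / 2 := by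
    intro v hv
    obtain ⟨w, hw, hd⟩ := hN.cover v hv
    refine Real.sqrt_le_iff.2 ⟨by positivity, ?_⟩
    have e : B *ᵥ v = B *ᵥ w + B *ᵥ (v - w) := by rw [← Matrix.mulVec_add, add_sub_cancel]
    have h3 := h1 w hw
    have h4 : √((B *ᵥ (v - w)) ⬝ᵥ (B *ᵥ (v - w))) ≤ ‖B‖ / 2 := by
      refine (sqrt_mulVec_dot_self_le B (v - w)).trans ?_
      have : √((v - w) ⬝ᵥ (v - w)) ≤ 1 / 2 := by
        rw [Real.sqrt_le_left (by norm_num)]; linarith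
      have := mul_le_mul_of_nonneg_left this (norm_nonneg B)
      linarith
    set x := B *ᵥ w
    set y := B *ᵥ (v - w)
    have h5 := (le_abs_self _).trans (abs_dot_le x y)
    have h6 := Real.mul_self_sqrt (dot_self_nonneg x)
    have h7 := Real.mul_self_sqrt (dot_self_nonneg y)
    rw [e, add_dotProduct, dotProduct_add, dotProduct_add, dotProduct_comm y x, ← h6, ← h7]
    have h8 := add_le_add h3 h4
    have h9 := pow_le_pow_left₀ (by positivity) h8 2
    linarith
  have h3 : ‖B‖ ≤ 2 * c + ‖B‖ / 2 := by
    refine opNorm_le_of_dot (by positivity) fun v => ?_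
    rcases eq_or_lt_of_le (dot_self_nonneg v) with h0 | h0
    · have := dotProduct_self_eq_zero.1 h0.symm
      simp [this]
    · set s := √(v ⬝ᵥ v)
      have hs0 : 0 < s := Real.sqrt_pos.2 h0
      have hss : s * s = v ⬝ᵥ v := Real.mul_self_sqrt h0.le
      have h4 := h2 (s⁻¹ • v) (by
        rw [smul_dotProduct, dotProduct_smul, smul_eq_mul, smul_eq_mul, ← hss]
        field_simp; rfl)
      rw [Matrix.mulVec_smul, sqrt_dot_self_smul, abs_of_pos (inv_pos.2 hs0),
        inv_mul_le_iff₀ hs0] at h4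
      rw [← hss, ← Real.mul_self_sqrt (dot_self_nonneg (B *ᵥ v))]
      have := mul_self_le_mul_self (Real.sqrt_nonneg _) h4
      linarith
  linarith

/-- A symmetric matrix is controlled by its quadratic form on sums and differences of points of a
net. -/
lemma IsHalfNet.opNorm_le_of_quadratic {N : Finset (Fin p → ℝ)} (hN : IsHalfNet N)
    {B : Matrix (Fin p) (Fin p) ℝ} (hB : Bᵀ = B) {c : ℝ}
    (h : ∀ w ∈ N, ∀ w' ∈ N, |(w + w') ⬝ᵥ B *ᵥ (w + w')| ≤ c ∧ |(w - w') ⬝ᵥ B *ᵥ (w - w')| ≤ c) :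
    ‖B‖ ≤ 2 * c := by
  -- Polarisation: a quarter of the difference of the two quadratic forms is the bilinear form,
  -- hence `c / 2`.
  have := hN.opNorm_le (B := B) (c := c / 2) fun w hw w' hw' => by
    obtain ⟨h1, h2⟩ := h w hw w' hw'
    have hs : w' ⬝ᵥ B *ᵥ w = w ⬝ᵥ B *ᵥ w' := by
      rw [Matrix.dotProduct_mulVec, ← Matrix.mulVec_transpose, hB, dotProduct_comm]
    rw [Matrix.mulVec_add, add_dotProduct, dotProduct_add, dotProduct_add, hs] at h1
    rw [Matrix.mulVec_sub, sub_dotProduct, dotProduct_sub, dotProduct_sub, hs] at h2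
    rw [abs_le] at h1 h2 ⊢
    constructor <;> linarith
  linarith

lemma dot_self_add_le {w w' : Fin p → ℝ} (h : w ⬝ᵥ w ≤ 1) (h' : w' ⬝ᵥ w' ≤ 1) :
    (w + w') ⬝ᵥ (w + w') ≤ 4 ∧ (w - w') ⬝ᵥ (w - w') ≤ 4 := by
  have e1 : (w + w') ⬝ᵥ (w + w') + (w - w') ⬝ᵥ (w - w') = 2 * (w ⬝ᵥ w) + 2 * (w' ⬝ᵥ w') := by
    simp only [add_dotProduct, dotProduct_add, sub_dotProduct, dotProduct_sub]
    ring
  have := dot_self_nonneg (w + w')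
  have := dot_self_nonneg (w - w')
  constructor <;> linarith

end Net

end CommonVAR

/-! ### Frequency-domain bounds for the autoregression. -/

namespace CommonVAR

open scoped Matrix.Norms.L2Operator

/-! ### Extreme eigenvalues of Hermitian matrices -/

section Rayleigh

variable {𝕜 : Type*} [RCLike 𝕜] {p : ℕ}

lemma normSq_unitary_mulVec {U : Matrix (Fin p) (Fin p) 𝕜} (hU : Uᴴ * U = 1) (x : Fin p → 𝕜) :
    ∑ i, ‖(U *ᵥ x) i‖ ^ 2 = ∑ i, ‖x i‖ ^ 2 := by
  have e : ∀ y : Fin p → 𝕜, ((∑ i, ‖y i‖ ^ 2 : ℝ) : 𝕜) = star y ⬝ᵥ y := fun y => by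
    push_cast
    exact Finset.sum_congr rfl fun i _ => (RCLike.conj_mul (y i)).symm
  have : ((∑ i, ‖(U *ᵥ x) i‖ ^ 2 : ℝ) : 𝕜) = ((∑ i, ‖x i‖ ^ 2 : ℝ) : 𝕜) := by
    rw [e, e, Matrix.star_mulVec, ← Matrix.dotProduct_mulVec, Matrix.mulVec_mulVec, hU,
      Matrix.one_mulVec]
  exact_mod_cast this

/-- The quadratic form of a Hermitian matrix in the coordinates of an eigenbasis. -/
lemma IsHermitian_quadratic {M : Matrix (Fin p) (Fin p) 𝕜} (hM : M.IsHermitian) (x : Fin p → 𝕜) :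
    ∃ y : Fin p → 𝕜, ∑ i, ‖y i‖ ^ 2 = ∑ i, ‖x i‖ ^ 2 ∧
      RCLike.re (star x ⬝ᵥ M *ᵥ x) = ∑ i, hM.eigenvalues i * ‖y i‖ ^ 2 := by
  let U : Matrix (Fin p) (Fin p) 𝕜 := hM.eigenvectorUnitary
  have h1 : Uᴴ * U = 1 := (Matrix.mem_unitaryGroup_iff').1 hM.eigenvectorUnitary.2
  have h2 : U * Uᴴ = 1 := (Matrix.mem_unitaryGroup_iff).1 hM.eigenvectorUnitary.2
  have h3 : M = U * Matrix.diagonal (RCLike.ofReal ∘ hM.eigenvalues) * Uᴴ := by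
    have := hM.spectral_theorem
    rw [Unitary.conjStarAlgAut_apply] at this
    exact this
  refine ⟨Uᴴ *ᵥ x, normSq_unitary_mulVec (by rw [Matrix.conjTranspose_conjTranspose, h2]) x, ?_⟩
  have h4 : star x ⬝ᵥ M *ᵥ x = ∑ i, (hM.eigenvalues i : 𝕜) * (‖(Uᴴ *ᵥ x) i‖ ^ 2 : 𝕜) := by
    conv_lhs => rw [h3]
    rw [← Matrix.mulVec_mulVec, ← Matrix.mulVec_mulVec, Matrix.dotProduct_mulVec]
    have : star x ᵥ* U = star (Uᴴ *ᵥ x) := by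
      rw [Matrix.star_mulVec, Matrix.conjTranspose_conjTranspose]
    rw [this]
    refine Finset.sum_congr rfl fun i _ => ?_
    rw [Matrix.mulVec_diagonal, ← RCLike.conj_mul]
    simp only [Pi.star_apply, Function.comp, RCLike.star_def]
    ring
  rw [h4, map_sum]
  refine Finset.sum_congr rfl fun i _ => ?_
  rw [← RCLike.ofReal_pow, ← RCLike.ofReal_mul, RCLike.ofReal_re]

variable {M : Matrix (Fin p) (Fin p) 𝕜}

lemma lamMin_le_eigenvalues (hM : M.IsHermitian) (i : Fin p) : lamMin M ≤ hM.eigenvalues i := by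
  rw [lamMin, hM.spectrum_real_eq_range_eigenvalues]
  exact csInf_le (Set.finite_range _).bddBelow ⟨i, rfl⟩

lemma eigenvalues_le_lamMax (hM : M.IsHermitian) (i : Fin p) : hM.eigenvalues i ≤ lamMax M := by
  rw [lamMax, hM.spectrum_real_eq_range_eigenvalues]
  exact le_csSup (Set.finite_range _).bddAbove ⟨i, rfl⟩

lemma lamMin_mul_le (hM : M.IsHermitian) (x : Fin p → 𝕜) :
    lamMin M * ∑ i, ‖x i‖ ^ 2 ≤ RCLike.re (star x ⬝ᵥ M *ᵥ x) := by
  obtain ⟨y, h1, h2⟩ := IsHermitian_quadratic hM x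
  rw [h2, ← h1, Finset.mul_sum]
  exact Finset.sum_le_sum fun i _ =>
    mul_le_mul_of_nonneg_right (lamMin_le_eigenvalues hM i) (sq_nonneg _)

lemma le_lamMax_mul (hM : M.IsHermitian) (x : Fin p → 𝕜) :
    RCLike.re (star x ⬝ᵥ M *ᵥ x) ≤ lamMax M * ∑ i, ‖x i‖ ^ 2 := by
  obtain ⟨y, h1, h2⟩ := IsHermitian_quadratic hM x
  rw [h2, ← h1, Finset.mul_sum]
  exact Finset.sum_le_sum fun i _ =>
    mul_le_mul_of_nonneg_right (eigenvalues_le_lamMax hM i) (sq_nonneg _)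

lemma exists_eigenvector (hM : M.IsHermitian) (i : Fin p) : ∃ x : Fin p → 𝕜,
    ∑ j, ‖x j‖ ^ 2 = 1 ∧ RCLike.re (star x ⬝ᵥ M *ᵥ x) = hM.eigenvalues i := by
  set v := hM.eigenvectorBasis i with hv
  have h1 : ‖v‖ = 1 := hM.eigenvectorBasis.orthonormal.1 i
  have h2 : ∑ j, ‖v.ofLp j‖ ^ 2 = 1 := by rw [← EuclideanSpace.norm_sq_eq, h1, one_pow]
  refine ⟨v.ofLp, h2, ?_⟩
  rw [hv, hM.mulVec_eigenvectorBasis, dotProduct_smul]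
  have e : star v.ofLp ⬝ᵥ v.ofLp = ((∑ j, ‖v.ofLp j‖ ^ 2 : ℝ) : 𝕜) := by
    push_cast
    exact Finset.sum_congr rfl fun i _ => RCLike.conj_mul (v.ofLp i)
  rw [← hv, e, h2]
  simp [RCLike.smul_re]

lemma le_lamMin (hp : 1 ≤ p) (hM : M.IsHermitian) {c : ℝ}
    (h : ∀ x : Fin p → 𝕜, c * ∑ i, ‖x i‖ ^ 2 ≤ RCLike.re (star x ⬝ᵥ M *ᵥ x)) : c ≤ lamMin M := by
  have : Nonempty (Fin p) := ⟨⟨0, hp⟩⟩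
  rw [lamMin, hM.spectrum_real_eq_range_eigenvalues]
  refine le_csInf (Set.range_nonempty _) ?_
  rintro _ ⟨i, rfl⟩
  obtain ⟨x, h1, h2⟩ := exists_eigenvector hM i
  have := h x
  rwa [h1, h2, mul_one] at this

lemma lamMax_le (hp : 1 ≤ p) (hM : M.IsHermitian) {c : ℝ}
    (h : ∀ x : Fin p → 𝕜, RCLike.re (star x ⬝ᵥ M *ᵥ x) ≤ c * ∑ i, ‖x i‖ ^ 2) : lamMax M ≤ c := by
  have : Nonempty (Fin p) := ⟨⟨0, hp⟩⟩
  rw [lamMax, hM.spectrum_real_eq_range_eigenvalues]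
  refine csSup_le (Set.range_nonempty _) ?_
  rintro _ ⟨i, rfl⟩
  obtain ⟨x, h1, h2⟩ := exists_eigenvector hM i
  have := h x
  rwa [h1, h2, mul_one] at this

lemma lamMin_le_lamMax (hp : 1 ≤ p) (hM : M.IsHermitian) : lamMin M ≤ lamMax M :=
  (lamMin_le_eigenvalues hM ⟨0, hp⟩).trans (eigenvalues_le_lamMax hM ⟨0, hp⟩)

lemma lamMin_pos (hp : 1 ≤ p) {M : Matrix (Fin p) (Fin p) ℝ} (hM : M.PosDef) : 0 < lamMin M := by
  have : Nonempty (Fin p) := ⟨⟨0, hp⟩⟩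
  rw [lamMin, hM.isHermitian.spectrum_real_eq_range_eigenvalues]
  obtain ⟨i, hi⟩ := (Set.range_nonempty hM.isHermitian.eigenvalues).csInf_mem (Set.finite_range _)
  rw [← hi]
  exact hM.eigenvalues_pos i

lemma isHermitian_gram (B : Matrix (Fin p) (Fin p) 𝕜) : (Bᴴ * B).IsHermitian :=
  Matrix.isHermitian_conjTranspose_mul_self B

lemma re_gram (B : Matrix (Fin p) (Fin p) 𝕜) (x : Fin p → 𝕜) :
    RCLike.re (star x ⬝ᵥ (Bᴴ * B) *ᵥ x) = ∑ i, ‖(B *ᵥ x) i‖ ^ 2 := by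
  have e : star x ⬝ᵥ (Bᴴ * B) *ᵥ x = ((∑ i, ‖(B *ᵥ x) i‖ ^ 2 : ℝ) : 𝕜) := by
    rw [← Matrix.mulVec_mulVec, Matrix.dotProduct_mulVec, ← Matrix.star_mulVec]
    push_cast
    exact Finset.sum_congr rfl fun i _ => RCLike.conj_mul ((B *ᵥ x) i)
  rw [e, RCLike.ofReal_re]

end Rayleigh

lemma real_quadratic_bounds {p : ℕ} {S : Matrix (Fin p) (Fin p) ℝ} (hS : S.IsHermitian)
    (x : Fin p → ℝ) :
    lamMin S * (x ⬝ᵥ x) ≤ x ⬝ᵥ S *ᵥ x ∧ x ⬝ᵥ S *ᵥ x ≤ lamMax S * (x ⬝ᵥ x) := by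
  have e : ∑ i, ‖x i‖ ^ 2 = x ⬝ᵥ x := Finset.sum_congr rfl fun i _ => by
    rw [Real.norm_eq_abs, sq_abs, sq]
  have h1 := lamMin_mul_le hS x
  have h2 := le_lamMax_mul hS x
  rw [e] at h1 h2
  exact ⟨by simpa using h1, by simpa using h2⟩

/-! ### The characteristic polynomial on the unit circle -/

section Char

variable {p : ℕ} {A : Matrix (Fin p) (Fin p) ℝ}

lemma sum_norm_sq_eq (x : Fin p → ℂ) : ∑ i, ‖x i‖ ^ 2 = ‖WithLp.toLp 2 x‖ ^ 2 :=
  (EuclideanSpace.norm_sq_eq (WithLp.toLp 2 x)).symm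

lemma norm_mulVec_le (B : Matrix (Fin p) (Fin p) ℂ) (x : Fin p → ℂ) :
    ‖WithLp.toLp 2 (B *ᵥ x)‖ ≤ ‖B‖ * ‖WithLp.toLp 2 x‖ :=
  Matrix.l2_opNorm_mulVec B (WithLp.toLp 2 x)

lemma lamMin_gram_nonneg (hp : 1 ≤ p) (B : Matrix (Fin p) (Fin p) ℂ) : 0 ≤ lamMin (Bᴴ * B) :=
  le_lamMin hp (isHermitian_gram B) fun x => by rw [re_gram, zero_mul]; positivity

lemma muMin_mul_le (hp : 1 ≤ p) (z : Circle) (x : Fin p → ℂ) :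
    muMin A * ∑ i, ‖x i‖ ^ 2 ≤ ∑ i, ‖(charPoly A z *ᵥ x) i‖ ^ 2 := by
  rw [← re_gram]
  refine le_trans (mul_le_mul_of_nonneg_right ?_ (by positivity)) (lamMin_mul_le (isHermitian_gram _) x)
  -- The family of smallest eigenvalues is bounded below by zero, which a real infimum needs to be a
  -- lower bound.
  exact ciInf_le ⟨0, by rintro _ ⟨w, rfl⟩; exact lamMin_gram_nonneg hp _⟩ z

lemma le_muMin (hp : 1 ≤ p) {c : ℝ} (h : ∀ (z : Circle) (x : Fin p → ℂ),
    c * ∑ i, ‖x i‖ ^ 2 ≤ ∑ i, ‖(charPoly A z *ᵥ x) i‖ ^ 2) : c ≤ muMin A :=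
  le_ciInf fun z => le_lamMin hp (isHermitian_gram _) fun x => by rw [re_gram]; exact h z x

/-- Without an upper bound the real supremum defining `muMax` would carry no information. -/
lemma bddAbove_lamMax (hp : 1 ≤ p) (A : Matrix (Fin p) (Fin p) ℝ) :
    BddAbove (Set.range fun z : Circle => lamMax ((charPoly A z)ᴴ * charPoly A z)) := by
  refine ⟨(‖(1 : Matrix (Fin p) (Fin p) ℂ)‖ + ‖A.map Complex.ofReal‖) ^ 2, ?_⟩
  rintro _ ⟨z, rfl⟩
  refine lamMax_le hp (isHermitian_gram _) fun x => ?_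
  rw [re_gram, sum_norm_sq_eq, sum_norm_sq_eq, ← mul_pow]
  refine pow_le_pow_left₀ (norm_nonneg _) ((norm_mulVec_le _ _).trans ?_) 2
  refine mul_le_mul_of_nonneg_right ?_ (norm_nonneg _)
  refine (norm_sub_le _ _).trans ?_
  rw [norm_smul, Circle.norm_coe, one_mul]

lemma le_muMax_mul (hp : 1 ≤ p) (z : Circle) (x : Fin p → ℂ) :
    ∑ i, ‖(charPoly A z *ᵥ x) i‖ ^ 2 ≤ muMax A * ∑ i, ‖x i‖ ^ 2 := by
  rw [← re_gram]
  refine (le_lamMax_mul (isHermitian_gram _) x).trans (mul_le_mul_of_nonneg_right ?_ (by positivity))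
  exact le_ciSup (bddAbove_lamMax hp A) z

lemma muMin_le_muMax (hp : 1 ≤ p) : muMin A ≤ muMax A := by
  have h : muMin A ≤ lamMin ((charPoly A (1 : Circle))ᴴ * charPoly A (1 : Circle)) :=
    ciInf_le ⟨0, by rintro _ ⟨w, rfl⟩; exact lamMin_gram_nonneg hp _⟩ (1 : Circle)
  exact (h.trans (lamMin_le_lamMax hp (isHermitian_gram _))).trans
    (le_ciSup (bddAbove_lamMax hp A) (1 : Circle))

/-- For a unit vector `x`, the parallelogram law at `z = ±1` gives `|x - A x|² + |x + A x|² ≥ 2`, so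
one of the two is at least `1`. -/
lemma one_le_muMax (hp : 1 ≤ p) : 1 ≤ muMax A := by
  let x : Fin p → ℂ := Pi.single ⟨0, hp⟩ 1
  have hx : ∑ i, ‖x i‖ ^ 2 = 1 := by
    rw [Finset.sum_eq_single ⟨0, hp⟩] <;> simp +contextual [x]
  have h1 := le_muMax_mul (A := A) hp 1 x
  have h2 := le_muMax_mul (A := A) hp (-1) x
  rw [hx, mul_one] at h1 h2
  set y := A.map Complex.ofReal *ᵥ x
  have e1 : charPoly A ((1 : Circle) : ℂ) *ᵥ x = x - y := by
    simp [charPoly, Matrix.sub_mulVec, y]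
  have e2 : charPoly A ((-1 : Circle) : ℂ) *ᵥ x = x + y := by
    simp [charPoly, Matrix.add_mulVec, y]
  rw [e1, sum_norm_sq_eq] at h1
  rw [e2, sum_norm_sq_eq] at h2
  rw [sum_norm_sq_eq] at hx
  have h3 := parallelogram_law_with_norm ℝ (WithLp.toLp 2 x) (WithLp.toLp 2 y)
  rw [← WithLp.toLp_add, ← WithLp.toLp_sub] at h3
  nlinarith [norm_nonneg (WithLp.toLp 2 y)]

/-- Gelfand's formula: eventually `‖Mⁿ‖ ≤ qⁿ` for some `q < 1` above the spectral radius. -/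
lemma tendsto_pow_complex (hA : spectralRadius ℂ (A.map Complex.ofReal) < 1) :
    Filter.Tendsto (fun n : ℕ => ‖(A.map Complex.ofReal) ^ n‖) Filter.atTop (nhds 0) := by
  set M := A.map Complex.ofReal
  obtain ⟨q, hq1, hq2⟩ := ENNReal.lt_iff_exists_nnreal_btwn.1 hA
  have hq : (q : ℝ) < 1 := by exact_mod_cast hq2
  have h1 := (spectrum.pow_nnnorm_pow_one_div_tendsto_nhds_spectralRadius M).eventually_lt_const hq1
  refine squeeze_zero' (Filter.Eventually.of_forall fun _ => norm_nonneg _) ?_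
    (tendsto_pow_atTop_nhds_zero_of_lt_one q.2 hq)
  filter_upwards [h1, Filter.eventually_gt_atTop 0] with n hn hn0
  have hn' : (n : ℝ) ≠ 0 := by exact_mod_cast hn0.ne'
  have h2 := ENNReal.rpow_le_rpow hn.le (show (0 : ℝ) ≤ n by positivity)
  rw [← ENNReal.rpow_mul, one_div_mul_cancel hn', ENNReal.rpow_one, ENNReal.rpow_natCast] at h2
  exact_mod_cast h2

lemma norm_apply_le (B : Matrix (Fin p) (Fin p) ℂ) (i j : Fin p) : ‖B i j‖ ≤ ‖B‖ := by
  have h1 := norm_mulVec_le B (Pi.single j 1)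
  have h2 : ‖WithLp.toLp 2 (Pi.single j 1 : Fin p → ℂ)‖ = 1 := by simp
  rw [h2, mul_one, Matrix.mulVec_single_one] at h1
  exact (PiLp.norm_apply_le (WithLp.toLp 2 (B.col j)) i).trans h1

lemma tendsto_pow_apply (hA : spectralRadius ℂ (A.map Complex.ofReal) < 1) (i j : Fin p) :
    Filter.Tendsto (fun n : ℕ => (A ^ n) i j) Filter.atTop (nhds 0) := by
  rw [tendsto_zero_iff_norm_tendsto_zero]
  refine squeeze_zero (fun _ => norm_nonneg _) (fun n => ?_) (tendsto_pow_complex hA)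
  have h := norm_apply_le ((A.map Complex.ofReal) ^ n) i j
  have e : (A.map Complex.ofReal) ^ n = (A ^ n).map Complex.ofReal :=
    (map_pow (Complex.ofRealHom.mapMatrix) A n).symm
  rw [e] at h ⊢
  simpa using h

/-- Once `‖Mⁿ‖ < 1/2`, the truncated Neumann series `Σ_{j<n} (z M)ʲ` inverts `I - z M` up to an
error at most one half, uniformly on the circle, so `|x| ≤ 2 c |𝒜(z) x|`. -/
lemma muMin_pos (hp : 1 ≤ p) (hA : spectralRadius ℂ (A.map Complex.ofReal) < 1) :
    0 < muMin A := by
  obtain ⟨n, hn⟩ := ((tendsto_pow_complex hA).eventually_lt_const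
    (show (0 : ℝ) < 1 / 2 by norm_num)).exists
  set M := A.map Complex.ofReal with hM
  set c := 1 + ∑ j ∈ Finset.range n, ‖M ^ j‖ with hc
  have hc0 : 0 < c := by positivity
  refine lt_of_lt_of_le (show 0 < (1 / (2 * c)) ^ 2 by positivity) (le_muMin hp fun z x => ?_)
  rw [sum_norm_sq_eq, sum_norm_sq_eq, ← mul_pow]
  refine pow_le_pow_left₀ (by positivity) ?_ 2
  rw [one_div, inv_mul_le_iff₀ (by positivity)]
  have h1 : (∑ j ∈ Finset.range n, ((z : ℂ) • M) ^ j) * charPoly A z + ((z : ℂ) • M) ^ n = 1 := by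
    rw [charPoly, ← hM, geom_sum_mul_neg, sub_add_cancel]
  have h2 : x = (∑ j ∈ Finset.range n, ((z : ℂ) • M) ^ j) *ᵥ (charPoly A z *ᵥ x)
      + (((z : ℂ) • M) ^ n) *ᵥ x := by
    rw [Matrix.mulVec_mulVec, ← Matrix.add_mulVec, h1, Matrix.one_mulVec]
  have h3 : ∀ j, ‖((z : ℂ) • M) ^ j‖ = ‖M ^ j‖ := fun j => by
    rw [smul_pow, norm_smul, norm_pow, Circle.norm_coe, one_pow, one_mul]
  have h4 : ‖∑ j ∈ Finset.range n, ((z : ℂ) • M) ^ j‖ ≤ c := by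
    refine (norm_sum_le _ _).trans ?_
    simp only [h3, hc]
    linarith
  have h5 : ‖WithLp.toLp 2 x‖ ≤ c * ‖WithLp.toLp 2 (charPoly A z *ᵥ x)‖
      + 1 / 2 * ‖WithLp.toLp 2 x‖ := by
    conv_lhs => rw [h2, WithLp.toLp_add]
    refine (norm_add_le _ _).trans (add_le_add ((norm_mulVec_le _ _).trans ?_)
      ((norm_mulVec_le _ _).trans ?_))
    · exact mul_le_mul_of_nonneg_right h4 (norm_nonneg _)
    · rw [h3]; exact mul_le_mul_of_nonneg_right hn.le (norm_nonneg _)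
  linarith

end Char

end CommonVAR

namespace CommonVAR

open scoped Matrix.Norms.L2Operator

section Parseval

variable {p : ℕ} {A : Matrix (Fin p) (Fin p) ℝ}

lemma parseval_polynomial (P : Polynomial ℂ) {n : ℕ} (hn : P.natDegree < n) :
    ∑ j ∈ Finset.range n, ‖P.coeff j‖ ^ 2
      = (2 * Real.pi)⁻¹ * ∫ t in (0 : ℝ)..2 * Real.pi, ‖P.eval (Circle.exp t : ℂ)‖ ^ 2 := by
  have h := P.sum_sq_norm_coeff_eq_circleAverage
  have h1 : ∑ j ∈ P.support, ‖P.coeff j‖ ^ 2 = ∑ j ∈ Finset.range n, ‖P.coeff j‖ ^ 2 := by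
    refine Finset.sum_subset (fun j hj => ?_) fun j _ hj => ?_
    · exact Finset.mem_range.2 (lt_of_le_of_lt (Polynomial.le_natDegree_of_mem_supp j hj) hn)
    · rw [Polynomial.notMem_support_iff.1 hj]; simp
  rw [← h1, h, Real.circleAverage, smul_eq_mul]
  simp [circleMap, Circle.coe_exp]

/-- The energy of a sequence of finite length is controlled by the energy of its innovations. -/
lemma muMin_mul_sum_le (hp : 1 ≤ p) {z : ℕ → Fin p → ℝ} {L : ℕ} (hz : ∀ j, L ≤ j → z j = 0) :
    muMin A * ∑ j ∈ Finset.range L, z j ⬝ᵥ z j ≤ z 0 ⬝ᵥ z 0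
      + ∑ j ∈ Finset.range L, (z (j + 1) - A *ᵥ z j) ⬝ᵥ (z (j + 1) - A *ᵥ z j) := by
  let P : Fin p → Polynomial ℂ := fun i =>
    ∑ j ∈ Finset.range L, Polynomial.monomial j ((z j i : ℝ) : ℂ)
  have hPc : ∀ i j, (P i).coeff j = ((z j i : ℝ) : ℂ) := fun i j => by
    simp only [P, Polynomial.finsetSum_coeff, Polynomial.coeff_monomial]
    rw [Finset.sum_ite_eq']
    split_ifs with h
    · rfl
    · rw [hz j (by simpa using h)]; simp
  -- `Q(w) = 𝒜(w) P(w)` for the generating polynomials: the coefficients of `Q` are `z 0` and the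
  -- innovations. Parseval reduces the claim to the pointwise inequality on the circle that defines
  -- `muMin`.
  let Q : Fin p → Polynomial ℂ := fun i =>
    P i - Polynomial.X * ∑ k, Polynomial.C ((A i k : ℝ) : ℂ) * P k
  have hQ0 : ∀ i, (Q i).coeff 0 = ((z 0 i : ℝ) : ℂ) := fun i => by
    simp [Q, hPc]
  have hQs : ∀ i j, (Q i).coeff (j + 1) = (((z (j + 1) - A *ᵥ z j) i : ℝ) : ℂ) := fun i j => by
    simp [Q, hPc, Polynomial.coeff_X_mul, Matrix.mulVec, dotProduct]
  have hdeg : ∀ (R : Polynomial ℂ) (n : ℕ), (∀ j, n < j → R.coeff j = 0) → R.natDegree < n + 1 :=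
    fun R n h => Nat.lt_succ_of_le (Polynomial.natDegree_le_iff_coeff_eq_zero.2 h)
  have hPd : ∀ i, (P i).natDegree < L + 1 := fun i => hdeg _ _ fun j hj => by
    rw [hPc, hz j hj.le]; simp
  have hQd : ∀ i, (Q i).natDegree < L + 1 := fun i => hdeg _ _ fun j hj => by
    obtain ⟨k, rfl⟩ : ∃ k, j = k + 1 := ⟨j - 1, by omega⟩
    rw [hQs, hz (k + 1) hj.le, hz k (by omega)]; simp
  have heval : ∀ (w : ℂ), (fun i => (Q i).eval w) = charPoly A w *ᵥ fun i => (P i).eval w := by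
    intro w
    funext i
    simp [Q, charPoly, Matrix.mulVec, dotProduct, Polynomial.eval_finsetSum]
    simp only [sub_mul, Finset.sum_sub_distrib, Finset.mul_sum, Matrix.one_apply, ite_mul, one_mul,
      zero_mul, Finset.sum_ite_eq, Finset.mem_univ, if_true, mul_assoc]
  have hcont : ∀ R : Polynomial ℂ, Continuous fun t : ℝ => ‖R.eval (Circle.exp t : ℂ)‖ ^ 2 :=
    fun R => by simp only [Circle.coe_exp]; fun_prop
  have hint : ∀ R : Fin p → Polynomial ℂ, (∀ i, (R i).natDegree < L + 1) →
      ∑ i, ∑ j ∈ Finset.range (L + 1), ‖(R i).coeff j‖ ^ 2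
        = (2 * Real.pi)⁻¹ * ∫ t in (0 : ℝ)..2 * Real.pi,
            ∑ i, ‖(R i).eval (Circle.exp t : ℂ)‖ ^ 2 := by
    intro R hR
    rw [intervalIntegral.integral_finsetSum fun i _ => (hcont (R i)).intervalIntegrable _ _,
      Finset.mul_sum]
    exact Finset.sum_congr rfl fun i _ => parseval_polynomial _ (hR i)
  have hP := hint P hPd
  have hQ := hint Q hQd
  have hle : muMin A * ∫ t in (0 : ℝ)..2 * Real.pi, ∑ i, ‖(P i).eval (Circle.exp t : ℂ)‖ ^ 2
      ≤ ∫ t in (0 : ℝ)..2 * Real.pi, ∑ i, ‖(Q i).eval (Circle.exp t : ℂ)‖ ^ 2 := by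
    rw [← intervalIntegral.integral_const_mul]
    refine intervalIntegral.integral_mono_on (by positivity) ?_ ?_ fun t _ => ?_
    · exact (continuous_const.mul (continuous_finsetSum _ fun i _ => hcont _)).intervalIntegrable _ _
    · exact (continuous_finsetSum _ fun i _ => hcont _).intervalIntegrable _ _
    · have := muMin_mul_le (A := A) hp (Circle.exp t) fun i => (P i).eval (Circle.exp t : ℂ)
      rwa [← heval] at this
  have hdot : ∀ x : Fin p → ℝ, ∑ i, ‖((x i : ℝ) : ℂ)‖ ^ 2 = x ⬝ᵥ x := fun x =>
    Finset.sum_congr rfl fun i _ => by rw [Complex.norm_real, Real.norm_eq_abs, sq_abs, sq]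
  have eP : ∑ i, ∑ j ∈ Finset.range (L + 1), ‖(P i).coeff j‖ ^ 2
      = ∑ j ∈ Finset.range L, z j ⬝ᵥ z j := by
    rw [Finset.sum_comm, Finset.sum_range_succ]
    simp only [hPc, hdot]
    rw [hz L le_rfl]
    simp
  have eQ : ∑ i, ∑ j ∈ Finset.range (L + 1), ‖(Q i).coeff j‖ ^ 2 = z 0 ⬝ᵥ z 0
      + ∑ j ∈ Finset.range L, (z (j + 1) - A *ᵥ z j) ⬝ᵥ (z (j + 1) - A *ᵥ z j) := by
    rw [Finset.sum_comm, Finset.sum_range_succ', add_comm]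
    simp only [hQ0, hQs, hdot]
  rw [← eP, ← eQ, hP, hQ]
  have := mul_le_mul_of_nonneg_left hle (show 0 ≤ (2 * Real.pi)⁻¹ by positivity)
  linarith

end Parseval

end CommonVAR

/-! ### Energy and concentration for the autoregression started from zero. -/

namespace CommonVAR

open scoped Matrix.Norms.L2Operator

/-! ### The autoregression started from zero -/

section Truncated

variable {p N : ℕ}

/-- The matrix selecting the innovation at time `j`. -/
def innov (N : ℕ) (j : ℕ) : Matrix (Fin p) (Fin N × Fin p) ℝ :=
  Matrix.of fun i k => if (k.1 : ℕ) = j ∧ i = k.2 then 1 else 0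

/-- The matrix expressing the state at time `j` of the autoregression started from zero in terms of
the innovations. -/
noncomputable def impulse (A Sh : Matrix (Fin p) (Fin p) ℝ) (N : ℕ) :
    ℕ → Matrix (Fin p) (Fin N × Fin p) ℝ
  | 0 => 0
  | j + 1 => A * impulse A Sh N j + Sh * innov N j

lemma innov_mulVec (j : ℕ) (hj : j < N) (x : Fin N × Fin p → ℝ) (i : Fin p) :
    (innov N j *ᵥ x) i = x (⟨j, hj⟩, i) := by
  rw [Matrix.mulVec, dotProduct, Finset.sum_eq_single (⟨j, hj⟩, i)]
  · simp [innov]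
  · rintro ⟨k, i'⟩ - hne
    have : ¬((k : ℕ) = j ∧ i = i') := fun h => hne (by
      ext
      · exact h.1
      · exact congrArg Fin.val h.2.symm)
    simp [innov, this]
  · simp

lemma innov_mulVec_of_le {j : ℕ} (hj : N ≤ j) (x : Fin N × Fin p → ℝ) : innov N j *ᵥ x = 0 := by
  funext i
  refine Finset.sum_eq_zero fun k _ => ?_
  have : ¬((k.1 : ℕ) = j ∧ i = k.2) := fun h => by have := k.1.2; omega
  simp [innov, this]

lemma impulse_succ_apply (A Sh : Matrix (Fin p) (Fin p) ℝ) (j : ℕ) (i : Fin p)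
    (k : Fin N × Fin p) : impulse A Sh N (j + 1) i k
      = ∑ i', A i i' * impulse A Sh N j i' k + ∑ i', Sh i i' * innov N j i' k := rfl

lemma impulse_apply_of_le (A Sh : Matrix (Fin p) (Fin p) ℝ) (j : ℕ) (i : Fin p)
    (k : Fin N × Fin p) (hk : j ≤ k.1) : impulse A Sh N j i k = 0 := by
  induction j generalizing i with
  | zero => rfl
  | succ j ih =>
    rw [impulse_succ_apply, Finset.sum_eq_zero fun i' _ => by rw [ih i' (by omega), mul_zero],
      Finset.sum_eq_zero fun i' _ => ?_, add_zero]
    have : ¬((k.1 : ℕ) = j ∧ i' = k.2) := fun h => by omega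
    simp [innov, this]

lemma impulse_succ_mulVec (A Sh : Matrix (Fin p) (Fin p) ℝ) (j : ℕ) (x : Fin N × Fin p → ℝ) :
    impulse A Sh N (j + 1) *ᵥ x = A *ᵥ (impulse A Sh N j *ᵥ x) + Sh *ᵥ (innov N j *ᵥ x) := by
  rw [impulse, Matrix.add_mulVec, Matrix.mulVec_mulVec, Matrix.mulVec_mulVec]
  rfl

lemma impulse_add_mulVec (A Sh : Matrix (Fin p) (Fin p) ℝ) (m : ℕ) (x : Fin N × Fin p → ℝ) :
    impulse A Sh N (N + m) *ᵥ x = A ^ m *ᵥ (impulse A Sh N N *ᵥ x) := by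
  induction m with
  | zero => simp
  | succ m ih =>
    rw [← add_assoc, impulse_succ_mulVec, ih, innov_mulVec_of_le (by omega), Matrix.mulVec_zero,
      add_zero, Matrix.mulVec_mulVec, ← pow_succ']

lemma sum_innov_dot (x : Fin N × Fin p → ℝ) {L : ℕ} (hL : N ≤ L) :
    ∑ j ∈ Finset.range L, (innov N j *ᵥ x) ⬝ᵥ (innov N j *ᵥ x) = x ⬝ᵥ x := by
  have h1 : ∑ j ∈ Finset.range L, (innov N j *ᵥ x) ⬝ᵥ (innov N j *ᵥ x)
      = ∑ j ∈ Finset.range N, (innov N j *ᵥ x) ⬝ᵥ (innov N j *ᵥ x) := by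
    refine (Finset.sum_subset (Finset.range_mono hL) fun j _ hj => ?_).symm
    rw [innov_mulVec_of_le (by simpa using hj)]
    simp
  rw [h1, Finset.sum_range, dotProduct, Fintype.sum_prod_type]
  refine Finset.sum_congr rfl fun k _ => Finset.sum_congr rfl fun i _ => ?_
  rw [innov_mulVec k k.2]

variable {A S Sh : Matrix (Fin p) (Fin p) ℝ}

lemma sqrt_mulVec_dot (hSh : Shᵀ = Sh) (hS : Sh * Sh = S) (v : Fin p → ℝ) :
    (Sh *ᵥ v) ⬝ᵥ (Sh *ᵥ v) = v ⬝ᵥ S *ᵥ v := by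
  rw [mulVec_dot_mulVec, hSh, hS]

/-- The energy of the autoregression is at most `lamMax S / muMin A` times that of the
innovations. -/
lemma energy_le (hp : 1 ≤ p) (hA : spectralRadius ℂ (A.map Complex.ofReal) < 1)
    (hSH : S.IsHermitian) (hSh : Shᵀ = Sh) (hS : Sh * Sh = S) (x : Fin N × Fin p → ℝ) (J : ℕ) :
    muMin A * ∑ j ∈ Finset.range J, (impulse A Sh N j *ᵥ x) ⬝ᵥ (impulse A Sh N j *ᵥ x)
      ≤ lamMax S * (x ⬝ᵥ x) := by
  set f : ℕ → Fin p → ℝ := fun j => impulse A Sh N j *ᵥ x with hf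
  have hμ := muMin_pos hp hA
  -- The path is cut off after time `L` to make it finite; the cut acts as one further innovation
  -- `-A f L`.
  have hfin : ∀ L, N ≤ L → muMin A * ∑ j ∈ Finset.range (L + 1), f j ⬝ᵥ f j
      ≤ lamMax S * (x ⬝ᵥ x) + (A *ᵥ f L) ⬝ᵥ (A *ᵥ f L) := by
    intro L hL
    let w : ℕ → Fin p → ℝ := fun j => if j < L + 1 then f j else 0
    have hw : ∀ j, j < L + 1 → w j = f j := fun j hj => if_pos hj
    have hw' : ∀ j, L + 1 ≤ j → w j = 0 := fun j hj => if_neg (by omega)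
    have h := muMin_mul_sum_le (A := A) hp (z := w) (L := L + 1) hw'
    have e1 : ∑ j ∈ Finset.range (L + 1), w j ⬝ᵥ w j = ∑ j ∈ Finset.range (L + 1), f j ⬝ᵥ f j :=
      Finset.sum_congr rfl fun j hj => by rw [hw j (Finset.mem_range.1 hj)]
    have e0 : w 0 = 0 := by rw [hw 0 (by omega), hf]; simp [impulse]
    rw [e1, e0, Finset.sum_range_succ (fun j => (w (j + 1) - A *ᵥ w j) ⬝ᵥ (w (j + 1) - A *ᵥ w j)),
      hw' (L + 1) le_rfl, hw L (by omega), zero_sub,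
      neg_dotProduct_neg, zero_dotProduct, zero_add] at h
    refine h.trans (add_le_add ?_ le_rfl)
    calc _ ≤ ∑ j ∈ Finset.range L, lamMax S * ((innov N j *ᵥ x) ⬝ᵥ (innov N j *ᵥ x)) := by
          refine Finset.sum_le_sum fun j hj => ?_
          have hj' := Finset.mem_range.1 hj
          rw [hw (j + 1) (by omega), hw j (by omega)]
          simp only [hf]
          rw [impulse_succ_mulVec, add_sub_cancel_left, sqrt_mulVec_dot hSh hS]
          exact (real_quadratic_bounds hSH _).2
      _ = _ := by rw [← Finset.mul_sum, sum_innov_dot x hL]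
  -- Once the innovations have ended, the path is a power of `A` applied to a fixed vector, so the
  -- cost of the cut vanishes as the cut moves to infinity.
  have hlim : Filter.Tendsto (fun m : ℕ => (A *ᵥ f (N + m)) ⬝ᵥ (A *ᵥ f (N + m))) Filter.atTop
      (nhds 0) := by
    have h1 : ∀ i, Filter.Tendsto (fun m : ℕ => (A *ᵥ f (N + m)) i) Filter.atTop (nhds 0) := by
      intro i
      have h2 : ∀ m, (A *ᵥ f (N + m)) i = ∑ k, (A ^ (m + 1)) i k * f N k := fun m => by
        simp only [hf]
        rw [impulse_add_mulVec, Matrix.mulVec_mulVec, ← pow_succ']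
        rfl
      simp only [h2]
      have h3 := tendsto_finsetSum (Finset.univ : Finset (Fin p)) fun k _ =>
        (((tendsto_pow_apply hA i k).comp (Filter.tendsto_add_atTop_nat 1)).mul_const (f N k))
      simpa using h3
    have h4 := tendsto_finsetSum (Finset.univ : Finset (Fin p)) fun i _ => (h1 i).mul (h1 i)
    simpa [dotProduct] using h4
  have hlim' := hlim.const_add (lamMax S * (x ⬝ᵥ x))
  rw [add_zero] at hlim'
  refine ge_of_tendsto hlim' ?_
  filter_upwards [Filter.eventually_ge_atTop J] with m hm
  refine le_trans ?_ (hfin (N + m) (by omega))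
  refine mul_le_mul_of_nonneg_left ?_ hμ.le
  exact Finset.sum_le_sum_of_subset_of_nonneg (Finset.range_mono (by omega))
    fun j _ _ => dot_self_nonneg _

variable (A Sh)

/-- The regressors built from the innovations `x`, observation starting at time `n`. -/
noncomputable def simX (n T : ℕ) (x : Fin (n + T) × Fin p → ℝ) : Matrix (Fin p) (Fin T) ℝ :=
  Matrix.of fun i t => (impulse A Sh (n + T) (n + t) *ᵥ x) i

/-- The responses built from the innovations `x`. -/
noncomputable def simY (n T : ℕ) (x : Fin (n + T) × Fin p → ℝ) : Matrix (Fin p) (Fin T) ℝ :=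
  Matrix.of fun i t => (impulse A Sh (n + T) (n + t + 1) *ᵥ x) i

/-- The matrix of the linear map taking the innovations to `Xᵀ v`. -/
noncomputable def simMap (n T : ℕ) (v : Fin p → ℝ) : Matrix (Fin T) (Fin (n + T) × Fin p) ℝ :=
  Matrix.of fun t k => (v ᵥ* impulse A Sh (n + T) (n + t)) k

/-- The expectation of the Gram matrix `X Xᵀ`. -/
noncomputable def simGram (n T : ℕ) : Matrix (Fin p) (Fin p) ℝ :=
  ∑ t : Fin T, impulse A Sh (n + T) (n + t) * (impulse A Sh (n + T) (n + t))ᵀ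

variable {A Sh} {n T : ℕ}

lemma simX_transpose_mulVec (x : Fin (n + T) × Fin p → ℝ) (v : Fin p → ℝ) :
    (simX A Sh n T x)ᵀ *ᵥ v = simMap A Sh n T v *ᵥ x := by
  funext t
  have : (simMap A Sh n T v *ᵥ x) t = (v ᵥ* impulse A Sh (n + T) (n + t)) ⬝ᵥ x := rfl
  rw [this, ← Matrix.dotProduct_mulVec, dotProduct_comm]
  rfl

lemma simX_transpose_mulVec_apply (x : Fin (n + T) × Fin p → ℝ) (v : Fin p → ℝ) (t : Fin T) :
    ((simX A Sh n T x)ᵀ *ᵥ v) t = v ⬝ᵥ (impulse A Sh (n + T) (n + t) *ᵥ x) := by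
  rw [dotProduct_comm]; rfl

lemma simMap_frobNorm_sq (v : Fin p → ℝ) :
    frobNorm (simMap A Sh n T v) ^ 2 = v ⬝ᵥ simGram A Sh n T *ᵥ v := by
  rw [frobNorm_sq_sum, simGram, Matrix.sum_mulVec, dotProduct_sum]
  refine Finset.sum_congr rfl fun t _ => ?_
  rw [← Matrix.mulVec_mulVec, Matrix.dotProduct_mulVec, Matrix.mulVec_transpose, dotProduct]
  exact Finset.sum_congr rfl fun k _ => sq _

lemma simGram_transpose : (simGram A Sh n T)ᵀ = simGram A Sh n T := by
  simp [simGram, Matrix.transpose_sum]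

/-- The energy bound controls the whole path at once, so the spectral norm of the map to `Xᵀ v` has
no factor `T`. This gives the deviations of the Gram matrix their order `√T`. -/
lemma simMap_opNorm_sq_le (hp : 1 ≤ p) (hA : spectralRadius ℂ (A.map Complex.ofReal) < 1)
    (hSH : S.IsHermitian) (hSh : Shᵀ = Sh) (hS : Sh * Sh = S) {q : ℝ} (hq0 : 0 ≤ q)
    (hq : lamMax S ≤ q * muMin A) (v : Fin p → ℝ) :
    ‖simMap A Sh n T v‖ ^ 2 ≤ q * (v ⬝ᵥ v) := by
  have hμ := muMin_pos hp hA
  have hqv : 0 ≤ q * (v ⬝ᵥ v) := mul_nonneg hq0 (dot_self_nonneg v)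
  have : ‖simMap A Sh n T v‖ ≤ √(q * (v ⬝ᵥ v)) := by
    refine opNorm_le_of_dot (Real.sqrt_nonneg _) fun x => ?_
    rw [Real.sq_sqrt hqv, ← simX_transpose_mulVec, dotProduct]
    simp only [simX_transpose_mulVec_apply]
    have h1 : ∀ y : Fin p → ℝ, (v ⬝ᵥ y) * (v ⬝ᵥ y) ≤ (v ⬝ᵥ v) * (y ⬝ᵥ y) := fun y => by
      have := pow_le_pow_left₀ (abs_nonneg _) (abs_dot_le v y) 2
      rwa [sq_abs, mul_pow, Real.sq_sqrt (dot_self_nonneg v), Real.sq_sqrt (dot_self_nonneg y),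
        sq] at this
    have h2 := energy_le (N := n + T) hp hA hSH hSh hS x (n + T)
    have h3 : ∑ j ∈ Finset.range (n + T), (impulse A Sh (n + T) j *ᵥ x)
        ⬝ᵥ (impulse A Sh (n + T) j *ᵥ x) ≤ q * (x ⬝ᵥ x) := by
      refine le_of_mul_le_mul_left (h2.trans ?_) hμ
      have := mul_le_mul_of_nonneg_right hq (dot_self_nonneg x)
      linarith
    calc _ ≤ ∑ t : Fin T, (v ⬝ᵥ v) * ((impulse A Sh (n + T) (n + t) *ᵥ x)
            ⬝ᵥ (impulse A Sh (n + T) (n + t) *ᵥ x)) := Finset.sum_le_sum fun t _ => h1 _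
      _ = (v ⬝ᵥ v) * ∑ t ∈ Finset.range T, (impulse A Sh (n + T) (n + t) *ᵥ x)
            ⬝ᵥ (impulse A Sh (n + T) (n + t) *ᵥ x) := by
          rw [← Finset.mul_sum, Finset.sum_range]
      _ ≤ (v ⬝ᵥ v) * ∑ j ∈ Finset.range (n + T), (impulse A Sh (n + T) j *ᵥ x)
            ⬝ᵥ (impulse A Sh (n + T) j *ᵥ x) := by
          refine mul_le_mul_of_nonneg_left ?_ (dot_self_nonneg v)
          rw [Finset.sum_range_add]
          have : 0 ≤ ∑ j ∈ Finset.range n, (impulse A Sh (n + T) j *ᵥ x)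
            ⬝ᵥ (impulse A Sh (n + T) j *ᵥ x) := Finset.sum_nonneg fun j _ => dot_self_nonneg _
          linarith
      _ ≤ (v ⬝ᵥ v) * (q * (x ⬝ᵥ x)) := mul_le_mul_of_nonneg_left h3 (dot_self_nonneg v)
      _ = _ := by ring
  calc _ ≤ √(q * (v ⬝ᵥ v)) ^ 2 := pow_le_pow_left₀ (norm_nonneg _) this 2
    _ = _ := Real.sq_sqrt hqv

lemma frobNorm_sq_le_card_mul {m k : Type*} [Fintype m] [Fintype k] [DecidableEq m] [DecidableEq k]
    (M : Matrix m k ℝ) : frobNorm M ^ 2 ≤ Fintype.card m * ‖M‖ ^ 2 := by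
  rw [← frobNorm_transpose, ← opNorm_transpose M]
  have h : ∀ j, ∑ i, Mᵀ i j ^ 2 ≤ ‖Mᵀ‖ ^ 2 := fun j => by
    have := mulVec_dot_self_le Mᵀ (Pi.single j 1)
    rw [Matrix.mulVec_single_one] at this
    simpa [dotProduct, sq, Pi.single_apply] using this
  rw [frobNorm_sq_sum, Finset.sum_comm]
  calc _ ≤ ∑ _j : m, ‖Mᵀ‖ ^ 2 := Finset.sum_le_sum fun j _ => h j
    _ = _ := by simp

/-- Each state contains the latest innovation with coefficient `Sh`, contributing `S` to its
covariance; earlier innovations only add to it. The condition `1 ≤ n` ensures that the first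
observed state already has one, with index `n + t - 1`. -/
lemma le_simGram (hn : 1 ≤ n) (hSH : S.IsHermitian) (hSh : Shᵀ = Sh) (hS : Sh * Sh = S)
    (v : Fin p → ℝ) : T * lamMin S * (v ⬝ᵥ v) ≤ v ⬝ᵥ simGram A Sh n T *ᵥ v := by
  rw [← simMap_frobNorm_sq, frobNorm_sq_sum]
  have h : ∀ t : Fin T, lamMin S * (v ⬝ᵥ v) ≤ ∑ k, simMap A Sh n T v t k ^ 2 := by
    intro t
    obtain ⟨j, hj⟩ : ∃ j, n + (t : ℕ) = j + 1 := ⟨n + t - 1, by omega⟩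
    have hjN : j < n + T := by have := t.2; omega
    have h1 : ∀ i, simMap A Sh n T v t (⟨j, hjN⟩, i) = (Sh *ᵥ v) i := by
      intro i
      have e1 : simMap A Sh n T v t (⟨j, hjN⟩, i)
          = ∑ i', v i' * impulse A Sh (n + T) (j + 1) i' (⟨j, hjN⟩, i) := by
        rw [← hj]; rfl
      have e2 : ∀ i', impulse A Sh (n + T) (j + 1) i' (⟨j, hjN⟩, i) = Sh i' i := by
        intro i'
        rw [impulse_succ_apply, Finset.sum_eq_zero fun i'' _ => by
          rw [impulse_apply_of_le _ _ j i'' (⟨j, hjN⟩, i) le_rfl, mul_zero]]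
        simp [innov]
      rw [e1]
      simp only [e2]
      refine Finset.sum_congr rfl fun i' _ => ?_
      have h2 : Sh i' i = Sh i i' := congrFun (congrFun hSh i) i'
      rw [h2]
      exact mul_comm _ _
    calc lamMin S * (v ⬝ᵥ v) ≤ (Sh *ᵥ v) ⬝ᵥ (Sh *ᵥ v) := by
          rw [sqrt_mulVec_dot hSh hS]; exact (real_quadratic_bounds hSH v).1
      _ = ∑ i, simMap A Sh n T v t (⟨j, hjN⟩, i) ^ 2 := by
          rw [dotProduct]
          exact Finset.sum_congr rfl fun i _ => by rw [h1, sq]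
      _ ≤ _ := by
          rw [Fintype.sum_prod_type]
          exact Finset.single_le_sum (f := fun k => ∑ i, simMap A Sh n T v t (k, i) ^ 2)
            (fun k _ => Finset.sum_nonneg fun i _ => sq_nonneg _) (Finset.mem_univ (⟨j, hjN⟩ : Fin (n + T)))
  calc _ = ∑ _t : Fin T, lamMin S * (v ⬝ᵥ v) := by simp [mul_assoc]
    _ ≤ _ := Finset.sum_le_sum fun t _ => h t

lemma simGram_le (hp : 1 ≤ p) (hA : spectralRadius ℂ (A.map Complex.ofReal) < 1)
    (hSH : S.IsHermitian) (hSh : Shᵀ = Sh) (hS : Sh * Sh = S) {q : ℝ} (hq0 : 0 ≤ q)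
    (hq : lamMax S ≤ q * muMin A) (v : Fin p → ℝ) :
    v ⬝ᵥ simGram A Sh n T *ᵥ v ≤ T * (q * (v ⬝ᵥ v)) := by
  rw [← simMap_frobNorm_sq]
  refine (frobNorm_sq_le_card_mul _).trans ?_
  rw [Fintype.card_fin]
  exact mul_le_mul_of_nonneg_left (simMap_opNorm_sq_le hp hA hSH hSh hS hq0 hq v) (by positivity)

end Truncated

end CommonVAR

namespace CommonVAR

open scoped Matrix.Norms.L2Operator

section Simulated

variable {p n T : ℕ} {A S Sh : Matrix (Fin p) (Fin p) ℝ} {c : ℝ}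
  {ν : Fin (n + T) × Fin p → Measure ℝ}

/-! ### Concentration of the Gram matrix -/

lemma measurable_dot_mulVec {m k : Type*} [Fintype m] [Fintype k] (a : m → ℝ) (M : Matrix m k ℝ) :
    Measurable fun x : k → ℝ => a ⬝ᵥ M *ᵥ x := by
  simp only [dotProduct, Matrix.mulVec]
  fun_prop

/-- The deviation is a centred quadratic form with matrix `Hᵀ H`, whose spectral norm is at most `4
q` and whose squared Frobenius norm is at most `16 T q²`; the Hanson-Wright bound applies to both
tails. The radius `2` accommodates sums and differences of net points. -/
lemma measure_gram_deviation_le (hp : 1 ≤ p) (hA : spectralRadius ℂ (A.map Complex.ofReal) < 1)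
    (hSH : S.IsHermitian) (hSh : Shᵀ = Sh) (hS : Sh * Sh = S) {q α : ℝ} (hα : 0 < α)
    (hαq : α ≤ q) (hq : lamMax S ≤ q * muMin A) (hν : ∀ k, IsSubG (ν k) c) (hc : 0 < c)
    (hc1 : 1 ≤ 4 * c) {v : Fin p → ℝ} (hv : v ⬝ᵥ v ≤ 4) :
    Measure.pi ν {x | T * α / 2 ≤ |((simX A Sh n T x)ᵀ *ᵥ v) ⬝ᵥ ((simX A Sh n T x)ᵀ *ᵥ v)
        - v ⬝ᵥ simGram A Sh n T *ᵥ v|}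
      ≤ 2 * eexp (-(T * α ^ 2 / (614400 * c ^ 2 * q ^ 2))) := by
  have hq0 : 0 < q := hα.trans_le hαq
  have := fun k => (hν k).prob
  set H := simMap A Sh n T v with hH
  have hop : ‖H‖ ^ 2 ≤ 4 * q := by
    have := simMap_opNorm_sq_le (n := n) (T := T) hp hA hSH hSh hS hq0.le hq v
    nlinarith
  have hfr : frobNorm H ^ 2 ≤ T * (4 * q) := by
    rw [hH, simMap_frobNorm_sq]
    refine (simGram_le hp hA hSH hSh hS hq0.le hq v).trans ?_
    have : q * (v ⬝ᵥ v) ≤ 4 * q := by nlinarith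
    exact mul_le_mul_of_nonneg_left this (Nat.cast_nonneg T)
  have hMn : ‖Hᵀ * H‖ ≤ 4 * q := by
    refine (Matrix.l2_opNorm_mul _ _).trans ?_
    rw [opNorm_transpose, ← sq]; exact hop
  have hMf : frobNorm (Hᵀ * H) ^ 2 ≤ 16 * (T * q ^ 2) := by
    have h1 := frobNorm_mul_le Hᵀ H
    rw [opNorm_transpose] at h1
    calc _ ≤ (‖H‖ * frobNorm H) ^ 2 := pow_le_pow_left₀ (frobNorm_nonneg _) h1 2
      _ = ‖H‖ ^ 2 * frobNorm H ^ 2 := mul_pow _ _ _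
      _ ≤ (4 * q) * (T * (4 * q)) := mul_le_mul hop hfr (sq_nonneg _) (by positivity)
      _ = _ := by ring
  have hid : ∀ x : Fin (n + T) × Fin p → ℝ, ((simX A Sh n T x)ᵀ *ᵥ v) ⬝ᵥ ((simX A Sh n T x)ᵀ *ᵥ v)
      - v ⬝ᵥ simGram A Sh n T *ᵥ v = x ⬝ᵥ ((Hᵀ * H) *ᵥ x) - (Hᵀ * H).trace := fun x => by
    rw [simX_transpose_mulVec, ← hH, mulVec_dot_mulVec, ← simMap_frobNorm_sq, ← hH, frobNorm_sq]
  simp only [hid]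
  -- The minimiser of `38400 c² q² T s² - s T α / 2`, where `38400 = 2400 · 16`. It is admissible
  -- because `α ≤ q` and `4 c ≥ 1`.
  set s := α / (153600 * (c ^ 2 * q ^ 2)) with hs
  have hs0 : 0 < s := by positivity
  have hsmall : 16 * (c * (s * ‖Hᵀ * H‖)) ≤ 1 := by
    have h1 : 16 * (c * (s * ‖Hᵀ * H‖)) ≤ 16 * (c * (s * (4 * q))) := by gcongr
    have h2 : 16 * (c * (s * (4 * q))) = α / (2400 * (c * q)) := by
      rw [hs]; field_simp; norm_num
    rw [h2] at h1
    refine h1.trans ((div_le_one (by positivity)).2 ?_)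
    nlinarith
  have hexp : 2400 * (c ^ 2 * s ^ 2 * frobNorm (Hᵀ * H) ^ 2) - s * (T * α / 2)
      ≤ -(T * α ^ 2 / (614400 * c ^ 2 * q ^ 2)) := by
    have h1 : 2400 * (c ^ 2 * s ^ 2 * frobNorm (Hᵀ * H) ^ 2)
        ≤ 2400 * (c ^ 2 * s ^ 2 * (16 * (T * q ^ 2))) := by gcongr
    have h2 : 2400 * (c ^ 2 * s ^ 2 * (16 * (T * q ^ 2))) - s * (T * α / 2)
        = -(T * α ^ 2 / (614400 * c ^ 2 * q ^ 2)) := by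
      rw [hs]; field_simp; ring
    linarith
  have hmeas : Measurable fun x : Fin (n + T) × Fin p → ℝ =>
      x ⬝ᵥ ((Hᵀ * H) *ᵥ x) - (Hᵀ * H).trace := by
    simp only [dotProduct, Matrix.mulVec]
    fun_prop
  have tail : ∀ e : ℝ, |e| = 1 → Measure.pi ν {x | T * α / 2
      ≤ e * (x ⬝ᵥ ((Hᵀ * H) *ᵥ x) - (Hᵀ * H).trace)}
        ≤ eexp (-(T * α ^ 2 / (614400 * c ^ 2 * q ^ 2))) := by
    intro e he
    have h1 := lintegral_hansonWright hν hc (Hᵀ * H) (s := s * e) (by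
      rw [abs_mul, he, mul_one, abs_of_pos hs0]; exact hsmall)
    have he2 : e ^ 2 = 1 := by rw [← sq_abs, he, one_pow]
    rw [mul_pow s e, he2, mul_one] at h1
    refine (measure_le_of_eexp (hmeas.const_mul e) hs0 (b := 2400 * (c ^ 2 * s ^ 2
      * frobNorm (Hᵀ * H) ^ 2)) ?_).trans (eexp_mono hexp)
    simpa only [mul_assoc] using h1
  refine (measure_mono (t := {x | T * α / 2 ≤ 1 * (x ⬝ᵥ ((Hᵀ * H) *ᵥ x) - (Hᵀ * H).trace)}
    ∪ {x | T * α / 2 ≤ (-1) * (x ⬝ᵥ ((Hᵀ * H) *ᵥ x) - (Hᵀ * H).trace)}) ?_).trans ?_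
  · intro x hx
    rcases le_abs.1 (show T * α / 2 ≤ |_| from hx) with h | h
    · left; simpa using h
    · right; simpa using h
  · refine (measure_union_le _ _).trans ?_
    rw [two_mul]
    exact add_le_add (tail 1 (by simp)) (tail (-1) (by simp))

/-! ### Concentration of the noise term -/

lemma simY_sub_apply (x : Fin (n + T) × Fin p → ℝ) :
    simY A Sh n T x - A * simX A Sh n T x
      = Matrix.of fun i (t : Fin T) => (Sh *ᵥ (innov (n + T) (n + t) *ᵥ x)) i := by
  ext i t
  have h : (A * simX A Sh n T x) i t = (A *ᵥ (impulse A Sh (n + T) (n + t) *ᵥ x)) i := rfl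
  rw [Matrix.sub_apply, h]
  simp only [simY, Matrix.of_apply]
  rw [impulse_succ_mulVec, Pi.add_apply, add_sub_cancel_left]

lemma noise_bilinear (hSh : Shᵀ = Sh) (x : Fin (n + T) × Fin p → ℝ) (u v : Fin p → ℝ) :
    u ⬝ᵥ (((simY A Sh n T x - A * simX A Sh n T x) * (simX A Sh n T x)ᵀ) *ᵥ v)
      = ∑ t ∈ Finset.range T, ((Sh *ᵥ u) ⬝ᵥ (innov (n + T) (n + t) *ᵥ x))
        * (v ⬝ᵥ (impulse A Sh (n + T) (n + t) *ᵥ x)) := by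
  rw [← Matrix.mulVec_mulVec, Matrix.dotProduct_mulVec, dotProduct, Finset.sum_range]
  refine Finset.sum_congr rfl fun t _ => ?_
  rw [simX_transpose_mulVec_apply, simY_sub_apply]
  congr 1
  have : (u ᵥ* Matrix.of fun i (t : Fin T) => (Sh *ᵥ (innov (n + T) (n + t) *ᵥ x)) i) t
      = u ⬝ᵥ (Sh *ᵥ (innov (n + T) (n + t) *ᵥ x)) := rfl
  rw [this, Matrix.dotProduct_mulVec, ← Matrix.mulVec_transpose, hSh]

/-- The exponent of the exponential supermartingale of the noise term. -/
noncomputable def noiseExponent (A Sh : Matrix (Fin p) (Fin p) ℝ) (n T : ℕ) (c lam : ℝ)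
    (a v : Fin p → ℝ) (m : ℕ) (x : Fin (n + T) × Fin p → ℝ) : ℝ :=
  ∑ t ∈ Finset.range m, (lam * ((a ⬝ᵥ (innov (n + T) (n + t) *ᵥ x))
      * (v ⬝ᵥ (impulse A Sh (n + T) (n + t) *ᵥ x)))
    - c * lam ^ 2 / 2 * (a ⬝ᵥ a) * (v ⬝ᵥ (impulse A Sh (n + T) (n + t) *ᵥ x)) ^ 2)

lemma measurable_noiseExponent (lam : ℝ) (a v : Fin p → ℝ) (m : ℕ) :
    Measurable (noiseExponent A Sh n T c lam a v m) := by
  unfold noiseExponent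
  refine Finset.measurable_fun_sum _ fun t _ => ?_
  exact (((measurable_dot_mulVec _ _).mul (measurable_dot_mulVec _ _)).const_mul _).sub
    (((measurable_dot_mulVec _ _).pow_const 2).const_mul _)

/-- The supermartingale property without conditional expectations: integrating the innovation at
time `n + m` first, with all others frozen, its sub-Gaussian bound cancels the compensator of that
time. -/
lemma lintegral_noiseExponent_le (hν : ∀ k, IsSubG (ν k) c) (lam : ℝ)
    (a v : Fin p → ℝ) (m : ℕ) (hm : m ≤ T) :
    ∫⁻ x, eexp (noiseExponent A Sh n T c lam a v m x) ∂Measure.pi ν ≤ 1 := by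
  have := fun k => (hν k).prob
  induction m with
  | zero => simp [noiseExponent, eexp_zero]
  | succ m ih =>
    refine le_trans ?_ (ih (by omega))
    have hmeas : Measurable fun x => eexp (noiseExponent A Sh n T c lam a v (m + 1) x) :=
      measurable_eexp.comp (measurable_noiseExponent lam a v (m + 1))
    rw [lintegral_pi_piecewise (fun k : Fin (n + T) × Fin p => (k.1 : ℕ) = n + m) hmeas]
    refine lintegral_mono fun y => ?_
    set d := v ⬝ᵥ (impulse A Sh (n + T) (n + m) *ᵥ y) with hd
    let pw : (Fin (n + T) × Fin p → ℝ) → Fin (n + T) × Fin p → ℝ :=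
      fun x k => if (k.1 : ℕ) = n + m then x k else y k
    have hnm : n + m < n + T := by omega
    have e1 : ∀ x, ∀ t ≤ m, impulse A Sh (n + T) (n + t) *ᵥ pw x
        = impulse A Sh (n + T) (n + t) *ᵥ y := by
      intro x t ht
      funext i
      refine Finset.sum_congr rfl fun k _ => ?_
      by_cases hk : (k.1 : ℕ) = n + m
      · have : impulse A Sh (n + T) (n + t) i k = 0 := impulse_apply_of_le _ _ _ _ _ (by omega)
        change impulse A Sh (n + T) (n + t) i k * _ = impulse A Sh (n + T) (n + t) i k * _
        rw [this]; simp
      · simp [pw, hk]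
    have e2 : ∀ x, ∀ t < m, innov (n + T) (n + t) *ᵥ pw x = innov (n + T) (n + t) *ᵥ y := by
      intro x t ht
      funext i
      rw [innov_mulVec _ (by omega), innov_mulVec _ (by omega)]
      simp [pw, ht.ne]
    have e3 : ∀ x, innov (n + T) (n + m) *ᵥ pw x = innov (n + T) (n + m) *ᵥ x := by
      intro x
      funext i
      rw [innov_mulVec _ hnm, innov_mulVec _ hnm]
      simp [pw]
    have key : ∀ x, noiseExponent A Sh n T c lam a v (m + 1) (pw x)
        = (noiseExponent A Sh n T c lam a v m y - c * lam ^ 2 / 2 * (a ⬝ᵥ a) * d ^ 2)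
          + ((lam * d) • (a ᵥ* innov (n + T) (n + m))) ⬝ᵥ x := by
      intro x
      rw [noiseExponent, Finset.sum_range_succ, e1 x m le_rfl, e3, ← hd, smul_dotProduct,
        ← Matrix.dotProduct_mulVec, smul_eq_mul]
      have : ∑ t ∈ Finset.range m, (lam * ((a ⬝ᵥ (innov (n + T) (n + t) *ᵥ pw x))
          * (v ⬝ᵥ (impulse A Sh (n + T) (n + t) *ᵥ pw x)))
          - c * lam ^ 2 / 2 * (a ⬝ᵥ a) * (v ⬝ᵥ (impulse A Sh (n + T) (n + t) *ᵥ pw x)) ^ 2)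
          = noiseExponent A Sh n T c lam a v m y := by
        refine Finset.sum_congr rfl fun t ht => ?_
        have ht' := Finset.mem_range.1 ht
        rw [e1 x t ht'.le, e2 x t ht']
      rw [this]
      ring
    have hnorm : (a ᵥ* innov (n + T) (n + m)) ⬝ᵥ (a ᵥ* innov (n + T) (n + m)) = a ⬝ᵥ a := by
      have h1 : ∀ k : Fin (n + T) × Fin p, (a ᵥ* innov (n + T) (n + m)) k
          = if (k.1 : ℕ) = n + m then a k.2 else 0 := by
        intro k
        by_cases hk : (k.1 : ℕ) = n + m
        · simp [Matrix.vecMul, dotProduct, innov, hk]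
        · simp [Matrix.vecMul, dotProduct, innov, hk]
      rw [dotProduct, Fintype.sum_prod_type, Finset.sum_eq_single (⟨n + m, hnm⟩ : Fin (n + T))]
      · simp [h1, dotProduct]
      · intro k _ hk
        have : ¬((k : ℕ) = n + m) := fun h => hk (Fin.ext h)
        simp [h1, this]
      · simp
    change ∫⁻ x, eexp (noiseExponent A Sh n T c lam a v (m + 1) (pw x)) ∂Measure.pi ν ≤ _
    simp only [key, eexp_add _ (_ ⬝ᵥ _)]
    rw [lintegral_const_mul' _ _ (eexp_ne_top _)]
    refine (mul_le_mul_right (lintegral_pi_eexp_linear (fun k => (hν k).mgf) _) _).trans ?_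
    rw [← eexp_add, smul_dotProduct, dotProduct_smul, hnorm, smul_eq_mul, smul_eq_mul]
    refine eexp_mono (le_of_eq ?_)
    ring

/-- Deviation bound for the noise term in a fixed pair of directions. -/
lemma measure_noise_le (hSH : S.IsHermitian) (hSh : Shᵀ = Sh) (hS : Sh * Sh = S)
    (hlam : 0 < lamMax S) (hν : ∀ k, IsSubG (ν k) c) (hc : 0 < c) {u v : Fin p → ℝ}
    (hu : u ⬝ᵥ u ≤ 1) {y : ℝ} (hy : 0 < y) :
    Measure.pi ν {x | ((simX A Sh n T x)ᵀ *ᵥ v) ⬝ᵥ ((simX A Sh n T x)ᵀ *ᵥ v) ≤ 3 / 2 ∧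
      2 * √(c * lamMax S * y) ≤ |u ⬝ᵥ (((simY A Sh n T x - A * simX A Sh n T x)
        * (simX A Sh n T x)ᵀ) *ᵥ v)|} ≤ 2 * eexp (-y) := by
  have := fun k => (hν k).prob
  have hpos : 0 < c * lamMax S := by positivity
  set w := √(c * lamMax S * y) with hw
  have hw0 : 0 < w := Real.sqrt_pos.2 (by positivity)
  have hww : w * w = c * lamMax S * y := Real.mul_self_sqrt (by positivity)
  -- Chosen so that `lam * w = y` and `c * lamMax S * lam² = y`. On the event the exponent is then
  -- at least `2 y - (3/4) y ≥ y`.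
  set lam := w / (c * lamMax S) with hlamdef
  have hlam0 : 0 < lam := by positivity
  have hlw : lam * w = y := by rw [hlamdef, div_mul_eq_mul_div, hww]; field_simp
  have hl2 : c * lamMax S * lam ^ 2 = y := by
    rw [hlamdef, div_pow, sq w, hww]; field_simp
  have haa : (Sh *ᵥ u) ⬝ᵥ (Sh *ᵥ u) ≤ lamMax S := by
    rw [sqrt_mulVec_dot hSh hS]
    refine (real_quadratic_bounds hSH u).2.trans ?_
    nlinarith
  have tail : ∀ e : ℝ, e ^ 2 = 1 → Measure.pi ν {x | y
      ≤ noiseExponent A Sh n T c (e * lam) (Sh *ᵥ u) v T x} ≤ eexp (-y) := by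
    intro e he
    have h := measure_le_of_eexp (μ := Measure.pi ν) (a := y) (b := 0)
      (measurable_noiseExponent (A := A) (Sh := Sh) (n := n) (T := T) (c := c) (e * lam)
        (Sh *ᵥ u) v T) one_pos (by
      simp only [one_mul, eexp_zero]
      exact lintegral_noiseExponent_le hν _ _ _ T le_rfl)
    simpa using h
  refine (measure_mono (t := {x | y ≤ noiseExponent A Sh n T c (1 * lam) (Sh *ᵥ u) v T x}
    ∪ {x | y ≤ noiseExponent A Sh n T c ((-1) * lam) (Sh *ᵥ u) v T x}) ?_).trans ?_
  · rintro x ⟨hx1, hx2⟩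
    have hexp : ∀ e : ℝ, e ^ 2 = 1 → noiseExponent A Sh n T c (e * lam) (Sh *ᵥ u) v T x
        = lam * (e * u ⬝ᵥ (((simY A Sh n T x - A * simX A Sh n T x) * (simX A Sh n T x)ᵀ) *ᵥ v))
          - c * lam ^ 2 / 2 * ((Sh *ᵥ u) ⬝ᵥ (Sh *ᵥ u))
            * (((simX A Sh n T x)ᵀ *ᵥ v) ⬝ᵥ ((simX A Sh n T x)ᵀ *ᵥ v)) := by
      intro e he
      rw [noiseExponent, Finset.sum_sub_distrib, ← Finset.mul_sum, ← Finset.mul_sum,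
        noise_bilinear hSh, mul_pow, he]
      have h2 : ((simX A Sh n T x)ᵀ *ᵥ v) ⬝ᵥ ((simX A Sh n T x)ᵀ *ᵥ v)
          = ∑ t ∈ Finset.range T, (v ⬝ᵥ (impulse A Sh (n + T) (n + t) *ᵥ x)) ^ 2 := by
        rw [Finset.sum_range, dotProduct]
        refine Finset.sum_congr rfl fun t _ => ?_
        rw [simX_transpose_mulVec_apply, sq]
      rw [h2]
      ring
    have hquad : c * lam ^ 2 / 2 * ((Sh *ᵥ u) ⬝ᵥ (Sh *ᵥ u))
        * (((simX A Sh n T x)ᵀ *ᵥ v) ⬝ᵥ ((simX A Sh n T x)ᵀ *ᵥ v)) ≤ 3 / 4 * y := by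
      calc _ ≤ c * lam ^ 2 / 2 * lamMax S * (3 / 2) := by
            refine mul_le_mul ?_ hx1 (dot_self_nonneg _) (by positivity)
            exact mul_le_mul_of_nonneg_left haa (by positivity)
        _ = 3 / 4 * (c * lamMax S * lam ^ 2) := by ring
        _ = _ := by rw [hl2]
    rcases le_abs.1 hx2 with h | h
    · left
      change y ≤ _
      rw [hexp 1 (by norm_num), one_mul]
      have := mul_le_mul_of_nonneg_left h hlam0.le
      linarith
    · right
      change y ≤ _
      rw [hexp (-1) (by norm_num), neg_one_mul]
      have := mul_le_mul_of_nonneg_left h hlam0.le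
      linarith
  · refine (measure_union_le _ _).trans ?_
    rw [two_mul]
    exact add_le_add (tail 1 (by norm_num)) (tail (-1) (by norm_num))

end Simulated

end CommonVAR

namespace CommonVAR

open scoped Matrix.Norms.L2Operator

/-! ### The simulated sample is good with high probability -/

/-- `R` is a square root of `G` up to rotation and `F` its inverse. Working with `F w` turns a net
of Euclidean directions into one adapted to the expected Gram matrix. -/
lemma exists_whitening {p : ℕ} {G : Matrix (Fin p) (Fin p) ℝ} (hG : Gᵀ = G)
    (hpos : ∀ v, 0 < v ⬝ᵥ v → 0 < v ⬝ᵥ G *ᵥ v) :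
    ∃ F R : Matrix (Fin p) (Fin p) ℝ, F * R = 1 ∧ R * F = 1 ∧
      ∀ v, (R *ᵥ v) ⬝ᵥ (R *ᵥ v) = v ⬝ᵥ G *ᵥ v := by
  obtain ⟨Q, l, hQ, hM⟩ := exists_diagonalization hG
  have hQ' : Q * Qᵀ = 1 := mul_eq_one_comm.1 hQ
  have hl : ∀ i, 0 < l i := by
    intro i
    have h1 := hpos (Q *ᵥ Pi.single i 1) (by
      rw [mulVec_dot_mulVec, hQ, Matrix.one_mulVec]; simp)
    have h2 : Qᵀ *ᵥ (G *ᵥ (Q *ᵥ Pi.single i 1)) = Matrix.diagonal l *ᵥ Pi.single i 1 := by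
      rw [hM]
      simp only [Matrix.mulVec_mulVec, Matrix.mul_assoc]
      rw [hQ, ← Matrix.mul_assoc, hQ]
      simp
    have h3 : (Q *ᵥ Pi.single i 1) ⬝ᵥ G *ᵥ (Q *ᵥ Pi.single i 1)
        = Pi.single i 1 ⬝ᵥ Qᵀ *ᵥ (G *ᵥ (Q *ᵥ Pi.single i 1)) := by
      rw [Matrix.dotProduct_mulVec (Pi.single i 1), Matrix.vecMul_transpose]
    rw [h3, h2] at h1
    simpa using h1
  have hs : ∀ i, √(l i) ≠ 0 := fun i => (Real.sqrt_pos.2 (hl i)).ne'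
  have hFR : (Q * Matrix.diagonal fun i => (√(l i))⁻¹) * (Matrix.diagonal (fun i => √(l i)) * Qᵀ)
      = 1 := by
    rw [Matrix.mul_assoc, ← Matrix.mul_assoc (Matrix.diagonal _), Matrix.diagonal_mul_diagonal]
    simp [hs, hQ']
  refine ⟨_, _, hFR, mul_eq_one_comm.1 hFR, fun v => ?_⟩
  rw [mulVec_dot_mulVec]
  congr 2
  rw [hM, Matrix.transpose_mul, Matrix.transpose_transpose, Matrix.diagonal_transpose,
    Matrix.mul_assoc, ← Matrix.mul_assoc (Matrix.diagonal _), Matrix.diagonal_mul_diagonal,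
    ← Matrix.mul_assoc]
  simp [Real.mul_self_sqrt (hl _).le]

/-- The net bound gives `‖X Xᵀ - G‖ ≤ T α`, at most half of the lower bound `2 T α` for `G`. Hence
`G ≤ 2 X Xᵀ`, which lets the noise bound in whitened coordinates be restated in terms of `|Xᵀ v|` at
the cost of `√2`. -/
lemma goodSample_of_net {p T : ℕ} {X Y : Matrix (Fin p) (Fin T) ℝ}
    {A G F R : Matrix (Fin p) (Fin p) ℝ} {α β q y n₀ : ℝ} {N : Finset (Fin p → ℝ)}
    (hN : IsHalfNet N) (hG : Gᵀ = G) (hlow : ∀ v, T * (2 * α) * (v ⬝ᵥ v) ≤ v ⬝ᵥ G *ᵥ v)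
    (hup : ∀ v, v ⬝ᵥ G *ᵥ v ≤ T * (q * (v ⬝ᵥ v))) (hqβ : q + α ≤ β) (hFR : F * R = 1)
    (hRF : R * F = 1) (hR : ∀ v, (R *ᵥ v) ⬝ᵥ (R *ᵥ v) = v ⬝ᵥ G *ᵥ v)
    (hgram : ∀ v, (∃ w ∈ N, ∃ w' ∈ N, v = w + w' ∨ v = w - w') →
      |(Xᵀ *ᵥ v) ⬝ᵥ (Xᵀ *ᵥ v) - v ⬝ᵥ G *ᵥ v| ≤ T * α / 2)
    (hnoise : ∀ w ∈ N, ∀ w' ∈ N, (Xᵀ *ᵥ (F *ᵥ w')) ⬝ᵥ (Xᵀ *ᵥ (F *ᵥ w')) ≤ 3 / 2 →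
      |w ⬝ᵥ (((Y - A * X) * Xᵀ) *ᵥ (F *ᵥ w'))| ≤ y)
    (hn₀ : 4 * y * √2 ≤ n₀) : GoodSample X Y A α β n₀ := by
  have hXX : ∀ v, (Xᵀ *ᵥ v) ⬝ᵥ (Xᵀ *ᵥ v) - v ⬝ᵥ G *ᵥ v = v ⬝ᵥ (X * Xᵀ - G) *ᵥ v := fun v => by
    rw [mulVec_dot_mulVec, Matrix.transpose_transpose, Matrix.sub_mulVec, dotProduct_sub]
  have hnorm : ‖X * Xᵀ - G‖ ≤ 2 * (T * α / 2) := by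
    refine hN.opNorm_le_of_quadratic (by simp [hG]) fun w hw w' hw' => ?_
    rw [← hXX, ← hXX]
    exact ⟨hgram _ ⟨w, hw, w', hw', .inl rfl⟩, hgram _ ⟨w, hw, w', hw', .inr rfl⟩⟩
  have hdev : ∀ v, |(Xᵀ *ᵥ v) ⬝ᵥ (Xᵀ *ᵥ v) - v ⬝ᵥ G *ᵥ v| ≤ T * α * (v ⬝ᵥ v) := by
    intro v
    rw [hXX]
    refine (abs_dot_le _ _).trans ?_
    have h1 := sqrt_mulVec_dot_self_le (X * Xᵀ - G) v
    have hv := dot_self_nonneg v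
    calc _ ≤ √(v ⬝ᵥ v) * (‖X * Xᵀ - G‖ * √(v ⬝ᵥ v)) := by gcongr
      _ = ‖X * Xᵀ - G‖ * (√(v ⬝ᵥ v) * √(v ⬝ᵥ v)) := by ring
      _ ≤ T * α * (v ⬝ᵥ v) := by
          rw [Real.mul_self_sqrt hv]
          exact mul_le_mul_of_nonneg_right (by linarith) hv
  have hB : ‖((Y - A * X) * Xᵀ) * F‖ ≤ 4 * y := by
    refine hN.opNorm_le fun w hw w' hw' => ?_
    rw [← Matrix.mulVec_mulVec]
    refine hnoise w hw w' hw' ?_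
    -- In whitened coordinates the expected form is `|w'|² ≤ 1` and the deviation at most half of
    -- it; this is the `3/2` under which the noise was bounded.
    have h1 := abs_le.1 (hdev (F *ᵥ w'))
    have h2 := hlow (F *ᵥ w')
    have h3 : (F *ᵥ w') ⬝ᵥ G *ᵥ (F *ᵥ w') = w' ⬝ᵥ w' := by
      rw [← hR, Matrix.mulVec_mulVec, hRF, Matrix.one_mulVec]
    have := hN.mem_ball w' hw'
    linarith [h1.2]
  refine ⟨fun v => ?_, fun v => ?_, fun u v => ?_⟩
  · have h1 := abs_le.1 (hdev v)
    have h2 := hlow v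
    linarith [h1.1]
  · have h1 := abs_le.1 (hdev v)
    have h2 := hup v
    have hv := dot_self_nonneg v
    have : T * (q + α) * (v ⬝ᵥ v) ≤ T * β * (v ⬝ᵥ v) := by gcongr
    linarith [h1.2]
  · have hv : ((Y - A * X) * Xᵀ) *ᵥ v = (((Y - A * X) * Xᵀ) * F) *ᵥ (R *ᵥ v) := by
      rw [Matrix.mulVec_mulVec, Matrix.mul_assoc _ F R, hFR, Matrix.mul_one]
    have h4y : 0 ≤ 4 * y := (norm_nonneg _).trans hB
    have hRv : √((R *ᵥ v) ⬝ᵥ (R *ᵥ v)) ≤ √2 * √((Xᵀ *ᵥ v) ⬝ᵥ (Xᵀ *ᵥ v)) := by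
      rw [← Real.sqrt_mul (by norm_num), hR]
      refine Real.sqrt_le_sqrt ?_
      have h1 := abs_le.1 (hdev v)
      have h2 := hlow v
      linarith [h1.1]
    rw [hv]
    refine (abs_dot_le _ _).trans ?_
    calc _ ≤ √(u ⬝ᵥ u) * (‖((Y - A * X) * Xᵀ) * F‖ * √((R *ᵥ v) ⬝ᵥ (R *ᵥ v))) :=
          mul_le_mul_of_nonneg_left (sqrt_mulVec_dot_self_le _ _) (Real.sqrt_nonneg _)
      _ ≤ √(u ⬝ᵥ u) * ((4 * y) * (√2 * √((Xᵀ *ᵥ v) ⬝ᵥ (Xᵀ *ᵥ v)))) := by gcongr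
      _ = (4 * y * √2) * √(u ⬝ᵥ u) * √((Xᵀ *ᵥ v) ⬝ᵥ (Xᵀ *ᵥ v)) := by ring
      _ ≤ _ := by gcongr

/-- The simulated sample is good, except on an event of small probability. -/
theorem measure_not_goodSample_le {p n T : ℕ} {A S Sh : Matrix (Fin p) (Fin p) ℝ} {c : ℝ}
    {ν : Fin (n + T) × Fin p → Measure ℝ} (hp : 1 ≤ p) (hn : 1 ≤ n) (hT : 0 < T)
    (hA : spectralRadius ℂ (A.map Complex.ofReal) < 1)
    (hSH : S.IsHermitian) (hSh : Shᵀ = Sh) (hS : Sh * Sh = S) (hlam : 0 < lamMax S)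
    {q α β : ℝ} (hα : 0 < α) (hαS : 2 * α ≤ lamMin S) (hαq : α ≤ q)
    (hq : lamMax S ≤ q * muMin A) (hqβ : q + α ≤ β) (hν : ∀ k, IsSubG (ν k) c) (hc : 0 < c) :
    Measure.pi ν {x | ¬GoodSample (simX A Sh n T x) (simY A Sh n T x) A α β
        (26 * √(c * lamMax S * p))}
      ≤ 25 ^ p * (4 * eexp (-(T * α ^ 2 / (614400 * c ^ 2 * q ^ 2))))
        + 25 ^ p * (2 * eexp (-(5 * p))) := by
  classical
  obtain ⟨N, hN⟩ := exists_isHalfNet p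
  have hq0 : 0 < q := hα.trans_le hαq
  have hT' : (0 : ℝ) < T := Nat.cast_pos.2 hT
  have hp' : (0 : ℝ) < p := Nat.cast_pos.2 hp
  have hc1 : 1 ≤ 4 * c := by
    have h0 : (0 : ℝ) < 4 * c := by positivity
    obtain ⟨k⟩ : Nonempty (Fin (n + T) × Fin p) := ⟨(⟨0, by omega⟩, ⟨0, by omega⟩)⟩
    exact (inv_le_one₀ h0).1 ((hν k).inv_le_one hc)
  have hlow : ∀ v, T * (2 * α) * (v ⬝ᵥ v) ≤ v ⬝ᵥ simGram A Sh n T *ᵥ v := fun v => by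
    refine le_trans ?_ (le_simGram hn hSH hSh hS v)
    have := dot_self_nonneg v
    gcongr
  obtain ⟨F, R, hFR, hRF, hR⟩ := exists_whitening (G := simGram A Sh n T) simGram_transpose
    fun v hv => lt_of_lt_of_le (by positivity) (hlow v)
  -- The tail `exp (-5 p)` beats the `25 ^ p ≤ exp (4 p)` pairs of net points.
  set y := 2 * √(c * lamMax S * (5 * p)) with hy
  let dev (v : Fin p → ℝ) : Set (Fin (n + T) × Fin p → ℝ) :=
    {x | T * α / 2 ≤ |((simX A Sh n T x)ᵀ *ᵥ v) ⬝ᵥ ((simX A Sh n T x)ᵀ *ᵥ v)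
        - v ⬝ᵥ simGram A Sh n T *ᵥ v|}
  let bad (u v : Fin p → ℝ) : Set (Fin (n + T) × Fin p → ℝ) :=
    {x | ((simX A Sh n T x)ᵀ *ᵥ v) ⬝ᵥ ((simX A Sh n T x)ᵀ *ᵥ v) ≤ 3 / 2 ∧
      y ≤ |u ⬝ᵥ (((simY A Sh n T x - A * simX A Sh n T x) * (simX A Sh n T x)ᵀ) *ᵥ v)|}
  have hsub : {x | ¬GoodSample (simX A Sh n T x) (simY A Sh n T x) A α β
      (26 * √(c * lamMax S * p))} ⊆ (⋃ k ∈ N ×ˢ N, (dev (k.1 + k.2) ∪ dev (k.1 - k.2)))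
        ∪ ⋃ k ∈ N ×ˢ N, bad k.1 (F *ᵥ k.2) := by
    intro x hx
    by_contra hcon
    simp only [Set.mem_union, Set.mem_iUnion, not_or, not_exists, Finset.mem_product] at hcon
    refine hx (goodSample_of_net hN simGram_transpose hlow
      (simGram_le hp hA hSH hSh hS hq0.le hq) hqβ hFR hRF hR (y := y) ?_ ?_ ?_)
    · rintro v ⟨w, hw, w', hw', rfl | rfl⟩
      · exact (not_le.1 (hcon.1 (w, w') ⟨hw, hw'⟩).1).le
      · exact (not_le.1 (hcon.1 (w, w') ⟨hw, hw'⟩).2).le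
    · intro w hw w' hw' h
      by_contra hlt
      exact hcon.2 (w, w') ⟨hw, hw'⟩ ⟨h, (not_le.1 hlt).le⟩
    · have h10 : √5 * √2 ≤ 26 / 8 := by
        rw [← Real.sqrt_mul (by norm_num)]
        exact Real.sqrt_le_iff.2 ⟨by norm_num, by norm_num⟩
      have h5 : √(c * lamMax S * (5 * p)) = √(c * lamMax S * p) * √5 := by
        rw [← Real.sqrt_mul (by positivity)]; congr 1; ring
      rw [hy, h5]
      have := Real.sqrt_nonneg (c * lamMax S * p)
      nlinarith
  have hcard : ((N ×ˢ N).card : ENNReal) ≤ 25 ^ p := by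
    have h : (N ×ˢ N).card ≤ 25 ^ p := by
      rw [Finset.card_product, show 25 = 5 * 5 from rfl, mul_pow]
      exact Nat.mul_le_mul hN.card_le hN.card_le
    exact_mod_cast h
  refine (measure_mono hsub).trans ((measure_union_le _ _).trans (add_le_add ?_ ?_))
  · refine (measure_biUnion_finset_le _ _).trans ((Finset.sum_le_card_nsmul _ _ _
      fun k hk => ?_).trans ((nsmul_eq_mul _ _).le.trans (mul_le_mul_left hcard _)))
    obtain ⟨h1, h2⟩ := Finset.mem_product.1 hk
    obtain ⟨d1, d2⟩ := dot_self_add_le (hN.mem_ball _ h1) (hN.mem_ball _ h2)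
    refine (measure_union_le _ _).trans ((add_le_add
      (measure_gram_deviation_le hp hA hSH hSh hS hα hαq hq hν hc hc1 d1)
      (measure_gram_deviation_le hp hA hSH hSh hS hα hαq hq hν hc hc1 d2)).trans (le_of_eq ?_))
    ring
  · refine (measure_biUnion_finset_le _ _).trans ((Finset.sum_le_card_nsmul _ _ _
      fun k hk => ?_).trans ((nsmul_eq_mul _ _).le.trans (mul_le_mul_left hcard _)))
    obtain ⟨h1, h2⟩ := Finset.mem_product.1 hk
    exact measure_noise_le hSH hSh hS hlam hν hc (hN.mem_ball _ h1) (by positivity)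

end CommonVAR

namespace CommonVAR

/-! ### From the simulated to the stationary autoregression -/

section Transfer

variable {Ω : Type*} [MeasurableSpace Ω] {μ : Measure Ω} {p : ℕ}
  {A S Sh : Matrix (Fin p) (Fin p) ℝ} {τ : NNReal} {ζ y : ℤ → Ω → Fin p → ℝ}

/-- The regressors of an observed path. -/
def pathX {T : ℕ} (f : Fin (T + 1) → Fin p → ℝ) : Matrix (Fin p) (Fin T) ℝ :=
  Matrix.of fun i t => f t.castSucc i

/-- The responses of an observed path. -/
def pathY {T : ℕ} (f : Fin (T + 1) → Fin p → ℝ) : Matrix (Fin p) (Fin T) ℝ :=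
  Matrix.of fun i t => f t.succ i

/-- All three conditions are non-strict inequalities between continuous functions of the path.
Closedness lets goodness survive the limit from simulated to stationary paths. -/
lemma isClosed_goodSample (T : ℕ) (α β n₀ : ℝ) :
    IsClosed {f : Fin (T + 1) → Fin p → ℝ | GoodSample (pathX f) (pathY f) A α β n₀} := by
  have hX : Continuous fun f : Fin (T + 1) → Fin p → ℝ => pathX f := by
    unfold pathX
    fun_prop
  have hY : Continuous fun f : Fin (T + 1) → Fin p → ℝ => pathY f := by
    unfold pathY
    fun_prop
  have hXv : ∀ v : Fin p → ℝ, Continuous fun f : Fin (T + 1) → Fin p → ℝ =>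
      ((pathX f)ᵀ *ᵥ v) ⬝ᵥ ((pathX f)ᵀ *ᵥ v) := fun v =>
    (hX.matrix_transpose.matrix_mulVec continuous_const).dotProduct
      (hX.matrix_transpose.matrix_mulVec continuous_const)
  have : {f : Fin (T + 1) → Fin p → ℝ | GoodSample (pathX f) (pathY f) A α β n₀}
      = (⋂ v, {f | T * α * (v ⬝ᵥ v) ≤ ((pathX f)ᵀ *ᵥ v) ⬝ᵥ ((pathX f)ᵀ *ᵥ v)})
        ∩ (⋂ v, {f | ((pathX f)ᵀ *ᵥ v) ⬝ᵥ ((pathX f)ᵀ *ᵥ v) ≤ T * β * (v ⬝ᵥ v)})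
        ∩ ⋂ u, ⋂ v, {f | |u ⬝ᵥ (((pathY f - A * pathX f) * (pathX f)ᵀ) *ᵥ v)|
            ≤ n₀ * √(u ⬝ᵥ u) * √(((pathX f)ᵀ *ᵥ v) ⬝ᵥ ((pathX f)ᵀ *ᵥ v))} := by
    ext f
    simp only [Set.mem_ofPred_eq, Set.mem_inter_iff, Set.mem_iInter]
    exact ⟨fun h => ⟨⟨h.lower, h.upper⟩, h.noise⟩, fun h => ⟨h.1.1, h.1.2, h.2⟩⟩
  rw [this]
  refine ((isClosed_iInter fun v => ?_).inter (isClosed_iInter fun v => ?_)).inter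
    (isClosed_iInter fun u => isClosed_iInter fun v => ?_)
  · exact isClosed_le continuous_const (hXv v)
  · exact isClosed_le (hXv v) continuous_const
  · refine isClosed_le ?_ (continuous_const.mul (hXv v).sqrt)
    exact (continuous_const.dotProduct (((hY.sub (continuous_const.matrix_mul hX)).matrix_mul
      hX.matrix_transpose).matrix_mulVec continuous_const)).abs

/-- The innovations that enter the autoregression started from zero at time `-n`. -/
def window (ζ : ℤ → Ω → Fin p → ℝ) (n T : ℕ) (ω : Ω) : Fin (n + T) × Fin p → ℝ :=
  fun k => ζ ((k.1 : ℕ) + 1 - n) ω k.2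

lemma state_eq {ω : Ω} (h : ∀ t, y t ω = A *ᵥ y (t - 1) ω + Sh *ᵥ ζ t ω) (n T j : ℕ)
    (hj : j ≤ n + T) :
    y (j - n) ω = impulse A Sh (n + T) j *ᵥ window ζ n T ω + A ^ j *ᵥ y (-n) ω := by
  induction j with
  | zero => simp [impulse]
  | succ j ih =>
    have e : innov (n + T) j *ᵥ window ζ n T ω = ζ (j + 1 - n) ω := by
      funext i
      rw [innov_mulVec j (by omega)]
      rfl
    rw [h, impulse_succ_mulVec, e, pow_succ', ← Matrix.mulVec_mulVec,
      show ((j + 1 : ℕ) : ℤ) - n - 1 = j - n by push_cast; ring, ih (by omega), Matrix.mulVec_add,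
      show ((j + 1 : ℕ) : ℤ) - n = j + 1 - n by push_cast; ring]
    abel

lemma measurable_window (h : ErrorAssumption μ S Sh τ ζ) (n T : ℕ) : Measurable (window ζ n T) :=
  measurable_pi_lambda _ fun k => (measurable_pi_apply k.2).comp (h.meas _)

lemma map_window [IsProbabilityMeasure μ] (h : ErrorAssumption μ S Sh τ ζ) (n T : ℕ) :
    μ.map (window ζ n T)
      = Measure.pi fun k : Fin (n + T) × Fin p => μ.map fun ω => ζ ((k.1 : ℕ) + 1 - n) ω k.2 := by
  have h1 : iIndepFun (fun (k : ℤ × Fin p) ω => ζ k.1 ω k.2) μ :=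
    iIndepFun_uncurry' (X := fun t i ω => ζ t ω i)
      (fun t i => (measurable_pi_apply i).comp (h.meas t)) h.indep h.indep_entries
  have hinj : Function.Injective
      fun k : Fin (n + T) × Fin p => (((k.1 : ℕ) + 1 - n : ℤ), k.2) := by
    rintro ⟨k, i⟩ ⟨k', i'⟩ hk
    simp only [Prod.mk.injEq] at hk
    ext
    · have := hk.1
      simp only
      omega
    · exact congrArg Fin.val hk.2
  exact (h1.precomp hinj).map_fun_eq_pi_map fun k =>
    ((measurable_pi_apply k.2).comp (h.meas _)).aemeasurable

lemma isSubG_map [IsProbabilityMeasure μ] (h : ErrorAssumption μ S Sh τ ζ) (t : ℤ) (i : Fin p) :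
    IsSubG (μ.map fun ω => ζ t ω i) ((τ : ℝ) ^ 2) := by
  have hm : Measurable fun ω => ζ t ω i := (measurable_pi_apply i).comp (h.meas t)
  have hcov := h.cov t i i
  rw [if_pos rfl] at hcov
  -- The integral of a non-integrable function is `0` by convention, so the value `1` of the
  -- variance already implies integrability.
  have hint : Integrable (fun ω => ζ t ω i * ζ t ω i) μ := by
    by_contra hc
    rw [integral_undef hc] at hcov
    exact zero_ne_one hcov
  have h2 : Measurable fun x : ℝ => x ^ 2 := by fun_prop
  refine ⟨Measure.isProbabilityMeasure_map hm.aemeasurable, fun u => ?_, ?_, ?_⟩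
  · have h4 : Measurable fun x => eexp (u * x) := measurable_eexp.comp (measurable_const_mul u)
    rw [lintegral_map h4 hm]
    have h3 := (h.subG t i).mgf_le u
    simp only [eexp]
    rw [← ofReal_integral_eq_lintegral_ofReal ((h.subG t i).integrable_exp_mul u)
      (Filter.Eventually.of_forall fun _ => (Real.exp_pos _).le)]
    refine ENNReal.ofReal_le_ofReal ?_
    simpa [mgf] using h3
  · rw [integrable_map_measure h2.aestronglyMeasurable hm.aemeasurable]
    simpa [Function.comp_def, sq] using hint
  · rw [integral_map hm.aemeasurable h2.aestronglyMeasurable]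
    simpa [sq] using hcov

/-- The influence of the state at time `-n` on the observed path vanishes as `n` grows, almost
surely along a subsequence. -/
lemma exists_seq_tendsto_remainder [IsProbabilityMeasure μ]
    (hA : spectralRadius ℂ (A.map Complex.ofReal) < 1) (hy : IsStationaryVAR μ A Sh ζ y) (T : ℕ) :
    ∃ ns : ℕ → ℕ, StrictMono ns ∧ ∀ᵐ ω ∂μ, Filter.Tendsto
      (fun k => fun t : Fin (T + 1) => A ^ (ns k + t) *ᵥ y (-(ns k : ℤ)) ω)
      Filter.atTop (nhds 0) := by
  let L (n : ℕ) (x : Fin p → ℝ) : Fin (T + 1) → Fin p → ℝ := fun t => A ^ (n + t) *ᵥ x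
  have hL : ∀ n, Measurable (L n) := fun n => by
    refine measurable_pi_lambda _ fun t => ?_
    exact (Continuous.matrix_mulVec continuous_const continuous_id).measurable
  have hlim : ∀ x, Filter.Tendsto (fun n => L n x) Filter.atTop (nhds 0) := by
    intro x
    refine tendsto_pi_nhds.2 fun t => tendsto_pi_nhds.2 fun i => ?_
    have h1 : ∀ j, Filter.Tendsto (fun n : ℕ => (A ^ (n + t)) i j * x j) Filter.atTop
        (nhds (0 * x j)) := fun j =>
      ((tendsto_pow_apply hA i j).comp (Filter.tendsto_add_atTop_nat t)).mul_const _
    have h2 := tendsto_finsetSum Finset.univ fun j _ => h1 j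
    simp only [zero_mul, Finset.sum_const_zero] at h2
    exact h2
  have h0 : TendstoInMeasure μ (fun n ω => L n (y 0 ω)) Filter.atTop fun _ => 0 :=
    tendstoInMeasure_of_tendsto_ae
      (fun n => ((hL n).comp (hy.meas 0)).aestronglyMeasurable)
      (Filter.Eventually.of_forall fun ω => hlim _)
  have hlaw : ∀ t, μ.map (y t) = μ.map (y 0) := by
    intro t
    have h1 := congrArg (Measure.map fun f : ℤ → Fin p → ℝ => f 0) (hy.stationary t)
    rw [Measure.map_map (measurable_pi_apply 0) (measurable_pi_lambda _ fun s => hy.meas _),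
      Measure.map_map (measurable_pi_apply 0) (measurable_pi_lambda _ fun s => hy.meas _)] at h1
    simpa [Function.comp_def] using h1
  -- The state at time `-n` varies with `n`, but by stationarity has the law of `y 0`. Convergence
  -- in measure depends only on these laws, and a subsequence then converges almost surely.
  have h1 : TendstoInMeasure μ (fun n ω => L n (y (-(n : ℤ)) ω)) Filter.atTop fun _ => 0 := by
    intro ε hε
    refine (h0 ε hε).congr fun n => ?_
    have hs : MeasurableSet {x | ε ≤ edist (L n x) 0} :=
      measurableSet_le measurable_const ((hL n).edist measurable_const)
    have h2 : μ.map (y (-(n : ℤ))) {x | ε ≤ edist (L n x) 0}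
        = μ.map (y 0) {x | ε ≤ edist (L n x) 0} := by rw [hlaw]
    rw [Measure.map_apply (hy.meas _) hs, Measure.map_apply (hy.meas _) hs] at h2
    exact h2.symm
  exact h1.exists_seq_tendsto_ae

lemma measurableSet_goodSample_data (hy : IsStationaryVAR μ A Sh ζ y) (T : ℕ) (α β n₀ : ℝ) :
    MeasurableSet {ω | GoodSample (dataX T fun t => y t ω) (dataY T fun t => y t ω) A α β n₀} := by
  have hm : Measurable fun ω (t : Fin (T + 1)) => y (t : ℕ) ω :=
    measurable_pi_lambda _ fun t => hy.meas _
  have := hm (isClosed_goodSample (A := A) T α β n₀).measurableSet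
  convert this using 1
  ext ω
  have : dataY T (fun t => y t ω) = pathY fun t : Fin (T + 1) => y (t : ℕ) ω := by
    ext i t
    simp [dataY, pathY]
  simp only [Set.mem_ofPred_eq, Set.mem_preimage, this]
  rfl

/-- The observed sample is good, except on an event of small probability. -/
theorem measure_not_goodSample_data_le [IsProbabilityMeasure μ] {T : ℕ} (hp : 1 ≤ p) (hT : 0 < T)
    (hA : spectralRadius ℂ (A.map Complex.ofReal) < 1) (h : ErrorAssumption μ S Sh τ ζ)
    (hy : IsStationaryVAR μ A Sh ζ y) (hlam : 0 < lamMax S) {q α β : ℝ} (hα : 0 < α)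
    (hαS : 2 * α ≤ lamMin S) (hαq : α ≤ q) (hq : lamMax S ≤ q * muMin A) (hqβ : q + α ≤ β)
    (hτ : 0 < τ) :
    μ {ω | ¬GoodSample (dataX T fun t => y t ω) (dataY T fun t => y t ω) A α β
        (26 * √((τ : ℝ) ^ 2 * lamMax S * p))}
      ≤ 25 ^ p * (4 * eexp (-(T * α ^ 2 / (614400 * ((τ : ℝ) ^ 2) ^ 2 * q ^ 2))))
        + 25 ^ p * (2 * eexp (-(5 * p))) := by
  set n₀ := 26 * √((τ : ℝ) ^ 2 * lamMax S * p)
  set B : ENNReal := 25 ^ p * (4 * eexp (-(T * α ^ 2 / (614400 * ((τ : ℝ) ^ 2) ^ 2 * q ^ 2))))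
        + 25 ^ p * (2 * eexp (-(5 * p)))
  have hSh : Shᵀ = Sh := by
    have := h.sqrt_psd.1
    rwa [Matrix.IsHermitian, Matrix.conjTranspose_eq_transpose_of_trivial] at this
  let Good : Set (Fin (T + 1) → Fin p → ℝ) := {f | GoodSample (pathX f) (pathY f) A α β n₀}
  have hclosed : IsClosed Good := isClosed_goodSample T α β n₀
  let sim (n : ℕ) (x : Fin (n + T) × Fin p → ℝ) : Fin (T + 1) → Fin p → ℝ :=
    fun t => impulse A Sh (n + T) (n + t) *ᵥ x
  have hsim : ∀ n, Measurable (sim n) := fun n => by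
    refine measurable_pi_lambda _ fun t => ?_
    exact (Continuous.matrix_mulVec continuous_const continuous_id).measurable
  have hbound : ∀ n, 1 ≤ n → μ {ω | sim n (window ζ n T ω) ∉ Good} ≤ B := by
    intro n hn
    have h1 := measure_not_goodSample_le (ν := fun k : Fin (n + T) × Fin p =>
      μ.map fun ω => ζ ((k.1 : ℕ) + 1 - n) ω k.2) (c := (τ : ℝ) ^ 2) hp hn hT hA h.posDef.1 hSh
      h.sqrt_sq hlam hα hαS hαq hq hqβ (fun k => isSubG_map h _ _) (by positivity)
    rw [← map_window h] at h1
    have hs : MeasurableSet {x | sim n x ∉ Good} := (hsim n hclosed.measurableSet).compl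
    have h2 := Measure.map_apply (measurable_window h n T) hs (μ := μ)
    exact h2.symm.le.trans h1
  obtain ⟨ns, hns, hlim⟩ := exists_seq_tendsto_remainder hA hy T
  -- The event that all simulated samples from the `m`-th on are bad. These events increase with `m`
  -- and each lies in a single bad event of probability at most `B`, so their union has probability
  -- at most `B`.
  let bad (m : ℕ) : Set Ω := ⋂ k ≥ m, {ω | sim (ns k) (window ζ (ns k) T ω) ∉ Good}
  have hmono : Monotone bad := fun m m' hm => Set.biInter_mono (fun k hk => le_trans hm hk)
    fun _ _ => le_rfl
  have hbad : μ (⋃ m, bad m) ≤ B := by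
    rw [hmono.measure_iUnion]
    refine iSup_le fun m => ?_
    have h1 : m + 1 ≤ ns (m + 1) := hns.le_apply
    exact (measure_mono (Set.biInter_subset_of_mem (Nat.le_succ m))).trans
      (hbound (ns (m + 1)) (by omega))
  refine le_trans (measure_mono_ae ?_) hbad
  filter_upwards [hlim, ae_all_iff.2 hy.eqn] with ω hω heq hnot
  by_contra hcon
  refine hnot ?_
  -- Outside the union infinitely many simulated paths are good, and they converge to the observed
  -- path; closedness finishes.
  have hfreq : ∃ᶠ k in Filter.atTop, sim (ns k) (window ζ (ns k) T ω) ∈ Good := by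
    rw [Filter.frequently_atTop]
    intro m
    have : ω ∉ bad m := fun hm => hcon (Set.mem_iUnion.2 ⟨m, hm⟩)
    simpa [bad, and_comm] using this
  have hconv : Filter.Tendsto (fun k => sim (ns k) (window ζ (ns k) T ω)) Filter.atTop
      (nhds fun t : Fin (T + 1) => y (t : ℕ) ω) := by
    have h1 : ∀ k, sim (ns k) (window ζ (ns k) T ω) = (fun t : Fin (T + 1) => y (t : ℕ) ω)
        - fun t : Fin (T + 1) => A ^ (ns k + t) *ᵥ y (-(ns k : ℤ)) ω := by
      intro k
      funext t
      have h2 := state_eq heq (ns k) T (ns k + t) (by have := t.2; omega)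
      rw [show ((ns k + (t : ℕ) : ℕ) : ℤ) - ns k = (t : ℕ) by push_cast; ring] at h2
      rw [Pi.sub_apply, h2, add_sub_cancel_right]
    simp only [h1]
    simpa using tendsto_const_nhds.sub hω
  have hmem : (fun t : Fin (T + 1) => y (t : ℕ) ω) ∈ Good :=
    hclosed.mem_of_frequently_of_tendsto hfreq hconv
  have hY : dataY T (fun t => y t ω) = pathY fun t : Fin (T + 1) => y (t : ℕ) ω := by
    ext i t
    simp [dataY, pathY]
  rw [hY]
  exact hmem

end Transfer

end CommonVAR

/-! ### Constants, probability bound and rate. -/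

namespace CommonVAR

/-! ### The quantities of the autoregression -/

section Quantities

lemma zpow_neg_two_eq (x : ℝ) : x ^ (-2 : ℤ) = (x ^ 2)⁻¹ := by
  rw [_root_.zpow_neg]
  norm_cast

lemma zpow_neg_four (x : ℝ) : x ^ (-4 : ℤ) = (x ^ 4)⁻¹ := by
  rw [_root_.zpow_neg]
  norm_cast

variable {p : ℕ} {A S : Matrix (Fin p) (Fin p) ℝ}

lemma alphaRSC_pos (hp : 1 ≤ p) (hS : S.PosDef) : 0 < alphaRSC A S :=
  div_pos (lamMin_pos hp hS) (by linarith [one_le_muMax (A := A) hp])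

lemma two_mul_alphaRSC_le (hp : 1 ≤ p) (hS : S.PosDef) : 2 * alphaRSC A S ≤ lamMin S := by
  have h1 := one_le_muMax (A := A) hp
  have h2 := lamMin_pos hp hS
  have h3 : 2 * alphaRSC A S = lamMin S / muMax A := by
    rw [alphaRSC]
    field_simp
  rw [h3]
  exact div_le_self h2.le h1

lemma M2_pos (hp : 1 ≤ p) (hA : spectralRadius ℂ (A.map Complex.ofReal) < 1) (hS : S.PosDef) :
    0 < M2 A S := by
  have h1 := one_le_muMax (A := A) hp
  have h2 := lamMin_pos hp hS
  have h3 := muMin_pos hp hA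
  have h4 := lamMin_le_lamMax hp hS.isHermitian
  exact div_pos (by positivity) (mul_pos (by linarith) (by linarith))

lemma M2_le_one (hp : 1 ≤ p) (hA : spectralRadius ℂ (A.map Complex.ofReal) < 1)
    (hS : S.PosDef) : M2 A S ≤ 1 := by
  have h1 := one_le_muMax (A := A) hp
  have h2 := lamMin_pos hp hS
  have h3 := muMin_pos hp hA
  have h4 := lamMin_le_lamMax hp hS.isHermitian
  have h5 := muMin_le_muMax (A := A) hp
  refine (div_le_one (mul_pos (by linarith) (by linarith))).2 ?_
  exact mul_le_mul h4 h5 h3.le (by linarith)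

/-- The ratio `α / q` in the Gram concentration, with `q = λ_max / μ_min`, is `M₂ / 2`; this is how
`M₂²` enters the sample size and the probability. -/
lemma two_mul_alphaRSC_eq (hp : 1 ≤ p) (hA : spectralRadius ℂ (A.map Complex.ofReal) < 1)
    (hS : S.PosDef) : 2 * alphaRSC A S = M2 A S * (lamMax S / muMin A) := by
  have h1 := one_le_muMax (A := A) hp
  have h2 := lamMin_pos hp hS
  have h3 := muMin_pos hp hA
  have h4 := lamMin_le_lamMax hp hS.isHermitian
  have h5 : lamMax S ≠ 0 := by linarith
  have h6 : muMax A ≠ 0 := by linarith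
  rw [alphaRSC, M2]
  field_simp

lemma betaRSS_eq : betaRSS A S = 3 / 2 * (lamMax S / muMin A) := by
  rw [betaRSS, mul_div_mul_comm]

lemma alphaRSC_le_betaRSS (hp : 1 ≤ p) (hA : spectralRadius ℂ (A.map Complex.ofReal) < 1)
    (hS : S.PosDef) : alphaRSC A S ≤ betaRSS A S := by
  have h1 := two_mul_alphaRSC_eq hp hA hS
  have h2 := M2_le_one hp hA hS
  have h3 : 0 < lamMax S / muMin A :=
    div_pos ((lamMin_pos hp hS).trans_le (lamMin_le_lamMax hp hS.isHermitian)) (muMin_pos hp hA)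
  rw [betaRSS_eq]
  nlinarith

/-- Explains `M₁`: the noise level carries `√λ_max` and the initial prediction error `√β`. -/
lemma betaRSS_mul_lamMax (hp : 1 ≤ p) (hA : spectralRadius ℂ (A.map Complex.ofReal) < 1) :
    betaRSS A S * lamMax S * 2 = 3 * M1 A S ^ 2 := by
  have h3 := muMin_pos hp hA
  rw [betaRSS, M1, div_pow, Real.sq_sqrt h3.le]
  field_simp

lemma M1_pos (hp : 1 ≤ p) (hA : spectralRadius ℂ (A.map Complex.ofReal) < 1) (hS : S.PosDef) :
    0 < M1 A S :=
  div_pos ((lamMin_pos hp hS).trans_le (lamMin_le_lamMax hp hS.isHermitian))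
    (Real.sqrt_pos.2 (muMin_pos hp hA))

lemma mul_le_dRR {r : ℕ} (h : r ≤ p) : (p : ℝ) * r ≤ dRR p r := by
  have h1 : (r : ℝ) ≤ p := Nat.cast_le.2 h
  have h2 : (0 : ℝ) ≤ r := Nat.cast_nonneg r
  rw [dRR]
  nlinarith

/-- Equivalent to `d (2p - d) - d ≤ r (2p - r)`, which holds as `x (2p - x)` increases on `[0, p]`.
Sharing a subspace saves at most half of the parameters. -/
lemma dRR_le_two_mul_dCS {r d : ℕ} (h : r ≤ p) (hd : d ≤ r) : dRR p r ≤ 2 * dCS p r d := by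
  have h1 : (r : ℝ) ≤ p := Nat.cast_le.2 h
  have h2 : (d : ℝ) ≤ r := Nat.cast_le.2 hd
  have h3 : (0 : ℝ) ≤ d := Nat.cast_nonneg d
  rw [dRR, dCS]
  nlinarith [mul_nonneg (sub_nonneg.2 h2) (sub_nonneg.2 h1)]

lemma dCS_lt_dRR {r d : ℕ} (h : r ≤ p) (hd : d ≤ r) (hd1 : 1 ≤ d) (hp2 : 2 ≤ p) :
    dCS p r d < dRR p r := by
  have h1 : (d : ℝ) ≤ p := Nat.cast_le.2 (hd.trans h)
  have h2 : (1 : ℝ) ≤ d := by exact_mod_cast hd1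
  have h3 : (2 : ℝ) ≤ p := by exact_mod_cast hp2
  rw [dRR, dCS]
  nlinarith

end Quantities

/-! ### The probability of a good sample -/

section Probability

/-- If `c = 0`, the variable would also be sub-Gaussian with constant `1/8`, contradicting the bound
for positive constants. -/
lemma IsSubG.one_le {ν : Measure ℝ} {c : ℝ} (h : IsSubG ν c) (hc : 0 ≤ c) : 1 ≤ 4 * c := by
  rcases eq_or_lt_of_le hc with rfl | hc'
  · have h1 : IsSubG ν (1 / 8) := ⟨h.prob, fun u => (h.mgf u).trans (eexp_mono (by
      have := sq_nonneg u; linarith)), h.integrable, h.second⟩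
    have h2 := h1.inv_le_one (by norm_num)
    norm_num at h2
  · exact (inv_le_one₀ (by positivity)).1 (h.inv_le_one hc')

variable {Ω : Type*} [MeasurableSpace Ω] {μ : Measure Ω} [IsProbabilityMeasure μ] {p T : ℕ}
  {A S Sh : Matrix (Fin p) (Fin p) ℝ} {τ : NNReal} {ζ y : ℤ → Ω → Fin p → ℝ}

/-- Unit variance forces `τ² ≥ 1/4`; this allows `τ ≤ 2 τ²` in the rate. -/
lemma ErrorAssumption.half_le (hp : 1 ≤ p) (h : ErrorAssumption μ S Sh τ ζ) :
    1 / 2 ≤ (τ : ℝ) := by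
  have h1 := (isSubG_map h 0 ⟨0, hp⟩).one_le (sq_nonneg _)
  have h2 : (0 : ℝ) ≤ τ := τ.2
  nlinarith

theorem measureReal_goodSample_ge (hp : 1 ≤ p)
    (hA : spectralRadius ℂ (A.map Complex.ofReal) < 1) (h : ErrorAssumption μ S Sh τ ζ)
    (hy : IsStationaryVAR μ A Sh ζ y)
    (hT : 2e7 * max ((τ : ℝ) ^ 4) ((τ : ℝ) ^ 2) * (M2 A S) ^ (-2 : ℤ) * p ≤ T) :
    1 - 4 * Real.exp (-(1 / 5e6 * (M2 A S) ^ 2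
          * min ((τ : ℝ) ^ (-2 : ℤ)) ((τ : ℝ) ^ (-4 : ℤ)) * T))
        - 2 * Real.exp (-(1 / 5e6 * p))
      ≤ μ.real {ω | GoodSample (dataX T fun t => y t ω) (dataY T fun t => y t ω) A
          (alphaRSC A S) (betaRSS A S) (26 * √((τ : ℝ) ^ 2 * lamMax S * p))} := by
  have hτ : 0 < (τ : ℝ) := lt_of_lt_of_le (by norm_num) (h.half_le hp)
  have hM2 := M2_pos hp hA h.posDef
  have hM2' := M2_le_one hp hA h.posDef
  have hα := alphaRSC_pos (A := A) hp h.posDef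
  have hlam : 0 < lamMax S :=
    (lamMin_pos hp h.posDef).trans_le (lamMin_le_lamMax hp h.posDef.isHermitian)
  have hμ := muMin_pos hp hA
  have hαq := two_mul_alphaRSC_eq hp hA h.posDef
  have hp' : (0 : ℝ) < p := Nat.cast_pos.2 hp
  set q := lamMax S / muMin A with hq
  have hq0 : 0 < q := div_pos hlam hμ
  have hTpos : (0 : ℝ) < T := lt_of_lt_of_le (by positivity) hT
  have hle := measure_not_goodSample_data_le (q := q) (β := betaRSS A S) hp (Nat.cast_pos.1 hTpos)
    hA h hy hlam hα (two_mul_alphaRSC_le hp h.posDef) (by nlinarith)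
    (by rw [hq, div_mul_cancel₀ _ hμ.ne']) (by rw [betaRSS_eq, ← hq]; nlinarith) hτ
  set B := {ω | GoodSample (dataX T fun t => y t ω) (dataY T fun t => y t ω) A
          (alphaRSC A S) (betaRSS A S) (26 * √((τ : ℝ) ^ 2 * lamMax S * p))} with hB
  have hcompl : μ.real Bᶜ ≤ 25 ^ p * (4 * Real.exp (-(T * alphaRSC A S ^ 2
      / (614400 * ((τ : ℝ) ^ 2) ^ 2 * q ^ 2)))) + 25 ^ p * (2 * Real.exp (-(5 * p))) := by
    refine ENNReal.toReal_le_of_le_ofReal (by positivity) (hle.trans (le_of_eq ?_))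
    rw [ENNReal.ofReal_add (by positivity) (by positivity), ENNReal.ofReal_mul (by positivity),
      ENNReal.ofReal_mul (by positivity), ENNReal.ofReal_mul (by positivity),
      ENNReal.ofReal_mul (by positivity), ENNReal.ofReal_pow (by positivity)]
    simp [eexp]
  have hBm : MeasurableSet B := measurableSet_goodSample_data hy T _ _ _
  have hone : μ.real B = 1 - μ.real Bᶜ := by
    rw [probReal_compl_eq_one_sub hBm]; ring
  have h25 : (25 : ℝ) ^ p ≤ Real.exp (4 * p) := by
    have h1 : (25 : ℝ) ≤ Real.exp 4 := by
      have h2 : Real.exp 4 = Real.exp 1 ^ 4 := by rw [← Real.exp_nat_mul]; norm_num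
      have h3 := Real.exp_one_gt_d9
      rw [h2]
      calc (25 : ℝ) ≤ 2.7182818283 ^ 4 := by norm_num
        _ ≤ _ := pow_le_pow_left₀ (by norm_num) h3.le 4
    rw [mul_comm, Real.exp_nat_mul]
    exact pow_le_pow_left₀ (by norm_num) h1 p
  -- The Gram tail has exponent `x / 2457600`, and the sample size gives `4 p ≤ x / 5e6`. As `2 /
  -- 5e6 ≤ 1 / 2457600`, removing the net entropy `4 p` leaves `x / 5e6`.
  set x := M2 A S ^ 2 * ((τ : ℝ) ^ 4)⁻¹ * T with hx
  have hxp : 2e7 * p ≤ x := by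
    have h1 : 2e7 * (τ : ℝ) ^ 4 * (M2 A S) ^ (-2 : ℤ) * p ≤ T := by
      refine le_trans ?_ hT
      gcongr
      exact le_max_left _ _
    have h2 : M2 A S ^ 2 * ((τ : ℝ) ^ 4)⁻¹ * (2e7 * (τ : ℝ) ^ 4 * (M2 A S) ^ (-2 : ℤ) * p)
        = 2e7 * p := by
      rw [zpow_neg_two_eq]
      field_simp
    rw [← h2, hx]
    gcongr
  have he1 : T * alphaRSC A S ^ 2 / (614400 * ((τ : ℝ) ^ 2) ^ 2 * q ^ 2) = x / 2457600 := by
    have : alphaRSC A S = M2 A S * q / 2 := by linarith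
    rw [this, hx]
    field_simp
    norm_num
  have he2 : 25 ^ p * (4 * Real.exp (-(T * alphaRSC A S ^ 2
      / (614400 * ((τ : ℝ) ^ 2) ^ 2 * q ^ 2)))) ≤ 4 * Real.exp (-(1 / 5e6 * (M2 A S) ^ 2
          * min ((τ : ℝ) ^ (-2 : ℤ)) ((τ : ℝ) ^ (-4 : ℤ)) * T)) := by
    rw [he1]
    have h1 : 1 / 5e6 * (M2 A S) ^ 2 * min ((τ : ℝ) ^ (-2 : ℤ)) ((τ : ℝ) ^ (-4 : ℤ)) * T
        ≤ 1 / 5e6 * x := by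
      have h2 : min ((τ : ℝ) ^ (-2 : ℤ)) ((τ : ℝ) ^ (-4 : ℤ)) ≤ ((τ : ℝ) ^ 4)⁻¹ :=
        (min_le_right _ _).trans (le_of_eq (zpow_neg_four _))
      calc _ ≤ 1 / 5e6 * (M2 A S) ^ 2 * ((τ : ℝ) ^ 4)⁻¹ * T := by gcongr
        _ = _ := by rw [hx]; ring
    calc _ ≤ Real.exp (4 * p) * (4 * Real.exp (-(x / 2457600))) := by gcongr
      _ = 4 * Real.exp (4 * p + -(x / 2457600)) := by rw [Real.exp_add]; ring
      _ ≤ _ := by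
        gcongr
        norm_num at h1 hxp ⊢
        linarith
  have he3 : 25 ^ p * (2 * Real.exp (-(5 * p))) ≤ 2 * Real.exp (-(1 / 5e6 * p)) := by
    calc _ ≤ Real.exp (4 * p) * (2 * Real.exp (-(5 * p))) := by gcongr
      _ = 2 * Real.exp (4 * p + -(5 * p)) := by rw [Real.exp_add]; ring
      _ ≤ _ := by
        gcongr
        norm_num
        linarith
  rw [hone]
  linarith

end Probability

/-! ### The error bound on a good sample -/

section Final

variable {p r d T : ℕ}

/-- The error of the spectral initial value in terms of the rate. -/
lemma initial_error_le {r T : ℕ} {α β τ L M : ℝ} (hT : (0 : ℝ) < T) (hα : 0 < α) (hβ : 0 < β)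
    (hτ : 1 / 2 ≤ τ) (hM : 0 < M) (hL : 0 < L) (hβL : β * L * 2 = 3 * M ^ 2) (hrp : r ≤ p) :
    √β / √α * (2 * (26 * √(τ ^ 2 * L * p)) * √(2 * r) / √(T * α))
      ≤ 181 * (α⁻¹ * τ ^ 2 * M * √(dRR p r / T)) := by
  have hτ0 : 0 < τ := by linarith
  have hsα : 0 < √α := Real.sqrt_pos.2 hα
  have hsT : 0 < √(T : ℝ) := Real.sqrt_pos.2 hT
  have hαinv : α⁻¹ = (√α)⁻¹ * (√α)⁻¹ := by rw [← mul_inv, Real.mul_self_sqrt hα.le]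
  have h1 : √β / √α * (2 * (26 * √(τ ^ 2 * L * p)) * √(2 * r) / √(T * α))
      = 52 * τ * α⁻¹ * √(3 * M ^ 2 * (p * r / T)) := by
    have e1 : √(3 * M ^ 2 * (p * r / T)) = √β * √(L * p) * √(2 * r) / √T := by
      rw [← hβL, ← Real.sqrt_mul hβ.le, ← Real.sqrt_mul (by positivity),
        ← Real.sqrt_div (by positivity)]
      congr 1
      ring
    have e2 : √(τ ^ 2 * L * p) = τ * √(L * p) := by
      rw [mul_assoc, Real.sqrt_mul (sq_nonneg τ), Real.sqrt_sq hτ0.le]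
    rw [e1, e2, Real.sqrt_mul hT.le, hαinv]
    field_simp
    ring
  have h2 : √(3 * M ^ 2 * (p * r / T)) ≤ 1.7321 * (M * √(dRR p r / T)) := by
    have e3 : √3 ≤ 1.7321 := Real.sqrt_le_iff.2 ⟨by norm_num, by norm_num⟩
    rw [mul_assoc, Real.sqrt_mul (by norm_num), Real.sqrt_mul (sq_nonneg M), Real.sqrt_sq hM.le]
    gcongr
    exact mul_le_dRR hrp
  rw [h1]
  calc _ ≤ 52 * (2 * τ ^ 2) * α⁻¹ * (1.7321 * (M * √(dRR p r / T))) := by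
        gcongr
        nlinarith
    _ = 52 * 2 * 1.7321 * (α⁻¹ * τ ^ 2 * M * √(dRR p r / T)) := by ring
    _ ≤ _ := mul_le_mul_of_nonneg_right (by norm_num) (by positivity)

/-- Joins the initial error bound and the confinement of the iterates. The accuracy condition, with
its factor `g⁻²`, supplies both the spectral gap for the initial value and the room `210 K⁴ κ Δ ≤
ρ³` for gradient descent. -/
theorem spectralInit_and_iterate_le {X Y : Matrix (Fin p) (Fin T) ℝ}
    {A : Matrix (Fin p) (Fin p) ℝ} {θ : Comp p r d} {K α β τ L M g a b η η₀ ρ κ : ℝ} (hK : 1 ≤ K)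
    (hd : d ≤ r) (hr : 1 ≤ r) (hT : 0 < T) (hα : 0 < α) (hαβ : α ≤ β) (hτ : 1 / 2 ≤ τ)
    (hL : 0 < L) (hM : 0 < M) (hβL : β * L * 2 = 3 * M ^ 2) (hθ : θ.IsDecompOf A)
    (hρ : 0 < ρ) (hρσ : ρ ^ 3 = sigma A 0) (hκ : κ = sigma A 0 / sigma A (r - 1))
    (hS : GoodSample X Y A α β (26 * √(τ ^ 2 * L * p)))
    (hg : 0 < g) (hgs : g ≤ sinTheta1 θ.R θ.P)
    (hacc : κ ^ 2 * g ^ (-2 : ℤ) * α⁻¹ * τ ^ 2 * M * √(dRR p r / T)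
      ≤ 1 / (40000 * K ^ 4) * sigma A (r - 1))
    (ha1 : K⁻¹ * (α * ρ ^ 2 * κ ^ (-2 : ℤ)) ≤ a) (ha2 : a ≤ K * (α * ρ ^ 2 * κ ^ (-2 : ℤ)))
    (hb1 : K⁻¹ * ρ ≤ b) (hb2 : b ≤ K * ρ) (hη₀ : 0 < η₀) (hη₁ : η₀ ≤ 1 / (260 * K ^ 4))
    (hη : η = η₀ * β⁻¹ * (ρ ^ 4)⁻¹) :
    (∃ θ₀ : Comp p r d, IsSpectralInit X Y b θ₀) ∧
    ∀ θ₀ : Comp p r d, IsSpectralInit X Y b θ₀ → ∀ I : ℕ,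
      frobNorm (((gdStep X Y a b η)^[I] θ₀).toMat - A)
        ≤ 3600 * (κ * α⁻¹ * τ ^ 2 * M * √(dCS p r d / T)) := by
  have hβ : 0 < β := hα.trans_le hαβ
  have hK0 : 0 < K := by linarith
  have hτ0 : 0 < τ := by linarith
  have hT' : (0 : ℝ) < T := Nat.cast_pos.2 hT
  have hrp : r ≤ p := by rw [← hθ.rank_eq]; exact Matrix.rank_le_height A
  have hs : 0 < sigma A (r - 1) := by rw [sigma_pos_iff, hθ.rank_eq]; omega
  have hκ1 : 1 ≤ κ := by
    rw [hκ, one_le_div hs]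
    exact sigma_antitone A (Nat.zero_le _)
  have hκ0 : 0 < κ := by linarith
  have hκs : κ * sigma A (r - 1) = ρ ^ 3 := by rw [hκ, div_mul_cancel₀ _ hs.ne', hρσ]
  have hg1 : g ≤ 1 := hgs.trans (Real.sin_le_one _)
  have hb : 0 < b := lt_of_lt_of_le (by positivity) hb1
  set s := sigma A (r - 1) with hsdef
  set n₀ := 26 * √(τ ^ 2 * L * p) with hn₀
  have hn : 0 ≤ n₀ := by positivity
  set δ := 2 * n₀ * √(2 * r) / √(T * α) with hδ
  have hδ0 : 0 ≤ δ := by positivity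
  set Z := α⁻¹ * τ ^ 2 * M * √(dRR p r / T) with hZ
  -- Scaled so that `√α Δ = √β κ δ`: the initial error `13 κ δ` is converted into prediction error
  -- through `β` and back through `α`.
  set Δ := κ * (√β / √α * δ) with hΔ
  have hsα : 0 < √α := Real.sqrt_pos.2 hα
  have hsβ : 0 < √β := Real.sqrt_pos.2 hβ
  have hsT : 0 < √(T : ℝ) := Real.sqrt_pos.2 hT'
  have hsqα : √α * √α = α := Real.mul_self_sqrt hα.le
  have hratio : 1 ≤ √β / √α := (one_le_div hsα).2 (Real.sqrt_le_sqrt hαβ)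
  have hmain : √β / √α * δ ≤ 181 * Z := initial_error_le hT' hα hβ hτ hM hL hβL hrp
  have hZacc : 40000 * K ^ 4 * (κ ^ 2 * Z) ≤ s * g ^ 2 := by
    have h1 : κ ^ 2 * g ^ (-2 : ℤ) * α⁻¹ * τ ^ 2 * M * √(dRR p r / T) = κ ^ 2 * Z / g ^ 2 := by
      rw [zpow_neg_two_eq, hZ, div_eq_mul_inv]
      ring
    rw [h1, div_le_iff₀ (by positivity), one_div_mul_eq_div, div_mul_eq_mul_div,
      le_div_iff₀ (by positivity)] at hacc
    linarith only [hacc]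
  have hZ0 : 0 ≤ Z := by positivity
  have hK4 : 1 ≤ K ^ 4 := one_le_pow₀ hK
  have hg2 : g ^ 2 ≤ g := by
    rw [sq]
    exact mul_le_of_le_one_left hg.le hg1
  have hδZ : δ ≤ 181 * Z := (le_mul_of_one_le_left hδ0 hratio).trans hmain
  have hZs : 40000 * Z ≤ s * g := by
    have h1 : 1 * (1 * Z) ≤ K ^ 4 * (κ ^ 2 * Z) := by
      gcongr
      exact one_le_pow₀ hκ1
    have h2 : s * g ^ 2 ≤ s * g := mul_le_mul_of_nonneg_left hg2 hs.le
    linarith only [h1, h2, hZacc]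
  have hδg : 6 * δ < g * s := by
    linarith only [hδZ, hZs, hZ0, mul_pos hs hg, mul_comm g s]
  have hsσ : s ≤ sigma A 0 := sigma_antitone A (Nat.zero_le _)
  have hδ1 : δ ≤ sigma A 0 := by
    have h2 : s * g ≤ s := mul_le_of_le_one_right hs.le hg1
    linarith only [h2, hsσ, hδg, hδ0, mul_comm g s]
  obtain ⟨hex, hall⟩ := spectralInit_spec hd hr hT hα hn hS hθ hg hgs hb le_rfl hδg hδ1
  refine ⟨hex, fun θ₀ hθ₀ I => ?_⟩
  obtain ⟨hU, hV, hE⟩ := hall θ₀ hθ₀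
  have hΔ0 : 0 ≤ Δ := by positivity
  have hΔZ : Δ ≤ κ * (181 * Z) := mul_le_mul_of_nonneg_left hmain hκ0.le
  have hαΔ : √α * Δ = √β * (κ * δ) := by rw [hΔ]; field_simp
  have hfin : frobNorm (((gdStep X Y a b η)^[I] θ₀).toMat - A) ≤ 14 * Δ := by
    have hκinv : κ ^ (-2 : ℤ) = (κ ^ 2)⁻¹ := zpow_neg_two_eq κ
    refine frobNorm_iterate_le (K := K) (ρ := ρ) (κ := κ) hd hr hS hn hT hθ.rank_eq hα hαβ hK hρ
      hρσ hκ1 hb ?_ hb2 ?_ ?_ ?_ ?_ hΔ0 ?_ hU hV ?_ ?_ I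
    · rwa [inv_mul_le_iff₀ hK0] at hb1
    · rw [inv_mul_le_iff₀ hK0, hκinv, ← div_eq_mul_inv, div_le_iff₀ (by positivity)] at ha1
      linarith
    · refine ha2.trans ?_
      have h1 : κ ^ (-2 : ℤ) ≤ 1 := by
        rw [hκinv]; exact inv_le_one_of_one_le₀ (one_le_pow₀ hκ1)
      calc _ ≤ K * (β * ρ ^ 2 * 1) := by gcongr
        _ = _ := by ring
    · rw [hη]; positivity
    · rw [hη]
      rw [le_div_iff₀ (by positivity)] at hη₁
      calc _ = η₀ * (260 * K ^ 4) := by field_simp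
        _ ≤ 1 := hη₁
    -- `210 · 181 = 38010`, which the constant `40000` of the accuracy condition covers.
    · calc _ ≤ 210 * K ^ 4 * κ * (κ * (181 * Z)) := by gcongr
        _ = 38010 * (K ^ 4 * (κ ^ 2 * Z)) := by ring
        _ ≤ 40000 * K ^ 4 * (κ ^ 2 * Z) := by
            have : 0 ≤ K ^ 4 * (κ ^ 2 * Z) := by positivity
            linarith
        _ ≤ s * g ^ 2 := hZacc
        _ ≤ s * 1 := by gcongr; linarith
        _ ≤ κ * s := by rw [mul_comm]; gcongr
        _ = ρ ^ 3 := hκs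
    · rw [hαΔ]
      rw [← hκ] at hE
      calc _ ≤ √β * (13 * κ * δ) := by gcongr
        _ = _ := by ring
    · rw [hαΔ]
      have h1 : 2 * n₀ * √(2 * r) = √T * (√α * δ) := by
        rw [hδ, Real.sqrt_mul hT'.le]; field_simp
      have h2 : √α * δ ≤ √β * (κ * δ) :=
        mul_le_mul (Real.sqrt_le_sqrt hαβ) (le_mul_of_one_le_left hδ0 hκ1) hδ0 hsβ.le
      rw [h1]
      exact mul_le_mul_of_nonneg_left h2 hsT.le
  refine hfin.trans ?_
  have hcs : √(dRR p r / T) ≤ 1.4143 * √(dCS p r d / T) := by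
    have e1 : √2 ≤ 1.4143 := Real.sqrt_le_iff.2 ⟨by norm_num, by norm_num⟩
    calc √(dRR p r / T) ≤ √(2 * (dCS p r d / T)) := by
          refine Real.sqrt_le_sqrt ?_
          rw [← mul_div_assoc]
          exact div_le_div_of_nonneg_right (dRR_le_two_mul_dCS hrp hd) hT'.le
      _ = √2 * √(dCS p r d / T) := Real.sqrt_mul (by norm_num) _
      _ ≤ _ := by gcongr
  -- `14` from the sublevel set, `181` from the initial error, `1.4143` for `√2` from `d_RR ≤ 2
  -- d_CS`; their product is below `3600`.
  calc 14 * Δ ≤ 14 * (κ * (181 * (α⁻¹ * τ ^ 2 * M * (1.4143 * √(dCS p r d / T))))) := by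
        refine mul_le_mul_of_nonneg_left (hΔZ.trans ?_) (by norm_num)
        rw [hZ]
        gcongr
    _ = 14 * 181 * 1.4143 * (κ * α⁻¹ * τ ^ 2 * M * √(dCS p r d / T)) := by ring
    _ ≤ _ := mul_le_mul_of_nonneg_right (by norm_num) (by positivity)

end Final

end CommonVAR

theorem mainTheorem3 (K : ℝ) (hK : 1 ≤ K) :
    ∃ CT cI CP CN CL CB : ℝ, 0 < CT ∧ 0 < cI ∧ 0 < CP ∧ 0 < CN ∧ 0 < CL ∧ CL ≤ 1 ∧ 0 < CB ∧
      ∀ (p r d T : ℕ), 1 ≤ r → d ≤ r →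
      ∀ (Ω : Type*) [MeasurableSpace Ω] (μ : Measure Ω) [IsProbabilityMeasure μ]
        (A : Matrix (Fin p) (Fin p) ℝ) (θ : CommonVAR.Comp p r d)
        (S Sh : Matrix (Fin p) (Fin p) ℝ) (τ : NNReal) (ζ y : ℤ → Ω → Fin p → ℝ)
        (g a b η₀ η σ₁ σr κ α β : ℝ),
      -- the rank-r coefficient matrix, its common-subspace decomposition, its singular values
      θ.IsDecompOf A →
      σ₁ = CommonVAR.sigma A 0 → σr = CommonVAR.sigma A (r - 1) → κ = σ₁ / σr →
      α = CommonVAR.alphaRSC A S → β = CommonVAR.betaRSS A S →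
      -- stability, errors, separation of the specific subspaces, and the observed process
      spectralRadius ℂ (A.map Complex.ofReal) < 1 →
      CommonVAR.ErrorAssumption μ S Sh τ ζ →
      0 < g → g ≤ CommonVAR.sinTheta1 θ.R θ.P →
      CommonVAR.IsStationaryVAR μ A Sh ζ y →
      -- sample size
      CT * max ((τ : ℝ) ^ 4) ((τ : ℝ) ^ 2) * (CommonVAR.M2 A S) ^ (-2 : ℤ) * p ≤ T →
      -- accuracy of the initial value
      κ ^ 2 * g ^ (-2 : ℤ) * α⁻¹ * (τ : ℝ) ^ 2 * CommonVAR.M1 A S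
        * Real.sqrt (CommonVAR.dRR p r / T) ≤ cI * σr →
      -- tuning parameters and step size
      K⁻¹ * (α * σ₁ ^ (2 / 3 : ℝ) * κ ^ (-2 : ℤ)) ≤ a →
      a ≤ K * (α * σ₁ ^ (2 / 3 : ℝ) * κ ^ (-2 : ℤ)) →
      K⁻¹ * σ₁ ^ (1 / 3 : ℝ) ≤ b → b ≤ K * σ₁ ^ (1 / 3 : ℝ) →
      0 < η₀ → η₀ ≤ 1 / (260 * K ^ 4) → η = η₀ * β⁻¹ * σ₁ ^ (-4 / 3 : ℝ) →
      (∀ I : ℕ,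
        CN * (Real.log (κ⁻¹ * σ₁ ^ (-1 / 3 : ℝ) * g) /
          Real.log (1 - CL * η₀ * α * β⁻¹ * κ ^ (-2 : ℤ))) ≤ I →
        ∃ E : Set Ω, MeasurableSet E ∧
          1 - 4 * Real.exp (-(CP * (CommonVAR.M2 A S) ^ 2
                * min ((τ : ℝ) ^ (-2 : ℤ)) ((τ : ℝ) ^ (-4 : ℤ)) * T))
            - 2 * Real.exp (-(CP * p)) ≤ μ.real E ∧
          ∀ ω ∈ E,
            let X := CommonVAR.dataX T (fun t => y t ω)
            let Y := CommonVAR.dataY T (fun t => y t ω)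
            (∃ θ₀ : CommonVAR.Comp p r d, CommonVAR.IsSpectralInit X Y b θ₀) ∧
            ∀ θ₀ : CommonVAR.Comp p r d, CommonVAR.IsSpectralInit X Y b θ₀ →
              CommonVAR.frobNorm (((CommonVAR.gdStep X Y a b η)^[I] θ₀).toMat - A) ≤
                CB * (κ * α⁻¹ * (τ : ℝ) ^ 2 * CommonVAR.M1 A S
                  * Real.sqrt (CommonVAR.dCS p r d / T))) ∧
      (1 ≤ d → 2 ≤ p →
        Real.sqrt (CommonVAR.dCS p r d / T) < Real.sqrt (CommonVAR.dRR p r / T)) := by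
  have hK0 : 0 < K := by linarith
  -- `2e7` and `1 / 5e6` are the constants of the probability bound, `1 / (40000 K⁴)` that of the
  -- accuracy condition, `3600` that of the final error.
  refine ⟨2e7, 1 / (40000 * K ^ 4), 1 / 5e6, 1, 1, 3600, by norm_num, by positivity, by norm_num,
    one_pos, one_pos, le_rfl, by norm_num, ?_⟩
  intro p r d T hr hd Ω _ μ _ A θ S Sh τ ζ y g a b η₀ η σ₁ σr κ α β hθ hσ₁ hσr hκ hα hβ hA hε hg hgs
    hy hT hacc ha1 ha2 hb1 hb2 hη₀ hη₁ hη
  have hrp : r ≤ p := by rw [← hθ.rank_eq]; exact Matrix.rank_le_height A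
  have hp : 1 ≤ p := hr.trans hrp
  have hτ : 1 / 2 ≤ (τ : ℝ) := hε.half_le hp
  have hτ0 : 0 < (τ : ℝ) := by linarith
  have hM2 := CommonVAR.M2_pos hp hA hε.posDef
  have hp' : (0 : ℝ) < p := Nat.cast_pos.2 hp
  have hT' : (0 : ℝ) < T := lt_of_lt_of_le (by positivity) hT
  have hσ : 0 < σ₁ := by rw [hσ₁, CommonVAR.sigma_pos_iff, hθ.rank_eq]; omega
  -- All fractional powers of `σ₁` are integer powers of `ρ = σ₁^(1/3)`, the common scale of the
  -- balanced factors.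
  have hρ (x : ℝ) (k : ℕ) (hx : x = k / 3) : σ₁ ^ x = (σ₁ ^ (1 / 3 : ℝ)) ^ k := by
    rw [← Real.rpow_natCast, ← Real.rpow_mul hσ.le]
    congr 1
    linarith
  have hρ2 := hρ (2 / 3) 2 (by norm_num)
  have hρ3 : (σ₁ ^ (1 / 3 : ℝ)) ^ 3 = σ₁ := by
    rw [← hρ 1 3 (by norm_num), Real.rpow_one]
  have hρ4 : σ₁ ^ (-4 / 3 : ℝ) = ((σ₁ ^ (1 / 3 : ℝ)) ^ 4)⁻¹ := by
    rw [← hρ (4 / 3) 4 (by norm_num), ← Real.rpow_neg hσ.le]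
    norm_num
  have hlam : 0 < CommonVAR.lamMax S := (CommonVAR.lamMin_pos hp hε.posDef).trans_le
    (CommonVAR.lamMin_le_lamMax hp hε.posDef.isHermitian)
  rw [hρ2] at ha1 ha2
  rw [hρ4] at hη
  subst hα hβ
  refine ⟨fun I _ => ⟨_, CommonVAR.measurableSet_goodSample_data hy T _ _ _,
    CommonVAR.measureReal_goodSample_ge hp hA hε hy hT, fun ω hω => ?_⟩, fun hd1 hp2 => ?_⟩
  · obtain ⟨hex, hall⟩ := CommonVAR.spectralInit_and_iterate_le hK hd hr (Nat.cast_pos.1 hT')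
      (CommonVAR.alphaRSC_pos hp hε.posDef) (CommonVAR.alphaRSC_le_betaRSS hp hA hε.posDef) hτ hlam
      (CommonVAR.M1_pos hp hA hε.posDef) (CommonVAR.betaRSS_mul_lamMax hp hA) hθ
      (Real.rpow_pos_of_pos hσ _) (hρ3.trans hσ₁) (by rw [hκ, hσ₁, hσr]) hω hg hgs
      (by rw [← hσr]; exact hacc) ha1 ha2 hb1 hb2 hη₀ hη₁ hη
    exact ⟨hex, fun θ₀ hθ₀ => hall θ₀ hθ₀ I⟩
  · have h0 : CommonVAR.dCS p r d < CommonVAR.dRR p r := CommonVAR.dCS_lt_dRR hrp hd hd1 hp2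
    have h1 : 0 ≤ CommonVAR.dCS p r d := by
      have h2 := CommonVAR.mul_le_dRR hrp
      have h3 := CommonVAR.dRR_le_two_mul_dCS hrp hd
      have h4 : (0 : ℝ) ≤ p * r := by positivity
      linarith
    exact Real.sqrt_lt_sqrt (div_nonneg h1 hT'.le) (div_lt_div_of_pos_right h0 hT')
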